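/- Model. Programs are finite and run on a random access machine with two memories: one of words of $O(k+\log n)$ bits (unit-time operations, including addition, subtraction, multiplication and indirect memory access), and one of $b$-bit numbers, on which addition, subtraction and multiplication modulo $2^b$, loading a constant, copying and testing for zero are each charged the time $i_\times(b)\ge 1$ for multiplying $b$-bit numbers. All memory cells outside the input are initially zero. Let $\omega$ be any real number such that two $N\times N$ matrices of $b$-bit numbers can be multiplied in $O(N^{\omega})$ time, i.e. by one program that, for all $N\ge1$ and all $b$, uses at most a constant times $N^{\omega}$ operations on numbers and on $O(\log N)$-bit words (for example the matrix multiplication constant, the smallest such number, if it is attained). A branch decomposition of a graph $G=(V,E)$ is a tree $T$ in which every node has degree one (a leaf) or three, with a bijection from the leaves of $T$ to $E$. Removing an edge $e$ of $T$ partitions $E$ into the edges at the leaves on the two sides of $e$; the middle set of $e$ is the set of vertices of $G$ that are an endpoint of an edge in each of the two parts. The width of $T$ is the maximum size of a middle set. A dominating set of $G$ is a set $D\subseteq V$ such that every vertex outside $D$ has a neighbour in $D$; it is minimum if it has the smallest cardinality among all dominating sets. Theorem. Let $G$ be a graph with $n$ vertices and $m$ edges, given with a branch decomposition $T$ of $G$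 (the nodes of $T$ with their neighbours, and for each leaf the endpoints of its edge), and let $k$ be the maximum of $2$ and the width of $T$. 1. There is an algorithm that, given $T$, computes the number of dominating sets of $G$ of each size $\kappa$, $0\le\kappa\le n$, in $O\bigl(m\,n^2\,3^{\frac{\omega}{2}k}\,i_\times(n)\bigr)$ time, with $n$-bit numbers. 2. There is an algorithm that, given $T$, computes the number of minimum dominating sets of $G$ in $O\bigl(m\,k^2\,3^{\frac{\omega}{2}k}\,i_\times(n)\bigr)$ time, with $n$-bit numbers. 3. There is an algorithm that, given $T$, computes the size of a minimum dominating set of $G$ in $O\bigl(m\,k^2\,3^{\frac{\omega}{2}k}\,i_\times(k)\bigr)$ time, with $O(k)$-bit numbers, each operation on which is charged $i_\times(k)$; in particular in $O\bigl(m\,k^2\,3^{\frac{\omega}{2}k}\bigr)$ time if operations on $O(k)$-bit numbers take unit time. The algorithms, and the constants in all $O$-bounds, do not depend on $G$, $T$, $n$, $m$, $k$ or the function $i_\times$. -/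

import Mathlib

/-! ## The machine

A random access machine with two memories, both indexed by words: a memory of words
(natural numbers of a bounded length `w`, with unit-time operations), and a memory of `b`-bit
numbers (with arithmetic modulo `2 ^ b`), every operation on which is charged a price `q`.
Programs are finite texts, independent of the input. -/

/-- Word expressions; `get e` is the content of the word cell whose address is the value of `e`
(so nested `get`s give indirect addressing); `sub` is truncated subtraction. -/
inductive WordExp : Type
  | lit (a : ℕ)
  | get (e : WordExp)
  | add (e f : WordExp)
  | sub (e f : WordExp)
  | mul (e f : WordExp)

namespace WordExp

/-- The value of a word expression in a word memory. -/
def eval (μ : ℕ → ℕ) : WordExp → ℕ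
  | lit a => a
  | get e => μ (eval μ e)
  | add e f => eval μ e + eval μ f
  | sub e f => eval μ e - eval μ f
  | mul e f => eval μ e * eval μ f

/-- No value that occurs in the evaluation of the expression exceeds the word length `w`. -/
def Fits (w : ℕ) (μ : ℕ → ℕ) : WordExp → Prop
  | lit a => a < 2 ^ w
  | get e => Fits w μ e ∧ μ (eval μ e) < 2 ^ w
  | add e f => Fits w μ e ∧ Fits w μ f ∧ eval μ e + eval μ f < 2 ^ w
  | sub e f => Fits w μ e ∧ Fits w μ f
  | mul e f => Fits w μ e ∧ Fits w μ f ∧ eval μ e * eval μ f < 2 ^ w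

/-- The number of unit-time operations in the evaluation of the expression. -/
def cost : WordExp → ℕ
  | lit _ => 1
  | get e => cost e + 1
  | add e f => cost e + cost f + 1
  | sub e f => cost e + cost f + 1
  | mul e f => cost e + cost f + 1

end WordExp

/-- Arithmetic operations on numbers. -/
inductive NumOp : Type
  | add
  | sub
  | mul

/-- The result of an arithmetic operation on `b`-bit numbers, modulo `2 ^ b`. -/
def NumOp.apply {b : ℕ} : NumOp → ZMod (2 ^ b) → ZMod (2 ^ b) → ZMod (2 ^ b)
  | add, x, y => x + y
  | sub, x, y => x - y
  | mul, x, y => x * y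

/-- Programs. Word cells and number cells are named by word expressions for their addresses.
* `setWord a e`: store the value of `e` in word cell `a`.
* `setNum a e`: store the value of the word expression `e`, as a number, in number cell `a`.
* `arith op a x y`: apply `op` to the number cells `x`, `y` and store the result in number cell `a`.
* `testNum a x`: store `0` in word cell `a` if number cell `x` holds zero, and `1` otherwise.
* `ite e p r`: run `p` if the value of `e` is not `0`, and `r` otherwise.
* `loop e p`: run `p` again and again, as long as the value of `e` is not `0`.
* `call p ws wl ns nl wd wr nd nr`: run `p` on fresh memories that hold copies of the `wl` word
  cells from `ws` on and of the `nl` number cells from `ns` on, and are zero elsewhere; afterwards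
  copy its first `wr` word cells to the word cells from `wd` on, and its first `nr` number cells to
  the number cells from `nd` on. Every copied cell is paid for. -/
inductive Program : Type
  | setWord (a e : WordExp)
  | setNum (a e : WordExp)
  | arith (op : NumOp) (a x y : WordExp)
  | testNum (a x : WordExp)
  | seq (p r : Program)
  | ite (e : WordExp) (p r : Program)
  | loop (e : WordExp) (p : Program)
  | call (p : Program) (ws wl ns nl wd wr nd nr : WordExp)

/-- The contents of the two memories. -/
structure Memory (b : ℕ) where
  /-- the word memory -/
  word : ℕ → ℕ
  /-- the memory of `b`-bit numbers -/
  num : ℕ → ZMod (2 ^ b)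

/-- The first `l` cells of a copy of `f` from cell `s` on, followed by zeros. -/
def cellsFrom {α : Type} [Zero α] (f : ℕ → α) (s l : ℕ) : ℕ → α :=
  fun i => if i < l then f (s + i) else 0

/-- `f` after its cells `d, …, d + l - 1` have been overwritten by the first `l` cells of `g`. -/
def overwriteCells {α : Type} (f g : ℕ → α) (d l : ℕ) : ℕ → α :=
  fun i => if d ≤ i ∧ i < d + l then g (i - d) else f i

/-- `Run w b q p s s' t`: on a machine with words of `w` bits and numbers of `b` bits, on which an
operation on words takes one unit of time and an operation on numbers `q` units, the program `p`
started with memory contents `s` halts with memory contents `s'` after time `t`. A run that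
produces a word of more than `w` bits does not exist. -/
inductive Run (w b q : ℕ) : Program → Memory b → Memory b → ℕ → Prop
  | setWord (a e : WordExp) (s : Memory b) (ha : a.Fits w s.word) (he : e.Fits w s.word) :
      Run w b q (.setWord a e) s
        ⟨Function.update s.word (a.eval s.word) (e.eval s.word), s.num⟩
        (a.cost + e.cost + 1)
  | setNum (a e : WordExp) (s : Memory b) (ha : a.Fits w s.word) (he : e.Fits w s.word) :
      Run w b q (.setNum a e) s
        ⟨s.word, Function.update s.num (a.eval s.word) (e.eval s.word : ZMod (2 ^ b))⟩
        (a.cost + e.cost + q)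
  | arith (op : NumOp) (a x y : WordExp) (s : Memory b)
      (ha : a.Fits w s.word) (hx : x.Fits w s.word) (hy : y.Fits w s.word) :
      Run w b q (.arith op a x y) s
        ⟨s.word, Function.update s.num (a.eval s.word)
          (op.apply (s.num (x.eval s.word)) (s.num (y.eval s.word)))⟩
        (a.cost + x.cost + y.cost + q)
  | testNum_zero (a x : WordExp) (s : Memory b) (ha : a.Fits w s.word) (hx : x.Fits w s.word)
      (h : s.num (x.eval s.word) = 0) :
      Run w b q (.testNum a x) s
        ⟨Function.update s.word (a.eval s.word) 0, s.num⟩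
        (a.cost + x.cost + q)
  | testNum_ne (a x : WordExp) (s : Memory b) (ha : a.Fits w s.word) (hx : x.Fits w s.word)
      (h : s.num (x.eval s.word) ≠ 0) :
      Run w b q (.testNum a x) s
        ⟨Function.update s.word (a.eval s.word) 1, s.num⟩
        (a.cost + x.cost + q)
  | seq (p r : Program) (s s' s'' : Memory b) (t t' : ℕ)
      (hp : Run w b q p s s' t) (hr : Run w b q r s' s'' t') :
      Run w b q (.seq p r) s s'' (t + t')
  | ite_true (e : WordExp) (p r : Program) (s s' : Memory b) (t : ℕ)
      (he : e.Fits w s.word) (h : e.eval s.word ≠ 0) (hp : Run w b q p s s' t) :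
      Run w b q (.ite e p r) s s' (e.cost + 1 + t)
  | ite_false (e : WordExp) (p r : Program) (s s' : Memory b) (t : ℕ)
      (he : e.Fits w s.word) (h : e.eval s.word = 0) (hr : Run w b q r s s' t) :
      Run w b q (.ite e p r) s s' (e.cost + 1 + t)
  | loop_stop (e : WordExp) (p : Program) (s : Memory b)
      (he : e.Fits w s.word) (h : e.eval s.word = 0) :
      Run w b q (.loop e p) s s (e.cost + 1)
  | loop_step (e : WordExp) (p : Program) (s s' s'' : Memory b) (t t' : ℕ)
      (he : e.Fits w s.word) (h : e.eval s.word ≠ 0)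
      (hp : Run w b q p s s' t) (hl : Run w b q (.loop e p) s' s'' t') :
      Run w b q (.loop e p) s s'' (e.cost + 1 + t + t')
  | call (p : Program) (ws wl ns nl wd wr nd nr : WordExp) (s u : Memory b) (t : ℕ)
      (hfit : ∀ e ∈ [ws, wl, ns, nl, wd, wr, nd, nr], e.Fits w s.word)
      (hws : ws.eval s.word + wl.eval s.word ≤ 2 ^ w)
      (hns : ns.eval s.word + nl.eval s.word ≤ 2 ^ w)
      (hwd : wd.eval s.word + wr.eval s.word ≤ 2 ^ w)
      (hnd : nd.eval s.word + nr.eval s.word ≤ 2 ^ w)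
      (hp : Run w b q p
        ⟨cellsFrom s.word (ws.eval s.word) (wl.eval s.word),
          cellsFrom s.num (ns.eval s.word) (nl.eval s.word)⟩ u t) :
      Run w b q (.call p ws wl ns nl wd wr nd nr) s
        ⟨overwriteCells s.word u.word (wd.eval s.word) (wr.eval s.word),
          overwriteCells s.num u.num (nd.eval s.word) (nr.eval s.word)⟩
        (([ws, wl, ns, nl, wd, wr, nd, nr].map WordExp.cost).sum + 1
          + (wl.eval s.word + wr.eval s.word)
          + q * (nl.eval s.word + nr.eval s.word) + t)

/-! ## Matrix multiplication -/

/-- The initial memory for the multiplication of two `N × N` matrices: `N` in word cell `0`, and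
the rows of the first and then of the second matrix one after the other in the number cells. -/
def matrixInput {b N : ℕ} (A B : Matrix (Fin N) (Fin N) (ZMod (2 ^ b))) : Memory b where
  word := fun i => if i = 0 then N else 0
  num := fun i =>
    if h : i < N * N then A (Fin.divNat ⟨i, h⟩) (Fin.modNat ⟨i, h⟩)
    else if h' : i - N * N < N * N then B (Fin.divNat ⟨i - N * N, h'⟩) (Fin.modNat ⟨i - N * N, h'⟩)
    else 0

/-- The real numbers `τ` such that two `N × N` matrices can be multiplied in `O(N ^ τ)` time: one
program multiplies any two such matrices of `b`-bit numbers, for all `N ≥ 1` and `b`, with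
`O(N ^ τ)` operations on `O(log N)`-bit words and on the numbers. The matrix multiplication
constant is the smallest (or the infimum) of these numbers. -/
def matrixMultiplicationExponents : Set ℝ :=
  {τ | ∃ (p : Program) (c C : ℕ), ∀ (b N : ℕ), 1 ≤ N →
    ∀ A B : Matrix (Fin N) (Fin N) (ZMod (2 ^ b)), ∃ (s : Memory b) (t : ℕ),
      Run (c * (Nat.log 2 N + 1)) b 1 p (matrixInput A B) s t ∧
      (t : ℝ) ≤ C * (N : ℝ) ^ τ ∧
      ∀ i j : Fin N, s.num (N * i + j) = (A * B) i j}

/-! ## Dominating sets -/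

/-- `D` is a dominating set of `G`: every vertex outside `D` has a neighbour in `D`. -/
def IsDominatingSet {V : Type*} (G : SimpleGraph V) (D : Finset V) : Prop :=
  ∀ v, v ∉ D → ∃ d ∈ D, G.Adj v d

/-- A dominating set of minimum cardinality. -/
def IsMinimumDominatingSet {V : Type*} (G : SimpleGraph V) (D : Finset V) : Prop :=
  IsDominatingSet G D ∧ ∀ D' : Finset V, IsDominatingSet G D' → D.card ≤ D'.card

/-! ## Branch decompositions -/

/-- A branch decomposition, with nodes `0, …, N - 1`, of a graph `G`: a tree in which every node
is a leaf (degree one) or has degree three, with a bijection from its leaves to the edges of `G`. -/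
structure BranchDecomposition {V : Type*} (G : SimpleGraph V) (N : ℕ) where
  /-- the tree -/
  tree : SimpleGraph (Fin N)
  isTree : tree.IsTree
  degree : ∀ x, (tree.neighborSet x).ncard = 1 ∨ (tree.neighborSet x).ncard = 3
  /-- the edge of `G` assigned to a leaf -/
  leafEdge : {x : Fin N // (tree.neighborSet x).ncard = 1} ≃ G.edgeSet

namespace BranchDecomposition

variable {V : Type*} {G : SimpleGraph V} {N : ℕ}

/-- The endpoints of the edges of `G` assigned to the leaves on the side of `x` when the tree edge
`{x, y}` is removed. -/
def sideVertices (T : BranchDecomposition G N) (x y : Fin N) : Set V :=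
  {v | ∃ l : {z : Fin N // (T.tree.neighborSet z).ncard = 1},
    (T.tree.deleteEdges {s(x, y)}).Reachable x l.1 ∧ v ∈ (T.leafEdge l : Sym2 V)}

/-- The middle set of the tree edge `{x, y}`. -/
def middleSet (T : BranchDecomposition G N) (x y : Fin N) : Set V :=
  T.sideVertices x y ∩ T.sideVertices y x

open Classical in
/-- The size of the largest middle set. -/
noncomputable def width (T : BranchDecomposition G N) : ℕ :=
  Finset.univ.sup fun e : Fin N × Fin N =>
    if T.tree.Adj e.1 e.2 then (T.middleSet e.1 e.2).ncard else 0

/-- The word memory `μ` holds a graph with vertices `0, …, n - 1` together with a branch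
decomposition of it: cell `0` holds `n`, cell `1` the number `N` of nodes, and four cells from
`4 x + 2` on describe the node `x`. For a leaf these hold `1`, its neighbour, and the two endpoints
of the edge assigned to it, and for any other node they hold `3` and its three neighbours (in any
order). All further cells are zero. The edges of the graph are listed by the leaves. -/
def IsEncodedBy {n : ℕ} {G : SimpleGraph (Fin n)} (T : BranchDecomposition G N) (μ : ℕ → ℕ) :
    Prop :=
  μ 0 = n ∧ μ 1 = N ∧
  (∀ x : {x : Fin N // (T.tree.neighborSet x).ncard = 1},
    μ (4 * x.1 + 2) = 1 ∧
    (∃ y : Fin N, T.tree.Adj x.1 y ∧ μ (4 * x.1 + 3) = y) ∧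
    ∃ u v : Fin n, (T.leafEdge x : Sym2 (Fin n)) = s(u, v) ∧
      μ (4 * x.1 + 4) = u ∧ μ (4 * x.1 + 5) = v) ∧
  (∀ x : Fin N, (T.tree.neighborSet x).ncard = 3 →
    μ (4 * x + 2) = 3 ∧
    ∀ y : Fin N, T.tree.Adj x y ↔
      (μ (4 * x + 3) = y ∨ μ (4 * x + 4) = y ∨ μ (4 * x + 5) = y)) ∧
  ∀ i, 4 * N + 2 ≤ i → μ i = 0

end BranchDecomposition

set_option linter.constructorNameAsVariable false
set_option linter.unusedVariables false

open Finset (add_sum_erase card_biUnion_le_card_mul card_eq_zero card_filter card_filter_le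
  card_image_of_injOn card_insert_eq_ite card_le_card card_le_two card_map card_pos card_powerset
  card_range card_union_of_disjoint coe_range disjoint_filter disjoint_filter_filter disjoint_left
  eq_of_subset_of_card_le erase_eq_of_notMem filter_eq_empty_iff filter_singleton filter_subset
  filter_subset_filter filter_true_of_mem filter_union image_insert image_subset_image
  insert_subset inter_eq_left inter_subset_left inter_subset_right mem_biUnion mem_erase
  mem_filter mem_image mem_image_of_mem mem_insert mem_inter mem_map mem_powerset mem_product
  mem_range mem_sdiff mem_singleton mem_union mem_union_left mem_union_right mem_univ
  mul_prod_erase mul_sum ne_of_mem_erase nonempty_iff_ne_empty notMem_empty prod_congr prod_eq_one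
  prod_eq_zero prod_image prod_ite_mem prod_mul_distrib prod_range_succ range range_add_one
  range_subset_range singleton_ne_empty subset_empty subset_insert subset_union_left
  subset_union_right sum_add_distrib sum_comm sum_congr sum_const sum_eq_single_of_mem sum_eq_zero
  sum_filter sum_image sum_insert sum_range_add sum_range_succ sum_subset union_subset
  union_subset_union univ)
open Function (iterate_succ_apply iterate_succ_apply' update update_apply update_of_ne
  update_self)
open Nat (add_mul_div_right add_mul_mod_self_right cast_sum div_add_mod div_eq_of_lt
  div_lt_of_lt_mul exists_eq_add_of_le floor_le le_floor le_mul_of_pos_left le_mul_of_pos_right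
  log lt_succ_iff_lt_or_eq mod_eq_of_lt mod_lt mul_add_div one_le_pow pow_le_pow_left
  pow_le_pow_right reduceAdd sub_le)

/-! ## A language of named arrays above the machine -/

/-- Classes of vertices at a join: only on the left, on both sides, forgotten, only on the right. -/
inductive Cls : Type
  | L | I | F | R
  deriving DecidableEq

/-- The names of the arrays and of the scalar variables (cell `0` of an array). -/
inductive Nm : Type
  | deg | own | par | ord | fc | sz | lst | cnt | tbl | lo | mark | markc | pow
  | o1 (c : Cls) | o2 (c : Cls) | o0 (c : Cls) | sg (c : Cls) | nc (c : Cls)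
  | nn | nN | noniso | root | tail | alloc | x | ty | u | w | y | hd | step | c1 | c2 | lim | i
  | st0 | st1 | st2 | tot | s0 | p0 | pw | e | d | dd | qL | qF | qR | pI | sA | sB | sC | out
  | w1 | w2 | t1 | t2 | p1 | p2 | j1 | j2 | xI | bL | bF | bR | ia | ib | ic | id | rr | found | j0
  | l | wx | base | p | pp | hh | hi | tt | tz | lu | lw
  deriving DecidableEq

namespace Nm

/-- All names. -/
def all : List Nm :=
  [deg, own, par, ord, fc, sz, lst, cnt, tbl, lo, mark, markc, pow,
   o1 .L, o1 .I, o1 .F, o1 .R, o2 .L, o2 .I, o2 .F, o2 .R, o0 .L, o0 .I, o0 .F, o0 .R,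
   sg .L, sg .I, sg .F, sg .R, nc .L, nc .I, nc .F, nc .R,
   nn, nN, noniso, root, tail, alloc, x, ty, u, w, y, hd, step, c1, c2, lim, i,
   st0, st1, st2, tot, s0, p0, pw, e, d, dd, qL, qF, qR, pI, sA, sB, sC, out,
   w1, w2, t1, t2, p1, p2, j1, j2, xI, bL, bF, bR, ia, ib, ic, id, rr, found, j0,
   l, wx, base, p, pp, hh, hi, tt, tz, lu, lw]

theorem mem_all (a : Nm) : a ∈ all := by
  cases a
  case o1 c => cases c <;> decide
  case o2 c => cases c <;> decide
  case o0 c => cases c <;> decide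
  case sg c => cases c <;> decide
  case nc c => cases c <;> decide
  all_goals decide

/-- The residue class modulo `128` in which an array is stored. -/
def code (a : Nm) : ℕ := all.idxOf a

theorem code_lt (a : Nm) : code a < 128 :=
  (List.idxOf_lt_length_of_mem (mem_all a)).trans_le (by decide)

theorem getElem?_code (a : Nm) : all[code a]? = some a := by
  rw [List.getElem?_eq_some_iff]
  exact ⟨List.idxOf_lt_length_of_mem (mem_all a), List.getElem_idxOf _⟩

theorem code_of_getElem? {a : Nm} {c : ℕ} (h : all[c]? = some a) : code a = c := by
  have hnd : all.Nodup := by decide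
  rw [List.getElem?_eq_some_iff] at h
  obtain ⟨hc, rfl⟩ := h
  exact hnd.idxOf_getElem c hc

end Nm

/-- The contents of the named arrays. -/
abbrev Store := Nm → ℕ → ℕ

/-- Expressions over named arrays. -/
inductive HExp : Type
  | lit (a : ℕ)
  | arr (a : Nm) (e : HExp)
  | add (e f : HExp)
  | sub (e f : HExp)
  | mul (e f : HExp)

instance : Add HExp := ⟨HExp.add⟩
instance : Sub HExp := ⟨HExp.sub⟩
instance : Mul HExp := ⟨HExp.mul⟩
instance (k : ℕ) : OfNat HExp k := ⟨HExp.lit k⟩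

/-- A scalar variable. -/
abbrev sc (a : Nm) : HExp := .arr a (.lit 0)
/-- An array cell. -/
abbrev rd (a : Nm) (e : HExp) : HExp := .arr a e

/-- The word expression for the address of a cell of a named array; the arrays are interleaved
above the input, whose length is `4 N + 2` with `N` in word cell `1`. -/
def cellAddr (a : Nm) (e : WordExp) : WordExp :=
  .add (.add (.mul (.lit 4) (.get (.lit 1))) (.lit (2 + a.code))) (.mul (.lit 128) e)

namespace HExp

/-- The value of an expression. -/
def eval (v : Store) : HExp → ℕ
  | lit a => a
  | arr a e => v a (eval v e)
  | add e f => eval v e + eval v f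
  | sub e f => eval v e - eval v f
  | mul e f => eval v e * eval v f

/-- Translation to word expressions. -/
def comp : HExp → WordExp
  | lit a => .lit a
  | arr a e => .get (cellAddr a (comp e))
  | add e f => .add (comp e) (comp f)
  | sub e f => .sub (comp e) (comp f)
  | mul e f => .mul (comp e) (comp f)

/-- The number of nodes of an expression. -/
def size : HExp → ℕ
  | lit _ => 1
  | arr _ e => size e + 1
  | add e f => size e + size f
  | sub e f => size e + size f
  | mul e f => size e + size f

/-- All literals are small. -/
def small : HExp → Bool
  | lit a => a ≤ 128
  | arr _ e => small e
  | add e f => small e && small f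
  | sub e f => small e && small f
  | mul e f => small e && small f

/-- Size condition under which evaluation never overflows. -/
def wf (e : HExp) : Bool := small e && decide (size e ≤ 60)

@[simp] theorem eval_lit (v : Store) (a : ℕ) : (lit a).eval v = a := rfl
@[simp] theorem eval_ofNat (v : Store) (a : ℕ) :
    HExp.eval v (no_index (OfNat.ofNat a : HExp)) = (OfNat.ofNat a : ℕ) := rfl
@[simp] theorem eval_zero (v : Store) : HExp.eval v (0 : HExp) = 0 := rfl
@[simp] theorem eval_one (v : Store) : HExp.eval v (1 : HExp) = 1 := rfl
@[simp] theorem eval_arr (v : Store) (a : Nm) (e : HExp) :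
    (arr a e).eval v = v a (e.eval v) := rfl
@[simp] theorem eval_add (v : Store) (e f : HExp) :
    (e + f).eval v = e.eval v + f.eval v := rfl
@[simp] theorem eval_sub (v : Store) (e f : HExp) :
    (e - f).eval v = e.eval v - f.eval v := rfl
@[simp] theorem eval_mul (v : Store) (e f : HExp) :
    (e * f).eval v = e.eval v * f.eval v := rfl

end HExp

open HExp (eval_lit eval_arr eval_add eval_mul eval_zero eval_ofNat eval_one eval_sub)

/-- Programs over named arrays. `read a e` stores the input cell `e` in the scalar `a`;
`for_ i m p` runs `p` with the scalar `i` equal to `0, …, m - 1`; `mm d a c` multiplies the two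
`d × d` matrices that are stored from number cell `a` on, and stores the product from `c` on. -/
inductive HProg : Type
  | skip
  | set (a : Nm) (e f : HExp)
  | read (a : Nm) (e : HExp)
  | setN (e f : HExp)
  | arith (op : NumOp) (e x y : HExp)
  | test (a : Nm) (e : HExp)
  | seq (p r : HProg)
  | ite (e : HExp) (p r : HProg)
  | for_ (i m : Nm) (p : HProg)
  | mm (d a c : Nm)

/-- Sequential composition. -/
infixr:60 " ;; " => HProg.seq

namespace HProg

/-- Assignment to a scalar. -/
abbrev asg (a : Nm) (f : HExp) : HProg := .set a (.lit 0) f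

/-- The names that a program may change. -/
def mods : HProg → List Nm
  | skip => []
  | set a _ _ => [a]
  | read a _ => [a]
  | setN _ _ => []
  | arith _ _ _ _ => []
  | test a _ => [a]
  | seq p r => mods p ++ mods r
  | ite _ p r => mods p ++ mods r
  | for_ i _ p => i :: mods p
  | mm _ _ _ => []

/-- Static well-formedness. -/
def wf : HProg → Bool
  | skip => true
  | set _ e f => e.wf && f.wf
  | read _ e => e.wf
  | setN e f => e.wf && f.wf
  | arith _ e x y => e.wf && x.wf && y.wf
  | test _ e => e.wf
  | seq p r => wf p && wf r
  | ite e p r => e.wf && wf p && wf r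
  | for_ i m p => wf p && decide (i ≠ m) && decide (i ∉ mods p) && decide (m ∉ mods p)
  | mm _ _ _ => true

/-- The word expression for the address of a scalar. -/
def scAddr (a : Nm) : WordExp := cellAddr a (.lit 0)

/-- Translation to machine programs, given a program for matrix multiplication. -/
def comp (M : Program) : HProg → Program
  | skip => .setWord (.lit 0) (.get (.lit 0))
  | set a e f => .setWord (cellAddr a e.comp) f.comp
  | read a e => .setWord (scAddr a) (.get e.comp)
  | setN e f => .setNum e.comp f.comp
  | arith op e x y => .arith op e.comp x.comp y.comp
  | test a e => .testNum (scAddr a) e.comp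
  | seq p r => .seq (comp M p) (comp M r)
  | ite e p r => .ite e.comp (comp M p) (comp M r)
  | for_ i m p => .seq (.setWord (scAddr i) (.lit 0))
      (.loop (.sub (.get (scAddr m)) (.get (scAddr i)))
        (.seq (comp M p) (.setWord (scAddr i) (.add (.get (scAddr i)) (.lit 1)))))
  | mm d a c => .call M (scAddr d) (.lit 1) (.get (scAddr a))
      (.mul (.lit 2) (.mul (.get (scAddr d)) (.get (scAddr d)))) (.lit 0) (.lit 0)
      (.get (scAddr c)) (.mul (.get (scAddr d)) (.get (scAddr d)))

end HProg

open HProg (scAddr mods)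

/-- The contents of the named arrays and of the memory of numbers, and the elapsed time. -/
@[ext] structure HState (b : ℕ) where
  /-- the named arrays -/
  v : Store
  /-- the numbers -/
  m : ℕ → ZMod (2 ^ b)
  /-- the elapsed time -/
  t : ℕ

/-- Change of one array cell. -/
def upd (v : Store) (a : Nm) (i x : ℕ) : Store :=
  fun a' => if a' = a then update (v a) i x else v a'

@[simp] theorem upd_same (v : Store) (a : Nm) (i x : ℕ) :
    upd v a i x a = update (v a) i x := by simp [upd]

@[simp] theorem upd_ne (v : Store) {a a' : Nm} (h : a' ≠ a) (i x : ℕ) :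
    upd v a i x a' = v a' := by simp [upd, h]

/-- The parameters of an execution: machine parameters, bound on all words, input, and the
matrix multiplication program with a bound on its running time. -/
structure Env where
  /-- word length -/
  w : ℕ
  /-- length of numbers -/
  b : ℕ
  /-- price of an operation on numbers -/
  q : ℕ
  /-- bound on all words -/
  B : ℕ
  /-- the input -/
  inp : ℕ → ℕ
  /-- matrix multiplication -/
  M : Program
  /-- the time for matrix multiplication -/
  tmm : ℕ → ℕ
  hq : 1 ≤ q
  hB : 1024 ≤ B
  hinp : ∀ i, inp i < B
  hN : 4 * inp 1 + 2 < B
  hw : B ^ 70 ≤ 2 ^ w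
  hM : ∀ D, 1 ≤ D → D < B → ∀ f : ℕ → ZMod (2 ^ b), ∃ (s : Memory b) (t : ℕ),
    Run w b q M ⟨fun i => if i = 0 then D else 0, cellsFrom f 0 (2 * (D * D))⟩ s t ∧
    t ≤ q * tmm D ∧ ∀ i < D, ∀ j < D,
      s.num (D * i + j) = ∑ k ∈ range D, f (i * D + k) * f (D * D + k * D + j)

namespace Env

variable (E : Env)

/-- The length of the input. -/
def len : ℕ := 4 * E.inp 1 + 2

/-- The word memory that represents named arrays. -/
def words (v : Store) : ℕ → ℕ := fun i =>
  if i < E.len then E.inp i else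
    match Nm.all[(i - E.len) % 128]? with
    | some a => v a ((i - E.len) / 128)
    | none => 0

/-- The machine memory that represents a state. -/
def conc (h : HState E.b) : Memory E.b := ⟨E.words h.v, h.m⟩

/-- All words in the arrays are bounded. -/
def Bd (v : Store) : Prop := ∀ a i, v a i < E.B

theorem words_addr (v : Store) (a : Nm) (j : ℕ) :
    E.words v (E.len + a.code + 128 * j) = v a j := by
  have h := a.code_lt
  have h1 : (E.len + a.code + 128 * j - E.len) % 128 = a.code := by omega
  have h2 : (E.len + a.code + 128 * j - E.len) / 128 = j := by omega
  simp only [words, h1, h2, Nm.getElem?_code]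
  rw [if_neg (by omega)]

theorem words_lt_len (v : Store) {i : ℕ} (h : i < E.len) : E.words v i = E.inp i := by
  simp [words, h]

theorem words_lt (v : Store) (hv : E.Bd v) (i : ℕ) : E.words v i < E.B := by
  have := E.hB
  unfold words
  split_ifs
  · exact E.hinp i
  · split
    · exact hv _ _
    · omega

theorem update_words (v : Store) (a : Nm) (j x : ℕ) :
    update (E.words v) (E.len + a.code + 128 * j) x = E.words (upd v a j x) := by
  funext i
  have h := a.code_lt
  by_cases hi : i = E.len + a.code + 128 * j
  · subst hi; rw [words_addr]; simp
  · rw [update_of_ne hi]; unfold words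
    split_ifs with h1
    · rfl
    · split
      · rename_i a' ha'
        have hc := Nm.code_of_getElem? ha'
        by_cases haa : a' = a
        · subst haa; rw [upd_same, update_of_ne]; intro h3; apply hi; omega
        · rw [upd_ne _ haa]
      · rfl

theorem pow_le_two_pow {p : ℕ} (hp : p ≤ 70) : E.B ^ p ≤ 2 ^ E.w :=
  (pow_le_pow_right (by have := E.hB; omega) hp).trans E.hw

theorem B_sq_mul_le {p : ℕ} : 1024 * E.B ^ p ≤ E.B ^ (p + 1) := by
  rw [pow_succ, mul_comm]; exact Nat.mul_le_mul_left _ E.hB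

theorem eval_lt {v : Store} (hv : E.Bd v) (e : HExp) (he : e.small = true) :
    e.eval v < E.B ^ e.size := by
  have hB := E.hB
  induction e with
  | lit a => simp [HExp.small] at he; simp [HExp.size]; omega
  | arr a e _ => exact (hv a _).trans_le (Nat.le_self_pow (by simp [HExp.size]) _)
  | add e f ihe ihf =>
    simp [HExp.small] at he
    have h1 := ihe he.1
    have h2 := ihf he.2
    simp only [HExp.eval, HExp.size, pow_add]
    have : 2 ≤ E.B ^ f.size ∨ f.size = 0 := by
      rcases Nat.eq_zero_or_pos f.size with h | h
      · exact .inr h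
      · exact .inl ((by omega : 2 ≤ E.B).trans (Nat.le_self_pow (by omega) _))
    have : 2 ≤ E.B ^ e.size ∨ e.size = 0 := by
      rcases Nat.eq_zero_or_pos e.size with h | h
      · exact .inr h
      · exact .inl ((by omega : 2 ≤ E.B).trans (Nat.le_self_pow (by omega) _))
    rcases this with h | h <;> rcases ‹2 ≤ E.B ^ f.size ∨ f.size = 0› with h' | h' <;>
      simp only [h, h', pow_zero] at * <;> nlinarith
  | sub e f ihe ihf =>
    simp [HExp.small] at he
    have h1 := ihe he.1
    simp only [HExp.eval, HExp.size, pow_add]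
    have : 1 ≤ E.B ^ f.size := one_le_pow _ _ (by omega)
    calc _ ≤ e.eval v := sub_le _ _
      _ < _ := h1
      _ ≤ _ := le_mul_of_pos_right _ this
  | mul e f ihe ihf =>
    simp [HExp.small] at he
    simp only [HExp.eval, HExp.size, pow_add]; exact Nat.mul_lt_mul'' (ihe he.1) (ihf he.2)

theorem eval_cellAddr (v : Store) (a : Nm) (e : WordExp) :
    (cellAddr a e).eval (E.words v) = E.len + a.code + 128 * e.eval (E.words v) := by
  have : E.words v 1 = E.inp 1 := E.words_lt_len v (by simp [len])
  simp [cellAddr, WordExp.eval, this, len]; ring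

theorem eval_comp (v : Store) (e : HExp) : e.comp.eval (E.words v) = e.eval v := by
  induction e with
  | lit a => rfl
  | arr a e ih => simp only [HExp.comp, WordExp.eval, eval_cellAddr, ih, words_addr, HExp.eval]
  | add e f ihe ihf => simp [HExp.comp, WordExp.eval, ihe, ihf, HExp.eval]
  | sub e f ihe ihf => simp [HExp.comp, WordExp.eval, ihe, ihf, HExp.eval]
  | mul e f ihe ihf => simp [HExp.comp, WordExp.eval, ihe, ihf, HExp.eval]

theorem fits_cellAddr {v : Store} (hv : E.Bd v) (a : Nm) (e : WordExp) {p : ℕ} (hp : p ≤ 66)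
    (he : e.Fits E.w (E.words v)) (h : e.eval (E.words v) < E.B ^ p) :
    (cellAddr a e).Fits E.w (E.words v) := by
  have hB := E.hB
  have h1 : E.words v 1 = E.inp 1 := E.words_lt_len v (by simp [len])
  have hN := E.hN
  have hc := a.code_lt
  have hw : 1024 * (E.B + E.B ^ p) ≤ 2 ^ E.w := by
    have h2 : 1024 * E.B ^ p ≤ E.B ^ (p + 1) := E.B_sq_mul_le
    have h3 := E.B_sq_mul_le (p := 1)
    have h4 : E.B ^ (1 + 1) ≤ E.B ^ (p + 2) := pow_le_pow_right (by omega) (by omega)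
    have h6 : E.B ^ (p + 1) ≤ E.B ^ (p + 2) := pow_le_pow_right (by omega) (by omega)
    have h5 : 1024 * E.B ^ (p + 2) ≤ E.B ^ (p + 3) := E.B_sq_mul_le
    have := E.pow_le_two_pow (p := p + 3) (by omega)
    rw [pow_one] at h3; omega
  simp only [cellAddr, WordExp.Fits, WordExp.eval, h1]
  generalize E.B ^ p = X at *
  refine ⟨⟨⟨by omega, ⟨by omega, by omega⟩, by omega⟩, by omega, by omega⟩, ⟨by omega, he, by omega⟩, by omega⟩

theorem fits_comp {v : Store} (hv : E.Bd v) (e : HExp) (he : e.small = true)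
    (hs : e.size ≤ 60) : e.comp.Fits E.w (E.words v) := by
  have hB := E.hB
  have hlt := E.eval_lt hv e he
  have hpw := E.pow_le_two_pow (p := e.size) (by omega)
  rw [← E.eval_comp v e] at hlt
  induction e with
  | lit a => simpa [HExp.comp, WordExp.Fits, WordExp.eval] using hlt.trans_le hpw
  | arr a e ih =>
    simp [HExp.small] at he; simp only [HExp.size] at hs
    have hlt' := E.eval_lt hv e he
    rw [← E.eval_comp v e] at hlt'
    exact ⟨E.fits_cellAddr hv a _ (by omega)
      (ih he (by omega) hlt' (E.pow_le_two_pow (by omega))) hlt',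
      hlt.trans_le hpw⟩
  | add e f ihe ihf =>
    simp [HExp.small] at he; simp only [HExp.size] at hs
    have h1 := E.eval_lt hv e he.1
    have h2 := E.eval_lt hv f he.2
    rw [← E.eval_comp v] at h1 h2
    exact ⟨ihe he.1 (by omega) h1 (E.pow_le_two_pow (by omega)),
      ihf he.2 (by omega) h2 (E.pow_le_two_pow (by omega)), hlt.trans_le hpw⟩
  | sub e f ihe ihf =>
    simp [HExp.small] at he; simp only [HExp.size] at hs
    have h1 := E.eval_lt hv e he.1
    have h2 := E.eval_lt hv f he.2
    rw [← E.eval_comp v] at h1 h2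
    exact ⟨ihe he.1 (by omega) h1 (E.pow_le_two_pow (by omega)),
      ihf he.2 (by omega) h2 (E.pow_le_two_pow (by omega))⟩
  | mul e f ihe ihf =>
    simp [HExp.small] at he; simp only [HExp.size] at hs
    have h1 := E.eval_lt hv e he.1
    have h2 := E.eval_lt hv f he.2
    rw [← E.eval_comp v] at h1 h2
    exact ⟨ihe he.1 (by omega) h1 (E.pow_le_two_pow (by omega)),
      ihf he.2 (by omega) h2 (E.pow_le_two_pow (by omega)), hlt.trans_le hpw⟩

theorem fits_wf {v : Store} (hv : E.Bd v) {e : HExp} (he : e.wf = true) :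
    e.comp.Fits E.w (E.words v) := by
  simp [HExp.wf] at he
  exact E.fits_comp hv e he.1 he.2

theorem fits_addr {v : Store} (hv : E.Bd v) (a : Nm) {e : HExp} (he : e.wf = true) :
    (cellAddr a e.comp).Fits E.w (E.words v) := by
  simp [HExp.wf] at he
  refine E.fits_cellAddr hv a _ (p := e.size) (by omega) (E.fits_comp hv e he.1 he.2) ?_
  rw [eval_comp]; exact E.eval_lt hv e he.1

theorem fits_scAddr {v : Store} (hv : E.Bd v) (a : Nm) :
    (scAddr a).Fits E.w (E.words v) :=
  E.fits_addr hv a (e := .lit 0) (by decide)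

theorem eval_scAddr (v : Store) (a : Nm) :
    (scAddr a).eval (E.words v) = E.len + a.code + 128 * 0 := by
  simp [scAddr, eval_cellAddr, WordExp.eval]

theorem fits_sc {v : Store} (hv : E.Bd v) (a : Nm) :
    (WordExp.get (scAddr a)).Fits E.w (E.words v) :=
  E.fits_wf hv (e := sc a) (by simp [HExp.wf, HExp.small, HExp.size])

theorem eval_sc (v : Store) (a : Nm) :
    (WordExp.get (scAddr a)).eval (E.words v) = v a 0 :=
  E.eval_comp v (sc a)

theorem Bd.upd {v : Store} (hv : E.Bd v) (a : Nm) (i : ℕ) {x : ℕ} (hx : x < E.B) :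
    E.Bd (upd v a i x) := by
  intro a' i'
  by_cases h : a' = a
  · subst h; rw [upd_same, update_apply]
    split_ifs
    · exact hx
    · exact hv _ _
  · rw [upd_ne _ h]; exact hv _ _

end Env

theorem cost_comp_le (e : HExp) : e.comp.cost + 11 ≤ 20 * e.size := by
  induction e with
  | lit a => simp [HExp.comp, WordExp.cost, HExp.size]
  | arr a e ih => simp [HExp.comp, cellAddr, WordExp.cost, HExp.size]; omega
  | add e f ihe ihf => simp [HExp.comp, WordExp.cost, HExp.size]; omega
  | sub e f ihe ihf => simp [HExp.comp, WordExp.cost, HExp.size]; omega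
  | mul e f ihe ihf => simp [HExp.comp, WordExp.cost, HExp.size]; omega

theorem cost_comp_le_of_wf {e : HExp} (he : e.wf = true) : e.comp.cost ≤ 1200 := by
  have := cost_comp_le e
  simp [HExp.wf] at he; omega

/-! ## Proof rules -/

namespace Env

variable (E : Env)

/-- Started in the state `h`, the program halts in a state that satisfies `Q`; one unit of the
time in the states stands for at most `8000` operations. -/
def wp (p : HProg) (h : HState E.b) (Q : HState E.b → Prop) : Prop :=
  p.wf = true → E.Bd h.v → ∃ h' : HState E.b,
    (∃ t, Run E.w E.b E.q (p.comp E.M) (E.conc h) (E.conc h') t ∧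
      t + 8000 * E.q * h.t ≤ 8000 * E.q * h'.t) ∧
    E.Bd h'.v ∧ (∀ a, a ∉ p.mods → h'.v a = h.v a) ∧ Q h'

variable {E} {p r : HProg} {h : HState E.b} {Q Q' : HState E.b → Prop}

theorem wp.mono (H : E.wp p h Q) (hQ : ∀ s, E.Bd s.v → (∀ a, a ∉ p.mods → s.v a = h.v a) → Q s → Q' s) :
    E.wp p h Q' := by
  intro hwf hbd
  obtain ⟨h', ht, hb, hf, hq⟩ := H hwf hbd
  exact ⟨h', ht, hb, hf, hQ _ hb hf hq⟩

theorem exec_intro (h' : HState E.b) (t : ℕ) (H : Q h')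
    (hr : Run E.w E.b E.q (p.comp E.M) (E.conc h) (E.conc h') t)
    (ht : t + 8000 * E.q * h.t ≤ 8000 * E.q * h'.t) (hb : E.Bd h'.v)
    (hf : ∀ a, a ∉ p.mods → h'.v a = h.v a) :
    ∃ h' : HState E.b, (∃ t, Run E.w E.b E.q (p.comp E.M) (E.conc h) (E.conc h') t ∧
      t + 8000 * E.q * h.t ≤ 8000 * E.q * h'.t) ∧
    E.Bd h'.v ∧ (∀ a, a ∉ p.mods → h'.v a = h.v a) ∧ Q h' :=
  ⟨h', ⟨t, hr, ht⟩, hb, hf, H⟩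

theorem budget {q t u u' : ℕ} (ht : t ≤ 8000 * q) (hu : u' = u + 1) :
    t + 8000 * q * u ≤ 8000 * q * u' := by
  subst hu; rw [Nat.mul_add]; omega

theorem wp_skip (H : Q ⟨h.v, h.m, h.t + 1⟩) : E.wp .skip h Q := by
  intro _ hbd
  refine exec_intro _ ((WordExp.lit 0).cost + (WordExp.get (.lit 0)).cost + 1) H ?_ ?_ ?_ ?_
  · have := Run.setWord (w := E.w) (b := E.b) (q := E.q) (.lit 0) (.get (.lit 0)) (E.conc h)
      (by simp [WordExp.Fits]) ?_
    · simpa [WordExp.eval, conc, HProg.comp] using this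
    · refine ⟨by simp [WordExp.Fits], ?_⟩
      simp only [conc]
      exact (E.words_lt _ hbd _).trans_le (by simpa using E.pow_le_two_pow (p := 1) (by omega))
  · have := E.hq
    exact budget (by simp [WordExp.cost]; omega) rfl
  · exact hbd
  · intros; rfl

theorem wp_set {a : Nm} {e f : HExp} (hf : E.Bd h.v → f.eval h.v < E.B)
    (H : Q ⟨upd h.v a (e.eval h.v) (f.eval h.v), h.m, h.t + 1⟩) : E.wp (.set a e f) h Q := by
  intro hwf hbd
  simp [HProg.wf] at hwf
  refine exec_intro _ ((cellAddr a e.comp).cost + f.comp.cost + 1) H ?_ ?_ ?_ ?_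
  · have := Run.setWord (w := E.w) (b := E.b) (q := E.q) (cellAddr a e.comp) f.comp (E.conc h)
      (E.fits_addr hbd a hwf.1) (E.fits_wf hbd hwf.2)
    simpa only [conc, HProg.comp, eval_cellAddr, eval_comp, update_words] using this
  · have := E.hq
    have h1 := cost_comp_le_of_wf hwf.1
    have h2 := cost_comp_le_of_wf hwf.2
    exact budget (by simp [cellAddr, WordExp.cost]; omega) rfl
  · exact hbd.upd _ _ _ (hf hbd)
  · intro a' ha'; simp [mods] at ha'; simp [ha']

theorem wp_read {a : Nm} {e : HExp} (he : e.eval h.v < 4 * E.inp 1 + 2)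
    (H : Q ⟨upd h.v a 0 (E.inp (e.eval h.v)), h.m, h.t + 1⟩) : E.wp (.read a e) h Q := by
  intro hwf hbd
  simp [HProg.wf] at hwf
  have hr : E.words h.v (e.eval h.v) = E.inp (e.eval h.v) := E.words_lt_len _ he
  refine exec_intro _ ((scAddr a).cost + (WordExp.get e.comp).cost + 1) H ?_ ?_ ?_ ?_
  · have := Run.setWord (w := E.w) (b := E.b) (q := E.q) (scAddr a) (.get e.comp) (E.conc h)
      (E.fits_scAddr hbd a) ⟨E.fits_wf hbd hwf, by
        refine (E.words_lt _ hbd _).trans_le (by simpa using E.pow_le_two_pow (p := 1) (by omega))⟩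
    simpa only [conc, HProg.comp, eval_scAddr, WordExp.eval, eval_comp, update_words, hr] using this
  · have := E.hq
    have h2 := cost_comp_le_of_wf hwf
    exact budget (by simp [scAddr, cellAddr, WordExp.cost]; omega) rfl
  · exact hbd.upd _ _ _ (E.hinp _)
  · intro a' ha'; simp [mods] at ha'; simp [ha']

theorem wp_setN {e f : HExp}
    (H : Q ⟨h.v, update h.m (e.eval h.v) (f.eval h.v : ZMod (2 ^ E.b)), h.t + 1⟩) :
    E.wp (.setN e f) h Q := by
  intro hwf hbd
  simp [HProg.wf] at hwf
  refine exec_intro _ (e.comp.cost + f.comp.cost + E.q) H ?_ ?_ ?_ ?_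
  · have := Run.setNum (w := E.w) (b := E.b) (q := E.q) e.comp f.comp (E.conc h)
      (E.fits_wf hbd hwf.1) (E.fits_wf hbd hwf.2)
    simpa only [conc, HProg.comp, eval_comp] using this
  · have := E.hq
    have h1 := cost_comp_le_of_wf hwf.1
    have h2 := cost_comp_le_of_wf hwf.2
    exact budget (by omega) rfl
  · exact hbd
  · intros; rfl

theorem wp_arith {op : NumOp} {e x y : HExp}
    (H : Q ⟨h.v, update h.m (e.eval h.v)
      (op.apply (h.m (x.eval h.v)) (h.m (y.eval h.v))), h.t + 1⟩) :
    E.wp (.arith op e x y) h Q := by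
  intro hwf hbd
  simp [HProg.wf] at hwf
  refine exec_intro _ (e.comp.cost + x.comp.cost + y.comp.cost + E.q) H ?_ ?_ ?_ ?_
  · have := Run.arith (w := E.w) (b := E.b) (q := E.q) op e.comp x.comp y.comp (E.conc h)
      (E.fits_wf hbd hwf.1.1) (E.fits_wf hbd hwf.1.2) (E.fits_wf hbd hwf.2)
    simpa only [conc, HProg.comp, eval_comp] using this
  · have := E.hq
    have h1 := cost_comp_le_of_wf hwf.1.1
    have h2 := cost_comp_le_of_wf hwf.1.2
    have h3 := cost_comp_le_of_wf hwf.2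
    exact budget (by omega) rfl
  · exact hbd
  · intros; rfl

open Classical in
theorem wp_test {a : Nm} {e : HExp}
    (H : Q ⟨upd h.v a 0 (if h.m (e.eval h.v) = 0 then 0 else 1), h.m, h.t + 1⟩) :
    E.wp (.test a e) h Q := by
  intro hwf hbd
  simp [HProg.wf] at hwf
  have h2 := cost_comp_le_of_wf hwf
  have hq := E.hq
  have hB := E.hB
  refine exec_intro _ ((scAddr a).cost + e.comp.cost + E.q) H ?_ ?_ ?_ ?_
  · by_cases h0 : h.m (e.eval h.v) = 0
    · have := Run.testNum_zero (w := E.w) (b := E.b) (q := E.q) (scAddr a) e.comp (E.conc h)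
        (E.fits_scAddr hbd a) (E.fits_wf hbd hwf) (by simpa only [conc, HProg.comp, eval_comp] using h0)
      simpa only [conc, HProg.comp, eval_scAddr, update_words, h0, if_true] using this
    · have := Run.testNum_ne (w := E.w) (b := E.b) (q := E.q) (scAddr a) e.comp (E.conc h)
        (E.fits_scAddr hbd a) (E.fits_wf hbd hwf) (by simpa only [conc, HProg.comp, eval_comp] using h0)
      simpa only [conc, HProg.comp, eval_scAddr, update_words, h0, if_false] using this
  · exact budget (by simp [scAddr, cellAddr, WordExp.cost]; omega) rfl
  · exact hbd.upd _ _ _ (by split_ifs <;> omega)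
  · intro a' ha'; simp [mods] at ha'; simp [ha']

theorem wp_seq (H : E.wp p h (fun s => E.wp r s Q)) : E.wp (p ;; r) h Q := by
  intro hwf hbd
  simp [HProg.wf] at hwf
  obtain ⟨s, ⟨t, hr, ht⟩, hb, hf, H⟩ := H hwf.1 hbd
  obtain ⟨s', ⟨t', hr', ht'⟩, hb', hf', H'⟩ := H hwf.2 hb
  refine ⟨s', ⟨_, .seq _ _ _ _ _ _ _ hr hr', by omega⟩, hb', ?_, H'⟩
  intro a ha
  simp [mods] at ha
  rw [hf' _ ha.2, hf _ ha.1]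

theorem wp_ite {e : HExp}
    (H1 : e.eval h.v ≠ 0 → E.wp p ⟨h.v, h.m, h.t + 1⟩ Q)
    (H2 : e.eval h.v = 0 → E.wp r ⟨h.v, h.m, h.t + 1⟩ Q) : E.wp (.ite e p r) h Q := by
  intro hwf hbd
  simp [HProg.wf] at hwf
  have h2 := cost_comp_le_of_wf hwf.1.1
  have hq := E.hq
  by_cases h0 : e.eval h.v = 0
  · obtain ⟨s, ⟨t, hr, ht⟩, hb, hf, H⟩ := H2 h0 hwf.2 hbd
    refine ⟨s, ⟨_, .ite_false _ _ _ _ _ _ (E.fits_wf hbd hwf.1.1) ?_ hr, ?_⟩, hb, ?_, H⟩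
    · simpa only [conc, HProg.comp, eval_comp] using h0
    · simp only [Nat.mul_add] at ht; omega
    · intro a ha; simp [mods] at ha; exact hf _ ha.2
  · obtain ⟨s, ⟨t, hr, ht⟩, hb, hf, H⟩ := H1 h0 hwf.1.2 hbd
    refine ⟨s, ⟨_, .ite_true _ _ _ _ _ _ (E.fits_wf hbd hwf.1.1) ?_ hr, ?_⟩, hb, ?_, H⟩
    · simpa only [conc, HProg.comp, eval_comp] using h0
    · simp only [Nat.mul_add] at ht; omega
    · intro a ha; simp [mods] at ha; exact hf _ ha.1

theorem wp_for {i m : Nm} (n c : ℕ)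
    (Inv : ℕ → (Store) → (ℕ → ZMod (2 ^ E.b)) → Prop) (hn : h.v m 0 = n)
    (h0 : Inv 0 (upd h.v i 0 0) h.m)
    (hs : ∀ j < n, ∀ s : HState E.b, (∀ a, a ∉ i :: p.mods → s.v a = h.v a) → s.v i 0 = j →
      Inv j s.v s.m → E.wp p s (fun s' => s'.t ≤ s.t + c ∧ Inv (j + 1) (upd s'.v i 0 (j + 1)) s'.m))
    (hQ : ∀ s : HState E.b, (∀ a, a ∉ i :: p.mods → s.v a = h.v a) → s.v i 0 = n →
      Inv n s.v s.m → s.t ≤ h.t + n * (c + 1) + 1 → Q s) :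
    E.wp (.for_ i m p) h Q := by
  intro hwf hbd
  simp [HProg.wf] at hwf
  obtain ⟨⟨⟨hwp, him⟩, hip⟩, hmp⟩ := hwf
  have hq := E.hq
  have hB := E.hB
  -- the loop from iteration `j` on
  have key : ∀ k j, j + k = n → ∀ s : HState E.b, E.Bd s.v →
      (∀ a, a ∉ i :: p.mods → s.v a = h.v a) → s.v i 0 = j → Inv j s.v s.m →
      ∃ s' : HState E.b, (∃ t, Run E.w E.b E.q
        (.loop (.sub (.get (scAddr m)) (.get (scAddr i)))
          (.seq (p.comp E.M) (.setWord (scAddr i)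
            (.add (.get (scAddr i)) (.lit 1))))) (E.conc s) (E.conc s') t ∧
        t + 8000 * E.q * s.t ≤ 8000 * E.q * s'.t + 50 * E.q) ∧ E.Bd s'.v ∧
        (∀ a, a ∉ i :: p.mods → s'.v a = h.v a) ∧ s'.v i 0 = n ∧ Inv n s'.v s'.m ∧
        s'.t ≤ s.t + k * (c + 1) := by
    intro k
    induction k with
    | zero =>
      intro j hj s hbs hfs his hinv; simp at hj; subst hj
      refine ⟨s, ⟨_, Run.loop_stop _ _ _ ⟨E.fits_sc hbs m, E.fits_sc hbs i⟩ ?_, ?_⟩, hbs, hfs, his,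
        hinv, by omega⟩
      · show _ - _ = 0
        have h1 := E.eval_sc s.v m
        have h2 := E.eval_sc s.v i
        simp only [conc]; rw [h1, h2, hfs m (by simp [Ne.symm him, hmp]), hn, his]; omega
      · simp [scAddr, cellAddr, WordExp.cost]; omega
    | succ k ih =>
      intro j hj s hbs hfs his hinv
      obtain ⟨s1, ⟨t1, hr1, ht1⟩, hb1, hf1, ⟨hc1, hi1⟩⟩ := hs j (by omega) s hfs his hinv hwp hbs
      have hm1 : n < E.B := by rw [← hn, ← hfs m (by simp [Ne.symm him, hmp])]; exact hbs _ _
      have hi' : s1.v i 0 = j := by rw [hf1 i hip, his]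
      have hb2 : E.Bd (upd s1.v i 0 (j + 1)) := hb1.upd _ _ _ (by omega)
      obtain ⟨s3, ⟨t3, hr3, ht3⟩, hb3, hf3, hi3, hinv3, hc3⟩ := ih (j + 1) (by omega)
        ⟨upd s1.v i 0 (j + 1), s1.m, s1.t + 1⟩ hb2 (by
          intro a ha; simp at ha; simp only
          rw [upd_ne _ ha.1, hf1 a ha.2, hfs a (by simp [ha])]) (by simp) hi1
      have h2 := E.eval_sc s1.v i
      have h3 : E.conc ⟨upd s1.v i 0 (j + 1), s1.m, s1.t + 1⟩ =
          ⟨update (E.conc s1).word ((scAddr i).eval (E.conc s1).word)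
            ((WordExp.add (.get (scAddr i)) (.lit 1)).eval (E.conc s1).word),
            (E.conc s1).num⟩ := by
        simp only [conc]; rw [eval_scAddr, WordExp.eval, h2, hi', update_words]; rfl
      rw [h3] at hr3
      have hfit : (WordExp.add (.get (scAddr i)) (.lit 1)).Fits E.w (E.conc s1).word := by
        have := E.pow_le_two_pow (p := 1) (by omega)
        rw [pow_one] at this; refine ⟨E.fits_sc hb1 i, ?_, ?_⟩
        · simp only [WordExp.Fits]; omega
        · simp only [conc]; rw [h2, hi']; simp only [WordExp.eval]; omega
      have hne : (WordExp.sub (.get (scAddr m)) (.get (scAddr i))).eval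
          (E.conc s).word ≠ 0 := by
        show _ - _ ≠ 0
        have h1 := E.eval_sc s.v m
        have h2 := E.eval_sc s.v i
        simp only [conc]; rw [h1, h2, hfs m (by simp [Ne.symm him, hmp]), hn, his]; omega
      have hfs2 : (WordExp.sub (.get (scAddr m)) (.get (scAddr i))).Fits E.w
          (E.conc s).word := ⟨E.fits_sc hbs m, E.fits_sc hbs i⟩
      have hrun := Run.loop_step _ _ _ _ _ _ _
        hfs2 hne
        (.seq _ _ _ _ _ _ _ hr1 (.setWord _ _ _ (E.fits_scAddr hb1 i) hfit)) hr3
      refine ⟨s3, ⟨_, hrun, ?_⟩, hb3, hf3, hi3, hinv3, ?_⟩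
      · have : (8000 * E.q) * (s1.t + 1) = 8000 * E.q * s1.t + 8000 * E.q := by ring
        simp only [this] at ht3
        have hcost : (scAddr i).cost ≤ 20 ∧ (scAddr m).cost ≤ 20 := by
          simp [scAddr, cellAddr, WordExp.cost]
        simp only [WordExp.cost]; omega
      · have : (k + 1) * (c + 1) = k * (c + 1) + (c + 1) := by ring
        rw [this]; simp only at hc3; omega
  obtain ⟨s, ⟨t, hr, ht⟩, hb, hf, hi, hinv, hc⟩ := key n 0 (by omega)
    ⟨upd h.v i 0 0, h.m, h.t⟩ (hbd.upd _ _ _ (by omega)) (by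
      intro a ha; simp at ha
      simp [ha.1]) (by simp) h0
  have h3 : E.conc ⟨upd h.v i 0 0, h.m, h.t⟩ =
      ⟨update (E.conc h).word ((scAddr i).eval (E.conc h).word)
        ((WordExp.lit 0).eval (E.conc h).word), (E.conc h).num⟩ := by
    simp only [conc]; rw [eval_scAddr, WordExp.eval, update_words]
  rw [h3] at hr
  refine ⟨⟨s.v, s.m, s.t + 1⟩, ⟨_, .seq _ _ _ _ _ _ _
    (.setWord _ _ _ (E.fits_scAddr hbd i) (by simp [WordExp.Fits])) hr, ?_⟩, hb, ?_,
    hQ _ hf hi hinv ?_⟩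
  · simp only [scAddr, cellAddr, WordExp.cost]
    have : (8000 * E.q) * (s.t + 1) = 8000 * E.q * s.t + 8000 * E.q := by ring
    simp only [this]; simp only at ht; omega
  · intro a ha; exact hf a (by simpa [mods] using ha)
  · simp only at hc ⊢; omega

theorem wp_mm {d a c : Nm} (hD : 1 ≤ h.v d 0)
    (H : Q ⟨h.v, fun i => if h.v c 0 ≤ i ∧ i < h.v c 0 + h.v d 0 * h.v d 0 then
        ∑ k ∈ range (h.v d 0),
          h.m (h.v a 0 + ((i - h.v c 0) / h.v d 0 * h.v d 0 + k)) *
          h.m (h.v a 0 + (h.v d 0 * h.v d 0 + k * h.v d 0 + (i - h.v c 0) % h.v d 0))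
        else h.m i, h.t + (E.tmm (h.v d 0) + 3 * (h.v d 0 * h.v d 0) + 1)⟩) :
    E.wp (.mm d a c) h Q := by
  intro hwf hbd
  have hq := E.hq
  have hB := E.hB
  obtain ⟨s, t, hr, ht, hs⟩ := E.hM (h.v d 0) hD (hbd _ _)
    (cellsFrom h.m (h.v a 0) (2 * (h.v d 0 * h.v d 0)))
  set D := h.v d 0 with hDdef
  have hDB : D < E.B := hbd _ _
  have hDD : D * D < E.B * E.B := Nat.mul_lt_mul'' hDB hDB
  have hpw : 1024 * (E.B * E.B) ≤ 2 ^ E.w := by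
    have h1 := E.B_sq_mul_le (p := 2)
    rw [pow_two] at h1; exact h1.trans (E.pow_le_two_pow (by omega))
  have hBB : E.B ≤ E.B * E.B := Nat.le_mul_self _
  have ed := E.eval_sc h.v d
  have ea := E.eval_sc h.v a
  have ec := E.eval_sc h.v c
  rw [← hDdef] at ed
  have hac : h.v a 0 < E.B := hbd _ _
  have hcc : h.v c 0 < E.B := hbd _ _
  have fd := E.fits_sc hbd d
  have fa := E.fits_sc hbd a
  have fc := E.fits_sc hbd c
  have hmul : (WordExp.mul (.get (scAddr d)) (.get (scAddr d))).eval (E.words h.v)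
      = D * D := by
    simp only [WordExp.eval] at ed ⊢; rw [ed]
  have hmul2 : (WordExp.mul (.lit 2) (.mul (.get (scAddr d)) (.get (scAddr d)))).eval
      (E.words h.v) = 2 * (D * D) := by
    simp only [WordExp.eval] at ed ⊢; rw [ed]
  have hsc : (scAddr d).eval (E.words h.v) + 1 ≤ 2 ^ E.w := by
    rw [eval_scAddr]
    have := d.code_lt
    have := E.hN
    simp only [len]; omega
  have hrun := Run.call (w := E.w) (q := E.q) E.M (scAddr d) (.lit 1) (.get (scAddr a))
    (.mul (.lit 2) (.mul (.get (scAddr d)) (.get (scAddr d)))) (.lit 0) (.lit 0)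
    (.get (scAddr c)) (.mul (.get (scAddr d)) (.get (scAddr d)))
    (E.conc h) s t ?_ ?_ ?_ ?_ ?_ ?_
  · have hmem : (⟨overwriteCells (E.conc h).word s.word ((WordExp.lit 0).eval (E.conc h).word)
          ((WordExp.lit 0).eval (E.conc h).word),
        overwriteCells (E.conc h).num s.num ((WordExp.get (scAddr c)).eval (E.conc h).word)
          ((WordExp.mul (.get (scAddr d)) (.get (scAddr d))).eval (E.conc h).word)⟩ :
        Memory E.b) = E.conc ⟨h.v, fun i => if h.v c 0 ≤ i ∧ i < h.v c 0 + D * D then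
          ∑ k ∈ range D, h.m (h.v a 0 + ((i - h.v c 0) / D * D + k)) *
            h.m (h.v a 0 + (D * D + k * D + (i - h.v c 0) % D)) else h.m i,
          h.t + (E.tmm D + 3 * (D * D) + 1)⟩ := by
      simp only [conc]; rw [ec, hmul]
      congr 1
      · funext i
        simp only [overwriteCells]
        split_ifs with hi
        · obtain ⟨i, rfl⟩ := exists_eq_add_of_le hi.1
          have hi2 : i < D * D := by omega
          have h1 : i / D < D := div_lt_of_lt_mul hi2
          have h2 : i % D < D := mod_lt _ hD
          simp only [Nat.add_sub_cancel_left]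
          have h3 := hs _ h1 _ h2
          rw [div_add_mod] at h3; rw [h3]; refine sum_congr rfl fun k hk => ?_
          rw [mem_range] at hk
          have h4 : i / D * D + k < D * D := by
            calc _ < i / D * D + D := by omega
              _ = (i / D + 1) * D := by ring
              _ ≤ D * D := Nat.mul_le_mul_right _ h1
          have h5 : k * D + i % D < D * D := by
            calc _ < k * D + D := by omega
              _ = (k + 1) * D := by ring
              _ ≤ D * D := Nat.mul_le_mul_right _ hk
          simp only [cellsFrom]; rw [if_pos (by omega), if_pos (by omega)]
        · rfl
    rw [hmem] at hrun; refine exec_intro _ _ H hrun ?_ hbd (fun a _ => rfl)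
    · simp only [conc]; rw [hmul, hmul2]
      simp only [List.map, List.sum_cons, List.sum_nil, WordExp.cost, WordExp.eval, scAddr,
        cellAddr]
      have h1 : 8000 * E.q * (h.t + (E.tmm D + 3 * (D * D) + 1)) =
        8000 * E.q * h.t + 8000 * (E.q * E.tmm D) + 8000 * (E.q * (3 * (D * D))) + 8000 * E.q := by
        ring
      rw [h1]
      have h2 : E.q * (2 * (D * D) + D * D) = E.q * (3 * (D * D)) := by ring
      rw [h2]
      have h3 : D * D ≤ E.q * (D * D) := le_mul_of_pos_left _ hq
      have h4 : E.q * (3 * (D * D)) = 3 * (E.q * (D * D)) := by ring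
      omega
  · intro e he; simp only [List.mem_cons, List.not_mem_nil, or_false] at he; simp only [conc]
    have hm : (WordExp.mul (.get (scAddr d)) (.get (scAddr d))).Fits E.w
        (E.words h.v) := ⟨fd, fd, by rw [ed]; omega⟩
    rcases he with rfl | rfl | rfl | rfl | rfl | rfl | rfl | rfl
    · exact E.fits_scAddr hbd d
    · simp only [WordExp.Fits]; omega
    · exact fa
    · refine ⟨by simp only [WordExp.Fits]; omega, hm, ?_⟩
      rw [hmul]; simp only [WordExp.eval]; omega
    · simp [WordExp.Fits]
    · simp [WordExp.Fits]
    · exact fc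
    · exact hm
  · exact hsc
  · simp only [conc]; rw [ea, hmul2]; omega
  · simp [WordExp.eval]
  · simp only [conc]; rw [ec, hmul]; omega
  · convert hr using 1
    simp only [conc]
    congr 1
    · funext i
      simp only [cellsFrom, show WordExp.eval (E.words h.v) (.lit 1) = 1 from rfl]
      rcases Nat.eq_zero_or_pos i with rfl | hi
      · simpa [WordExp.eval] using ed
      · rw [if_neg (by omega), if_neg (by omega)]
    · rw [ea, hmul2]
      funext i
      simp only [cellsFrom, Nat.zero_add]
      split_ifs <;> rfl

end Env

/-! ## Ternary digits -/

/-- The `i`-th ternary digit. -/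
def digit (x i : ℕ) : Fin 3 := ⟨x / 3 ^ i % 3, mod_lt _ (by norm_num)⟩

/-- The number with the ternary digits `δ 0, …, δ (s - 1)`. -/
def ofDigits3 (s : ℕ) (δ : ℕ → Fin 3) : ℕ := ∑ i ∈ range s, (δ i : ℕ) * 3 ^ i

theorem ofDigits3_succ (s : ℕ) (δ : ℕ → Fin 3) :
    ofDigits3 (s + 1) δ = ofDigits3 s δ + (δ s : ℕ) * 3 ^ s := by
  simp [ofDigits3, sum_range_succ]

theorem ofDigits3_congr {s : ℕ} {δ δ' : ℕ → Fin 3} (h : ∀ i < s, δ i = δ' i) :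
    ofDigits3 s δ = ofDigits3 s δ' :=
  sum_congr rfl fun i hi => by rw [h i (mem_range.1 hi)]

theorem ofDigits3_lt (s : ℕ) (δ : ℕ → Fin 3) : ofDigits3 s δ < 3 ^ s := by
  induction s with
  | zero => simp [ofDigits3]
  | succ s ih =>
    rw [ofDigits3_succ, pow_succ]
    have := (δ s).isLt
    have h2 : (δ s : ℕ) * 3 ^ s ≤ 2 * 3 ^ s := Nat.mul_le_mul_right _ (by omega)
    omega

theorem ofDigits3_inj {s : ℕ} {δ δ' : ℕ → Fin 3} (h : ofDigits3 s δ = ofDigits3 s δ') :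
    ∀ i < s, δ i = δ' i := by
  induction s with
  | zero => intro i hi; omega
  | succ s ih =>
    rw [ofDigits3_succ, ofDigits3_succ] at h
    have h1 := ofDigits3_lt s δ
    have h2 := ofDigits3_lt s δ'
    have hd : (δ s : ℕ) = δ' s := by
      have e1 : (ofDigits3 s δ + (δ s : ℕ) * 3 ^ s) / 3 ^ s = δ s := by
        rw [add_mul_div_right _ _ (by positivity), div_eq_of_lt h1, zero_add]
      have e2 : (ofDigits3 s δ' + (δ' s : ℕ) * 3 ^ s) / 3 ^ s = δ' s := by
        rw [add_mul_div_right _ _ (by positivity), div_eq_of_lt h2, zero_add]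
      rw [← e1, ← e2, h]
    rw [hd] at h; intro i hi
    rcases lt_succ_iff_lt_or_eq.1 hi with hi | rfl
    · exact ih (by omega) i hi
    · exact Fin.ext hd

theorem ofDigits3_digit_mod (s x : ℕ) : ofDigits3 s (digit x) = x % 3 ^ s := by
  induction s with
  | zero => simp [ofDigits3, Nat.mod_one]
  | succ s ih =>
    rw [ofDigits3_succ, ih, pow_succ, Nat.mod_mul]; simp [digit, mul_comm]

theorem ofDigits3_digit {s x : ℕ} (h : x < 3 ^ s) : ofDigits3 s (digit x) = x := by
  rw [ofDigits3_digit_mod, mod_eq_of_lt h]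

theorem digit_add_mul {s x i : ℕ} (d : Fin 3) (h : x < 3 ^ s) (hi : i < s) :
    digit (x + d * 3 ^ s) i = digit x i := by
  have h1 : ofDigits3 s (digit (x + d * 3 ^ s)) = ofDigits3 s (digit x) := by
    rw [ofDigits3_digit_mod, ofDigits3_digit h, add_mul_mod_self_right, mod_eq_of_lt h]
  exact ofDigits3_inj h1 i hi

theorem digit_add_mul_self {s x : ℕ} (d : Fin 3) (h : x < 3 ^ s) :
    digit (x + d * 3 ^ s) s = d := by
  apply Fin.ext
  simp only [digit]
  rw [add_mul_div_right _ _ (by positivity), div_eq_of_lt h, zero_add,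
    mod_eq_of_lt d.isLt]

theorem sum_range_three_mul {R : Type*} [AddCommMonoid R] (P : ℕ) (g : ℕ → R) :
    ∑ x ∈ range (P * 3), g x = ∑ d : Fin 3, ∑ x ∈ range P, g (x + d * P) := by
  rw [mul_comm, show 3 * P = P + P + P by ring, sum_range_add, sum_range_add, Fin.sum_univ_three]
  simp only [Fin.val_zero, Fin.val_one, Fin.val_two, zero_mul, add_zero, one_mul]
  congr 1
  · congr 1
    exact sum_congr rfl fun x _ => by rw [add_comm]
  · exact sum_congr rfl fun x _ => by congr 1; ring

theorem sum_digits_prod {R : Type*} [CommSemiring R] (s : ℕ) (g : ℕ → Fin 3 → R) :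
    ∑ x ∈ range (3 ^ s), ∏ i ∈ range s, g i (digit x i) =
      ∏ i ∈ range s, ∑ d : Fin 3, g i d := by
  induction s with
  | zero => simp
  | succ s ih =>
    rw [pow_succ, sum_range_three_mul, prod_range_succ, ← ih, mul_sum]
    refine sum_congr rfl fun d _ => ?_
    rw [Finset.sum_mul]; refine sum_congr rfl fun x hx => ?_
    rw [mem_range] at hx; rw [prod_range_succ, digit_add_mul_self d hx]
    congr 1
    refine prod_congr rfl fun i hi => ?_
    rw [digit_add_mul d hx (mem_range.1 hi)]

theorem sum_range_mul_eq {R : Type*} [AddCommMonoid R] (Q D : ℕ) (g : ℕ → R) :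
    ∑ b ∈ range Q, ∑ i ∈ range D, g (b * D + i) = ∑ x ∈ range (Q * D), g x := by
  induction Q with
  | zero => simp
  | succ Q ih =>
    rw [sum_range_succ, ih, add_mul, one_mul, sum_range_add]

/-! ## Partial dominating sets at the edges of a branch decomposition -/

/-- The incidence data of a list of graph edges with numbers `x`, `x ∈ Λ`: the endpoints of the edge
`x` are `eu x` and `ev x`, and each vertex `v` is paid for by an edge `own v`. -/
structure Edges where
  /-- first endpoint -/
  eu : ℕ → ℕ
  /-- second endpoint -/
  ev : ℕ → ℕ
  /-- owner of a vertex -/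
  own : ℕ → ℕ
  /-- all edges -/
  Λ : Finset ℕ

/-- The transfer coefficients: `σ` is `0` for a vertex in the set, `1` for a vertex outside and not
dominated, `2` for a vertex outside; `r` is `0` in the set, `1` not dominated, `2` dominated. -/
def loc (R : Type*) [CommRing R] (σ r : Fin 3) : R :=
  if (σ = 0 ∧ r = 0) ∨ (σ = 1 ∧ r = 1) ∨ (σ = 2 ∧ r ≠ 0) then 1 else 0

/-- The sign of a digit at a forgotten vertex. -/
def wt (R : Type*) [CommRing R] (σ : Fin 3) : R := if σ = 1 then -1 else 1

namespace Edges

variable (G : Edges)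

/-- Incidence. -/
def inc (x v : ℕ) : Prop := G.eu x = v ∨ G.ev x = v

instance (x v : ℕ) : Decidable (G.inc x v) := inferInstanceAs (Decidable (_ ∨ _))

/-- The endpoints of a set of edges. -/
def VS (S : Finset ℕ) : Finset ℕ := S.biUnion fun x => {G.eu x, G.ev x}

theorem mem_VS {S : Finset ℕ} {v : ℕ} : v ∈ G.VS S ↔ ∃ x ∈ S, G.inc x v := by
  simp [VS, inc, eq_comm]

theorem VS_union (S S' : Finset ℕ) : G.VS (S ∪ S') = G.VS S ∪ G.VS S' := by
  ext v; simp [mem_VS, or_and_right, exists_or]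

theorem VS_mono {S S' : Finset ℕ} (h : S ⊆ S') : G.VS S ⊆ G.VS S' :=
  Finset.biUnion_subset_biUnion_of_subset_left _ h

/-- `v` has a neighbour in `D` along an edge in `S`. -/
def dom (S D : Finset ℕ) (v : ℕ) : Prop :=
  ∃ x ∈ S, (G.eu x = v ∧ G.ev x ∈ D) ∨ (G.ev x = v ∧ G.eu x ∈ D)

instance (S D : Finset ℕ) (v : ℕ) : Decidable (G.dom S D v) :=
  inferInstanceAs (Decidable (∃ x ∈ S, _))

/-- The state of a vertex. -/
def pt (S D : Finset ℕ) (v : ℕ) : Fin 3 := if v ∈ D then 0 else if G.dom S D v then 2 else 1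

/-- The vertices paid for by an edge in `S`. -/
def Own (S : Finset ℕ) : Finset ℕ := (G.VS S).filter fun v => G.own v ∈ S

/-- `M` contains all endpoints of edges in `S` that are endpoints of another edge. -/
structure Closed (S M : Finset ℕ) : Prop where
  sub : S ⊆ G.Λ
  M_sub : M ⊆ G.VS S
  mem : ∀ v ∈ G.VS S, v ∉ M → ∀ x ∈ G.Λ, G.inc x v → x ∈ S

/-- The table of a family of sets. -/
def tab (R : Type*) [CommRing R] (S M : Finset ℕ) (A : Finset (Finset ℕ)) (σ : ℕ → Fin 3) : R :=
  ∑ D ∈ A, ∏ v ∈ M, loc R (σ v) (G.pt S D v)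

/-- Dominating sets among the endpoints of the edges. -/
def Dominating (D : Finset ℕ) : Prop :=
  D ⊆ G.VS G.Λ ∧ ∀ v ∈ G.VS G.Λ, v ∈ D ∨ G.dom G.Λ D v

/-- The dominating sets of interest: all, or those of minimum size. -/
def Target (full : Bool) (D : Finset ℕ) : Prop :=
  G.Dominating D ∧ (full = false → ∀ D', G.Dominating D' → D.card ≤ D'.card)

/-- Sets of endpoints of edges in `S` that dominate all endpoints outside `M`. -/
def Partial (S M D : Finset ℕ) : Prop :=
  D ⊆ G.VS S ∧ ∀ v ∈ G.VS S, v ∉ M → v ∈ D ∨ G.dom S D v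

/-- `A` describes, sorted by size above `lo`, the partial solutions on the edges in `S`. -/
structure Sem (full flat : Bool) (S M : Finset ℕ) (A : ℕ → Finset (Finset ℕ)) (lo W : ℕ) :
    Prop where
  empty : ∀ j, W < j → A j = ∅
  sound : ∀ j, ∀ D ∈ A j, G.Partial S M D ∧ (D ∩ G.Own S).card = lo + j
  complete : ∀ D, G.Target full D → ∃ j, (D ∩ G.Own S).card = lo + j ∧ ∃ D' ∈ A j,
    (∀ v ∈ M, G.pt S D' v = G.pt S D v) ∧ (flat = false → D' = D ∩ G.VS S)

/-- Agreement of two partial solutions at a join that forgets the vertices in `F`. -/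
def Compat (S₁ M₁ S₂ M₂ F D₁ D₂ : Finset ℕ) : Prop :=
  (∀ v ∈ M₁ ∩ M₂, v ∈ D₁ ↔ v ∈ D₂) ∧ ∀ v ∈ F, v ∈ D₁ ∪ D₂ ∨ G.dom S₁ D₁ v ∨ G.dom S₂ D₂ v

instance (S₁ M₁ S₂ M₂ F D₁ D₂ : Finset ℕ) : Decidable (G.Compat S₁ M₁ S₂ M₂ F D₁ D₂) :=
  inferInstanceAs (Decidable (_ ∧ _))

/-- The hypotheses of a join. -/
structure Join (S₁ M₁ S₂ M₂ M F : Finset ℕ) : Prop where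
  c₁ : G.Closed S₁ M₁
  c₂ : G.Closed S₂ M₂
  disj : Disjoint S₁ S₂
  c : G.Closed (S₁ ∪ S₂) M
  union : M ∪ F = M₁ ∪ M₂
  disjF : Disjoint M F

/-- The family at a join. -/
def joinFam (S₁ M₁ S₂ M₂ F : Finset ℕ) (A₁ A₂ : ℕ → Finset (Finset ℕ)) (J : ℕ) :
    Finset (Finset ℕ) :=
  (range (J + 1)).biUnion fun j => ((A₁ j ×ˢ A₂ (J - j)).filter fun D =>
    G.Compat S₁ M₁ S₂ M₂ F D.1 D.2).image fun D => D.1 ∪ D.2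

variable {G}

theorem dom_mono {S S' D D' : Finset ℕ} (hS : S ⊆ S') (hD : D ⊆ D') {v : ℕ} (h : G.dom S D v) :
    G.dom S' D' v := by
  obtain ⟨x, hx, h⟩ := h
  exact ⟨x, hS hx, h.imp (fun h => ⟨h.1, hD h.2⟩) fun h => ⟨h.1, hD h.2⟩⟩

theorem dom_union_left {S S' D : Finset ℕ} {v : ℕ} :
    G.dom (S ∪ S') D v ↔ G.dom S D v ∨ G.dom S' D v := by
  simp [dom, or_and_right, exists_or]

theorem dom_inter_VS {S D : Finset ℕ} {v : ℕ} : G.dom S (D ∩ G.VS S) v ↔ G.dom S D v := by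
  refine ⟨fun h => dom_mono subset_rfl inter_subset_left h, ?_⟩
  rintro ⟨x, hx, h⟩
  refine ⟨x, hx, h.imp (fun h => ⟨h.1, ?_⟩) fun h => ⟨h.1, ?_⟩⟩
  · exact mem_inter.2 ⟨h.2, G.mem_VS.2 ⟨x, hx, .inr rfl⟩⟩
  · exact mem_inter.2 ⟨h.2, G.mem_VS.2 ⟨x, hx, .inl rfl⟩⟩

theorem mem_VS_of_dom {S D : Finset ℕ} {v : ℕ} (h : G.dom S D v) : v ∈ G.VS S := by
  obtain ⟨x, hx, h⟩ := h
  exact G.mem_VS.2 ⟨x, hx, h.imp (·.1) (·.1)⟩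

namespace Join

variable {S₁ M₁ S₂ M₂ M F : Finset ℕ} (H : G.Join S₁ M₁ S₂ M₂ M F)
include H

theorem shared {v : ℕ} (h₁ : v ∈ G.VS S₁) (h₂ : v ∈ G.VS S₂) : v ∈ M₁ ∩ M₂ := by
  obtain ⟨x, hx, hxv⟩ := G.mem_VS.1 h₁
  obtain ⟨y, hy, hyv⟩ := G.mem_VS.1 h₂
  by_contra hv
  rw [mem_inter, not_and_or] at hv
  rcases hv with hv | hv
  · exact disjoint_left.1 H.disj (H.c₁.mem v h₁ hv y (H.c₂.sub hy) hyv) hy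
  · exact disjoint_left.1 H.disj hx (H.c₂.mem v h₂ hv x (H.c₁.sub hx) hxv)

/-- Agreeing parts are recovered from their union. -/
theorem inter_left {D₁ D₂ : Finset ℕ} (h₁ : D₁ ⊆ G.VS S₁) (h₂ : D₂ ⊆ G.VS S₂)
    (ha : ∀ v ∈ M₁ ∩ M₂, v ∈ D₁ ↔ v ∈ D₂) : (D₁ ∪ D₂) ∩ G.VS S₁ = D₁ := by
  ext v
  simp only [mem_inter, mem_union]
  constructor
  · rintro ⟨h | h, hv⟩
    · exact h
    · exact (ha v (H.shared hv (h₂ h))).2 h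
  · exact fun h => ⟨.inl h, h₁ h⟩

theorem inter_right {D₁ D₂ : Finset ℕ} (h₁ : D₁ ⊆ G.VS S₁) (h₂ : D₂ ⊆ G.VS S₂)
    (ha : ∀ v ∈ M₁ ∩ M₂, v ∈ D₁ ↔ v ∈ D₂) : (D₁ ∪ D₂) ∩ G.VS S₂ = D₂ := by
  ext v
  simp only [mem_inter, mem_union]
  constructor
  · rintro ⟨h | h, hv⟩
    · exact (ha v (H.shared (h₁ h) hv)).1 h
    · exact h
  · exact fun h => ⟨.inr h, h₂ h⟩

theorem dom_iff {D₁ D₂ : Finset ℕ} (h₁ : D₁ ⊆ G.VS S₁) (h₂ : D₂ ⊆ G.VS S₂)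
    (ha : ∀ v ∈ M₁ ∩ M₂, v ∈ D₁ ↔ v ∈ D₂) {v : ℕ} :
    G.dom (S₁ ∪ S₂) (D₁ ∪ D₂) v ↔ G.dom S₁ D₁ v ∨ G.dom S₂ D₂ v := by
  rw [dom_union_left, ← dom_inter_VS (S := S₁), ← dom_inter_VS (S := S₂),
    H.inter_left h₁ h₂ ha, H.inter_right h₁ h₂ ha]

/-- The factor of a vertex on one side. -/
def factor (_H : G.Join S₁ M₁ S₂ M₂ M F) (R : Type*) [CommRing R] (D₁ D₂ : Finset ℕ) (v : ℕ)
    (s : Fin 3) : R :=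
  (if v ∈ M₁ then loc R s (G.pt S₁ D₁ v) else 1) * (if v ∈ M₂ then loc R s (G.pt S₂ D₂ v) else 1)

omit H in
theorem loc_mul_loc_of_ne {R : Type*} [CommRing R] {s r r' : Fin 3} (h : ¬ (r = 0 ↔ r' = 0)) :
    loc R s r * loc R s r' = 0 := by
  revert h
  fin_cases s <;> fin_cases r <;> fin_cases r' <;> simp [loc]

omit H in
theorem pt_eq_zero {S D : Finset ℕ} {v : ℕ} : G.pt S D v = 0 ↔ v ∈ D := by
  unfold pt; split_ifs <;> simp_all

theorem factor_of_disagree {R : Type*} [CommRing R] {D₁ D₂ : Finset ℕ} {v : ℕ}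
    (hv : v ∈ M₁ ∩ M₂) (h : ¬ (v ∈ D₁ ↔ v ∈ D₂)) (s : Fin 3) : H.factor R D₁ D₂ v s = 0 := by
  rw [mem_inter] at hv
  simp only [factor, hv.1, hv.2, if_true]
  exact loc_mul_loc_of_ne (by rwa [pt_eq_zero, pt_eq_zero])

theorem factor_of_agree {R : Type*} [CommRing R] {D₁ D₂ : Finset ℕ} (h₁ : D₁ ⊆ G.VS S₁)
    (h₂ : D₂ ⊆ G.VS S₂) (ha : ∀ v ∈ M₁ ∩ M₂, v ∈ D₁ ↔ v ∈ D₂) {v : ℕ} (hv : v ∈ M₁ ∪ M₂)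
    (s : Fin 3) : H.factor R D₁ D₂ v s = loc R s (G.pt (S₁ ∪ S₂) (D₁ ∪ D₂) v) := by
  have hd := H.dom_iff h₁ h₂ ha (v := v)
  by_cases hv₁ : v ∈ M₁ <;> by_cases hv₂ : v ∈ M₂
  · have := ha v (mem_inter.2 ⟨hv₁, hv₂⟩)
    simp only [factor, hv₁, hv₂, if_true]; simp only [pt, hd, mem_union, this, or_self]
    by_cases a : v ∈ D₂ <;> by_cases b : G.dom S₁ D₁ v <;> by_cases c : G.dom S₂ D₂ v <;>
      simp only [a, b, c, if_true, if_false, or_true, true_or, or_self] <;>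
      fin_cases s <;> simp [loc]
  · have hn : v ∉ G.VS S₂ := fun h =>
      hv₂ (mem_inter.1 (H.shared (H.c₁.M_sub hv₁) h)).2
    have h3 : v ∉ D₂ := fun h => hn (h₂ h)
    have h4 : ¬ G.dom S₂ D₂ v := fun h => hn (mem_VS_of_dom h)
    simp [factor, hv₁, hv₂, pt, hd, h3, h4]
  · have hn : v ∉ G.VS S₁ := fun h =>
      hv₁ (mem_inter.1 (H.shared h (H.c₂.M_sub hv₂))).1
    have h3 : v ∉ D₁ := fun h => hn (h₁ h)
    have h4 : ¬ G.dom S₁ D₁ v := fun h => hn (mem_VS_of_dom h)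
    simp [factor, hv₁, hv₂, pt, hd, h3, h4]
  · simp_all

omit H in
theorem sum_wt_loc {R : Type*} [CommRing R] (r : Fin 3) :
    ∑ s : Fin 3, wt R s * loc R s r = if r = 1 then 0 else 1 := by
  fin_cases r <;> simp [Fin.sum_univ_three, wt, loc]

/-- Summation over the states of the forgotten vertices glues two partial solutions. -/
theorem prod_factor {R : Type*} [CommRing R] {D₁ D₂ : Finset ℕ} (h₁ : D₁ ⊆ G.VS S₁)
    (h₂ : D₂ ⊆ G.VS S₂) (σ : ℕ → Fin 3) :
    (∏ v ∈ M, H.factor R D₁ D₂ v (σ v)) * ∏ v ∈ F, ∑ s, wt R s * H.factor R D₁ D₂ v s =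
      if G.Compat S₁ M₁ S₂ M₂ F D₁ D₂ then
        ∏ v ∈ M, loc R (σ v) (G.pt (S₁ ∪ S₂) (D₁ ∪ D₂) v) else 0 := by
  by_cases ha : ∀ v ∈ M₁ ∩ M₂, v ∈ D₁ ↔ v ∈ D₂
  · have hM : ∀ v ∈ M, v ∈ M₁ ∪ M₂ := fun v hv => H.union ▸ mem_union_left _ hv
    have hF : ∀ v ∈ F, v ∈ M₁ ∪ M₂ := fun v hv => H.union ▸ mem_union_right _ hv
    rw [prod_congr rfl fun v hv => H.factor_of_agree h₁ h₂ ha (hM v hv) (σ v)]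
    have : ∀ v ∈ F, ∑ s, wt R s * H.factor R D₁ D₂ v s =
        if v ∈ D₁ ∪ D₂ ∨ G.dom S₁ D₁ v ∨ G.dom S₂ D₂ v then 1 else 0 := by
      intro v hv
      rw [sum_congr rfl fun s _ => by rw [H.factor_of_agree h₁ h₂ ha (hF v hv) s],
        sum_wt_loc]
      simp only [pt, H.dom_iff h₁ h₂ ha]
      by_cases a : v ∈ D₁ ∪ D₂ <;> by_cases b : G.dom S₁ D₁ v ∨ G.dom S₂ D₂ v <;> simp [a, b]
    rw [prod_congr rfl this]
    by_cases hc : ∀ v ∈ F, v ∈ D₁ ∪ D₂ ∨ G.dom S₁ D₁ v ∨ G.dom S₂ D₂ v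
    · rw [if_pos ⟨ha, hc⟩, prod_congr rfl fun v hv => if_pos (hc v hv)]; simp
    · rw [if_neg fun h => hc h.2]
      push Not at hc
      obtain ⟨v, hv, h⟩ := hc; rw [prod_eq_zero hv (if_neg (by tauto)), mul_zero]
  · rw [if_neg fun h => ha h.1]
    push Not at ha
    obtain ⟨v, hv, h⟩ := ha
    have h' : ¬ (v ∈ D₁ ↔ v ∈ D₂) := by tauto
    have hvU : v ∈ M ∪ F := by
      rw [H.union]; exact mem_union_left _ (mem_inter.1 hv).1
    rcases mem_union.1 hvU with hv' | hv'
    · rw [prod_eq_zero hv' (H.factor_of_disagree hv h' _), zero_mul]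
    · rw [prod_eq_zero hv' , mul_zero]
      exact sum_eq_zero fun s _ => by rw [H.factor_of_disagree hv h', mul_zero]

end Join

end Edges

namespace Edges

variable {G : Edges}

namespace Join

variable {S₁ M₁ S₂ M₂ M F : Finset ℕ} (H : G.Join S₁ M₁ S₂ M₂ M F)
include H

/-- The contraction of two tables over the states of the forgotten vertices. -/
theorem sum_tab_mul_tab {R : Type*} [CommRing R] {n : ℕ} {f : ℕ → ℕ}
    (hF : F = (range n).image f) (hf : Set.InjOn f (range n))
    {A₁ A₂ : Finset (Finset ℕ)} (h₁ : ∀ D ∈ A₁, D ⊆ G.VS S₁) (h₂ : ∀ D ∈ A₂, D ⊆ G.VS S₂)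
    (σ : ℕ → Fin 3) (τ : ℕ → ℕ → Fin 3) (hτ : ∀ x < 3 ^ n, ∀ v ∈ M, τ x v = σ v)
    (hτF : ∀ x < 3 ^ n, ∀ i < n, τ x (f i) = digit x i) :
    ∑ x ∈ range (3 ^ n), (∏ i ∈ range n, wt R (digit x i)) *
      (G.tab R S₁ M₁ A₁ (τ x) * G.tab R S₂ M₂ A₂ (τ x)) =
    ∑ D ∈ (A₁ ×ˢ A₂).filter fun D => G.Compat S₁ M₁ S₂ M₂ F D.1 D.2,
      ∏ v ∈ M, loc R (σ v) (G.pt (S₁ ∪ S₂) (D.1 ∪ D.2) v) := by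
  have e1 : ∀ x < 3 ^ n, (∏ i ∈ range n, wt R (digit x i)) *
      (G.tab R S₁ M₁ A₁ (τ x) * G.tab R S₂ M₂ A₂ (τ x)) = ∑ D ∈ A₁ ×ˢ A₂,
      (∏ v ∈ M, H.factor R D.1 D.2 v (σ v)) * ∏ i ∈ range n,
        (wt R (digit x i) * H.factor R D.1 D.2 (f i) (digit x i)) := by
    intro x hx; simp only [tab]; rw [Finset.sum_mul_sum, ← Finset.sum_product', mul_sum]
    refine sum_congr rfl fun D hD => ?_
    have p1 : ∏ v ∈ M₁, loc R (τ x v) (G.pt S₁ D.1 v) = ∏ v ∈ M₁ ∪ M₂,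
        (if v ∈ M₁ then loc R (τ x v) (G.pt S₁ D.1 v) else 1) := by
      rw [prod_ite_mem, Finset.union_inter_cancel_left]
    have p2 : ∏ v ∈ M₂, loc R (τ x v) (G.pt S₂ D.2 v) = ∏ v ∈ M₁ ∪ M₂,
        (if v ∈ M₂ then loc R (τ x v) (G.pt S₂ D.2 v) else 1) := by
      rw [prod_ite_mem, Finset.union_inter_cancel_right]
    have p0 : (∏ v ∈ M₁, loc R (τ x v) (G.pt S₁ D.1 v)) *
        ∏ v ∈ M₂, loc R (τ x v) (G.pt S₂ D.2 v) =
        ∏ v ∈ M ∪ F, H.factor R D.1 D.2 v (τ x v) := by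
      rw [p1, p2, ← prod_mul_distrib, H.union]; rfl
    rw [p0, Finset.prod_union H.disjF, prod_mul_distrib]
    have p4 : ∏ v ∈ M, H.factor R D.1 D.2 v (τ x v) = ∏ v ∈ M, H.factor R D.1 D.2 v (σ v) :=
      prod_congr rfl fun v hv => by rw [hτ x hx v hv]
    have p3 : ∏ v ∈ F, H.factor R D.1 D.2 v (τ x v) =
        ∏ i ∈ range n, H.factor R D.1 D.2 (f i) (digit x i) := by
      subst hF; rw [prod_image hf]
      exact prod_congr rfl fun i hi => by rw [hτF x hx i (mem_range.1 hi)]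
    rw [p3, p4]; ring
  rw [sum_congr rfl fun x hx => e1 x (mem_range.1 hx), sum_comm,
    sum_filter]
  refine sum_congr rfl fun D hD => ?_
  rw [mem_product] at hD
  rw [← mul_sum, sum_digits_prod n fun i s => wt R s * H.factor R D.1 D.2 (f i) s,
    ← H.prod_factor (h₁ _ hD.1) (h₂ _ hD.2)]
  congr 1
  subst hF
  rw [prod_image hf]

variable {full flat : Bool} {A₁ A₂ : ℕ → Finset (Finset ℕ)} {lo₁ lo₂ W₁ W₂ : ℕ}
  (hA₁ : G.Sem full flat S₁ M₁ A₁ lo₁ W₁) (hA₂ : G.Sem full flat S₂ M₂ A₂ lo₂ W₂)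
include hA₁ hA₂

theorem tab_joinFam {R : Type*} [CommRing R] (J : ℕ) (σ : ℕ → Fin 3) :
    G.tab R (S₁ ∪ S₂) M (G.joinFam S₁ M₁ S₂ M₂ F A₁ A₂ J) σ = ∑ j ∈ range (J + 1),
      ∑ D ∈ (A₁ j ×ˢ A₂ (J - j)).filter fun D => G.Compat S₁ M₁ S₂ M₂ F D.1 D.2,
        ∏ v ∈ M, loc R (σ v) (G.pt (S₁ ∪ S₂) (D.1 ∪ D.2) v) := by
  have hl : ∀ j, ∀ D ∈ (A₁ j ×ˢ A₂ (J - j)).filter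
      (fun D => G.Compat S₁ M₁ S₂ M₂ F D.1 D.2),
      (D.1 ∪ D.2) ∩ G.VS S₁ = D.1 ∧ (D.1 ∪ D.2) ∩ G.VS S₂ = D.2 ∧ D.1 ∈ A₁ j := by
    intro j D hD; rw [mem_filter, mem_product] at hD
    have a1 := (hA₁.sound _ _ hD.1.1).1.1
    have a2 := (hA₂.sound _ _ hD.1.2).1.1
    exact ⟨H.inter_left a1 a2 hD.2.1, H.inter_right a1 a2 hD.2.1, hD.1.1⟩
  rw [tab, joinFam, Finset.sum_biUnion]
  · refine sum_congr rfl fun j _ => ?_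
    rw [sum_image]; intro D hD D' hD' hE; obtain ⟨a, b, _⟩ := hl j D hD
    obtain ⟨a', b', _⟩ := hl j D' hD'; simp only at hE; rw [hE] at a b
    exact Prod.ext (a.symm.trans a') (b.symm.trans b')
  · intro j _ j' _ hj; rw [Function.onFun, disjoint_left]; intro X hX hX'; rw [mem_image] at hX hX'
    obtain ⟨D, hD, rfl⟩ := hX; obtain ⟨D', hD', hE⟩ := hX'; obtain ⟨a, -, c⟩ := hl j D hD
    obtain ⟨a', -, c'⟩ := hl j' D' hD'; rw [hE, a] at a'
    have := (hA₁.sound _ _ c).2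
    have h' := (hA₁.sound _ _ c').2
    rw [← a'] at h'; omega

omit hA₁ hA₂ in
theorem own_inter (hinc : ∀ v ∈ G.VS G.Λ, G.own v ∈ G.Λ ∧ G.inc (G.own v) v) (D : Finset ℕ) :
    (D ∩ G.Own (S₁ ∪ S₂)).card =
      (D ∩ G.VS S₁ ∩ G.Own S₁).card + (D ∩ G.VS S₂ ∩ G.Own S₂).card := by
  rw [← card_union_of_disjoint]
  · congr 1
    ext v
    simp only [Own, mem_inter, mem_union, mem_filter, VS_union]
    constructor
    · rintro ⟨hD, hv, ho | ho⟩
      · have : v ∈ G.VS G.Λ := by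
          rcases hv with hv | hv
          · exact G.VS_mono H.c₁.sub hv
          · exact G.VS_mono H.c₂.sub hv
        have : v ∈ G.VS S₁ := G.mem_VS.2 ⟨_, ho, (hinc v this).2⟩
        exact .inl ⟨⟨hD, this⟩, this, ho⟩
      · have : v ∈ G.VS G.Λ := by
          rcases hv with hv | hv
          · exact G.VS_mono H.c₁.sub hv
          · exact G.VS_mono H.c₂.sub hv
        have : v ∈ G.VS S₂ := G.mem_VS.2 ⟨_, ho, (hinc v this).2⟩
        exact .inr ⟨⟨hD, this⟩, this, ho⟩
    · rintro (⟨⟨hD, _⟩, hv, ho⟩ | ⟨⟨hD, _⟩, hv, ho⟩)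
      · exact ⟨hD, .inl hv, .inl ho⟩
      · exact ⟨hD, .inr hv, .inr ho⟩
  · rw [disjoint_left]; intro v h1 h2; simp only [Own, mem_inter, mem_filter] at h1 h2
    exact disjoint_left.1 H.disj h1.2.2 h2.2.2

omit H hA₁ hA₂ in
theorem _root_.Edges.inter_VS_inter_Own (S D : Finset ℕ) : D ∩ G.VS S ∩ G.Own S = D ∩ G.Own S := by
  ext v; simp only [Own, mem_inter, mem_filter]; tauto

omit H hA₁ hA₂ in
theorem _root_.Edges.pt_inter (S D : Finset ℕ) {v : ℕ} (hv : v ∈ G.VS S) :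
    G.pt S (D ∩ G.VS S) v = G.pt S D v := by
  simp only [pt, dom_inter_VS, mem_inter, hv, and_true]

omit H hA₁ hA₂ in
theorem _root_.Edges.pt_eq_iff {S D D' : Finset ℕ} {v : ℕ} :
    G.pt S D v = G.pt S D' v ↔ (v ∈ D ↔ v ∈ D') ∧ (v ∉ D → (G.dom S D v ↔ G.dom S D' v)) := by
  unfold pt; split_ifs <;> simp_all

/-- The family at a join describes the partial solutions. -/
theorem sem (hinc : ∀ v ∈ G.VS G.Λ, G.own v ∈ G.Λ ∧ G.inc (G.own v) v) :
    G.Sem full flat (S₁ ∪ S₂) M (G.joinFam S₁ M₁ S₂ M₂ F A₁ A₂) (lo₁ + lo₂) (W₁ + W₂) where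
  empty J hJ := by
    refine subset_empty.1 (Finset.biUnion_subset.2 fun j _ => subset_empty.2 ?_)
    rcases Nat.lt_or_ge W₁ j with h | h
    · rw [hA₁.empty j h]; simp
    · rw [hA₂.empty (J - j) (by omega)]; simp
  sound J D hD := by
    simp only [joinFam, mem_biUnion, mem_image, mem_filter,
      mem_product, mem_range, Prod.exists] at hD
    obtain ⟨j, hj, D₁, D₂, ⟨⟨h1, h2⟩, hc⟩, rfl⟩ := hD; obtain ⟨⟨s1, f1⟩, n1⟩ := hA₁.sound _ _ h1
    obtain ⟨⟨s2, f2⟩, n2⟩ := hA₂.sound _ _ h2; refine ⟨⟨?_, ?_⟩, ?_⟩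
    · rw [VS_union]; exact union_subset_union s1 s2
    · intro v hv hM; rw [H.dom_iff s1 s2 hc.1]
      by_cases hF : v ∈ F
      · exact hc.2 v hF
      · have hU : v ∉ M₁ ∪ M₂ := by
          rw [← H.union, mem_union]; tauto
        rw [mem_union, not_or] at hU; rw [VS_union, mem_union] at hv; rw [mem_union]
        rcases hv with hv | hv
        · have := f1 v hv hU.1; tauto
        · have := f2 v hv hU.2; tauto
    · rw [H.own_inter hinc, H.inter_left s1 s2 hc.1, H.inter_right s1 s2 hc.1, n1, n2]; omega
  complete D hD := by
    obtain ⟨j₁, n1, D₁, h1, p1, e1⟩ := hA₁.complete D hD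
    obtain ⟨j₂, n2, D₂, h2, p2, e2⟩ := hA₂.complete D hD
    have s1 := (hA₁.sound _ _ h1).1.1
    have s2 := (hA₂.sound _ _ h2).1.1
    have ha : ∀ v ∈ M₁ ∩ M₂, v ∈ D₁ ↔ v ∈ D₂ := by
      intro v hv; rw [mem_inter] at hv
      rw [(pt_eq_iff.1 (p1 v hv.1)).1, (pt_eq_iff.1 (p2 v hv.2)).1]
    have hM : ∀ v ∈ M₁ ∪ M₂, G.pt (S₁ ∪ S₂) (D₁ ∪ D₂) v = G.pt (S₁ ∪ S₂) D v := by
      intro v hv; rw [pt_eq_iff, H.dom_iff s1 s2 ha, dom_union_left, mem_union]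
      by_cases hv₁ : v ∈ M₁
      · have q1 := pt_eq_iff.1 (p1 v hv₁)
        by_cases hv₂ : v ∈ M₂
        · have q2 := pt_eq_iff.1 (p2 v hv₂)
          tauto
        · have hn : v ∉ G.VS S₂ := fun h =>
            hv₂ (mem_inter.1 (H.shared (H.c₁.M_sub hv₁) h)).2
          have h3 : v ∉ D₂ := fun h => hn (s2 h)
          have h4 : ∀ X, ¬ G.dom S₂ X v := fun X h => hn (mem_VS_of_dom h)
          simp only [h3, h4, or_false]; exact q1
      · have hv₂ : v ∈ M₂ := by rw [mem_union] at hv; tauto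
        have q2 := pt_eq_iff.1 (p2 v hv₂)
        have hn : v ∉ G.VS S₁ := fun h =>
          hv₁ (mem_inter.1 (H.shared h (H.c₂.M_sub hv₂))).1
        have h3 : v ∉ D₁ := fun h => hn (s1 h)
        have h4 : ∀ X, ¬ G.dom S₁ X v := fun X h => hn (mem_VS_of_dom h)
        simp only [h3, h4, false_or]; exact q2
    refine ⟨j₁ + j₂, ?_, D₁ ∪ D₂, ?_, ?_, ?_⟩
    · rw [H.own_inter hinc, inter_VS_inter_Own, inter_VS_inter_Own, n1, n2]; omega
    · simp only [joinFam, mem_biUnion, mem_image, mem_filter,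
        mem_product, mem_range, Prod.exists]
      refine ⟨j₁, by omega, D₁, D₂, ⟨⟨h1, by rwa [Nat.add_sub_cancel_left]⟩, ha, ?_⟩, rfl⟩
      intro v hv
      have hvU : v ∈ M₁ ∪ M₂ := H.union ▸ mem_union_right _ hv
      have hvM : v ∉ M := fun h => disjoint_left.1 H.disjF h hv
      have hVS : v ∈ G.VS (S₁ ∪ S₂) := by
        rw [VS_union]; exact union_subset_union H.c₁.M_sub H.c₂.M_sub hvU
      have hq := pt_eq_iff.1 (hM v hvU)
      rw [H.dom_iff s1 s2 ha] at hq
      have : v ∈ D ∨ G.dom (S₁ ∪ S₂) D v := by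
        rcases hD.1.2 v (G.VS_mono H.c.sub hVS) with h | ⟨x, hx, h⟩
        · exact .inl h
        · exact .inr ⟨x, H.c.mem v hVS hvM x hx (h.imp (·.1) (·.1)), h⟩
      tauto
    · intro v hv; exact hM v (H.union ▸ mem_union_left _ hv)
    · intro hf; rw [e1 hf, e2 hf, VS_union, Finset.inter_union_distrib_left]

omit H hA₁ hA₂ in
theorem card_joinFam_le {k c : ℕ} (h1 : ∀ j, (A₁ j).card ≤ k) (h2 : ∀ j, (A₂ j).card ≤ c)
    (J : ℕ) : (G.joinFam S₁ M₁ S₂ M₂ F A₁ A₂ J).card ≤ (J + 1) * (k * c) := by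
  rw [joinFam]
  refine (card_biUnion_le_card_mul _ _ (k * c) fun j _ => ?_).trans (by simp)
  refine Finset.card_image_le.trans ((card_filter_le _ _).trans ?_)
  rw [Finset.card_product]
  exact Nat.mul_le_mul (h1 _) (h2 _)

end Join

variable {full flat : Bool} {S M : Finset ℕ} {A : ℕ → Finset (Finset ℕ)} {lo W : ℕ}

/-- Partial solutions that occur in minimum dominating sets have nearly minimum size. -/
theorem card_inter_Own_le (hc : G.Closed S M) (hinc : ∀ v ∈ G.VS G.Λ, G.own v ∈ G.Λ ∧
    G.inc (G.own v) v) {D D' : Finset ℕ} (hD : G.Target false D) (hD' : G.Partial S M D') :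
    (D ∩ G.Own S).card ≤ (D' ∩ G.Own S).card + M.card := by
  have hsub : G.VS S ⊆ G.VS G.Λ := G.VS_mono hc.sub
  have hdom : G.Dominating ((D \ G.VS S) ∪ (D' ∪ M)) := by
    refine ⟨?_, ?_⟩
    · refine union_subset (Finset.sdiff_subset.trans hD.1.1) (union_subset
        (hD'.1.trans hsub) (hc.M_sub.trans hsub))
    · intro v hv
      by_cases hvS : v ∈ G.VS S
      · by_cases hM : v ∈ M
        · exact .inl (by simp [hM])
        · rcases hD'.2 v hvS hM with h | h
          · exact .inl (by simp [h])
          · exact .inr (dom_mono hc.sub (fun x hx => by simp [hx]) h)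
      · rcases hD.1.2 v hv with h | ⟨x, hx, h⟩
        · exact .inl (by simp [h, hvS])
        · right
          have hxS : x ∉ S := fun hxS => hvS (G.mem_VS.2 ⟨x, hxS, h.imp (·.1) (·.1)⟩)
          have key : ∀ u, G.inc x u → u ∈ D → u ∈ (D \ G.VS S) ∪ (D' ∪ M) := by
            intro u hu huD
            by_cases huS : u ∈ G.VS S
            · have : u ∈ M := by
                by_contra hM
                exact hxS (hc.mem u huS hM x hx hu)
              simp [this]
            · simp [huD, huS]
          exact ⟨x, hx, h.imp (fun h => ⟨h.1, key _ (.inr rfl) h.2⟩)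
            fun h => ⟨h.1, key _ (.inl rfl) h.2⟩⟩
  have h1 := hD.2 rfl _ hdom
  have h2 : ((D \ G.VS S) ∪ (D' ∪ M)).card ≤
      (D \ G.VS S).card + ((D' ∩ G.Own S).card + M.card) := by
    refine (Finset.card_union_le _ _).trans (Nat.add_le_add_left ?_ _)
    refine le_trans (card_le_card (?_ : D' ∪ M ⊆ (D' ∩ G.Own S) ∪ M))
      (Finset.card_union_le _ _)
    intro v hv; rw [mem_union] at hv ⊢
    by_cases hM : v ∈ M
    · exact .inr hM
    · have hvD : v ∈ D' := by tauto
      have hvS := hD'.1 hvD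
      have ho := hinc v (hsub hvS)
      exact .inl (mem_inter.2 ⟨hvD, mem_filter.2 ⟨hvS,
        hc.mem v hvS hM _ ho.1 ho.2⟩⟩)
  have h3 : (D \ G.VS S).card + (D ∩ G.Own S).card ≤ D.card := by
    rw [← Finset.card_sdiff_add_card_inter D (G.VS S)]
    refine Nat.add_le_add_left (card_le_card ?_) _
    exact Finset.inter_subset_inter_left (filter_subset _ _)
  omega

/-- Restriction to the layers from the first nonempty one on. -/
theorem Sem.window (h : G.Sem full flat S M A lo W) (hc : G.Closed S M)
    (hinc : ∀ v ∈ G.VS G.Λ, G.own v ∈ G.Λ ∧ G.inc (G.own v) v) {j₀ W₀ : ℕ}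
    (hfull : full = true → lo = 0 ∧ j₀ = 0 ∧ (G.VS G.Λ).card ≤ W₀)
    (hne : full = false → (A j₀).Nonempty ∧ (∀ j < j₀, A j = ∅) ∧ W₀ = M.card) :
    G.Sem full flat S M (fun j => if j ≤ W₀ then A (j₀ + j) else ∅) (lo + j₀) W₀ where
  empty j hj := by simp [Nat.not_le.2 hj]
  sound j D hD := by
    split_ifs at hD with hj
    · have := h.sound _ _ hD
      exact ⟨this.1, by omega⟩
    · simp at hD
  complete D hD := by
    obtain ⟨j, n, D', hD', hp, he⟩ := h.complete D hD
    have hj : j₀ ≤ j ∧ j ≤ j₀ + W₀ := by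
      cases full with
      | true =>
        obtain ⟨h1, h2, h3⟩ := hfull rfl; refine ⟨by omega, ?_⟩
        have : (D ∩ G.Own S).card ≤ (G.VS G.Λ).card :=
          card_le_card (inter_subset_left.trans hD.1.1)
        omega
      | false =>
        obtain ⟨⟨D₀, hD₀⟩, h2, h3⟩ := hne rfl
        have s0 := h.sound _ _ hD₀
        have := card_inter_Own_le hc hinc hD s0.1
        refine ⟨?_, by omega⟩
        by_contra hlt
        rw [h2 j (by omega)] at hD'; simp at hD'
    refine ⟨j - j₀, by omega, D', ?_, hp, he⟩
    rw [if_pos (by omega), show j₀ + (j - j₀) = j by omega]; exact hD'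

/-- Reduction to one partial solution for each pattern. -/
theorem Sem.exists_flat (h : G.Sem full true S M A lo W) :
    ∃ A' : ℕ → Finset (Finset ℕ), G.Sem full true S M A' lo W ∧
      (∀ j, (A' j).card ≤ 3 ^ M.card) ∧ (∀ j, A' j = ∅ ↔ A j = ∅) ∧
      ∀ j (ρ : ℕ → Fin 3), ((A' j).filter fun D => ∀ v ∈ M, G.pt S D v = ρ v).card =
        if ((A j).filter fun D => ∀ v ∈ M, G.pt S D v = ρ v).card = 0 then 0 else 1 := by
  classical
  let pat : Finset ℕ → (M → Fin 3) := fun D v => G.pt S D v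
  have key : ∀ j, ∃ B ⊆ A j, Set.InjOn pat B ∧ (A j).image pat = B.image pat := by
    intro j
    obtain ⟨B, hB, hi⟩ := Finset.exists_subset_injOn_image_eq_of_surjOn (s := A j)
      (t := (A j).image pat) (f := pat) (by
        intro x hx; simpa using hx)
    exact ⟨B, by exact_mod_cast hB, hi.1, hi.2.symm⟩
  choose B hB hi hm using key
  have hpat : ∀ j, ∀ D ∈ A j, ∃ D' ∈ B j, ∀ v ∈ M, G.pt S D' v = G.pt S D v := by
    intro j D hD
    have : pat D ∈ (B j).image pat := hm j ▸ mem_image_of_mem _ hD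
    obtain ⟨D', hD', he⟩ := mem_image.1 this; exact ⟨D', hD', fun v hv => congrFun he ⟨v, hv⟩⟩
  refine ⟨B, ⟨?_, ?_, ?_⟩, ?_, ?_, ?_⟩
  · intro j hj
    have := hB j
    rw [h.empty j hj, subset_empty] at this; exact this
  · exact fun j D hD => h.sound j D (hB j hD)
  · intro D hD; obtain ⟨j, n, D', hD', hp, -⟩ := h.complete D hD
    obtain ⟨D'', hD'', hp'⟩ := hpat j D' hD'
    exact ⟨j, n, D'', hD'', fun v hv => (hp' v hv).trans (hp v hv), by simp⟩
  · intro j; rw [← card_image_of_injOn (hi j)]; exact (Finset.card_le_univ _).trans (by simp)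
  · intro j
    constructor
    · intro h0
      by_contra h1
      obtain ⟨D, hD⟩ := nonempty_iff_ne_empty.2 h1; obtain ⟨D', hD', -⟩ := hpat j D hD
      rw [h0] at hD'; simp at hD'
    · intro h0
      have := hB j
      rwa [h0, subset_empty] at this
  · intro j ρ
    split_ifs with h0
    · rw [card_eq_zero] at h0 ⊢; rw [filter_eq_empty_iff] at h0 ⊢; exact fun D hD => h0 (hB j hD)
    · have : 0 < ((A j).filter fun D => ∀ v ∈ M, G.pt S D v = ρ v).card := Nat.pos_of_ne_zero h0
      obtain ⟨D, hD⟩ := card_pos.1 this; rw [mem_filter] at hD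
      obtain ⟨D', hD', hp⟩ := hpat j D hD.1; rw [Finset.card_eq_one]
      refine ⟨D', Finset.eq_singleton_iff_unique_mem.2 ⟨?_, ?_⟩⟩
      · rw [mem_filter]; exact ⟨hD', fun v hv => (hp v hv).trans (hD.2 v hv)⟩
      · intro D'' hD''; rw [mem_filter] at hD''; refine hi j hD''.1 hD' ?_
        funext v
        show G.pt S D'' v = G.pt S D' v
        rw [hD''.2 v v.2, hp v v.2, hD.2 v v.2]

end Edges

/-! ## Tables -/

theorem digit_add_mul_pow {s p J x : ℕ} (hp : p < s) : digit (J * 3 ^ s + x) p = digit x p := by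
  apply Fin.ext
  obtain ⟨k, rfl⟩ := Nat.exists_eq_add_of_lt hp
  simp only [digit]
  rw [show J * 3 ^ (p + k + 1) + x = x + (J * 3 ^ k * 3) * 3 ^ p by ring,
    add_mul_div_right _ _ (by positivity), add_mul_mod_self_right]

theorem digit_sub_pow {s p x : ℕ} (hp : p < s) (hx : x < 3 ^ s) (h2 : digit x p = 2) :
    3 ^ p ≤ x ∧ ∀ i < s, digit (x - 3 ^ p) i = if i = p then 1 else digit x i := by
  have h1 : ofDigits3 s (digit x) = ofDigits3 s (update (digit x) p 1) + 3 ^ p := by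
    simp only [ofDigits3]
    rw [← add_sum_erase _ _ (mem_range.2 hp),
      ← add_sum_erase _ (fun i => ((update (digit x) p 1 i : Fin 3) : ℕ) * 3 ^ i)
        (mem_range.2 hp)]
    simp only [update_self, h2, Fin.val_two, Fin.val_one]
    have : ∀ i ∈ (range s).erase p, ((digit x i : Fin 3) : ℕ) * 3 ^ i =
        ((update (digit x) p 1 i : Fin 3) : ℕ) * 3 ^ i := fun i hi => by
      rw [update_of_ne (ne_of_mem_erase hi)]
    rw [sum_congr rfl this]; ring
  rw [ofDigits3_digit hx] at h1
  refine ⟨by omega, fun i hi => ?_⟩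
  have h3 : x - 3 ^ p = ofDigits3 s (update (digit x) p 1) := by omega
  have h4 : ofDigits3 s (digit (x - 3 ^ p)) = ofDigits3 s (update (digit x) p 1) := by
    rw [ofDigits3_digit (lt_of_le_of_lt (sub_le _ _) hx), h3]
  rw [ofDigits3_inj h4 i hi, update_apply]

/-- The value of a table cell with a kernel for each position. -/
def cellv {R : Type*} [CommRing R] (K : ℕ → Fin 3 → Fin 3 → R) (s : ℕ) {ι : Type*} (A : Finset ι)
    (g : ι → ℕ → Fin 3) (x : ℕ) : R :=
  ∑ D ∈ A, ∏ i ∈ range s, K i (digit x i) (g D i)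

/-- The kernel that selects equal states. -/
def eqK (R : Type*) [CommRing R] (σ r : Fin 3) : R := if σ = r then 1 else 0

theorem cellv_step {R : Type*} [CommRing R] {K K' : ℕ → Fin 3 → Fin 3 → R} {s p : ℕ} (hp : p < s)
    (c : R) (hne : ∀ i, i ≠ p → K' i = K i)
    (hK : ∀ σ r, K' p σ r = K p σ r + if σ = 2 then c * K p 1 r else 0) {ι : Type*}
    (A : Finset ι) (g : ι → ℕ → Fin 3) {x : ℕ} (hx : x < 3 ^ s) :
    cellv K' s A g x = cellv K s A g x +
      if digit x p = 2 then c * cellv K s A g (x - 3 ^ p) else 0 := by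
  have hmem := mem_range.2 hp
  have key : ∀ D, ∏ i ∈ range s, K' i (digit x i) (g D i) =
      ∏ i ∈ range s, K i (digit x i) (g D i) +
      if digit x p = 2 then c * ∏ i ∈ range s, K i (digit (x - 3 ^ p) i) (g D i) else 0 := by
    intro D
    rw [← mul_prod_erase _ _ hmem, ← mul_prod_erase _
      (fun i => K i (digit x i) (g D i)) hmem, hK,
      prod_congr rfl fun i hi => by rw [hne i (ne_of_mem_erase hi)]]
    split_ifs with h2
    · obtain ⟨-, hd⟩ := digit_sub_pow hp hx h2
      rw [← mul_prod_erase _ (fun i => K i (digit (x - 3 ^ p) i) (g D i)) hmem, hd p hp,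
        if_pos rfl]
      have : ∏ i ∈ (range s).erase p, K i (digit (x - 3 ^ p) i) (g D i) =
          ∏ i ∈ (range s).erase p, K i (digit x i) (g D i) := by
        refine prod_congr rfl fun i hi => ?_
        rw [mem_erase, mem_range] at hi; rw [hd i hi.2, if_neg hi.1]
      rw [this]; ring
    · ring
  simp only [cellv]
  rw [sum_congr rfl fun D _ => key D, sum_add_distrib]
  congr 1
  split_ifs
  · rw [mul_sum]
  · simp

theorem loc_mobius (R : Type*) [CommRing R] (σ r : Fin 3) :
    eqK R σ r = loc R σ r + if σ = 2 then (-1) * loc R 1 r else 0 := by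
  fin_cases σ <;> fin_cases r <;> simp [eqK, loc]

theorem eqK_zeta (R : Type*) [CommRing R] (σ r : Fin 3) :
    loc R σ r = eqK R σ r + if σ = 2 then 1 * eqK R 1 r else 0 := by
  fin_cases σ <;> fin_cases r <;> simp [eqK, loc]

theorem cellv_eqK {R : Type*} [CommRing R] (s : ℕ) {ι : Type*} (A : Finset ι)
    (g : ι → ℕ → Fin 3) (x : ℕ) :
    cellv (fun _ => eqK R) s A g x = ((A.filter fun D => ∀ i < s, g D i = digit x i).card : R) := by
  rw [cellv, card_filter, cast_sum]
  refine sum_congr rfl fun D _ => ?_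
  split_ifs with h
  · rw [prod_eq_one]; · simp
    intro i hi; rw [eqK, if_pos (h i (mem_range.1 hi)).symm]
  · push Not at h
    obtain ⟨i, hi, h⟩ := h
    rw [prod_eq_zero (mem_range.2 hi) (by rw [eqK, if_neg (Ne.symm h)])]; simp

namespace Edges

variable {G : Edges} {full flat : Bool} {S M : Finset ℕ} {A : ℕ → Finset (Finset ℕ)} {lo W : ℕ}

/-- The cells of a table whose positions are listed by `f`. -/
theorem tab_eq_cellv {R : Type*} [CommRing R] {s : ℕ} {f : ℕ → ℕ}
    (hM : M = (range s).image f) (hf : Set.InjOn f (range s))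
    (A : Finset (Finset ℕ)) (σ : ℕ → Fin 3) :
    G.tab R S M A σ = cellv (fun _ => loc R) s A (fun D i => G.pt S D (f i))
      (ofDigits3 s fun i => σ (f i)) := by
  subst hM
  simp only [tab, cellv]
  refine sum_congr rfl fun D _ => ?_
  rw [prod_image hf]
  refine prod_congr rfl fun i hi => ?_
  rw [ofDigits3_inj (ofDigits3_digit (ofDigits3_lt s fun i => σ (f i))) i (mem_range.1 hi)]

theorem exists_cellv_ne_zero {b s : ℕ} {f : ℕ → ℕ}
    (hM : M = (range s).image f) (hf : Set.InjOn f (range s))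
    {A : Finset (Finset ℕ)} {D₀ : Finset ℕ} (hD₀ : D₀ ∈ A)
    (hb : (A.filter fun D => ∀ v ∈ M, v ∈ D ↔ v ∈ D₀).card < 2 ^ b) :
    ∃ x < 3 ^ s, cellv (fun _ => loc (ZMod (2 ^ b))) s A (fun D i => G.pt S D (f i)) x ≠ 0 := by
  refine ⟨_, ofDigits3_lt s fun i => if f i ∈ D₀ then 0 else 2, ?_⟩
  have := tab_eq_cellv (G := G) (R := ZMod (2 ^ b)) (S := S) hM hf A fun v => if v ∈ D₀ then 0 else 2
  rw [← this, tab]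
  have h1 : ∀ D ∈ A, ∏ v ∈ M, loc (ZMod (2 ^ b)) (if v ∈ D₀ then 0 else 2) (G.pt S D v) =
      ((if ∀ v ∈ M, v ∈ D ↔ v ∈ D₀ then 1 else 0 : ℕ) : ZMod (2 ^ b)) := by
    intro D _
    have h2 : ∀ v, loc (ZMod (2 ^ b)) (if v ∈ D₀ then 0 else 2) (G.pt S D v) =
        if v ∈ D ↔ v ∈ D₀ then 1 else 0 := by
      intro v
      have := Join.pt_eq_zero (G := G) (S := S) (D := D) (v := v)
      by_cases a : v ∈ D <;> by_cases c : v ∈ D₀ <;> simp_all [loc]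
    simp only [h2]
    split_ifs with h
    · rw [prod_eq_one fun v hv => if_pos (h v hv)]; simp
    · push Not at h
      obtain ⟨v, hv, h⟩ := h; rw [prod_eq_zero hv (if_neg (by tauto))]; simp
  rw [sum_congr rfl h1, ← cast_sum, ← card_filter]
  intro h0
  rw [ZMod.natCast_eq_zero_iff] at h0
  have hpos : 0 < (A.filter fun D => ∀ v ∈ M, v ∈ D ↔ v ∈ D₀).card :=
    card_pos.2 ⟨D₀, by simp [hD₀]⟩
  exact absurd (Nat.le_of_dvd hpos h0) (by omega)

/-- Partial solutions of fixed size and trace on `M` are fewer than all sets of vertices. -/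
theorem card_filter_lt_two_pow (hc : G.Closed S M)
    (hinc : ∀ v ∈ G.VS G.Λ, G.own v ∈ G.Λ ∧ G.inc (G.own v) v) {n c : ℕ} (hn : 1 ≤ n)
    (hVS : G.VS G.Λ ⊆ range n) {A : Finset (Finset ℕ)}
    (hA : ∀ D ∈ A, D ⊆ G.VS S ∧ (D ∩ G.Own S).card = c) (D₀ : Finset ℕ) :
    (A.filter fun D => ∀ v ∈ M, v ∈ D ↔ v ∈ D₀).card < 2 ^ n := by
  have hsub : G.VS S ⊆ range n := (G.VS_mono hc.sub).trans hVS
  rw [← card_range n, ← card_powerset]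
  refine Finset.card_lt_card (Finset.ssubset_iff_subset_ne.2 ⟨?_, ?_⟩)
  · intro D hD; rw [mem_filter] at hD; rw [mem_powerset]; exact (hA D hD.1).1.trans hsub
  · intro heq
    have h1 : (∅ : Finset ℕ) ∈ A.filter fun D => ∀ v ∈ M, v ∈ D ↔ v ∈ D₀ := by
      rw [heq]; simp
    have h2 : range n ∈ A.filter fun D => ∀ v ∈ M, v ∈ D ↔ v ∈ D₀ := by
      rw [heq]; simp
    rw [mem_filter] at h1 h2
    have hsub2 := (hA _ h2.1).1
    have hc1 := (hA _ h1.1).2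
    have hc2 := (hA _ h2.1).2
    rw [Finset.empty_inter, Finset.card_empty] at hc1; rw [← hc1, card_eq_zero] at hc2
    have h0 : 0 ∈ G.VS S := hsub2 (by simp; omega)
    have hM : 0 ∉ M := by
      intro h
      have a := h1.2 0 h
      have b := h2.2 0 h
      have : (0 : ℕ) ∈ range n := by simp; omega
      simp only [this, true_iff, notMem_empty, false_iff] at a b; exact a b
    have ho := hinc 0 (G.VS_mono hc.sub h0)
    have : 0 ∈ range n ∩ G.Own S := mem_inter.2 ⟨hsub h0, mem_filter.2
      ⟨h0, hc.mem 0 h0 hM _ ho.1 ho.2⟩⟩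
    rw [hc2] at this; simp at this

theorem Own_all (hinc : ∀ v ∈ G.VS G.Λ, G.own v ∈ G.Λ ∧ G.inc (G.own v) v) :
    G.Own G.Λ = G.VS G.Λ :=
  filter_true_of_mem fun v hv => (hinc v hv).1

theorem partial_all {D : Finset ℕ} : G.Partial G.Λ ∅ D ↔ G.Dominating D := by
  simp [Partial, Dominating]

theorem Sem.eq_of_full (h : G.Sem true false G.Λ ∅ A 0 W)
    (hinc : ∀ v ∈ G.VS G.Λ, G.own v ∈ G.Λ ∧ G.inc (G.own v) v) (j : ℕ) (D : Finset ℕ) :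
    D ∈ A j ↔ G.Dominating D ∧ D.card = j := by
  constructor
  · intro hD; obtain ⟨h1, h2⟩ := h.sound j D hD
    rw [Own_all hinc, inter_eq_left.2 h1.1, zero_add] at h2; exact ⟨partial_all.1 h1, h2⟩
  · rintro ⟨h1, rfl⟩
    obtain ⟨j, h2, D', hD', -, h3⟩ := h.complete D ⟨h1, by simp⟩
    rw [h3 rfl, inter_eq_left.2 h1.1] at hD'
    rw [Own_all hinc, inter_eq_left.2 h1.1, zero_add] at h2
    rwa [h2]

theorem Sem.card_of_target (h : G.Sem false flat G.Λ ∅ A lo W) (h0 : (A 0).Nonempty)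
    (hinc : ∀ v ∈ G.VS G.Λ, G.own v ∈ G.Λ ∧ G.inc (G.own v) v) {D : Finset ℕ}
    (hD : G.Target false D) : D.card = lo := by
  obtain ⟨D₀, hD₀⟩ := h0
  obtain ⟨h1, h2⟩ := h.sound 0 D₀ hD₀
  rw [Own_all hinc, inter_eq_left.2 h1.1, add_zero] at h2
  have h3 := hD.2 rfl D₀ (partial_all.1 h1)
  obtain ⟨j, h4, -⟩ := h.complete D hD
  rw [Own_all hinc, inter_eq_left.2 hD.1.1] at h4
  omega

theorem Sem.eq_of_min (h : G.Sem false false G.Λ ∅ A lo W) (h0 : (A 0).Nonempty)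
    (hinc : ∀ v ∈ G.VS G.Λ, G.own v ∈ G.Λ ∧ G.inc (G.own v) v) (D : Finset ℕ) :
    D ∈ A 0 ↔ G.Target false D := by
  constructor
  · intro hD; obtain ⟨h1, h2⟩ := h.sound 0 D hD
    rw [Own_all hinc, inter_eq_left.2 h1.1, add_zero] at h2
    refine ⟨partial_all.1 h1, fun _ D' hD' => ?_⟩
    by_contra hlt
    -- a smaller dominating set gives a minimum one
    obtain ⟨D₁, hD₁, hmin⟩ := exists_minimal_of_wellFoundedLT
      (fun X : ℕ => ∃ Y, G.Dominating Y ∧ Y.card = X) ⟨_, D', hD', rfl⟩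
    obtain ⟨Y, hY, rfl⟩ := hD₁
    have ht : G.Target false Y := by
      refine ⟨hY, fun _ Z hZ => ?_⟩
      rcases le_total Y.card Z.card with h | h
      · exact h
      · exact hmin ⟨Z, hZ, rfl⟩ h
    have := h.card_of_target ⟨D, hD⟩ hinc ht
    have h5 := ht.2 rfl D' hD'
    omega
  · intro hD
    have hlo := h.card_of_target h0 hinc hD
    obtain ⟨j, h2, D', hD', -, h3⟩ := h.complete D hD; rw [h3 rfl, inter_eq_left.2 hD.1.1] at hD'
    rw [Own_all hinc, inter_eq_left.2 hD.1.1] at h2; obtain rfl : j = 0 := by omega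
    exact hD'

/-- There is a dominating set of interest. -/
theorem exists_target (full : Bool) : ∃ D, G.Target full D := by
  have hV : G.Dominating (G.VS G.Λ) := ⟨subset_rfl, fun v hv => .inl hv⟩
  obtain ⟨k, hk, hmin⟩ := exists_minimal_of_wellFoundedLT
    (fun X : ℕ => ∃ Y, G.Dominating Y ∧ Y.card = X) ⟨_, _, hV, rfl⟩
  obtain ⟨Y, hY, rfl⟩ := hk
  refine ⟨Y, hY, fun _ Z hZ => ?_⟩
  rcases le_total Y.card Z.card with h | h
  · exact h
  · exact hmin ⟨Z, hZ, rfl⟩ h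

/-- The first layer with a partial solution exists. -/
theorem Sem.exists_nonempty (h : G.Sem full flat S M A lo W) (hD : ∃ D, G.Target full D) :
    ∃ j ≤ W, (A j).Nonempty := by
  obtain ⟨D, hD⟩ := hD
  obtain ⟨j, -, D', hD', -⟩ := h.complete D hD
  refine ⟨j, ?_, D', hD'⟩
  by_contra hj
  rw [h.empty j (by omega)] at hD'
  simp at hD'

end Edges

/-! ## The program -/

namespace DS

open HProg

/-- Counts the incidence of the vertex in scalar `a` with the leaf `x`. -/
def touch (a : Nm) : HProg :=
  .ite (rd .deg (sc a)) .skip (asg .noniso (sc .noniso + 1)) ;;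
  .set .deg (sc a) (rd .deg (sc a) + 1) ;;
  .set .own (sc a) (sc .x)

/-- Degrees, owners, the number of vertices that are not isolated, and a root. -/
def scan : HProg :=
  .for_ .x .nN
    (.read .ty (4 * sc .x + 2) ;;
     .ite (sc .ty - 1) .skip
      (.read .u (4 * sc .x + 4) ;; .read .w (4 * sc .x + 5) ;; touch .u ;; touch .w ;;
       asg .root (sc .x)))

/-- Appends the neighbour in slot `k` of the node `x` to the queue, unless it is the parent. -/
def slot (k : HExp) : HProg :=
  .read .y (4 * sc .x + k) ;;
  .ite ((sc .y - rd .par (sc .x)) + (rd .par (sc .x) - sc .y))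
    (.set .par (sc .y) (sc .x) ;; .set .ord (sc .tail) (sc .y) ;; asg .tail (sc .tail + 1)) .skip

/-- Breadth first search from the root. -/
def bfs : HProg :=
  .set .par (sc .root) (sc .nN) ;; .set .ord 0 (sc .root) ;; asg .tail 1 ;;
  .for_ .hd .nN
    (asg .x (rd .ord (sc .hd)) ;; .set .fc (sc .x) (sc .tail) ;; .read .ty (4 * sc .x + 2) ;;
     slot 3 ;; .ite (sc .ty - 1) (slot 4 ;; slot 5) .skip)

/-- The cell `i` of the list of the node in scalar `a`. -/
def at_ (a i : Nm) : HExp := sc a * sc .nn + sc i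

/-- Extension of the offset arrays of a class by a vertex with strides `st1`, `st2`, `st0`. -/
def extend (c : Cls) : HProg :=
  asg .pw (rd .pow (sc (.nc c))) ;;
  .for_ .e .pw
    (.set (.o1 c) (sc .e + sc .pw) (rd (.o1 c) (sc .e) + sc .st1) ;;
     .set (.o1 c) (sc .e + 2 * sc .pw) (rd (.o1 c) (sc .e) + 2 * sc .st1) ;;
     .set (.o2 c) (sc .e + sc .pw) (rd (.o2 c) (sc .e) + sc .st2) ;;
     .set (.o2 c) (sc .e + 2 * sc .pw) (rd (.o2 c) (sc .e) + 2 * sc .st2) ;;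
     .set (.o0 c) (sc .e + sc .pw) (rd (.o0 c) (sc .e) + sc .st0) ;;
     .set (.o0 c) (sc .e + 2 * sc .pw) (rd (.o0 c) (sc .e) + 2 * sc .st0) ;;
     .set (.sg c) (sc .e + sc .pw) (1 - rd (.sg c) (sc .e)) ;;
     .set (.sg c) (sc .e + 2 * sc .pw) (rd (.sg c) (sc .e))) ;;
  asg (.nc c) (sc (.nc c) + 1)

/-- Appends the vertex `u` to the list of the node `x`. -/
def push : HProg :=
  .set .lst (at_ .x .s0) (sc .u) ;; .set .cnt (at_ .x .s0) (sc .tot) ;;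
  asg .st0 (rd .pow (sc .s0)) ;; asg .s0 (sc .s0 + 1)

/-- Sorts the vertices of the two children into classes. -/
def classify : HProg :=
  asg (.nc .L) 0 ;; asg (.nc .I) 0 ;; asg (.nc .F) 0 ;; asg (.nc .R) 0 ;; asg .s0 0 ;;
  .set .pow 0 1 ;;
  asg .lim (rd .sz (sc .c1) + rd .sz (sc .c2)) ;;
  .for_ .i .lim (.set .pow (sc .i + 1) (3 * rd .pow (sc .i))) ;;
  asg .lim (rd .sz (sc .c2)) ;;
  .for_ .i .lim
    (.set .mark (rd .lst (at_ .c2 .i)) (rd .pow (sc .i)) ;;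
     .set .markc (rd .lst (at_ .c2 .i)) (rd .cnt (at_ .c2 .i))) ;;
  asg .lim (rd .sz (sc .c1)) ;;
  .for_ .i .lim
    (asg .u (rd .lst (at_ .c1 .i)) ;; asg .st1 (rd .pow (sc .i)) ;;
     asg .st2 (rd .mark (sc .u)) ;; asg .tot (rd .cnt (at_ .c1 .i)) ;; asg .st0 0 ;;
     .ite (sc .st2) (asg .tot (sc .tot + rd .markc (sc .u))) .skip ;;
     .set .mark (sc .u) 0 ;;
     .ite (rd .deg (sc .u) - sc .tot)
       (push ;; .ite (sc .st2) (extend .I) (extend .L))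
       (extend .F)) ;;
  asg .lim (rd .sz (sc .c2)) ;;
  .for_ .i .lim
    (asg .u (rd .lst (at_ .c2 .i)) ;; asg .st1 0 ;; asg .st2 (rd .mark (sc .u)) ;; asg .st0 0 ;;
     .ite (sc .st2)
       (.set .mark (sc .u) 0 ;; asg .tot (rd .markc (sc .u)) ;;
        .ite (rd .deg (sc .u) - sc .tot) (push ;; extend .R) (extend .F))
       .skip)

/-- The number of layers of the table of the node in scalar `a`, minus one. -/
def width (full : Bool) (a : Nm) : HExp := if full then sc .nn else rd .sz (sc a)

/-- One product of two square blocks. -/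
def block : HProg :=
  .for_ .ia .d (.for_ .ib .d
    (.arith .add (sc .sA + sc .ia * sc .d + sc .ib) 0
      (sc .t1 + sc .j1 * sc .p1 + rd (.o1 .L) (sc .bL * sc .d + sc .ia) + rd (.o1 .I) (sc .xI) +
        rd (.o1 .F) (sc .bF * sc .d + sc .ib)) ;;
     .ite (rd (.sg .F) (sc .bF * sc .d + sc .ib))
      (.arith .sub (sc .sA + sc .ia * sc .d + sc .ib) 0 (sc .sA + sc .ia * sc .d + sc .ib))
      .skip ;;
     .arith .add (sc .sB + sc .ia * sc .d + sc .ib) 0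
      (sc .t2 + sc .j2 * sc .p2 + rd (.o2 .F) (sc .bF * sc .d + sc .ia) + rd (.o2 .I) (sc .xI) +
        rd (.o2 .R) (sc .bR * sc .d + sc .ib)))) ;;
  .mm .d .sA .sC ;;
  .for_ .ia .d (.for_ .ib .d
    (asg .y (sc .out + (sc .j1 + sc .j2) * sc .p0 + rd (.o0 .L) (sc .bL * sc .d + sc .ia) +
        rd (.o0 .I) (sc .xI) + rd (.o0 .R) (sc .bR * sc .d + sc .ib)) ;;
     .arith .add (sc .y) (sc .y) (sc .sC + sc .ia * sc .d + sc .ib)))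

/-- All products of blocks. -/
def contract : HProg :=
  .for_ .j1 .w1 (.for_ .j2 .w2 (.for_ .xI .pI (.for_ .bL .qL (.for_ .bF .qF (.for_ .bR .qR block)))))

/-- The block size and the numbers of blocks. -/
def sizes : HProg :=
  asg .dd (sc (.nc .L) - (sc (.nc .L) - sc (.nc .F))) ;;
  asg .dd (sc .dd - (sc .dd - sc (.nc .R))) ;;
  asg .d (rd .pow (sc .dd)) ;;
  asg .qL (rd .pow (sc (.nc .L) - sc .dd)) ;;
  asg .qF (rd .pow (sc (.nc .F) - sc .dd)) ;;
  asg .qR (rd .pow (sc (.nc .R) - sc .dd)) ;;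
  asg .pI (rd .pow (sc (.nc .I))) ;;
  asg .p0 (rd .pow (sc .s0))

/-- Space for three blocks and the new table. -/
def space : HProg :=
  asg .sA (sc .alloc) ;;
  asg .sB (sc .sA + sc .d * sc .d) ;;
  asg .sC (sc .sB + sc .d * sc .d) ;;
  asg .out (sc .sC + sc .d * sc .d)

/-- The positions and sizes of the tables of the children. -/
def views (full : Bool) : HProg :=
  asg .w1 (width full .c1 + 1) ;;
  asg .w2 (width full .c2 + 1) ;;
  asg .t1 (rd .tbl (sc .c1)) ;;
  asg .t2 (rd .tbl (sc .c2)) ;;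
  asg .p1 (rd .pow (rd .sz (sc .c1))) ;;
  asg .p2 (rd .pow (rd .sz (sc .c2)))

/-- Preparation of the scalars for `contract`. -/
def prepare (full : Bool) : HProg := sizes ;; space ;; views full

/-- The first nonempty layer (or layer `0`), and the new table. -/
def settle (full : Bool) : HProg :=
  asg .rr (sc .w1 + sc .w2 - 1) ;;
  asg .found (if full then 1 else 0) ;; asg .j0 0 ;;
  .for_ .l .rr (.for_ .e .p0
    (.ite (sc .found) .skip
      (.test .tz (sc .out + sc .l * sc .p0 + sc .e) ;;
       .ite (sc .tz) (asg .found 1 ;; asg .j0 (sc .l)) .skip))) ;;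
  .set .tbl (sc .x) (sc .out + sc .j0 * sc .p0) ;;
  .set .lo (sc .x) (rd .lo (sc .c1) + rd .lo (sc .c2) + sc .j0) ;;
  .set .sz (sc .x) (sc .s0) ;;
  asg .wx (width full .x + 1) ;;
  asg .alloc (sc .out + (sc .rr + sc .wx) * sc .p0)

/-- For each position, combines the cells with digit `2` with those with digit `1`. -/
def pass (op : NumOp) : HProg :=
  .for_ .p .s0
    (asg .pp (rd .pow (sc .p)) ;;
     asg .hh (sc .wx * rd .pow (sc .s0 - 1 - sc .p)) ;;
     .for_ .hi .hh (.for_ .e .pp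
       (asg .y (sc .base + sc .hi * (3 * sc .pp) + sc .pp + sc .e) ;;
        .arith op (sc .y + sc .pp) (sc .y + sc .pp) (sc .y))))

/-- Replaces all nonzero cells by `1`. -/
def clip : HProg :=
  asg .tt (sc .wx * sc .p0) ;;
  .for_ .i .tt (.test .tz (sc .base + sc .i) ;; .setN (sc .base + sc .i) (sc .tz))

/-- Reduction to one solution for each pattern. -/
def flatten : HProg :=
  asg .base (rd .tbl (sc .x)) ;; pass .sub ;; clip ;; pass .add

/-- The table of the node `x` with the children `c1` and `c2`. -/
def combine (full flat : Bool) : HProg :=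
  (classify ;; prepare full ;; contract) ;; settle full ;; if flat then flatten else .skip

/-- The list of the leaf `x`, and the layers for which its vertices count. -/
def leafList : HProg :=
  .read .u (4 * sc .x + 4) ;; .read .w (4 * sc .x + 5) ;;
  .set .tbl (sc .x) (sc .alloc) ;; .set .lo (sc .x) 0 ;; .set .sz (sc .x) 2 ;;
  .set .lst (sc .x * sc .nn) (sc .u) ;; .set .lst (sc .x * sc .nn + 1) (sc .w) ;;
  .set .cnt (sc .x * sc .nn) 1 ;; .set .cnt (sc .x * sc .nn + 1) 1 ;;
  asg .lu (9 - 9 * ((rd .own (sc .u) - sc .x) + (sc .x - rd .own (sc .u)))) ;;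
  asg .lw (9 - 9 * ((rd .own (sc .w) - sc .x) + (sc .x - rd .own (sc .w))))

/-- The table of the leaf `x`. -/
def leafCells : HProg :=
  .setN (sc .alloc + sc .lu + sc .lw) 1 ;;
  .setN (sc .alloc + sc .lu + 6) 1 ;;
  .setN (sc .alloc + sc .lw + 2) 1 ;;
  .setN (sc .alloc + 4) 1 ;;
  .setN (sc .alloc + 5) 1 ;;
  .setN (sc .alloc + 7) 1 ;;
  .setN (sc .alloc + 8) 1

/-- The list and the table of the leaf `x`. -/
def leaf (full : Bool) : HProg :=
  leafList ;; leafCells ;; asg .alloc (sc .alloc + 9 * (width full .x + 1))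

/-- The tables of all nodes, from the last to the first. -/
def tables (full flat : Bool) : HProg :=
  .for_ .step .nN
    (asg .x (rd .ord (sc .nN - 1 - sc .step)) ;; .read .ty (4 * sc .x + 2) ;;
     .ite (sc .ty - 1)
      (asg .c1 (rd .ord (rd .fc (sc .x))) ;; asg .c2 (rd .ord (rd .fc (sc .x) + 1)) ;;
       combine full flat)
      (leaf full)) ;;
  asg .x (sc .nN) ;; asg .c1 (rd .ord 0) ;; asg .c2 (rd .ord 1) ;; combine full flat

/-- The preparations. -/
def setup : HProg :=
  .read .nn 0 ;; .read .nN 1 ;; asg .alloc (sc .nn + 1) ;; scan ;; bfs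

/-- Everything up to the table of the root. -/
def main (full flat : Bool) : HProg := setup ;; tables full flat

/-- The numbers of dominating sets of all sizes. -/
def outputAll : HProg :=
  asg .lim (sc .nn + 1) ;; asg .y (sc .nn - sc .noniso) ;;
  .for_ .i .lim
    (.setN (sc .i) 0 ;;
     .ite (sc .y - sc .i) .skip
      (.arith .add (sc .i) (sc .i) (rd .tbl (sc .nN) + (sc .i - sc .y))))

/-- The number of minimum dominating sets. -/
def outputMin : HProg := .arith .add 0 0 (rd .tbl (sc .nN))

end DS

namespace Env

variable {E : Env} {p r : HProg} {h : HState E.b} {Q Q' : HState E.b → Prop}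

theorem wp_set_seq {a : Nm} {e f : HExp}
    (H : E.wp r ⟨upd h.v a (e.eval h.v) (f.eval h.v), h.m, h.t + 1⟩ Q)
    (hf : E.Bd h.v → f.eval h.v < E.B) : E.wp (.set a e f ;; r) h Q :=
  wp_seq (wp_set hf H)

theorem wp_read_seq {a : Nm} {e : HExp}
    (H : E.wp r ⟨upd h.v a 0 (E.inp (e.eval h.v)), h.m, h.t + 1⟩ Q)
    (he : e.eval h.v < 4 * E.inp 1 + 2) : E.wp (.read a e ;; r) h Q :=
  wp_seq (wp_read he H)

theorem wp_setN_seq {e f : HExp}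
    (H : E.wp r ⟨h.v, update h.m (e.eval h.v) (f.eval h.v : ZMod (2 ^ E.b)), h.t + 1⟩ Q) :
    E.wp (.setN e f ;; r) h Q :=
  wp_seq (wp_setN H)

end Env

/-! ## Offsets -/

/-- `O x` is the sum of the digits of `x` times the strides. -/
def Off (O : ℕ → ℕ) (k : ℕ) (st : ℕ → ℕ) : Prop :=
  ∀ x < 3 ^ k, O x = ∑ i ∈ range k, (digit x i : ℕ) * st i

/-- `O x` is the parity of the number of digits `1` of `x`. -/
def Sgn (O : ℕ → ℕ) (k : ℕ) : Prop :=
  ∀ x < 3 ^ k, O x = (∑ i ∈ range k, if digit x i = 1 then 1 else 0) % 2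

theorem exists_digit_split {k x : ℕ} (hx : x < 3 ^ (k + 1)) :
    ∃ y < 3 ^ k, ∃ d : Fin 3, x = y + d * 3 ^ k := by
  refine ⟨x % 3 ^ k, mod_lt _ (by positivity), ⟨x / 3 ^ k, ?_⟩, ?_⟩
  · exact div_lt_of_lt_mul (by rw [← pow_succ]; exact hx)
  · simp only; rw [mul_comm, Nat.mod_add_div]

theorem Off.zero (O : ℕ → ℕ) (st : ℕ → ℕ) (h : O 0 = 0) : Off O 0 st := by
  intro x hx; obtain rfl : x = 0 := by simpa using hx
  simpa using h

theorem Sgn.zero (O : ℕ → ℕ) (h : O 0 = 0) : Sgn O 0 := by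
  intro x hx; obtain rfl : x = 0 := by simpa using hx
  simpa using h

theorem Off.succ {O O' : ℕ → ℕ} {k a : ℕ} {st : ℕ → ℕ} (h : Off O k st)
    (h0 : ∀ x < 3 ^ k, O' x = O x) (h1 : ∀ x < 3 ^ k, O' (x + 3 ^ k) = O x + a)
    (h2 : ∀ x < 3 ^ k, O' (x + 2 * 3 ^ k) = O x + 2 * a) :
    Off O' (k + 1) (update st k a) := by
  intro x hx
  obtain ⟨y, hy, d, rfl⟩ := exists_digit_split hx
  rw [sum_range_succ, digit_add_mul_self d hy, update_self]
  have : ∑ i ∈ range k, (digit (y + d * 3 ^ k) i : ℕ) * update st k a i = O y := by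
    rw [h y hy]; refine sum_congr rfl fun i hi => ?_
    rw [mem_range] at hi; rw [digit_add_mul d hy hi, update_of_ne (by omega)]
  rw [this]
  fin_cases d
  · simpa using h0 y hy
  · simpa using h1 y hy
  · simpa using h2 y hy

theorem Sgn.succ {O O' : ℕ → ℕ} {k : ℕ} (h : Sgn O k)
    (h0 : ∀ x < 3 ^ k, O' x = O x) (h1 : ∀ x < 3 ^ k, O' (x + 3 ^ k) = 1 - O x)
    (h2 : ∀ x < 3 ^ k, O' (x + 2 * 3 ^ k) = O x) : Sgn O' (k + 1) := by
  intro x hx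
  obtain ⟨y, hy, d, rfl⟩ := exists_digit_split hx
  rw [sum_range_succ, digit_add_mul_self d hy]
  rw [sum_congr rfl fun i hi => by rw [digit_add_mul d hy (mem_range.1 hi)]]
  have := h y hy
  have a0 := h0 y hy
  have a1 := h1 y hy
  have a2 := h2 y hy
  generalize (∑ i ∈ range k, if digit y i = 1 then 1 else 0) = A at *
  fin_cases d
  · simp at a0 ⊢; omega
  · simp at a1 ⊢; omega
  · simp at a2 ⊢; omega

theorem Off.le {O : ℕ → ℕ} {k : ℕ} {st : ℕ → ℕ} (h : Off O k st) {x : ℕ} (hx : x < 3 ^ k) :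
    O x ≤ ∑ i ∈ range k, 2 * st i := by
  rw [h x hx]
  refine Finset.sum_le_sum fun i _ => Nat.mul_le_mul_right _ ?_
  have := (digit x i).isLt; omega

theorem Sgn.prod_wt {O : ℕ → ℕ} {k : ℕ} (h : Sgn O k) (R : Type*) [CommRing R] {x : ℕ}
    (hx : x < 3 ^ k) :
    ∏ i ∈ range k, wt R (digit x i) = if O x = 0 then 1 else -1 := by
  have : ∀ i, wt R (digit x i) = (-1) ^ (if digit x i = 1 then 1 else 0) := by
    intro i; unfold wt; split_ifs <;> simp
  rw [prod_congr rfl fun i _ => this i, Finset.prod_pow_eq_pow_sum, h x hx]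
  rcases Nat.mod_two_eq_zero_or_one (∑ i ∈ range k, if digit x i = 1 then 1 else 0) with e | e
  · rw [if_pos e, Even.neg_one_pow (Nat.even_iff.2 e)]
  · rw [if_neg (by omega), Odd.neg_one_pow (Nat.odd_iff.2 e)]

theorem Sgn.le {O : ℕ → ℕ} {k : ℕ} (h : Sgn O k) {x : ℕ} (hx : x < 3 ^ k) : O x ≤ 1 := by
  rw [h x hx]; omega

theorem Off.congr_st {O : ℕ → ℕ} {k : ℕ} {st st' : ℕ → ℕ} (h : Off O k st)
    (hs : ∀ i < k, st i = st' i) : Off O k st' := by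
  intro x hx
  rw [h x hx]
  exact sum_congr rfl fun i hi => by rw [hs i (mem_range.1 hi)]

namespace DS

open Env

variable {E : Env} {h : HState E.b}

theorem wp_extend {c : Cls} {k : ℕ} {a1 a2 a0 : ℕ → ℕ} (hk : h.v (.nc c) 0 = k)
    (hp : h.v .pow k = 3 ^ k) (H1 : Off (h.v (.o1 c)) k a1) (H2 : Off (h.v (.o2 c)) k a2)
    (H0 : Off (h.v (.o0 c)) k a0) (HS : Sgn (h.v (.sg c)) k)
    (b1 : ∑ i ∈ range k, 2 * a1 i + 2 * h.v .st1 0 < E.B)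
    (b2 : ∑ i ∈ range k, 2 * a2 i + 2 * h.v .st2 0 < E.B)
    (b0 : ∑ i ∈ range k, 2 * a0 i + 2 * h.v .st0 0 < E.B)
    (bk : k + 1 < E.B) :
    E.wp (extend c) h fun s => s.m = h.m ∧ s.t ≤ h.t + 9 * 3 ^ k + 3 ∧ s.v (.nc c) 0 = k + 1 ∧
      Off (s.v (.o1 c)) (k + 1) (update a1 k (h.v .st1 0)) ∧
      Off (s.v (.o2 c)) (k + 1) (update a2 k (h.v .st2 0)) ∧
      Off (s.v (.o0 c)) (k + 1) (update a0 k (h.v .st0 0)) ∧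
      Sgn (s.v (.sg c)) (k + 1) := by
  have hB := E.hB
  set P := 3 ^ k with hP
  unfold extend
  refine wp_set_seq ?_ (fun hb => hb _ _)
  refine wp_seq (wp_for P 8 (fun j v m => m = h.m ∧
    (∀ x < P, v (.o1 c) x = h.v (.o1 c) x) ∧ (∀ x < P, v (.o2 c) x = h.v (.o2 c) x) ∧
    (∀ x < P, v (.o0 c) x = h.v (.o0 c) x) ∧ (∀ x < P, v (.sg c) x = h.v (.sg c) x) ∧
    (∀ x < j, v (.o1 c) (x + P) = h.v (.o1 c) x + h.v .st1 0) ∧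
    (∀ x < j, v (.o1 c) (x + 2 * P) = h.v (.o1 c) x + 2 * h.v .st1 0) ∧
    (∀ x < j, v (.o2 c) (x + P) = h.v (.o2 c) x + h.v .st2 0) ∧
    (∀ x < j, v (.o2 c) (x + 2 * P) = h.v (.o2 c) x + 2 * h.v .st2 0) ∧
    (∀ x < j, v (.o0 c) (x + P) = h.v (.o0 c) x + h.v .st0 0) ∧
    (∀ x < j, v (.o0 c) (x + 2 * P) = h.v (.o0 c) x + 2 * h.v .st0 0) ∧
    (∀ x < j, v (.sg c) (x + P) = 1 - h.v (.sg c) x) ∧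
    (∀ x < j, v (.sg c) (x + 2 * P) = h.v (.sg c) x)) ?_ ?_ ?_ ?_)
  · simp [hk, hp]
  · simp
  · intro j hj s hf hi ⟨im, i1, i2, i0, is, i1a, i1b, i2a, i2b, i0a, i0b, isa, isb⟩
    have f1 : s.v .st1 0 = h.v .st1 0 := by rw [hf _ (by simp [mods])]; simp
    have f2 : s.v .st2 0 = h.v .st2 0 := by rw [hf _ (by simp [mods])]; simp
    have f0 : s.v .st0 0 = h.v .st0 0 := by rw [hf _ (by simp [mods])]; simp
    have fp : s.v .pw 0 = P := by rw [hf _ (by simp [mods])]; simp [hk, hp]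
    have o1 := i1 j hj
    have o2 := i2 j hj
    have o0 := i0 j hj
    have og := is j hj
    have l1 := H1.le hj
    have l2 := H2.le hj
    have l0 := H0.le hj
    have lg := HS.le hj
    iterate 7 refine wp_set_seq ?_ ?_
    refine wp_set ?_ ?_
    · intro _; simp [hi, fp, og, upd_same, update_apply]; split_ifs <;> omega
    rotate_left
    all_goals try (intro _; simp [hi, fp, f1, f2, f0, o1, o2, o0, og, update_apply]; try omega)
    · split_ifs <;> omega
    · split_ifs <;> omega
    · split_ifs <;> omega
    refine ⟨by simp, im, ?_⟩
    simp only [eval_add, eval_sub, eval_mul, eval_arr, eval_lit,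
      eval_ofNat, upd_same, ne_eq, reduceCtorEq, not_false_eq_true, upd_ne, hi, fp,
      f1, f2, f0]
    refine ⟨?_, ?_, ?_, ?_, ?_, ?_, ?_, ?_, ?_, ?_, ?_, ?_⟩
    all_goals
      intro x hx; simp only [update_apply]
      grind
  · intro s hf hi ⟨im, i1, i2, i0, is, i1a, i1b, i2a, i2b, i0a, i0b, isa, isb⟩ ht
    have fk : s.v (.nc c) 0 = k := by rw [hf _ (by simp [mods])]; simpa using hk
    have f1 : s.v .st1 0 = h.v .st1 0 := by rw [hf _ (by simp [mods])]; simp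
    refine wp_set (fun _ => by simpa [fk] using bk) ⟨im, ?_, by simp [fk], ?_, ?_, ?_, ?_⟩
    · simp only at ht ⊢; omega
    · simpa using H1.succ i1 i1a i1b
    · simpa using H2.succ i2 i2a i2b
    · simpa using H0.succ i0 i0a i0b
    · simpa using HS.succ is isa isb

end DS

/-! ## Classification of the vertices at a join -/

/-- The two lists of vertices at a join, with the numbers of incident edges so far, and the
degrees. -/
structure JoinLists where
  /-- length of the first list -/
  s1 : ℕ
  /-- length of the second list -/
  s2 : ℕ
  /-- first list -/
  f1 : ℕ → ℕ
  /-- second list -/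
  f2 : ℕ → ℕ
  /-- incident edges on the left -/
  k1 : ℕ → ℕ
  /-- incident edges on the right -/
  k2 : ℕ → ℕ
  /-- degrees -/
  dg : ℕ → ℕ
  inj1 : Set.InjOn f1 (range s1)
  inj2 : Set.InjOn f2 (range s2)

namespace JoinLists

variable (J : JoinLists)

/-- The vertices on the left. -/
def M1 : Finset ℕ := (range J.s1).image J.f1
/-- The vertices on the right. -/
def M2 : Finset ℕ := (range J.s2).image J.f2

/-- The number of incident edges. -/
def tot (u : ℕ) : ℕ := (if u ∈ J.M1 then J.k1 u else 0) + if u ∈ J.M2 then J.k2 u else 0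

/-- The class of a vertex. -/
def cl (u : ℕ) : Cls :=
  if J.dg u ≤ J.tot u then .F else if u ∈ J.M1 then if u ∈ J.M2 then .I else .L else .R

/-- The vertices of a class. -/
def ofCls (c : Cls) : Finset ℕ := (J.M1 ∪ J.M2).filter fun u => J.cl u = c

/-- The stride of a vertex on the left. -/
def e1 (u : ℕ) : ℕ := ∑ i ∈ range J.s1, if J.f1 i = u then 3 ^ i else 0
/-- The stride of a vertex on the right. -/
def e2 (u : ℕ) : ℕ := ∑ i ∈ range J.s2, if J.f2 i = u then 3 ^ i else 0

theorem mem_M1 {u : ℕ} : u ∈ J.M1 ↔ ∃ i < J.s1, J.f1 i = u := by simp [M1]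
theorem mem_M2 {u : ℕ} : u ∈ J.M2 ↔ ∃ i < J.s2, J.f2 i = u := by simp [M2]

theorem f1_mem {i : ℕ} (h : i < J.s1) : J.f1 i ∈ J.M1 := J.mem_M1.2 ⟨i, h, rfl⟩
theorem f2_mem {i : ℕ} (h : i < J.s2) : J.f2 i ∈ J.M2 := J.mem_M2.2 ⟨i, h, rfl⟩

theorem sum_ite_of_inj {s : ℕ} {f g : ℕ → ℕ} (hf : Set.InjOn f (range s)) {i : ℕ}
    (hi : i < s) : (∑ j ∈ range s, if f j = f i then g j else 0) = g i := by
  rw [sum_eq_single_of_mem i (mem_range.2 hi), if_pos rfl]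
  intro j hj hji
  rw [if_neg]
  exact fun h => hji (hf (by simpa using hj) (by simpa using hi) h)

theorem e1_f1 {i : ℕ} (h : i < J.s1) : J.e1 (J.f1 i) = 3 ^ i := sum_ite_of_inj J.inj1 h
theorem e2_f2 {i : ℕ} (h : i < J.s2) : J.e2 (J.f2 i) = 3 ^ i := sum_ite_of_inj J.inj2 h

theorem e1_eq_zero {u : ℕ} (h : u ∉ J.M1) : J.e1 u = 0 :=
  sum_eq_zero fun i hi => if_neg fun hu => h (J.mem_M1.2 ⟨i, mem_range.1 hi, hu⟩)

theorem e2_eq_zero {u : ℕ} (h : u ∉ J.M2) : J.e2 u = 0 :=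
  sum_eq_zero fun i hi => if_neg fun hu => h (J.mem_M2.2 ⟨i, mem_range.1 hi, hu⟩)

theorem e1_le (u : ℕ) : J.e1 u ≤ 3 ^ (J.s1 + J.s2) := by
  by_cases h : u ∈ J.M1
  · obtain ⟨i, hi, rfl⟩ := J.mem_M1.1 h
    rw [J.e1_f1 hi]; exact pow_le_pow_right (by norm_num) (by omega)
  · rw [J.e1_eq_zero h]; positivity

theorem e2_le (u : ℕ) : J.e2 u ≤ 3 ^ (J.s1 + J.s2) := by
  by_cases h : u ∈ J.M2
  · obtain ⟨i, hi, rfl⟩ := J.mem_M2.1 h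
    rw [J.e2_f2 hi]; exact pow_le_pow_right (by norm_num) (by omega)
  · rw [J.e2_eq_zero h]; positivity

theorem e2_pos {u : ℕ} (h : u ∈ J.M2) : J.e2 u ≠ 0 := by
  obtain ⟨i, hi, rfl⟩ := J.mem_M2.1 h
  rw [J.e2_f2 hi]; positivity

theorem card_M1 : J.M1.card = J.s1 := by
  rw [M1, card_image_of_injOn J.inj1, card_range]
theorem card_M2 : J.M2.card = J.s2 := by
  rw [M2, card_image_of_injOn J.inj2, card_range]

theorem card_union_le : (J.M1 ∪ J.M2).card ≤ J.s1 + J.s2 := by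
  rw [← J.card_M1, ← J.card_M2]; exact Finset.card_union_le _ _

theorem card_ofCls_le (c : Cls) : (J.ofCls c).card ≤ J.s1 + J.s2 :=
  (card_filter_le _ _).trans J.card_union_le

/-- The state after the vertices in `U` have been classified: the offset arrays of the classes. -/
structure Classes (U : Finset ℕ) (v : Store) (k : Cls → ℕ) (vs : Cls → ℕ → ℕ) (e0 : ℕ → ℕ) :
    Prop where
  nc : ∀ c, v (.nc c) 0 = k c
  o1 : ∀ c, Off (v (.o1 c)) (k c) fun t => J.e1 (vs c t)
  o2 : ∀ c, Off (v (.o2 c)) (k c) fun t => J.e2 (vs c t)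
  o0 : ∀ c, Off (v (.o0 c)) (k c) fun t => e0 (vs c t)
  sg : ∀ c, Sgn (v (.sg c)) (k c)
  bij : ∀ c u, (∃ t < k c, vs c t = u) ↔ u ∈ U ∧ J.cl u = c
  inj : ∀ c, Set.InjOn (vs c) (range (k c))

/-- The state after the vertices in `U` have been classified: the list of the vertices that
are kept, and their strides. -/
structure Kept (U : Finset ℕ) (f0 : ℕ → ℕ) (s0 : ℕ) (e0 : ℕ → ℕ) : Prop where
  bij : ∀ u, (∃ p < s0, f0 p = u) ↔ u ∈ U ∧ J.cl u ≠ .F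
  inj : Set.InjOn f0 (range s0)
  st : ∀ p < s0, e0 (f0 p) = 3 ^ p
  stF : ∀ u, J.cl u = .F → e0 u = 0

variable {J} {U : Finset ℕ} {v : Store} {k : Cls → ℕ} {vs : Cls → ℕ → ℕ} {e0 : ℕ → ℕ}

theorem Classes.mem (H : J.Classes U v k vs e0) {c : Cls} {t : ℕ} (ht : t < k c) :
    vs c t ∈ U ∧ J.cl (vs c t) = c := (H.bij c _).1 ⟨t, ht, rfl⟩

theorem Classes.image (H : J.Classes U v k vs e0) (c : Cls) :
    (range (k c)).image (vs c) = U.filter fun u => J.cl u = c := by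
  ext u; simp [← H.bij c u]

theorem Classes.card (H : J.Classes U v k vs e0) (c : Cls) :
    k c = (U.filter fun u => J.cl u = c).card := by
  rw [← H.image, card_image_of_injOn (H.inj c), card_range]

theorem Classes.le (H : J.Classes U v k vs e0) (hU : U ⊆ J.M1 ∪ J.M2) (c : Cls) :
    k c ≤ (J.ofCls c).card := by
  rw [H.card]; exact card_le_card (filter_subset_filter _ hU)

theorem Classes.congr (H : J.Classes U v k vs e0) {v' : Store} {e0' : ℕ → ℕ}
    (h1 : ∀ c, v' (.nc c) = v (.nc c) ∧ v' (.o1 c) = v (.o1 c) ∧ v' (.o2 c) = v (.o2 c) ∧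
      v' (.o0 c) = v (.o0 c) ∧ v' (.sg c) = v (.sg c)) (h0 : ∀ u ∈ U, e0' u = e0 u) :
    J.Classes U v' k vs e0' where
  nc c := by rw [(h1 c).1, H.nc]
  o1 c := by rw [(h1 c).2.1]; exact H.o1 c
  o2 c := by rw [(h1 c).2.2.1]; exact H.o2 c
  o0 c := by
    rw [(h1 c).2.2.2.1]; exact (H.o0 c).congr_st fun t ht => (h0 _ (H.mem ht).1).symm
  sg c := by rw [(h1 c).2.2.2.2]; exact H.sg c
  bij := H.bij
  inj := H.inj

theorem Classes.insert (H : J.Classes U v k vs e0) {v' : Store} {u : ℕ} {c : Cls} (hu : u ∉ U)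
    (hc : J.cl u = c)
    (h1 : ∀ c', c' ≠ c → v' (.nc c') = v (.nc c') ∧ v' (.o1 c') = v (.o1 c') ∧
      v' (.o2 c') = v (.o2 c') ∧ v' (.o0 c') = v (.o0 c') ∧ v' (.sg c') = v (.sg c'))
    (hk : v' (.nc c) 0 = k c + 1)
    (H1 : Off (v' (.o1 c)) (k c + 1) (update (fun t => J.e1 (vs c t)) (k c) (J.e1 u)))
    (H2 : Off (v' (.o2 c)) (k c + 1) (update (fun t => J.e2 (vs c t)) (k c) (J.e2 u)))
    (H0 : Off (v' (.o0 c)) (k c + 1) (update (fun t => e0 (vs c t)) (k c) (e0 u)))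
    (HS : Sgn (v' (.sg c)) (k c + 1)) :
    ∃ k' vs', J.Classes (insert u U) v' k' vs' e0 := by
  have hup : ∀ (e : ℕ → ℕ) t, update (fun t => e (vs c t)) (k c) (e u) t =
      e (update (vs c) (k c) u t) := by
    intro e t; by_cases ht : t = k c
    · subst ht; simp
    · simp [ht]
  refine ⟨update k c (k c + 1), update vs c (update (vs c) (k c) u),
    ?_, ?_, ?_, ?_, ?_, ?_, ?_⟩
  all_goals intro c'; by_cases hcc : c' = c
  all_goals try subst hcc
  all_goals first
    | simp only [ne_eq, hcc, not_false_eq_true, update_of_ne]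
    | simp only [update_self]
  · exact hk
  · rw [(h1 c' hcc).1, H.nc]
  · exact H1.congr_st fun t _ => hup _ t
  · rw [(h1 c' hcc).2.1]; exact H.o1 c'
  · exact H2.congr_st fun t _ => hup _ t
  · rw [(h1 c' hcc).2.2.1]; exact H.o2 c'
  · exact H0.congr_st fun t _ => hup _ t
  · rw [(h1 c' hcc).2.2.2.1]; exact H.o0 c'
  · exact HS
  · rw [(h1 c' hcc).2.2.2.2]; exact H.sg c'
  · intro w; rw [mem_insert, or_and_right, ← H.bij c' w]
    constructor
    · rintro ⟨t, ht, rfl⟩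
      by_cases htk : t = k c'
      · subst htk; left; simpa using hc
      · right; exact ⟨t, by omega, by simp [htk]⟩
    · rintro (⟨rfl, -⟩ | ⟨t, ht, rfl⟩)
      · exact ⟨k c', by omega, by simp⟩
      · exact ⟨t, by omega, by simp [ht.ne]⟩
  · intro w; rw [mem_insert, or_and_right, ← H.bij c' w]; refine ⟨.inr, ?_⟩
    rintro (⟨rfl, h⟩ | h)
    · exact absurd (hc.symm.trans h).symm hcc
    · exact h
  · intro a ha b hb hab; simp only [coe_range, Set.mem_Iio] at ha hb
    by_cases h1 : a = k c' <;> by_cases h2 : b = k c'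
    · omega
    · simp only [h1, update_self, ne_eq, h2, not_false_eq_true, update_of_ne] at hab
      exact absurd (hab ▸ (H.mem (c := c') (t := b) (by omega)).1) hu
    · simp only [h1, update_self, ne_eq, h2, not_false_eq_true, update_of_ne] at hab
      exact absurd (hab ▸ (H.mem (c := c') (t := a) (by omega)).1) hu
    · simp only [ne_eq, h1, h2, not_false_eq_true, update_of_ne] at hab
      exact H.inj c' (by simp; omega) (by simp; omega) hab
  · exact H.inj c'

theorem Kept.insertF {f0 : ℕ → ℕ} {s0 : ℕ} (H : J.Kept U f0 s0 e0) {u : ℕ} (hc : J.cl u = .F) :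
    J.Kept (insert u U) f0 s0 e0 where
  bij w := by
    rw [H.bij, mem_insert]; refine ⟨fun h => ⟨.inr h.1, h.2⟩, fun h => ⟨h.1.resolve_left ?_, h.2⟩⟩
    rintro rfl; exact h.2 hc
  inj := H.inj
  st := H.st
  stF := H.stF

theorem Kept.insert {f0 : ℕ → ℕ} {s0 : ℕ} (H : J.Kept U f0 s0 e0) {u : ℕ} (hu : u ∉ U)
    (hc : J.cl u ≠ .F) {f0' : ℕ → ℕ} (h1 : f0' s0 = u) (h2 : ∀ p < s0, f0' p = f0 p) :
    J.Kept (insert u U) f0' (s0 + 1) (update e0 u (3 ^ s0)) where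
  bij w := by
    rw [mem_insert, or_and_right, ← H.bij w]
    constructor
    · rintro ⟨p, hp, rfl⟩
      rcases lt_succ_iff_lt_or_eq.1 hp with h | rfl
      · exact .inr ⟨p, h, (h2 p h).symm⟩
      · rw [h1]; exact .inl ⟨rfl, hc⟩
    · rintro (⟨rfl, -⟩ | ⟨p, hp, rfl⟩)
      · exact ⟨s0, by omega, h1⟩
      · exact ⟨p, by omega, h2 p hp⟩
  inj := by
    have hn : ∀ p < s0, f0' p ≠ u := fun p hp h => hu ((H.bij u).1 ⟨p, hp, (h2 p hp).symm.trans h⟩).1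
    intro a ha b hb hab; simp only [coe_range, Set.mem_Iio] at ha hb
    rcases lt_succ_iff_lt_or_eq.1 ha with h | rfl <;>
      rcases lt_succ_iff_lt_or_eq.1 hb with h' | rfl
    · rw [h2 a h, h2 b h'] at hab; exact H.inj (by simpa using h) (by simpa using h') hab
    · rw [h1] at hab; exact absurd hab (hn a h)
    · rw [h1] at hab; exact absurd hab.symm (hn b h')
    · rfl
  st p hp := by
    rcases lt_succ_iff_lt_or_eq.1 hp with h | rfl
    · have hn : f0 p ≠ u := fun h' => hu ((H.bij u).1 ⟨p, h, h'⟩).1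
      rw [h2 p h, update_of_ne hn, H.st p h]
    · rw [h1, update_self]
  stF w hw := by
    rw [update_of_ne, H.stF w hw]
    rintro rfl; exact hc hw

theorem Kept.image {f0 : ℕ → ℕ} {s0 : ℕ} (H : J.Kept U f0 s0 e0) :
    (range s0).image f0 = U.filter fun u => J.cl u ≠ .F := by
  ext u; simp [← H.bij u]

theorem Kept.le {f0 : ℕ → ℕ} {s0 : ℕ} (H : J.Kept U f0 s0 e0) : s0 ≤ U.card := by
  rw [← card_range s0, ← card_image_of_injOn H.inj, H.image]
  exact card_filter_le _ _

theorem Kept.e0_le {f0 : ℕ → ℕ} {s0 : ℕ} (H : J.Kept U f0 s0 e0) {u : ℕ} (hu : u ∈ U) :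
    e0 u ≤ 3 ^ s0 := by
  by_cases hc : J.cl u = .F
  · rw [H.stF u hc]; positivity
  · obtain ⟨p, hp, rfl⟩ := (H.bij u).2 ⟨hu, hc⟩
    rw [H.st p hp]; exact pow_le_pow_right (by norm_num) hp.le

theorem cl_ne_F {u : ℕ} : J.cl u ≠ .F ↔ J.tot u < J.dg u := by
  unfold cl; split_ifs <;> simp <;> omega

end JoinLists

namespace DS

open Env

variable {E : Env} {h : HState E.b} {J : JoinLists} {U : Finset ℕ} {k : Cls → ℕ}
  {vs : Cls → ℕ → ℕ} {e0 : ℕ → ℕ}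

/-- Placing a vertex into its class. -/
theorem wp_extend_classes {c : Cls} {u : ℕ} {Q : HState E.b → Prop} (H : J.Classes U h.v k vs e0)
    (hU : insert u U ⊆ J.M1 ∪ J.M2) (hu : u ∉ U) (hc : J.cl u = c)
    (hpow : ∀ i ≤ J.s1 + J.s2, h.v .pow i = 3 ^ i)
    (hB : 2 * (J.s1 + J.s2 + 1) * 3 ^ (J.s1 + J.s2) < E.B)
    (he0 : ∀ w ∈ insert u U, e0 w ≤ 3 ^ (J.s1 + J.s2))
    (h1 : h.v .st1 0 = J.e1 u) (h2 : h.v .st2 0 = J.e2 u) (h0 : h.v .st0 0 = e0 u)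
    {K : ℕ} (hK : (J.ofCls c).card ≤ K)
    (HQ : ∀ s : HState E.b, (∀ a, a ∉ (extend c).mods → s.v a = h.v a) → s.m = h.m →
      s.t ≤ h.t + 12 * 3 ^ K → (∃ k' vs', J.Classes (insert u U) s.v k' vs' e0) → Q s) :
    E.wp (extend c) h Q := by
  have hk := H.le ((subset_insert _ _).trans hU) c
  have hk2 := hk.trans (J.card_ofCls_le c)
  have hbd : ∀ (e : ℕ → ℕ), (∀ w ∈ insert u U, e w ≤ 3 ^ (J.s1 + J.s2)) →
      ∑ i ∈ range (k c), 2 * e (vs c i) + 2 * e u < E.B := by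
    intro e he; refine lt_of_le_of_lt ?_ hB
    have h1 : ∑ i ∈ range (k c), 2 * e (vs c i) ≤ (k c) * (2 * 3 ^ (J.s1 + J.s2)) := by
      refine (Finset.sum_le_card_nsmul _ _ (2 * 3 ^ (J.s1 + J.s2)) fun i hi => ?_).trans (by simp)
      exact Nat.mul_le_mul_left _ (he _ (Finset.mem_insert_of_mem (H.mem (mem_range.1 hi)).1))
    have h2 := he u (Finset.mem_insert_self _ _)
    have h3 : (k c) * (2 * 3 ^ (J.s1 + J.s2)) ≤ (J.s1 + J.s2) * (2 * 3 ^ (J.s1 + J.s2)) :=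
      Nat.mul_le_mul_right _ hk2
    nlinarith
  have hpos : 1 ≤ 3 ^ (J.s1 + J.s2) := one_le_pow _ _ (by norm_num)
  refine (wp_extend (H.nc c) (hpow _ hk2) (H.o1 c) (H.o2 c) (H.o0 c) (H.sg c) ?_ ?_ ?_ ?_).mono ?_
  · rw [h1]; exact hbd _ fun w _ => J.e1_le w
  · rw [h2]; exact hbd _ fun w _ => J.e2_le w
  · rw [h0]; exact hbd _ he0
  · nlinarith
  · intro s _ hf ⟨hm, ht, hn, g1, g2, g0, gs⟩
    refine HQ s hf hm (ht.trans ?_) (H.insert hu hc ?_ hn ?_ ?_ ?_ gs)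
    · have : 3 ^ k c ≤ 3 ^ K := pow_le_pow_right (by norm_num) (hk.trans hK)
      have : 1 ≤ 3 ^ K := one_le_pow _ _ (by norm_num)
      omega
    · intro c' hcc; refine ⟨?_, ?_, ?_, ?_, ?_⟩ <;> exact hf _ (by simp [extend, mods, hcc])
    · rwa [← h1]
    · rwa [← h2]
    · rwa [← h0]

end DS

namespace JoinLists

/-- The state of the arrays after the vertices in `U` have been placed into their classes, with the
list of the node `x` under construction. The lists of the other nodes are as in `v₀`. -/
structure Placed (J : JoinLists) (n x : ℕ) (v₀ : Store) (U : Finset ℕ) (v : Store) :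
    Prop where
  ex : ∃ k vs e0, J.Classes U v k vs e0 ∧ J.Kept U (fun p => v .lst (x * n + p)) (v .s0 0) e0
  cnt : ∀ p < v .s0 0, v .cnt (x * n + p) = J.tot (v .lst (x * n + p))
  frame : ∀ y i, y ≠ x → i < n → v .lst (y * n + i) = v₀ .lst (y * n + i) ∧
    v .cnt (y * n + i) = v₀ .cnt (y * n + i)

theorem Placed.congr {J : JoinLists} {n x : ℕ} {v₀ v v' : Store} {U : Finset ℕ}
    (H : J.Placed n x v₀ U v)
    (h1 : ∀ c, v' (.nc c) = v (.nc c) ∧ v' (.o1 c) = v (.o1 c) ∧ v' (.o2 c) = v (.o2 c) ∧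
      v' (.o0 c) = v (.o0 c) ∧ v' (.sg c) = v (.sg c))
    (h2 : v' .lst = v .lst) (h3 : v' .cnt = v .cnt) (h4 : v' .s0 = v .s0) :
    J.Placed n x v₀ U v' where
  ex := by
    obtain ⟨k, vs, e0, H1, H2⟩ := H.ex
    exact ⟨k, vs, e0, H1.congr h1 fun _ _ => rfl, by rw [h2, h4]; exact H2⟩
  cnt := by rw [h2, h3, h4]; exact H.cnt
  frame := by rw [h2, h3]; exact H.frame

end JoinLists

theorem row_ne {n x y i p : ℕ} (hxy : y ≠ x) (hi : i < n) (hp : p < n) :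
    y * n + i ≠ x * n + p := by
  intro h
  have h1 : (y * n + i) / n = y := by rw [mul_comm, mul_add_div (by omega), div_eq_of_lt hi]; rfl
  have h2 : (x * n + p) / n = x := by rw [mul_comm, mul_add_div (by omega), div_eq_of_lt hp]; rfl
  exact hxy (by rw [← h1, h, h2])

namespace DS

open Env HProg

variable {E : Env} {h : HState E.b} {J : JoinLists} {U : Finset ℕ}

theorem wp_place {n x u K δ : ℕ} {v₀ : Store} {r : HProg} (H : J.Placed n x v₀ U h.v)
    (hn : h.v .nn 0 = n) (hx : h.v .x 0 = x) (hUn : J.M1 ∪ J.M2 ⊆ range n)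
    (hU : insert u U ⊆ J.M1 ∪ J.M2) (hu : u ∉ U)
    (hpow : ∀ i ≤ J.s1 + J.s2, h.v .pow i = 3 ^ i)
    (hB : 2 * (J.s1 + J.s2 + 1) * 3 ^ (J.s1 + J.s2) < E.B)
    (hK : ∀ c, (J.ofCls c).card ≤ K) (hhu : h.v .u 0 = u) (hd : h.v .deg u = J.dg u)
    (h1 : h.v .st1 0 = J.e1 u) (h2 : h.v .st2 0 = J.e2 u) (h0 : h.v .st0 0 = 0)
    (ht : h.v .tot 0 = J.tot u)
    (hr : J.cl u ≠ .F → ∀ (s : HState E.b) Q, s.v .st2 0 = J.e2 u →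
      E.wp (extend (J.cl u)) ⟨s.v, s.m, s.t + δ⟩ Q → E.wp r s Q) :
    E.wp (.ite (rd .deg (sc .u) - sc .tot) (push ;; r) (extend .F)) h fun s => s.m = h.m ∧
      s.t ≤ h.t + (12 * 3 ^ K + 5 + δ) ∧ J.Placed n x v₀ (insert u U) s.v := by
  obtain ⟨k, vs, e0, HC, HK⟩ := H.ex
  have hUM := (subset_insert _ _).trans hU
  have hs0 : h.v .s0 0 < n ∧ h.v .s0 0 < J.s1 + J.s2 := by
    have h1 := HK.le
    have h2 := card_le_card hU
    rw [Finset.card_insert_of_notMem hu] at h2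
    have h3 := card_le_card hUn
    rw [card_range] at h3
    have := J.card_union_le
    omega
  have hpos : 1 ≤ 3 ^ (J.s1 + J.s2) := one_le_pow _ _ (by norm_num)
  have he0 : ∀ w ∈ insert u U, update e0 u (3 ^ h.v .s0 0) w ≤ 3 ^ (J.s1 + J.s2) := by
    have hle : 3 ^ h.v .s0 0 ≤ 3 ^ (J.s1 + J.s2) := pow_le_pow_right (by norm_num) hs0.2.le
    intro w hw
    by_cases hwu : w = u
    · subst hwu; simpa using hle
    · rw [update_of_ne hwu]; exact (HK.e0_le (Finset.mem_of_mem_insert_of_ne hw hwu)).trans hle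
  refine wp_ite ?_ ?_
  · intro hne
    have hc : J.cl u ≠ .F := by
      rw [JoinLists.cl_ne_F]; simp [hhu, hd, ht] at hne; omega
    refine wp_seq ?_
    unfold push; refine wp_set_seq (wp_set_seq (wp_set_seq (wp_set ?_ (hr hc _ _ ?_ ?_)) ?_) ?_) ?_
    · intro hb; simp; nlinarith
    · simpa using h2
    · refine wp_extend_classes (J := J) (U := U) (k := k) (vs := vs)
        (e0 := update e0 u (3 ^ h.v .s0 0)) (u := u) (K := K)
        (HC.congr (fun c => by simp) ?_) hU hu rfl (by simpa using hpow) hB he0 (by simpa using h1)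
        (by simpa using h2) (by simpa using hpow _ hs0.2.le) (hK _) ?_
      · intro w hw; rw [update_of_ne]; rintro rfl; exact hu hw
      · intro s hf hm hs ⟨k', vs', HC'⟩
        have hl : s.v .lst = update (h.v .lst) (x * n + h.v .s0 0) u := by
          rw [hf _ (by simp [extend, mods])]; simp [at_, hn, hx, hhu]
        have hcn : s.v .cnt = update (h.v .cnt) (x * n + h.v .s0 0) (J.tot u) := by
          rw [hf _ (by simp [extend, mods])]; simp [at_, hn, hx, ht]
        have hs0' : s.v .s0 0 = h.v .s0 0 + 1 := by
          rw [hf _ (by simp [extend, mods])]; simp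
        refine ⟨hm, ?_, ⟨k', vs', _, HC', ?_⟩, ?_, ?_⟩
        · simp only at hs ⊢; omega
        · rw [hs0']; refine HK.insert hu hc ?_ ?_
          · simp [hl]
          · intro p hp; simp [hl, hp.ne]
        · rw [hs0', hl, hcn]; intro p hp
          rcases lt_succ_iff_lt_or_eq.1 hp with hp | rfl
          · simpa [hp.ne] using H.cnt p hp
          · simp
        · rw [hl, hcn]; intro y i hy hi
          have := row_ne hy hi hs0.1
          rw [update_of_ne this, update_of_ne this]; exact H.frame y i hy hi
    · exact fun hb => hb _ _
    · exact fun hb => hb _ _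
    · exact fun hb => hb _ _
  · intro heq
    have hc : J.cl u = .F := by
      by_contra hc
      rw [← ne_eq, JoinLists.cl_ne_F] at hc; simp [hhu, hd, ht] at heq; omega
    refine wp_extend_classes (J := J) (U := U) (k := k) (vs := vs) (e0 := e0) (u := u) (K := K)
        HC hU hu hc hpow hB ?_ h1 h2 (by rw [HK.stF u hc]; exact h0) (hK _) ?_
    · intro w hw
      by_cases hwu : w = u
      · subst hwu; rw [HK.stF w hc]; omega
      · have := he0 w hw; rwa [update_of_ne hwu] at this
    · intro s hf hm hs ⟨k', vs', HC'⟩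
      have hl : s.v .lst = h.v .lst := hf _ (by simp [extend, mods])
      have hcn : s.v .cnt = h.v .cnt := hf _ (by simp [extend, mods])
      have hs0' : s.v .s0 = h.v .s0 := hf _ (by simp [extend, mods])
      refine ⟨hm, ?_, ⟨k', vs', _, HC', ?_⟩, ?_, ?_⟩
      · simp only at hs ⊢; omega
      · rw [hs0', hl]; exact HK.insertF hc
      · rw [hs0', hl, hcn]; exact H.cnt
      · rw [hl, hcn]; exact H.frame

theorem wp_pows {n : ℕ} (hl : h.v .lim 0 = n) (h0 : h.v .pow 0 = 1) (hB : 3 ^ n < E.B) :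
    E.wp (.for_ .i .lim (.set .pow (sc .i + 1) (3 * rd .pow (sc .i)))) h fun s =>
      s.m = h.m ∧ s.t ≤ h.t + 2 * n + 1 ∧ ∀ i ≤ n, s.v .pow i = 3 ^ i := by
  refine wp_for n 1 (fun j v m => m = h.m ∧ ∀ i ≤ j, v .pow i = 3 ^ i) hl ?_ ?_ ?_
  · refine ⟨rfl, fun i hi => ?_⟩
    obtain rfl : i = 0 := by omega
    simpa using h0
  · intro j hj s hf hi ⟨hm, hp⟩
    have hle : 3 ^ (j + 1) ≤ 3 ^ n := pow_le_pow_right (by norm_num) hj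
    have e : 3 * 3 ^ j = 3 ^ (j + 1) := by rw [pow_succ, mul_comm]
    refine wp_set ?_ ⟨le_rfl, hm, ?_⟩
    · intro _; simp [hi, hp j le_rfl]; omega
    · intro i hij
      simp only [eval_add, eval_mul, eval_arr, eval_ofNat, eval_lit,
        hi, hp j le_rfl, upd_same, ne_eq, reduceCtorEq, not_false_eq_true, upd_ne, e]
      by_cases h : i = j + 1
      · subst h; simp
      · rw [update_of_ne h]; exact hp i (by omega)
  · intro s hf hi ⟨hm, hp⟩ ht; exact ⟨hm, by omega, hp⟩

theorem wp_marks {n c2 : ℕ} (hn : h.v .nn 0 = n) (hc : h.v .c2 0 = c2) (hl : h.v .lim 0 = J.s2)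
    (hp : ∀ i < J.s2, h.v .pow i = 3 ^ i) (h0 : ∀ u, h.v .mark u = 0)
    (h1 : ∀ i < J.s2, h.v .lst (c2 * n + i) = J.f2 i ∧ h.v .cnt (c2 * n + i) = J.k2 (J.f2 i)) :
    E.wp (.for_ .i .lim (.set .mark (rd .lst (at_ .c2 .i)) (rd .pow (sc .i)) ;;
     .set .markc (rd .lst (at_ .c2 .i)) (rd .cnt (at_ .c2 .i)))) h fun s =>
      s.m = h.m ∧ s.t ≤ h.t + 3 * J.s2 + 1 ∧ (∀ u, s.v .mark u = J.e2 u) ∧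
        ∀ u ∈ J.M2, s.v .markc u = J.k2 u := by
  refine wp_for J.s2 2 (fun j v m => m = h.m ∧ (∀ u, v .mark u = if ∃ i < j, J.f2 i = u then J.e2 u
    else 0) ∧ ∀ i < j, v .markc (J.f2 i) = J.k2 (J.f2 i)) hl ?_ ?_ ?_
  · exact ⟨rfl, by simpa using h0, by simp⟩
  · intro j hj s hf hi ⟨hm, hk, hkc⟩
    have g1 : s.v .lst = h.v .lst := hf _ (by decide)
    have g2 : s.v .cnt = h.v .cnt := hf _ (by decide)
    have g3 : s.v .nn 0 = n := by rw [hf _ (by decide), hn]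
    have g4 : s.v .c2 0 = c2 := by rw [hf _ (by decide), hc]
    have g5 : s.v .pow = h.v .pow := hf _ (by decide)
    refine wp_set_seq (wp_set ?_ ⟨by simp, hm, ?_, ?_⟩) ?_
    · exact fun hb => hb _ _
    · intro u
      simp only [eval_add, eval_mul, eval_arr, eval_lit, at_,
        hi, g1, g2, g3, g4, g5, upd_same, ne_eq, reduceCtorEq, not_false_eq_true,
        upd_ne, (h1 j hj).1, hp j hj]
      by_cases hu : u = J.f2 j
      · subst hu; rw [update_self, if_pos ⟨j, by omega, rfl⟩, J.e2_f2 hj]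
      · rw [update_of_ne hu, hk]
        congr 1
        refine propext ⟨fun ⟨i, h1, h2⟩ => ⟨i, by omega, h2⟩, fun ⟨i, h1, h2⟩ => ⟨i, ?_, h2⟩⟩
        rcases lt_succ_iff_lt_or_eq.1 h1 with h | rfl
        · exact h
        · exact absurd h2.symm hu
    · intro i hij
      simp only [eval_add, eval_mul, eval_arr, eval_lit, at_,
        hi, g1, g2, g3, g4, g5, upd_same, ne_eq, reduceCtorEq, not_false_eq_true,
        upd_ne, (h1 j hj).1, (h1 j hj).2]
      by_cases hu : J.f2 i = J.f2 j
      · rw [hu, update_self]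
      · rw [update_of_ne hu]; refine hkc i ?_
        rcases lt_succ_iff_lt_or_eq.1 hij with h | rfl
        · exact h
        · exact absurd rfl hu
    · exact fun hb => hb _ _
  · intro s hf hi ⟨hm, hk, hkc⟩ ht; refine ⟨hm, by omega, fun u => ?_, fun u hu => ?_⟩
    · rw [hk]; split_ifs with hex
      · rfl
      · rw [J.e2_eq_zero]; rwa [J.mem_M2]
    · obtain ⟨i, hi, rfl⟩ := J.mem_M2.1 hu; exact hkc i hi

end DS

namespace DS

open Env HProg

variable {E : Env} {h : HState E.b} {J : JoinLists}

/-- The conditions under which vertices can be classified. -/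
structure ClassifyOk (B : ℕ) (J : JoinLists) (n x c1 c2 K : ℕ) (v : Store) : Prop where
  hn : v .nn 0 = n
  hx : v .x 0 = x
  hc1 : v .c1 0 = c1
  hc2 : v .c2 0 = c2
  ne1 : c1 ≠ x
  ne2 : c2 ≠ x
  l1 : ∀ i < J.s1, v .lst (c1 * n + i) = J.f1 i ∧ v .cnt (c1 * n + i) = J.k1 (J.f1 i)
  l2 : ∀ i < J.s2, v .lst (c2 * n + i) = J.f2 i ∧ v .cnt (c2 * n + i) = J.k2 (J.f2 i)
  dg : ∀ u ∈ J.M1 ∪ J.M2, v .deg u = J.dg u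
  le : J.M1 ∪ J.M2 ⊆ range n
  big : 2 * (J.s1 + J.s2 + 1) * 3 ^ (J.s1 + J.s2) < B
  kB : ∀ u, J.k1 u + J.k2 u < B
  hK : ∀ c, (J.ofCls c).card ≤ K

variable {n x c1 c2 K : ℕ} {v₀ : Store}

theorem ClassifyOk.s1_le (H : ClassifyOk E.B J n x c1 c2 K v₀) : J.s1 ≤ n := by
  rw [← J.card_M1]
  simpa using card_le_card (subset_union_left.trans H.le)

theorem ClassifyOk.s2_le (H : ClassifyOk E.B J n x c1 c2 K v₀) : J.s2 ≤ n := by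
  rw [← J.card_M2]
  simpa using card_le_card (subset_union_right.trans H.le)

theorem wp_pass1 (H : ClassifyOk E.B J n x c1 c2 K v₀)
    (hn : h.v .nn 0 = n) (hx : h.v .x 0 = x) (hc : h.v .c1 0 = c1) (hl : h.v .lim 0 = J.s1)
    (hdg : h.v .deg = v₀ .deg) (hpow : ∀ i ≤ J.s1 + J.s2, h.v .pow i = 3 ^ i)
    (hmark : ∀ u, h.v .mark u = J.e2 u) (hmarkc : ∀ u ∈ J.M2, h.v .markc u = J.k2 u)
    (hP : J.Placed n x v₀ ∅ h.v) :
    E.wp (.for_ .i .lim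
    (asg .u (rd .lst (at_ .c1 .i)) ;; asg .st1 (rd .pow (sc .i)) ;;
     asg .st2 (rd .mark (sc .u)) ;; asg .tot (rd .cnt (at_ .c1 .i)) ;; asg .st0 0 ;;
     .ite (sc .st2) (asg .tot (sc .tot + rd .markc (sc .u))) .skip ;;
     .set .mark (sc .u) 0 ;;
     .ite (rd .deg (sc .u) - sc .tot)
       (push ;; .ite (sc .st2) (extend .I) (extend .L))
       (extend .F))) h fun s => s.m = h.m ∧ s.t ≤ h.t + J.s1 * (12 * 3 ^ K + 16) + 1 ∧
      J.Placed n x v₀ J.M1 s.v ∧ ∀ u, s.v .mark u = if u ∈ J.M1 then 0 else J.e2 u := by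
  have hBpos := E.hB
  refine wp_for J.s1 (12 * 3 ^ K + 15) (fun j v m => m = h.m ∧
    J.Placed n x v₀ ((range j).image J.f1) v ∧
    ∀ u, v .mark u = if u ∈ (range j).image J.f1 then 0 else J.e2 u) hl ?_ ?_ ?_
  · refine ⟨rfl, ?_, by simpa using hmark⟩
    exact hP.congr (fun c => by simp) (by simp) (by simp) (by simp)
  · intro j hj s hf hi ⟨hm, hPl, hmk⟩
    set u := J.f1 j with hu
    set U := (range j).image J.f1 with hUdef
    have hu1 : u ∈ J.M1 := J.f1_mem hj
    have hU1 : U ⊆ J.M1 := image_subset_image (range_subset_range.2 hj.le)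
    have huU : u ∉ U := by
      simp only [hUdef, mem_image, mem_range, not_exists, not_and]; intro i hi h
      have := J.inj1 (by simp; omega) (by simpa using hj) h
      omega
    have g3 : s.v .nn 0 = n := by rw [hf _ (by decide), hn]
    have g4 : s.v .c1 0 = c1 := by rw [hf _ (by decide), hc]
    have g5 : s.v .pow = h.v .pow := hf _ (by decide)
    have g6 : s.v .deg = v₀ .deg := by rw [hf _ (by decide), hdg]
    have g7 : s.v .x 0 = x := by rw [hf _ (by decide), hx]
    have g8 : s.v .markc = h.v .markc := hf _ (by decide)
    have hjn := hj.trans_le H.s1_le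
    have g1 : s.v .lst (c1 * n + j) = u := by
      rw [(hPl.frame c1 j H.ne1 hjn).1, (H.l1 j hj).1]
    have g2 : s.v .cnt (c1 * n + j) = J.k1 u := by
      rw [(hPl.frame c1 j H.ne1 hjn).2, (H.l1 j hj).2]
    have gm : s.v .mark u = J.e2 u := by rw [hmk, if_neg huU]
    have e1u : J.e1 u = 3 ^ j := J.e1_f1 hj
    -- the last two statements
    have key : ∀ s' : HState E.b, s'.m = s.m → s'.t ≤ s.t + 7 → s'.v .u 0 = u →
        s'.v .st1 0 = J.e1 u → s'.v .st2 0 = J.e2 u → s'.v .st0 0 = 0 → s'.v .tot 0 = J.tot u →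
        J.Placed n x v₀ U s'.v → s'.v .nn 0 = n → s'.v .x 0 = x → s'.v .pow = h.v .pow →
        s'.v .deg = v₀ .deg → s'.v .mark = s.v .mark →
        E.wp (.set .mark (sc .u) 0 ;; .ite (rd .deg (sc .u) - sc .tot)
          (push ;; .ite (sc .st2) (extend .I) (extend .L)) (extend .F)) s' fun s'' =>
          s''.t ≤ s.t + (12 * 3 ^ K + 15) ∧ s''.m = h.m ∧
          J.Placed n x v₀ ((range (j + 1)).image J.f1) (upd s''.v .i 0 (j + 1)) ∧
          ∀ w, upd s''.v .i 0 (j + 1) .mark w =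
            if w ∈ (range (j + 1)).image J.f1 then 0 else J.e2 w := by
      intro s' h1 h2 h3 h4 h5 h6 h7 h8 h9 h10 h11 h12 h13
      have hins : (range (j + 1)).image J.f1 = insert u U := by
        rw [range_add_one, image_insert]
      refine wp_set_seq ?_ (fun _ => by simp; omega)
      refine (wp_place (δ := 1) (U := U) (u := u) (n := n) (x := x) (v₀ := v₀) (J := J)
        (h8.congr (fun c => by simp) (by simp) (by simp) (by simp))
        (by simpa using h9) (by simpa using h10) H.le (insert_subset
          (mem_union_left _ hu1) (hU1.trans subset_union_left)) huU
        (by simpa [h11] using hpow) H.big H.hK (by simpa using h3) ?_ (by simpa using h4)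
        (by simpa using h5) (by simpa using h6) (by simpa using h7) ?_).mono ?_
      · simpa [h12] using H.dg u (mem_union_left _ hu1)
      · intro hcF r Q hst hw
        have hncl : ¬ J.dg u ≤ J.tot u := by rw [JoinLists.cl_ne_F] at hcF; omega
        refine wp_ite ?_ ?_
        · intro hne
          have : u ∈ J.M2 := by
            by_contra hu2
            simp [hst, J.e2_eq_zero hu2] at hne
          have hcl : J.cl u = .I := by simp [JoinLists.cl, hncl, hu1, this]
          rwa [hcl] at hw
        · intro heq
          have : u ∉ J.M2 := by
            intro hu2; simp [hst, J.e2_pos hu2] at heq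
          have hcl : J.cl u = .L := by simp [JoinLists.cl, hncl, hu1, this]
          rwa [hcl] at hw
      · intro s'' _ hf'' ⟨hm'', ht'', hP''⟩; rw [hins]
        refine ⟨?_, ?_, hP''.congr (fun c => by simp) (by simp) (by simp) (by simp), ?_⟩
        · simp only at ht''; omega
        · rw [hm'']; exact h1.trans hm
        · intro w; rw [upd_ne _ (by simp), hf'' .mark (by decide)]
          simp only [eval_arr, eval_lit, eval_zero, upd_same, h3, h13]
          by_cases hw : w = u
          · subst hw; simp
          · simp [hw, hmk]
    refine wp_set_seq (wp_set_seq (wp_set_seq (wp_set_seq (wp_set_seq (wp_seq (wp_ite ?_ ?_))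
      ?_) ?_) ?_) ?_) ?_
    · intro hne
      have hu2 : u ∈ J.M2 := by
        by_contra hu2
        simp [at_, hi, g3, g4, g1, gm, J.e2_eq_zero hu2] at hne
      have htot : J.tot u = J.k1 u + J.k2 u := by simp [JoinLists.tot, hu1, hu2]
      refine wp_set ?_ (key _ rfl (by simp only; omega) ?_ ?_ ?_ ?_ ?_ ?_ ?_ ?_ ?_ ?_ ?_)
      · intro _; simp [at_, hi, g3, g4, g1, g2, g8, hmarkc u hu2]; exact H.kB u
      · simp [at_, hi, g3, g4, g1]
      · simp [hi, g5, hpow j (by omega), e1u]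
      · simp [at_, hi, g3, g4, g1, gm]
      · simp
      · simp [at_, hi, g3, g4, g1, g2, g8, hmarkc u hu2, htot]
      · exact hPl.congr (fun c => by simp) (by simp) (by simp) (by simp)
      all_goals simp [g3, g5, g6, g7]
    · intro heq
      have hu2 : u ∉ J.M2 := by
        intro hu2; simp [at_, hi, g3, g4, g1, gm, J.e2_pos hu2] at heq
      have htot : J.tot u = J.k1 u := by simp [JoinLists.tot, hu1, hu2]
      refine wp_skip (key _ rfl (by simp only; omega) ?_ ?_ ?_ ?_ ?_ ?_ ?_ ?_ ?_ ?_ ?_)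
      · simp [at_, hi, g3, g4, g1]
      · simp [hi, g5, hpow j (by omega), e1u]
      · simp [at_, hi, g3, g4, g1, gm]
      · simp
      · simp [at_, hi, g3, g4, g1, g2, htot]
      · exact hPl.congr (fun c => by simp) (by simp) (by simp) (by simp)
      all_goals simp [g3, g5, g6, g7]
    · intro _; simp; omega
    all_goals exact fun hb => hb _ _
  · intro s hf hi ⟨hm, hPl, hmk⟩ ht
    exact ⟨hm, by rw [show 12 * 3 ^ K + 16 = 12 * 3 ^ K + 15 + 1 by rfl]; exact ht, hPl, hmk⟩

theorem wp_pass2 (H : ClassifyOk E.B J n x c1 c2 K v₀)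
    (hn : h.v .nn 0 = n) (hx : h.v .x 0 = x) (hc : h.v .c2 0 = c2) (hl : h.v .lim 0 = J.s2)
    (hdg : h.v .deg = v₀ .deg) (hpow : ∀ i ≤ J.s1 + J.s2, h.v .pow i = 3 ^ i)
    (hmark : ∀ u, h.v .mark u = if u ∈ J.M1 then 0 else J.e2 u)
    (hmarkc : ∀ u ∈ J.M2, h.v .markc u = J.k2 u) (hP : J.Placed n x v₀ J.M1 h.v) :
    E.wp (.for_ .i .lim
    (asg .u (rd .lst (at_ .c2 .i)) ;; asg .st1 0 ;; asg .st2 (rd .mark (sc .u)) ;; asg .st0 0 ;;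
     .ite (sc .st2)
       (.set .mark (sc .u) 0 ;; asg .tot (rd .markc (sc .u)) ;;
        .ite (rd .deg (sc .u) - sc .tot) (push ;; extend .R) (extend .F))
       .skip)) h fun s => s.m = h.m ∧ s.t ≤ h.t + J.s2 * (12 * 3 ^ K + 16) + 1 ∧
      J.Placed n x v₀ (J.M1 ∪ J.M2) s.v ∧ ∀ u, s.v .mark u = 0 := by
  have hBpos := E.hB
  refine wp_for J.s2 (12 * 3 ^ K + 15) (fun j v m => m = h.m ∧
    J.Placed n x v₀ (J.M1 ∪ (range j).image J.f2) v ∧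
    ∀ u, v .mark u = if u ∈ J.M1 ∪ (range j).image J.f2 then 0 else J.e2 u) hl ?_ ?_ ?_
  · refine ⟨rfl, ?_, by simpa using hmark⟩
    simpa using hP.congr (fun c => by simp) (by simp) (by simp) (by simp)
  · intro j hj s hf hi ⟨hm, hPl, hmk⟩
    set u := J.f2 j with hu
    set U := J.M1 ∪ (range j).image J.f2 with hUdef
    have hins : J.M1 ∪ (range (j + 1)).image J.f2 = insert u U := by
      rw [range_add_one, image_insert, Finset.union_insert]
    rw [hins]
    have hu2 : u ∈ J.M2 := J.f2_mem hj
    have hU1 : U ⊆ J.M1 ∪ J.M2 := Finset.union_subset_union_right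
      (image_subset_image (range_subset_range.2 hj.le))
    have g3 : s.v .nn 0 = n := by rw [hf _ (by decide), hn]
    have g4 : s.v .c2 0 = c2 := by rw [hf _ (by decide), hc]
    have g5 : s.v .pow = h.v .pow := hf _ (by decide)
    have g6 : s.v .deg = v₀ .deg := by rw [hf _ (by decide), hdg]
    have g7 : s.v .x 0 = x := by rw [hf _ (by decide), hx]
    have g8 : s.v .markc = h.v .markc := hf _ (by decide)
    have hjn := hj.trans_le H.s2_le
    have g1 : s.v .lst (c2 * n + j) = u := by
      rw [(hPl.frame c2 j H.ne2 hjn).1, (H.l2 j hj).1]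
    refine wp_set_seq (wp_set_seq (wp_set_seq (wp_set_seq (wp_ite ?_ ?_) ?_) ?_) ?_) ?_
    · intro hne
      have huU : u ∉ U := by
        intro hu'; simp [at_, hi, g3, g4, g1, hmk, hu'] at hne
      have gm : s.v .mark u = J.e2 u := by rw [hmk, if_neg huU]
      have hu1 : u ∉ J.M1 := fun h => huU (mem_union_left _ h)
      have htot : J.tot u = J.k2 u := by simp [JoinLists.tot, hu1, hu2]
      refine wp_set_seq (wp_set_seq ?_ (fun hb => hb _ _)) (fun _ => by simp; omega)
      refine (wp_place (δ := 0) (U := U) (u := u) (n := n) (x := x) (v₀ := v₀) (J := J)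
        (hPl.congr (fun c => by simp) (by simp) (by simp) (by simp))
        (by simpa using g3) (by simpa using g7) H.le (insert_subset
          (mem_union_right _ hu2) hU1) huU
        (by simpa [g5] using hpow) H.big H.hK (by simp [at_, hi, g3, g4, g1]) ?_
        (by simp [J.e1_eq_zero hu1])
        (by simp [at_, hi, g3, g4, g1, gm]) (by simp)
        (by simp [at_, hi, g3, g4, g1, g8, hmarkc u hu2, htot]) ?_).mono ?_
      · simpa [g6] using H.dg u (mem_union_right _ hu2)
      · intro hcF r Q hst hw
        have hncl : ¬ J.dg u ≤ J.tot u := by rw [JoinLists.cl_ne_F] at hcF; omega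
        have hcl : J.cl u = .R := by simp [JoinLists.cl, hncl, hu1]
        rwa [hcl] at hw
      · intro s'' _ hf'' ⟨hm'', ht'', hP''⟩
        refine ⟨?_, ?_, hP''.congr (fun c => by simp) (by simp) (by simp) (by simp), ?_⟩
        · simp only at ht''; omega
        · rw [hm'']; exact hm
        · intro w; rw [upd_ne _ (by simp), hf'' .mark (by decide)]
          by_cases hw : w = u
          · subst hw; simp [at_, hi, g3, g4, g1]
          · simp [at_, hi, g3, g4, g1, hw, hmk]
    · intro heq
      have huU : u ∈ U := by
        by_contra hu'
        simp [at_, hi, g3, g4, g1, hmk, hu', J.e2_pos hu2] at heq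
      rw [Finset.insert_eq_of_mem huU]; refine wp_skip ⟨by simp only; omega, hm, ?_, ?_⟩
      · exact hPl.congr (fun c => by simp) (by simp) (by simp) (by simp)
      · simpa using hmk
    · intro _; simp; omega
    · exact fun hb => hb _ _
    · intro _; simp; omega
    · exact fun hb => hb _ _
  · intro s hf hi ⟨hm, hPl, hmk⟩ ht
    refine ⟨hm, by rw [show 12 * 3 ^ K + 16 = 12 * 3 ^ K + 15 + 1 by rfl]; exact ht, hPl, ?_⟩
    intro u; rw [hmk]; split_ifs with hu
    · rfl
    · exact J.e2_eq_zero fun h => hu (mem_union_right _ h)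

theorem wp_classify (H : ClassifyOk E.B J n x c1 c2 K h.v) (hs1 : h.v .sz c1 = J.s1)
    (hs2 : h.v .sz c2 = J.s2) (hmark : ∀ u, h.v .mark u = 0)
    (ho : ∀ c, h.v (.o1 c) 0 = 0 ∧ h.v (.o2 c) 0 = 0 ∧ h.v (.o0 c) 0 = 0 ∧ h.v (.sg c) 0 = 0) :
    E.wp classify h fun s => s.m = h.m ∧ s.t ≤ h.t + (J.s1 + J.s2 + 1) * (60 * 3 ^ K) ∧
      J.Placed n x h.v (J.M1 ∪ J.M2) s.v ∧ (∀ u, s.v .mark u = 0) ∧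
      (∀ i ≤ J.s1 + J.s2, s.v .pow i = 3 ^ i) := by
  have hB := E.hB
  have hpos : 1 ≤ 3 ^ (J.s1 + J.s2) := one_le_pow _ _ (by norm_num)
  have hKp : 1 ≤ 3 ^ K := one_le_pow _ _ (by norm_num)
  have hbig : 3 ^ (J.s1 + J.s2) < E.B ∧ J.s1 + J.s2 < E.B := by
    have := H.big
    constructor <;> nlinarith
  unfold classify
  iterate 7 refine wp_set_seq ?_ (fun _ => by simp [H.hc1, H.hc2, hs1, hs2]; omega)
  refine wp_seq ((wp_pows (n := J.s1 + J.s2) (by simp [H.hc1, H.hc2, hs1, hs2]) (by simp)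
    hbig.1).mono ?_)
  rintro s1 - f1 ⟨hm1, ht1, hp1⟩
  have k1 : s1.v .sz = h.v .sz := by rw [f1 _ (by decide)]; simp
  have k2 : s1.v .c2 = h.v .c2 := by rw [f1 _ (by decide)]; simp
  have k3 : s1.v .c1 = h.v .c1 := by rw [f1 _ (by decide)]; simp
  have k4 : s1.v .nn = h.v .nn := by rw [f1 _ (by decide)]; simp
  have k5 : s1.v .lst = h.v .lst := by rw [f1 _ (by decide)]; simp
  have k6 : s1.v .cnt = h.v .cnt := by rw [f1 _ (by decide)]; simp
  have k7 : s1.v .mark = h.v .mark := by rw [f1 _ (by decide)]; simp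
  have k8 : s1.v .deg = h.v .deg := by rw [f1 _ (by decide)]; simp
  have k9 : s1.v .x = h.v .x := by rw [f1 _ (by decide)]; simp
  refine wp_set_seq ?_ (fun hb => hb _ _)
  refine wp_seq ((wp_marks (J := J) (n := n) (c2 := c2) (by simp [k4, H.hn]) (by simp [k2, H.hc2])
    (by simp [k1, k2, H.hc2, hs2]) (fun i hi => by simpa using hp1 i (by omega))
    (by simpa [k7] using hmark) (by simpa [k5, k6] using H.l2)).mono ?_)
  rintro s2 - f2 ⟨hm2, ht2, hk2, hkc2⟩
  have l1 : s2.v .sz = h.v .sz := by rw [f2 _ (by decide)]; simp [k1]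
  have l2 : s2.v .c2 = h.v .c2 := by rw [f2 _ (by decide)]; simp [k2]
  have l3 : s2.v .c1 = h.v .c1 := by rw [f2 _ (by decide)]; simp [k3]
  have l4 : s2.v .nn = h.v .nn := by rw [f2 _ (by decide)]; simp [k4]
  have l8 : s2.v .deg = h.v .deg := by rw [f2 _ (by decide)]; simp [k8]
  have l9 : s2.v .x = h.v .x := by rw [f2 _ (by decide)]; simp [k9]
  have lp : ∀ i ≤ J.s1 + J.s2, s2.v .pow i = 3 ^ i := by
    rw [f2 _ (by decide)]; simpa using hp1
  have hpl : J.Placed n x h.v ∅ s2.v := by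
    have a0 : s2.v .s0 0 = 0 := by
      rw [f2 _ (by decide)]; simp only [ne_eq, reduceCtorEq, not_false_eq_true, upd_ne]
      rw [f1 _ (by decide)]; simp
    have a1 : s2.v .lst = h.v .lst := by rw [f2 _ (by decide)]; simp [k5]
    have a2 : s2.v .cnt = h.v .cnt := by rw [f2 _ (by decide)]; simp [k6]
    refine ⟨⟨fun _ => 0, fun _ _ => 0, fun _ => 0, ⟨?_, ?_, ?_, ?_, ?_, ?_, ?_⟩, ?_⟩, ?_, ?_⟩
    · intro c
      rw [f2 _ (by cases c <;> decide)]; simp only [ne_eq, reduceCtorEq, not_false_eq_true, upd_ne]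
      rw [f1 _ (by cases c <;> decide)]; cases c <;> simp
    · intro c
      rw [f2 _ (by cases c <;> decide)]; simp only [ne_eq, reduceCtorEq, not_false_eq_true, upd_ne]
      rw [f1 _ (by cases c <;> decide)]; exact Off.zero _ _ (by simpa using (ho c).1)
    · intro c
      rw [f2 _ (by cases c <;> decide)]; simp only [ne_eq, reduceCtorEq, not_false_eq_true, upd_ne]
      rw [f1 _ (by cases c <;> decide)]; exact Off.zero _ _ (by simpa using (ho c).2.1)
    · intro c
      rw [f2 _ (by cases c <;> decide)]; simp only [ne_eq, reduceCtorEq, not_false_eq_true, upd_ne]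
      rw [f1 _ (by cases c <;> decide)]; exact Off.zero _ _ (by simpa using (ho c).2.2.1)
    · intro c
      rw [f2 _ (by cases c <;> decide)]; simp only [ne_eq, reduceCtorEq, not_false_eq_true, upd_ne]
      rw [f1 _ (by cases c <;> decide)]; exact Sgn.zero _ (by simpa using (ho c).2.2.2)
    · intro c u; simp
    · intro c; simp
    · rw [a0]; exact ⟨by simp, by simp, by simp, by simp⟩
    · simp [a0]
    · simp [a1, a2]
  refine wp_set_seq ?_ (fun hb => hb _ _)
  refine wp_seq ((wp_pass1 (J := J) (v₀ := h.v) H (by simp [l4, H.hn]) (by simp [l9, H.hx])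
    (by simp [l3, H.hc1]) (by simp [l1, l3, H.hc1, hs1]) (by simp [l8]) (by simpa using lp)
    (by simpa using hk2) (by simpa using hkc2)
    (hpl.congr (fun c => by simp) (by simp) (by simp) (by simp))).mono ?_)
  rintro s3 - f3 ⟨hm3, ht3, hP3, hk3⟩
  refine wp_set_seq ?_ (fun hb => hb _ _)
  refine (wp_pass2 (J := J) (v₀ := h.v) H ?_ ?_ ?_ ?_ ?_ ?_ (by simpa using hk3) ?_
    (hP3.congr (fun c => by simp) (by simp) (by simp) (by simp))).mono ?_
  · simp [f3 .nn (by decide), l4, H.hn]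
  · simp [f3 .x (by decide), l9, H.hx]
  · simp [f3 .c2 (by decide), l2, H.hc2]
  · simp [f3 .c2 (by decide), f3 .sz (by decide), l1, l2, H.hc2, hs2]
  · simp [f3 .deg (by decide), l8]
  · simpa [f3 .pow (by decide)] using lp
  · simpa [f3 .markc (by decide)] using hkc2
  · rintro s4 - f4 ⟨hm4, ht4, hP4, hk4⟩
    refine ⟨?_, ?_, hP4, hk4, ?_⟩
    · rw [hm4]; simp only; rw [hm3]; simp only; rw [hm2]; simp only; rw [hm1]
    · simp only at ht1 ht2 ht3 ht4
      have : (J.s1 + J.s2 + 1) * (60 * 3 ^ K) = (J.s1 + J.s2) * (12 * 3 ^ K) +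
        48 * ((J.s1 + J.s2) * 3 ^ K) + 60 * 3 ^ K := by ring
      have : J.s1 + J.s2 ≤ (J.s1 + J.s2) * 3 ^ K := le_mul_of_pos_right _ hKp
      have e1 : J.s1 * (12 * 3 ^ K + 16) = J.s1 * (12 * 3 ^ K) + J.s1 * 16 := by ring
      have e2 : J.s2 * (12 * 3 ^ K + 16) = J.s2 * (12 * 3 ^ K) + J.s2 * 16 := by ring
      have e3 : (J.s1 + J.s2) * (12 * 3 ^ K) = J.s1 * (12 * 3 ^ K) + J.s2 * (12 * 3 ^ K) := by ring
      rw [e1] at ht3; rw [e2] at ht4; omega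
    · rw [f4 _ (by decide)]; simpa [f3 .pow (by decide)] using lp

end DS

namespace Env

variable {E : Env} {p : HProg} {h : HState E.b}

/-- A loop whose body adds to the cells from `hi` on and leaves the cells below `lo` unchanged. -/
theorem wp_for_add {i m : Nm} (lo hi n c : ℕ) (δ : ℕ → ℕ → ZMod (2 ^ E.b)) (hn : h.v m 0 = n)
    {Q : HState E.b → Prop}
    (hs : ∀ j < n, ∀ s : HState E.b, (∀ a, a ∉ i :: p.mods → s.v a = h.v a) → s.v i 0 = j →
      (∀ a < lo, s.m a = h.m a) → E.wp p s fun s' => s'.t ≤ s.t + c ∧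
        (∀ a < lo, s'.m a = s.m a) ∧ ∀ a, hi ≤ a → s'.m a = s.m a + δ j a)
    (hQ : ∀ s : HState E.b, s.t ≤ h.t + n * (c + 1) + 1 → (∀ a < lo, s.m a = h.m a) →
      (∀ a, hi ≤ a → s.m a = h.m a + ∑ j ∈ range n, δ j a) → Q s) :
    E.wp (.for_ i m p) h Q := by
  refine wp_for n c (fun j _ m => (∀ a < lo, m a = h.m a) ∧
    ∀ a, hi ≤ a → m a = h.m a + ∑ j' ∈ range j, δ j' a) hn (by simp) ?_ ?_
  · intro j hj s hf hi' ⟨h1, h2⟩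
    refine (hs j hj s hf hi' h1).mono fun s' _ _ ⟨ht, g1, g2⟩ => ⟨ht, ?_, ?_⟩
    · intro a ha; rw [g1 a ha, h1 a ha]
    · intro a ha; rw [g2 a ha, h2 a ha, sum_range_succ, add_assoc]
  · intro s _ _ ⟨h1, h2⟩ ht; exact hQ s ht h1 h2

end Env

theorem mul_add_eq {d i j i' j' : ℕ} (hj : j < d) (hj' : j' < d) (h : i * d + j = i' * d + j') :
    i = i' ∧ j = j' := by
  have : i = i' := by by_contra hne; exact row_ne hne hj hj' h
  subst this
  exact ⟨rfl, by omega⟩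

namespace DS

open Env HProg

variable {E : Env} {h : HState E.b}

/-- Address in the first table. -/
def ad1 (v : Store) (j xI xL xF : ℕ) : ℕ :=
  v .t1 0 + j * v .p1 0 + v (.o1 .L) xL + v (.o1 .I) xI + v (.o1 .F) xF
/-- Address in the second table. -/
def ad2 (v : Store) (j xI xF xR : ℕ) : ℕ :=
  v .t2 0 + j * v .p2 0 + v (.o2 .F) xF + v (.o2 .I) xI + v (.o2 .R) xR
/-- Address in the new table. -/
def ad0 (v : Store) (j xI xL xR : ℕ) : ℕ :=
  v .out 0 + j * v .p0 0 + v (.o0 .L) xL + v (.o0 .I) xI + v (.o0 .R) xR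

/-- Signed entry of the first table. -/
def en1 {b : ℕ} (v : Store) (m : ℕ → ZMod (2 ^ b)) (j xI xL xF : ℕ) : ZMod (2 ^ b) :=
  if v (.sg .F) xF = 0 then m (ad1 v j xI xL xF) else - m (ad1 v j xI xL xF)
/-- Entry of the second table. -/
def en2 {b : ℕ} (v : Store) (m : ℕ → ZMod (2 ^ b)) (j xI xF xR : ℕ) : ZMod (2 ^ b) :=
  m (ad2 v j xI xF xR)

/-- The scratch space of a contraction. -/
structure Scratch {b : ℕ} (v : Store) (m : ℕ → ZMod (2 ^ b)) (A d : ℕ) : Prop where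
  hd : v .d 0 = d
  pos : 1 ≤ d
  sA : v .sA 0 = A
  sB : v .sB 0 = A + d * d
  sC : v .sC 0 = A + d * d + d * d
  out : A + d * d + d * d + d * d ≤ v .out 0
  hA : 1 ≤ A
  h0 : m 0 = 0

theorem wp_fill {A d j1 j2 xI bL bF bR : ℕ} (H : Scratch h.v h.m A d)
    (e1 : h.v .j1 0 = j1) (e2 : h.v .j2 0 = j2) (e3 : h.v .xI 0 = xI) (e4 : h.v .bL 0 = bL)
    (e5 : h.v .bF 0 = bF) (e6 : h.v .bR 0 = bR)
    (h1 : ∀ i < d, ∀ k < d, ad1 h.v j1 xI (bL * d + i) (bF * d + k) < A)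
    (h2 : ∀ i < d, ∀ k < d, ad2 h.v j2 xI (bF * d + i) (bR * d + k) < A) :
    E.wp (.for_ .ia .d (.for_ .ib .d
    (.arith .add (sc .sA + sc .ia * sc .d + sc .ib) 0
      (sc .t1 + sc .j1 * sc .p1 + rd (.o1 .L) (sc .bL * sc .d + sc .ia) + rd (.o1 .I) (sc .xI) +
        rd (.o1 .F) (sc .bF * sc .d + sc .ib)) ;;
     .ite (rd (.sg .F) (sc .bF * sc .d + sc .ib))
      (.arith .sub (sc .sA + sc .ia * sc .d + sc .ib) 0 (sc .sA + sc .ia * sc .d + sc .ib))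
      .skip ;;
     .arith .add (sc .sB + sc .ia * sc .d + sc .ib) 0
      (sc .t2 + sc .j2 * sc .p2 + rd (.o2 .F) (sc .bF * sc .d + sc .ia) + rd (.o2 .I) (sc .xI) +
        rd (.o2 .R) (sc .bR * sc .d + sc .ib))))) h fun s => s.t ≤ h.t + 9 * (d * d) ∧
      (∀ a < A, s.m a = h.m a) ∧ (∀ a, A + d * d + d * d ≤ a → s.m a = h.m a) ∧
      (∀ i < d, ∀ k < d, s.m (A + (i * d + k)) = en1 h.v h.m j1 xI (bL * d + i) (bF * d + k)) ∧
      (∀ i < d, ∀ k < d, s.m (A + d * d + (i * d + k)) =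
        en2 h.v h.m j2 xI (bF * d + i) (bR * d + k)) := by
  have hpos := H.pos
  have hlin : ∀ i < d, ∀ k < d, i * d + k < d * d := fun i hi k hk => by
    calc i * d + k < i * d + d := by omega
      _ = (i + 1) * d := by ring
      _ ≤ d * d := Nat.mul_le_mul_right _ hi
  let Inv : ℕ → (ℕ → ZMod (2 ^ E.b)) → Prop := fun cur m => (∀ a < A, m a = h.m a) ∧
    (∀ a, A + d * d + d * d ≤ a → m a = h.m a) ∧
    (∀ i < d, ∀ k < d, i * d + k < cur →
      m (A + (i * d + k)) = en1 h.v h.m j1 xI (bL * d + i) (bF * d + k)) ∧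
    (∀ i < d, ∀ k < d, i * d + k < cur → m (A + d * d + (i * d + k)) =
        en2 h.v h.m j2 xI (bF * d + i) (bR * d + k))
  refine wp_for d (d * 6 + 1) (fun i _ m => Inv (i * d) m) H.hd ?_ ?_ ?_
  · refine ⟨fun _ _ => rfl, fun _ _ => rfl, ?_, ?_⟩ <;> intro i _ k _ hlt <;> omega
  · intro i hi s hf hsi hinv
    have gd : s.v .d 0 = d := by rw [hf _ (by decide), H.hd]
    refine wp_for d 5 (fun k _ m => Inv (i * d + k) m) gd hinv ?_ ?_
    · intro k hk r hfr hrk ⟨i1, i2, i3, i4⟩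
      have f : ∀ a, a ≠ .ia → a ≠ .ib → r.v a = h.v a := by
        intro a ha hb; rw [hfr a (by simp [mods, hb]), hf a (by simp [mods, ha, hb])]
      have fi : r.v .ia 0 = i := by rw [hfr _ (by decide), hsi]
      have hx : i * d + k < d * d := hlin i hi k hk
      have ea : HExp.eval r.v (sc .sA + sc .ia * sc .d + sc .ib) = A + (i * d + k) := by
        simp [f, fi, hrk, H.sA, H.hd]; ring
      have eb : HExp.eval r.v (sc .sB + sc .ia * sc .d + sc .ib) = A + d * d + (i * d + k) := by
        simp [f, fi, hrk, H.sB, H.hd]; ring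
      have et1 : HExp.eval r.v (sc .t1 + sc .j1 * sc .p1 + rd (.o1 .L) (sc .bL * sc .d + sc .ia) +
          rd (.o1 .I) (sc .xI) + rd (.o1 .F) (sc .bF * sc .d + sc .ib)) =
          ad1 h.v j1 xI (bL * d + i) (bF * d + k) := by
        simp [f, fi, hrk, H.hd, ad1, e1, e3, e4, e5]
      have et2 : HExp.eval r.v (sc .t2 + sc .j2 * sc .p2 + rd (.o2 .F) (sc .bF * sc .d + sc .ia) +
          rd (.o2 .I) (sc .xI) + rd (.o2 .R) (sc .bR * sc .d + sc .ib)) =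
          ad2 h.v j2 xI (bF * d + i) (bR * d + k) := by
        simp [f, fi, hrk, H.hd, ad2, e2, e3, e6, e5]
      have esg : HExp.eval r.v (rd (.sg .F) (sc .bF * sc .d + sc .ib)) =
          h.v (.sg .F) (bF * d + k) := by
        simp [f, hrk, H.hd, e5]
      have z0 : r.m 0 = 0 := by rw [i1 0 H.hA, H.h0]
      have b1 := h1 i hi k hk
      have b2 := h2 i hi k hk
      have hA := H.hA
      -- the last instruction
      have key : ∀ q : HState E.b, q.v = r.v → q.t ≤ r.t + 3 →
          (∀ a, a ≠ A + (i * d + k) → q.m a = r.m a) →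
          q.m (A + (i * d + k)) = en1 h.v h.m j1 xI (bL * d + i) (bF * d + k) →
          E.wp (.arith .add (sc .sB + sc .ia * sc .d + sc .ib) 0
            (sc .t2 + sc .j2 * sc .p2 + rd (.o2 .F) (sc .bF * sc .d + sc .ia) +
            rd (.o2 .I) (sc .xI) + rd (.o2 .R) (sc .bR * sc .d + sc .ib))) q fun s' =>
            s'.t ≤ r.t + 5 ∧ Inv (i * d + (k + 1)) s'.m := by
        intro q hqv hqt hq1 hq2; refine wp_arith ⟨?_, ?_⟩
        · simp only; omega
        · simp only [hqv, eb, et2, eval_zero, NumOp.apply]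
          rw [hq1 0 (by omega), z0, zero_add, hq1 _ (by omega), i1 _ b2]; refine ⟨?_, ?_, ?_, ?_⟩
          · intro a ha; rw [update_of_ne (by omega), hq1 a (by omega), i1 a ha]
          · intro a ha; rw [update_of_ne (by omega), hq1 a (by omega), i2 a ha]
          · intro i' hi' k' hk' hlt
            have := hlin i' hi' k' hk'
            rw [update_of_ne (by omega)]
            rcases Nat.lt_or_ge (i' * d + k') (i * d + k) with hl | hl
            · rw [hq1 _ (by omega), i3 i' hi' k' hk' hl]
            · obtain ⟨rfl, rfl⟩ := mul_add_eq hk' hk (show i' * d + k' = i * d + k by omega)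
              exact hq2
          · intro i' hi' k' hk' hlt
            rcases Nat.lt_or_ge (i' * d + k') (i * d + k) with hl | hl
            · rw [update_of_ne (by omega), hq1 _ (by omega), i4 i' hi' k' hk' hl]
            · obtain ⟨rfl, rfl⟩ := mul_add_eq hk' hk (show i' * d + k' = i * d + k by omega)
              rw [update_self]; rfl
      refine wp_seq (wp_arith (wp_seq (wp_ite ?_ ?_)))
      · intro hne; simp only [esg] at hne; refine wp_arith (key _ rfl (by simp only; omega) ?_ ?_)
        · intro a ha; simp only [ea]; rw [update_of_ne ha, update_of_ne ha]
        · simp only [ea, et1, eval_zero, NumOp.apply, update_self]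
          rw [update_of_ne (by omega), z0, zero_add, zero_sub, i1 _ b1, en1, if_neg hne]
      · intro heq; simp only [esg] at heq; refine wp_skip (key _ rfl (by simp only; omega) ?_ ?_)
        · intro a ha; simp only [ea]; rw [update_of_ne ha]
        · simp only [ea, et1, eval_zero, NumOp.apply, update_self]
          rw [z0, zero_add, i1 _ b1, en1, if_pos heq]
    · intro r hfr hrk hinv ht; refine ⟨by omega, ?_⟩; rw [Nat.add_mul, one_mul]; exact hinv
  · intro s hf hsi ⟨i1, i2, i3, i4⟩ ht
    refine ⟨?_, i1, i2, fun i hi k hk => i3 i hi k hk (hlin i hi k hk),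
      fun i hi k hk => i4 i hi k hk (hlin i hi k hk)⟩
    have : d * (d * 6 + 1 + 1) + 1 ≤ 9 * (d * d) := by nlinarith
    omega

/-- The contribution of a pair of blocks. -/
def blockSum {b : ℕ} (v : Store) (m : ℕ → ZMod (2 ^ b)) (d j1 j2 xI bL bF bR a : ℕ) :
    ZMod (2 ^ b) :=
  ∑ i ∈ range d, ∑ k ∈ range d,
    if ad0 v (j1 + j2) xI (bL * d + i) (bR * d + k) = a then
      ∑ l ∈ range d, en1 v m j1 xI (bL * d + i) (bF * d + l) *
        en2 v m j2 xI (bF * d + l) (bR * d + k) else 0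

theorem wp_block {A d j1 j2 xI bL bF bR : ℕ} (H : Scratch h.v h.m A d)
    (e1 : h.v .j1 0 = j1) (e2 : h.v .j2 0 = j2) (e3 : h.v .xI 0 = xI) (e4 : h.v .bL 0 = bL)
    (e5 : h.v .bF 0 = bF) (e6 : h.v .bR 0 = bR)
    (h1 : ∀ i < d, ∀ k < d, ad1 h.v j1 xI (bL * d + i) (bF * d + k) < A)
    (h2 : ∀ i < d, ∀ k < d, ad2 h.v j2 xI (bF * d + i) (bR * d + k) < A)
    (h3 : ∀ i < d, ∀ k < d, ad0 h.v (j1 + j2) xI (bL * d + i) (bR * d + k) < E.B) :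
    E.wp block h fun s => s.t ≤ h.t + (E.tmm d + 20 * (d * d)) ∧ (∀ a < A, s.m a = h.m a) ∧
      ∀ a, h.v .out 0 ≤ a → s.m a = h.m a + blockSum h.v h.m d j1 j2 xI bL bF bR a := by
  have hpos := H.pos
  have hlin : ∀ i < d, ∀ k < d, i * d + k < d * d := fun i hi k hk => by
    calc i * d + k < i * d + d := by omega
      _ = (i + 1) * d := by ring
      _ ≤ d * d := Nat.mul_le_mul_right _ hi
  refine wp_seq ((wp_fill H e1 e2 e3 e4 e5 e6 h1 h2).mono ?_)
  rintro s - hf ⟨ht, m1, m2, m3, m4⟩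
  have f : ∀ a, a ≠ .ia → a ≠ .ib → s.v a = h.v a := by
    intro a ha hb; exact hf a (by simp [mods, ha, hb])
  have hout := H.out
  refine wp_seq (wp_mm (by simpa [f, H.hd] using hpos) ?_)
  simp only [f, ne_eq, reduceCtorEq, not_false_eq_true, H.hd, H.sA, H.sC]
  set m' : ℕ → ZMod (2 ^ E.b) := fun i =>
    if A + d * d + d * d ≤ i ∧ i < A + d * d + d * d + d * d then
      ∑ k ∈ range d,
        s.m (A + ((i - (A + d * d + d * d)) / d * d + k)) *
          s.m (A + (d * d + k * d + (i - (A + d * d + d * d)) % d))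
    else s.m i with hm'
  have c1 : ∀ a < A, m' a = h.m a := fun a ha => by
    rw [hm']; simp only; rw [if_neg (by omega), m1 a ha]
  have c2 : ∀ a, h.v .out 0 ≤ a → m' a = h.m a := fun a ha => by
    rw [hm']; simp only; rw [if_neg (by omega), m2 a (by omega)]
  have c3 : ∀ i < d, ∀ k < d, m' (A + d * d + d * d + (i * d + k)) =
      ∑ l ∈ range d, en1 h.v h.m j1 xI (bL * d + i) (bF * d + l) *
        en2 h.v h.m j2 xI (bF * d + l) (bR * d + k) := fun i hi k hk => by
    have := hlin i hi k hk
    rw [hm']; simp only; rw [if_pos (by omega)]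
    have q1 : (A + d * d + d * d + (i * d + k) - (A + d * d + d * d)) / d = i := by
      rw [Nat.add_sub_cancel_left, mul_comm, mul_add_div (by omega), div_eq_of_lt hk]; rfl
    have q2 : (A + d * d + d * d + (i * d + k) - (A + d * d + d * d)) % d = k := by
      rw [Nat.add_sub_cancel_left, mul_comm, Nat.mul_add_mod, mod_eq_of_lt hk]
    rw [q1, q2]; refine sum_congr rfl fun l hl => ?_
    rw [mem_range] at hl; rw [m3 i hi l hl, ← m4 l hl k hk]
    congr 2; ring
  have hd' : s.v .d 0 = d := by rw [f _ (by simp) (by simp), H.hd]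
  refine wp_for_add (h.v .out 0) (h.v .out 0) d (d * 3 + 1) (fun i a => ∑ k ∈ range d,
    if ad0 h.v (j1 + j2) xI (bL * d + i) (bR * d + k) = a then
      m' (A + d * d + d * d + (i * d + k)) else 0) (by simpa using hd') ?_ ?_
  · intro i hi r hfr hri hrm
    have hd'' : r.v .d 0 = d := by rw [hfr _ (by decide)]; simpa using hd'
    refine wp_for_add (h.v .out 0) (h.v .out 0) d 2 (fun k a =>
      if ad0 h.v (j1 + j2) xI (bL * d + i) (bR * d + k) = a then
      m' (A + d * d + d * d + (i * d + k)) else 0) hd'' ?_ ?_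
    · intro k hk q hfq hqk hqm
      have g : ∀ a, a ≠ .ia → a ≠ .ib → a ≠ .y → q.v a = h.v a := by
        intro a ha hb hc; rw [hfq a (by simp [mods, hb, hc]), hfr a (by simp [mods, ha, hb, hc])]
        simpa using f a ha hb
      have gi : q.v .ia 0 = i := by rw [hfq _ (by decide), hri]
      have hx := hlin i hi k hk
      have ey : HExp.eval q.v (sc .out + (sc .j1 + sc .j2) * sc .p0 +
          rd (.o0 .L) (sc .bL * sc .d + sc .ia) + rd (.o0 .I) (sc .xI) +
          rd (.o0 .R) (sc .bR * sc .d + sc .ib)) =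
          ad0 h.v (j1 + j2) xI (bL * d + i) (bR * d + k) := by
        simp [g, gi, hqk, H.hd, ad0, e1, e2, e3, e4, e6]
      have hy : h.v .out 0 ≤ ad0 h.v (j1 + j2) xI (bL * d + i) (bR * d + k) := by
        simp only [ad0]; omega
      refine wp_set_seq (wp_arith ⟨by simp only; omega, ?_⟩) ?_
      · simp only [ey]
        simp only [eval_add, eval_mul, eval_arr, eval_lit, upd_same, ne_eq,
          reduceCtorEq, not_false_eq_true, upd_ne, update_self, gi, hqk, g, H.hd, H.sC,
          NumOp.apply]
        rw [show A + d * d + d * d + i * d + k = A + d * d + d * d + (i * d + k) by ring]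
        have ec : q.m (A + d * d + d * d + (i * d + k)) =
            m' (A + d * d + d * d + (i * d + k)) := by
          rw [hqm _ (by omega), hrm _ (by omega)]
        rw [ec]
        constructor
        · intro a ha; rw [update_of_ne (by omega)]
        · intro a ha
          by_cases hay : ad0 h.v (j1 + j2) xI (bL * d + i) (bR * d + k) = a
          · subst hay; rw [update_self, if_pos rfl]
          · rw [update_of_ne (Ne.symm hay), if_neg hay, add_zero]
      · intro _; rw [ey]; exact h3 i hi k hk
    · intro q hqt hq1 hq2; exact ⟨by omega, hq1, hq2⟩
  · intro r hrt hr1 hr2; refine ⟨?_, ?_, ?_⟩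
    · have : d * (d * 3 + 1 + 1) + 1 ≤ 6 * (d * d) := by nlinarith
      simp only at hrt
      have : d * d ≥ 1 := Nat.mul_pos hpos hpos
      omega
    · intro a ha; rw [hr1 a (by omega)]; exact c1 a ha
    · intro a ha; rw [hr2 a ha]; simp only; rw [c2 a ha, blockSum]
      congr 1
      refine sum_congr rfl fun i hi => sum_congr rfl fun k hk => ?_
      rw [c3 i (mem_range.1 hi) k (mem_range.1 hk)]

end DS

namespace DS

open Env HProg

variable {E : Env} {h : HState E.b}

theorem loop_time_le {n X c e c' : ℕ} (hn : 1 ≤ n) (hX : 1 ≤ X) (hc : c' = X * (c + e)) :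
    n * (c' + 1) + 1 ≤ n * X * (c + (e + 2)) := by
  subst hc
  have h1 : n ≤ n * X := le_mul_of_pos_right _ hX
  have h2 : n * X * (c + (e + 2)) = n * (X * (c + e)) + 2 * (n * X) := by ring
  have h3 : n * (X * (c + e) + 1) + 1 = n * (X * (c + e)) + n + 1 := by ring
  omega

theorem sum_blocks {R : Type*} [CommRing R] (d qL qF qR : ℕ) (X Y : ℕ → ℕ → R) (P : ℕ → ℕ → Prop)
    [∀ i j, Decidable (P i j)] :
    ∑ bL ∈ range qL, ∑ bF ∈ range qF, ∑ bR ∈ range qR,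
      ∑ i ∈ range d, ∑ k ∈ range d,
        (if P (bL * d + i) (bR * d + k) then
          ∑ l ∈ range d, X (bL * d + i) (bF * d + l) * Y (bF * d + l) (bR * d + k) else 0) =
    ∑ xL ∈ range (qL * d), ∑ xR ∈ range (qR * d),
      if P xL xR then ∑ xF ∈ range (qF * d), X xL xF * Y xF xR else 0 := by
  rw [← sum_range_mul_eq]
  refine sum_congr rfl fun bL _ => ?_
  rw [sum_comm]
  simp_rw [← sum_range_mul_eq qR d]
  rw [sum_comm (s := range d)]
  refine sum_congr rfl fun bR _ => ?_
  rw [sum_comm]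
  refine sum_congr rfl fun i _ => ?_
  rw [sum_comm]
  refine sum_congr rfl fun k _ => ?_
  split_ifs
  · rw [← sum_range_mul_eq]
  · simp

/-- The conditions under which two tables can be contracted. -/
structure ContractOk {b : ℕ} (B : ℕ) (v : Store) (m : ℕ → ZMod (2 ^ b))
    (A d w1 w2 pI qL qF qR : ℕ) : Prop extends Scratch v m A d where
  hw1 : v .w1 0 = w1
  hw2 : v .w2 0 = w2
  hpI : v .pI 0 = pI
  hqL : v .qL 0 = qL
  hqF : v .qF 0 = qF
  hqR : v .qR 0 = qR
  pos2 : 1 ≤ w2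
  posI : 1 ≤ pI
  posL : 1 ≤ qL
  posF : 1 ≤ qF
  posR : 1 ≤ qR
  pos1 : 1 ≤ w1
  h1 : ∀ j < w1, ∀ xI < pI, ∀ xL < qL * d, ∀ xF < qF * d, ad1 v j xI xL xF < A
  h2 : ∀ j < w2, ∀ xI < pI, ∀ xF < qF * d, ∀ xR < qR * d, ad2 v j xI xF xR < A
  h3 : ∀ j1 < w1, ∀ j2 < w2, ∀ xI < pI, ∀ xL < qL * d, ∀ xR < qR * d,
    ad0 v (j1 + j2) xI xL xR < B

theorem wp_contract {A d w1 w2 pI qL qF qR : ℕ}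
    (H : ContractOk E.B h.v h.m A d w1 w2 pI qL qF qR) :
    E.wp contract h fun s =>
      s.t ≤ h.t + w1 * (w2 * (pI * (qL * (qF * qR)))) * (E.tmm d + 32 * (d * d)) ∧
      (∀ a < A, s.m a = h.m a) ∧ ∀ a, h.v .out 0 ≤ a → s.m a = h.m a +
        ∑ j1 ∈ range w1, ∑ j2 ∈ range w2, ∑ xI ∈ range pI,
          ∑ xL ∈ range (qL * d), ∑ xR ∈ range (qR * d),
            if ad0 h.v (j1 + j2) xI xL xR = a then ∑ xF ∈ range (qF * d),
              en1 h.v h.m j1 xI xL xF * en2 h.v h.m j2 xI xF xR else 0 := by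
  have hpos := H.pos
  have hlin : ∀ q, ∀ b < q, ∀ i < d, b * d + i < q * d := fun q b hb i hi => by
    calc b * d + i < b * d + d := by omega
      _ = (b + 1) * d := by ring
      _ ≤ q * d := Nat.mul_le_mul_right _ hb
  set c0 := E.tmm d + 20 * (d * d) with hc0
  have p1 := H.posR
  have p2 : 1 ≤ qF * qR := Nat.mul_pos H.posF p1
  have p3 : 1 ≤ qL * (qF * qR) := Nat.mul_pos H.posL p2
  have p4 : 1 ≤ pI * (qL * (qF * qR)) := Nat.mul_pos H.posI p3
  have p5 : 1 ≤ w2 * (pI * (qL * (qF * qR))) := Nat.mul_pos H.pos2 p4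
  refine wp_for_add A (h.v .out 0) w1 (w2 * (pI * (qL * (qF * qR))) * (c0 + 10)) (fun j1 a =>
    ∑ j2 ∈ range w2, ∑ xI ∈ range pI, ∑ bL ∈ range qL,
    ∑ bF ∈ range qF, ∑ bR ∈ range qR, blockSum h.v h.m d j1 j2 xI bL bF bR a)
    H.hw1 ?_ ?_
  · intro j1 hj1 s1 f1 i1 m1
    refine wp_for_add A (h.v .out 0) w2 (pI * (qL * (qF * qR)) * (c0 + 8)) (fun j2 a =>
      ∑ xI ∈ range pI, ∑ bL ∈ range qL, ∑ bF ∈ range qF,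
      ∑ bR ∈ range qR, blockSum h.v h.m d j1 j2 xI bL bF bR a)
      (by rw [f1 _ (by decide), H.hw2]) ?_ ?_
    · intro j2 hj2 s2 f2 i2 m2
      refine wp_for_add A (h.v .out 0) pI (qL * (qF * qR) * (c0 + 6)) (fun xI a =>
        ∑ bL ∈ range qL, ∑ bF ∈ range qF,
        ∑ bR ∈ range qR, blockSum h.v h.m d j1 j2 xI bL bF bR a)
        (by rw [f2 _ (by decide), f1 _ (by decide), H.hpI]) ?_ ?_
      · intro xI hxI s3 f3 i3 m3
        refine wp_for_add A (h.v .out 0) qL (qF * qR * (c0 + 4)) (fun bL a =>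
          ∑ bF ∈ range qF,
          ∑ bR ∈ range qR, blockSum h.v h.m d j1 j2 xI bL bF bR a)
          (by rw [f3 _ (by decide), f2 _ (by decide), f1 _ (by decide), H.hqL]) ?_ ?_
        · intro bL hbL s4 f4 i4 m4
          refine wp_for_add A (h.v .out 0) qF (qR * (c0 + 2)) (fun bF a =>
            ∑ bR ∈ range qR, blockSum h.v h.m d j1 j2 xI bL bF bR a)
            (by rw [f4 _ (by decide), f3 _ (by decide), f2 _ (by decide), f1 _ (by decide),
              H.hqF]) ?_ ?_
          · intro bF hbF s5 f5 i5 m5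
            refine wp_for_add A (h.v .out 0) qR c0 (fun bR a =>
              blockSum h.v h.m d j1 j2 xI bL bF bR a)
              (by rw [f5 _ (by decide), f4 _ (by decide), f3 _ (by decide), f2 _ (by decide),
                f1 _ (by decide), H.hqR]) ?_ ?_
            · intro bR hbR s f6 i6 m6
              have G : ∀ a, a ∉ contract.mods → s.v a = h.v a := by
                intro a ha
                rw [f6 a fun h => ha ((by decide : _ ⊆ contract.mods) h),
                  f5 a fun h => ha ((by decide : _ ⊆ contract.mods) h),
                  f4 a fun h => ha ((by decide : _ ⊆ contract.mods) h),
                  f3 a fun h => ha ((by decide : _ ⊆ contract.mods) h),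
                  f2 a fun h => ha ((by decide : _ ⊆ contract.mods) h),
                  f1 a fun h => ha ((by decide : _ ⊆ contract.mods) h)]
              have hm : ∀ a < A, s.m a = h.m a := by
                intro a ha; rw [m6 a ha, m5 a ha, m4 a ha, m3 a ha, m2 a ha, m1 a ha]
              have g1 : ad1 s.v = ad1 h.v := by
                funext j xI xL xF
                simp only [ad1]
                rw [G .t1 (by decide), G .p1 (by decide), G (.o1 .L) (by decide),
                  G (.o1 .I) (by decide), G (.o1 .F) (by decide)]
              have g2 : ad2 s.v = ad2 h.v := by
                funext j xI xL xF
                simp only [ad2]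
                rw [G .t2 (by decide), G .p2 (by decide), G (.o2 .F) (by decide),
                  G (.o2 .I) (by decide), G (.o2 .R) (by decide)]
              have g0 : ad0 s.v = ad0 h.v := by
                funext j xI xL xF
                simp only [ad0]
                rw [G .out (by decide), G .p0 (by decide), G (.o0 .L) (by decide),
                  G (.o0 .I) (by decide), G (.o0 .R) (by decide)]
              have b1 : ∀ i < d, ∀ k < d, ad1 h.v j1 xI (bL * d + i) (bF * d + k) < A :=
                fun i hi k hk => H.h1 j1 hj1 xI hxI _ (hlin _ _ hbL i hi) _ (hlin _ _ hbF k hk)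
              have b2 : ∀ i < d, ∀ k < d, ad2 h.v j2 xI (bF * d + i) (bR * d + k) < A :=
                fun i hi k hk => H.h2 j2 hj2 xI hxI _ (hlin _ _ hbF i hi) _ (hlin _ _ hbR k hk)
              refine (wp_block (A := A) (d := d) (j1 := j1) (j2 := j2) (xI := xI) (bL := bL)
                (bF := bF) (bR := bR) ?_ ?_ ?_ ?_ ?_ ?_ i6 ?_ ?_ ?_).mono ?_
              · refine ⟨?_, H.pos, ?_, ?_, ?_, ?_, H.hA, ?_⟩
                · rw [G _ (by decide), H.hd]
                · rw [G _ (by decide), H.sA]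
                · rw [G _ (by decide), H.sB]
                · rw [G _ (by decide), H.sC]
                · rw [G _ (by decide)]; exact H.out
                · rw [hm 0 H.hA, H.h0]
              · rw [f6 _ (by decide), f5 _ (by decide), f4 _ (by decide), f3 _ (by decide),
                  f2 _ (by decide), i1]
              · rw [f6 _ (by decide), f5 _ (by decide), f4 _ (by decide), f3 _ (by decide), i2]
              · rw [f6 _ (by decide), f5 _ (by decide), f4 _ (by decide), i3]
              · rw [f6 _ (by decide), f5 _ (by decide), i4]
              · rw [f6 _ (by decide), i5]
              · rw [g1]; exact b1
              · rw [g2]; exact b2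
              · rw [g0]; exact fun i hi k hk => H.h3 j1 hj1 j2 hj2 xI hxI _ (hlin _ _ hbL i hi) _
                  (hlin _ _ hbR k hk)
              · rintro s' - - ⟨ht', n1, n2⟩
                refine ⟨ht', n1, fun a ha => ?_⟩
                rw [G .out (by decide)] at n2; rw [n2 a ha]
                congr 1
                simp only [blockSum, g0]
                refine sum_congr rfl fun i hi => sum_congr rfl fun k hk => ?_
                congr 1
                refine sum_congr rfl fun l hl => ?_
                rw [mem_range] at hi hk hl; simp only [en1, en2, g1, g2]
                rw [hm _ (b1 i hi l hl), hm _ (b2 l hl k hk), G (.sg .F) (by decide)]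
            · intro s ht h1 h2
              exact ⟨ht.trans (by
                have := loop_time_le (n := qR) (X := 1) (c := c0) (e := 0) H.posR le_rfl
                  (by ring : c0 = 1 * (c0 + 0))
                rw [mul_one, Nat.zero_add] at this
                omega), h1, h2⟩
          · intro s ht h1 h2
            exact ⟨ht.trans ((Nat.add_assoc _ _ _).le.trans <| Nat.add_le_add_left
              (loop_time_le H.posF p1 rfl) _), h1, h2⟩
        · intro s ht h1 h2
          exact ⟨ht.trans ((Nat.add_assoc _ _ _).le.trans <| Nat.add_le_add_left
            (loop_time_le H.posL p2 rfl) _), h1, h2⟩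
      · intro s ht h1 h2
        exact ⟨ht.trans ((Nat.add_assoc _ _ _).le.trans <| Nat.add_le_add_left
          (loop_time_le H.posI p3 rfl) _), h1, h2⟩
    · intro s ht h1 h2
      exact ⟨ht.trans ((Nat.add_assoc _ _ _).le.trans <| Nat.add_le_add_left
        (loop_time_le H.pos2 p4 rfl) _), h1, h2⟩
  · intro s ht h1 h2; refine ⟨ht.trans ?_, h1, fun a ha => ?_⟩
    · rw [Nat.add_assoc]
      refine Nat.add_le_add_left ((loop_time_le H.pos1 p5 rfl).trans (Nat.mul_le_mul_left _ ?_)) _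
      have : 1 ≤ d * d := Nat.mul_pos hpos hpos
      omega
    · rw [h2 a ha]
      congr 1
      refine sum_congr rfl fun j1 _ => sum_congr rfl fun j2 _ =>
        sum_congr rfl fun xI _ => ?_
      simp only [blockSum]
      exact sum_blocks d qL qF qR (fun xL xF => en1 h.v h.m j1 xI xL xF)
        (fun xF xR => en2 h.v h.m j2 xI xF xR) (fun xL xR => ad0 h.v (j1 + j2) xI xL xR = a)

end DS

theorem digit_ofDigits3 {s i : ℕ} (δ : ℕ → Fin 3) (hi : i < s) : digit (ofDigits3 s δ) i = δ i :=
  ofDigits3_inj (ofDigits3_digit (ofDigits3_lt s δ)) i hi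

namespace JoinLists

variable {J : JoinLists} {v : Store} {k : Cls → ℕ} {vs : Cls → ℕ → ℕ} {e0 : ℕ → ℕ}
  {f0 : ℕ → ℕ} {s0 : ℕ}

theorem cl_cases {p : Finset ℕ} (g : ℕ → ℕ) :
    ∑ u ∈ p, g u = ∑ u ∈ p with J.cl u = .L, g u + ∑ u ∈ p with J.cl u = .I, g u +
      ∑ u ∈ p with J.cl u = .F, g u + ∑ u ∈ p with J.cl u = .R, g u := by
  simp only [sum_filter, ← sum_add_distrib]
  refine sum_congr rfl fun u _ => ?_
  cases J.cl u <;> simp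

theorem not_mem_M1_of_R {u : ℕ} (h : J.cl u = .R) : u ∉ J.M1 := by
  intro hu; unfold cl at h; split_ifs at h

theorem not_mem_M2_of_L {u : ℕ} (h : J.cl u = .L) : u ∉ J.M2 := by
  intro hu; unfold cl at h; split_ifs at h

theorem sum_e1 (g : ℕ → ℕ) : ∑ u ∈ J.M1 ∪ J.M2, g u * J.e1 u =
    ∑ i ∈ range J.s1, g (J.f1 i) * 3 ^ i := by
  rw [← sum_subset (subset_union_left (s₁ := J.M1) (s₂ := J.M2))]
  · rw [M1, sum_image J.inj1]; exact sum_congr rfl fun i hi => by rw [J.e1_f1 (mem_range.1 hi)]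
  · intro u _ hu; rw [J.e1_eq_zero hu, mul_zero]

theorem sum_e2 (g : ℕ → ℕ) : ∑ u ∈ J.M1 ∪ J.M2, g u * J.e2 u =
    ∑ i ∈ range J.s2, g (J.f2 i) * 3 ^ i := by
  rw [← sum_subset (subset_union_right (s₁ := J.M1) (s₂ := J.M2))]
  · rw [M2, sum_image J.inj2]; exact sum_congr rfl fun i hi => by rw [J.e2_f2 (mem_range.1 hi)]
  · intro u _ hu; rw [J.e2_eq_zero hu, mul_zero]

/-- The vertices that are kept. -/
def MK (J : JoinLists) : Finset ℕ := (J.M1 ∪ J.M2).filter fun u => J.cl u ≠ .F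

theorem sum_e0 (HK : J.Kept (J.M1 ∪ J.M2) f0 s0 e0) (g : ℕ → ℕ) :
    ∑ u ∈ J.M1 ∪ J.M2, g u * e0 u = ∑ i ∈ range s0, g (f0 i) * 3 ^ i := by
  rw [← sum_subset (filter_subset (fun u => J.cl u ≠ .F) (J.M1 ∪ J.M2))]
  · rw [← HK.image, sum_image HK.inj]
    exact sum_congr rfl fun i hi => by rw [HK.st i (mem_range.1 hi)]
  · intro u h1 hu
    have : J.cl u = .F := by by_contra hc; exact hu (mem_filter.2 ⟨h1, hc⟩)
    rw [HK.stF u this, mul_zero]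

/-- The index of an assignment of digits in the offset arrays of a class. -/
def index (k : Cls → ℕ) (vs : Cls → ℕ → ℕ) (τ : ℕ → Fin 3) (c : Cls) : ℕ :=
  ofDigits3 (k c) fun t => τ (vs c t)

theorem index_lt (τ : ℕ → Fin 3) (c : Cls) : index k vs τ c < 3 ^ k c := ofDigits3_lt _ _

variable (H : J.Classes (J.M1 ∪ J.M2) v k vs e0)
include H

theorem Classes.off_index {O e : ℕ → ℕ} {c : Cls} (hO : Off O (k c) fun t => e (vs c t))
    (τ : ℕ → Fin 3) : O (index k vs τ c) =
      ∑ u ∈ J.M1 ∪ J.M2 with J.cl u = c, (τ u : ℕ) * e u := by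
  rw [← H.image, sum_image (H.inj c), hO _ (index_lt τ c)]
  exact sum_congr rfl fun i hi => by
    rw [index, digit_ofDigits3 _ (mem_range.1 hi)]

theorem Classes.off1 (τ : ℕ → Fin 3) : v (.o1 .L) (index k vs τ .L) + v (.o1 .I) (index k vs τ .I) +
    v (.o1 .F) (index k vs τ .F) = ofDigits3 J.s1 fun i => τ (J.f1 i) := by
  rw [H.off_index (H.o1 _), H.off_index (H.o1 _), H.off_index (H.o1 _), ofDigits3,
    ← sum_e1 (fun u => (τ u : ℕ)), cl_cases (p := J.M1 ∪ J.M2)]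
  have : ∑ u ∈ J.M1 ∪ J.M2 with J.cl u = .R, (τ u : ℕ) * J.e1 u = 0 :=
    sum_eq_zero fun u hu => by
      rw [J.e1_eq_zero (not_mem_M1_of_R (mem_filter.1 hu).2), mul_zero]
  rw [this, add_zero]

theorem Classes.off2 (τ : ℕ → Fin 3) : v (.o2 .F) (index k vs τ .F) + v (.o2 .I) (index k vs τ .I) +
    v (.o2 .R) (index k vs τ .R) = ofDigits3 J.s2 fun i => τ (J.f2 i) := by
  rw [H.off_index (H.o2 _), H.off_index (H.o2 _), H.off_index (H.o2 _), ofDigits3,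
    ← sum_e2 (fun u => (τ u : ℕ)), cl_cases (p := J.M1 ∪ J.M2)]
  have : ∑ u ∈ J.M1 ∪ J.M2 with J.cl u = .L, (τ u : ℕ) * J.e2 u = 0 :=
    sum_eq_zero fun u hu => by
      rw [J.e2_eq_zero (not_mem_M2_of_L (mem_filter.1 hu).2), mul_zero]
  rw [this]; ring

theorem Classes.off0 (HK : J.Kept (J.M1 ∪ J.M2) f0 s0 e0) (τ : ℕ → Fin 3) :
    v (.o0 .L) (index k vs τ .L) + v (.o0 .I) (index k vs τ .I) +
    v (.o0 .R) (index k vs τ .R) = ofDigits3 s0 fun i => τ (f0 i) := by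
  rw [H.off_index (H.o0 _), H.off_index (H.o0 _), H.off_index (H.o0 _), ofDigits3,
    ← sum_e0 HK (fun u => (τ u : ℕ)), cl_cases (p := J.M1 ∪ J.M2)]
  have : ∑ u ∈ J.M1 ∪ J.M2 with J.cl u = .F, (τ u : ℕ) * e0 u = 0 :=
    sum_eq_zero fun u hu => by
      rw [HK.stF u (mem_filter.1 hu).2, mul_zero]
  rw [this, add_zero]

theorem Classes.exists_index {x : Cls → ℕ} (hx : ∀ c, x c < 3 ^ k c) :
    ∃ τ, ∀ c, index k vs τ c = x c := by
  classical
  refine ⟨fun u => if h : ∃ t < k (J.cl u), vs (J.cl u) t = u then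
    digit (x (J.cl u)) h.choose else 0, fun c => ?_⟩
  refine (ofDigits3_congr fun t ht => ?_).trans (ofDigits3_digit (hx c))
  have hc := (H.mem ht).2
  have hex : ∃ t' < k (J.cl (vs c t)), vs (J.cl (vs c t)) t' = vs c t := by
    rw [hc]; exact ⟨t, ht, rfl⟩
  beta_reduce
  rw [dif_pos hex]
  have key : ∀ c', c' = c → ∀ hex : ∃ t' < k c', vs c' t' = vs c t,
      digit (x c') hex.choose = digit (x c) t := by
    rintro _ rfl hex
    congr 1
    exact H.inj _ (by simpa using hex.choose_spec.1) (by simpa using ht) hex.choose_spec.2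
  exact key _ hc hex

theorem Classes.off1_lt {xI xL xF : ℕ} (hI : xI < 3 ^ k .I) (hL : xL < 3 ^ k .L)
    (hF : xF < 3 ^ k .F) : v (.o1 .L) xL + v (.o1 .I) xI + v (.o1 .F) xF < 3 ^ J.s1 := by
  obtain ⟨τ, hτ⟩ := H.exists_index (x := fun c => match c with | .I => xI | .L => xL | .F => xF | .R => 0)
    (by rintro (_ | _ | _ | _) <;> simp_all)
  have := H.off1 τ
  rw [hτ, hτ, hτ] at this
  simp only at this
  rw [this]; exact ofDigits3_lt _ _

theorem Classes.off2_lt {xI xR xF : ℕ} (hI : xI < 3 ^ k .I) (hR : xR < 3 ^ k .R)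
    (hF : xF < 3 ^ k .F) : v (.o2 .F) xF + v (.o2 .I) xI + v (.o2 .R) xR < 3 ^ J.s2 := by
  obtain ⟨τ, hτ⟩ := H.exists_index (x := fun c => match c with | .I => xI | .L => 0 | .F => xF | .R => xR)
    (by rintro (_ | _ | _ | _) <;> simp_all)
  have := H.off2 τ
  rw [hτ, hτ, hτ] at this
  simp only at this
  rw [this]; exact ofDigits3_lt _ _

theorem Classes.off0_iff (HK : J.Kept (J.M1 ∪ J.M2) f0 s0 e0) {xI xL xR : ℕ} (hI : xI < 3 ^ k .I)
    (hL : xL < 3 ^ k .L) (hR : xR < 3 ^ k .R) :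
    v (.o0 .L) xL + v (.o0 .I) xI + v (.o0 .R) xR < 3 ^ s0 ∧ ∀ σ : ℕ → Fin 3,
      (v (.o0 .L) xL + v (.o0 .I) xI + v (.o0 .R) xR = (ofDigits3 s0 fun i => σ (f0 i)) ↔
        xI = index k vs σ .I ∧ xL = index k vs σ .L ∧ xR = index k vs σ .R) := by
  obtain ⟨τ, hτ⟩ := H.exists_index (x := fun c => match c with | .I => xI | .L => xL | .F => 0 | .R => xR)
    (by rintro (_ | _ | _ | _) <;> simp_all)
  have h0 := H.off0 HK τ
  rw [hτ, hτ, hτ] at h0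
  simp only at h0
  refine ⟨by rw [h0]; exact ofDigits3_lt _ _, fun σ => ⟨fun h => ?_, fun h => ?_⟩⟩
  · rw [h0] at h
    have h1 := ofDigits3_inj h
    have h2 : ∀ u ∈ J.M1 ∪ J.M2, J.cl u ≠ .F → τ u = σ u := by
      intro u hu hc; obtain ⟨p, hp, rfl⟩ := (HK.bij u).2 ⟨hu, hc⟩; exact h1 p hp
    have h3 : ∀ c, c ≠ .F → index k vs τ c = index k vs σ c := fun c hc =>
      ofDigits3_congr fun t ht => h2 _ (H.mem ht).1 (by rwa [(H.mem ht).2])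
    exact ⟨(hτ .I).symm.trans (h3 _ (by simp)), (hτ .L).symm.trans (h3 _ (by simp)),
      (hτ .R).symm.trans (h3 _ (by simp))⟩
  · rw [h.1, h.2.1, h.2.2]; exact H.off0 HK σ

omit H in
theorem sum_join_index {R : Type*} [AddCommMonoid R] {nI nL nR a b c : ℕ} (ha : a < nI)
    (hb : b < nL) (hc : c < nR) (P : ℕ → ℕ → ℕ → Prop) [∀ x y z, Decidable (P x y z)]
    (hP : ∀ x < nI, ∀ y < nL, ∀ z < nR, P x y z ↔ x = a ∧ y = b ∧ z = c) (g : ℕ → ℕ → ℕ → R) :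
    ∑ x ∈ range nI, ∑ y ∈ range nL, ∑ z ∈ range nR,
      (if P x y z then g x y z else 0) = g a b c := by
  have hm : ∀ {n m : ℕ}, m ∈ range n ↔ m < n := mem_range
  rw [sum_eq_single_of_mem a (hm.2 ha), sum_eq_single_of_mem b (hm.2 hb),
    sum_eq_single_of_mem c (hm.2 hc), if_pos ((hP a ha b hb c hc).2 ⟨rfl, rfl, rfl⟩)]
  · intro z hz hne; rw [if_neg fun h => hne ((hP a ha b hb z (hm.1 hz)).1 h).2.2]
  · intro y hy hne; refine sum_eq_zero fun z hz => ?_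
    rw [if_neg fun h => hne ((hP a ha y (hm.1 hy) z (hm.1 hz)).1 h).2.1]
  · intro x hx hne; refine sum_eq_zero fun y hy => sum_eq_zero fun z hz => ?_
    rw [if_neg fun h => hne ((hP x (hm.1 hx) y (hm.1 hy) z (hm.1 hz)).1 h).1]

end JoinLists

/-- The cells of the table of a family, from `base` on. -/
def IsTable {b : ℕ} (G : Edges) (m : ℕ → ZMod (2 ^ b)) (base s W : ℕ) (f : ℕ → ℕ) (S : Finset ℕ)
    (A : ℕ → Finset (Finset ℕ)) : Prop :=
  ∀ j ≤ W, ∀ x < 3 ^ s, m (base + j * 3 ^ s + x) =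
    cellv (fun _ => loc (ZMod (2 ^ b))) s (A j) (fun D i => G.pt S D (f i)) x

theorem IsTable.tab {b : ℕ} {G : Edges} {m : ℕ → ZMod (2 ^ b)} {base s W : ℕ} {f : ℕ → ℕ}
    {S M : Finset ℕ} {A : ℕ → Finset (Finset ℕ)} (H : IsTable G m base s W f S A)
    (hM : M = (range s).image f) (hf : Set.InjOn f (range s)) {j : ℕ} (hj : j ≤ W)
    (τ : ℕ → Fin 3) :
    m (base + j * 3 ^ s + ofDigits3 s fun i => τ (f i)) = G.tab (ZMod (2 ^ b)) S M (A j) τ := by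
  rw [H j hj _ (ofDigits3_lt _ _), Edges.tab_eq_cellv hM hf]

namespace DS

open JoinLists

variable {J : JoinLists} {v : Store} {k : Cls → ℕ} {vs : Cls → ℕ → ℕ} {e0 : ℕ → ℕ}
  {f0 : ℕ → ℕ} {s0 : ℕ} {b : ℕ} {m : ℕ → ZMod (2 ^ b)} {G : Edges} {S₁ S₂ : Finset ℕ}
  {A₁ A₂ : ℕ → Finset (Finset ℕ)} {W₁ W₂ lo₁ lo₂ : ℕ} {full flat : Bool}

/-- The sums computed by a contraction are the table of the join. -/
theorem contract_eq_cellv (H : J.Classes (J.M1 ∪ J.M2) v k vs e0)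
    (HK : J.Kept (J.M1 ∪ J.M2) f0 s0 e0)
    (HJ : G.Join S₁ J.M1 S₂ J.M2 J.MK (J.ofCls .F))
    (hS₁ : G.Sem full flat S₁ J.M1 A₁ lo₁ W₁) (hS₂ : G.Sem full flat S₂ J.M2 A₂ lo₂ W₂)
    (hp1 : v .p1 0 = 3 ^ J.s1) (hp2 : v .p2 0 = 3 ^ J.s2) (hp0 : v .p0 0 = 3 ^ s0)
    (T₁ : IsTable G m (v .t1 0) J.s1 W₁ J.f1 S₁ A₁) (T₂ : IsTable G m (v .t2 0) J.s2 W₂ J.f2 S₂ A₂)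
    {j y : ℕ} (hj : j ≤ W₁ + W₂) (hy : y < 3 ^ s0) :
    ∑ j1 ∈ range (W₁ + 1), ∑ j2 ∈ range (W₂ + 1), ∑ xI ∈ range (3 ^ k .I),
      ∑ xL ∈ range (3 ^ k .L), ∑ xR ∈ range (3 ^ k .R),
        (if ad0 v (j1 + j2) xI xL xR = v .out 0 + j * 3 ^ s0 + y then
          ∑ xF ∈ range (3 ^ k .F), en1 v m j1 xI xL xF * en2 v m j2 xI xF xR else 0) =
    cellv (fun _ => loc (ZMod (2 ^ b))) s0 (G.joinFam S₁ J.M1 S₂ J.M2 (J.ofCls .F) A₁ A₂ j)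
      (fun D i => G.pt (S₁ ∪ S₂) D (f0 i)) y := by
  classical
  have hA₁ : ∀ j, ∀ D ∈ A₁ j, D ⊆ G.VS S₁ := fun j D hD => (hS₁.sound j D hD).1.1
  have hA₂ : ∀ j, ∀ D ∈ A₂ j, D ⊆ G.VS S₂ := fun j D hD => (hS₂.sound j D hD).1.1
  have he₁ := hS₁.empty
  have he₂ := hS₂.empty
  have hMK : J.MK = (range s0).image f0 := HK.image.symm
  -- an assignment with the digits of `y`
  obtain ⟨σ, hσ⟩ : ∃ σ : ℕ → Fin 3, y = ofDigits3 s0 fun i => σ (f0 i) := by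
    refine ⟨fun u => if h : ∃ p < s0, f0 p = u then digit y h.choose else 0, ?_⟩
    refine (ofDigits3_digit hy).symm.trans (ofDigits3_congr fun i hi => ?_)
    have hex : ∃ p < s0, f0 p = f0 i := ⟨i, hi, rfl⟩
    beta_reduce
    rw [dif_pos hex]
    congr 1
    exact HK.inj (by simpa using hi) (by simpa using hex.choose_spec.1) hex.choose_spec.2.symm
  have hF : J.ofCls .F = (range (k .F)).image (vs .F) := (H.image .F).symm
  set X := index k vs σ with hX
  let g : ℕ → ℕ → ZMod (2 ^ b) := fun j1 j2 =>
    ∑ xF ∈ range (3 ^ k .F), en1 v m j1 (X .I) (X .L) xF * en2 v m j2 (X .I) xF (X .R)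
  have hcol : ∀ j1 j2, ∑ xI ∈ range (3 ^ k .I), ∑ xL ∈ range (3 ^ k .L),
      ∑ xR ∈ range (3 ^ k .R),
        (if ad0 v (j1 + j2) xI xL xR = v .out 0 + j * 3 ^ s0 + y then
          ∑ xF ∈ range (3 ^ k .F), en1 v m j1 xI xL xF * en2 v m j2 xI xF xR else 0) =
      if j1 + j2 = j then g j1 j2 else 0 := by
    intro j1 j2
    have hiff : ∀ xI < 3 ^ k .I, ∀ xL < 3 ^ k .L, ∀ xR < 3 ^ k .R,
        (ad0 v (j1 + j2) xI xL xR = v .out 0 + j * 3 ^ s0 + y ↔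
          j1 + j2 = j ∧ xI = X .I ∧ xL = X .L ∧ xR = X .R) := by
      intro xI hI xL hL xR hR; obtain ⟨q1, q2⟩ := H.off0_iff HK hI hL hR
      rw [← q2 σ, ← hσ, ad0, hp0]
      constructor
      · intro he; exact mul_add_eq q1 hy (by omega)
      · rintro ⟨rfl, he⟩; omega
    split_ifs with hjj
    · exact sum_join_index (index_lt σ _) (index_lt σ _) (index_lt σ _) _
        (fun x hx y hy z hz => by simpa [hjj] using hiff x hx y hy z hz)
        (fun xI xL xR => ∑ xF ∈ range (3 ^ k .F), en1 v m j1 xI xL xF * en2 v m j2 xI xF xR)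
    · refine sum_eq_zero fun x hx => sum_eq_zero fun y hy =>
        sum_eq_zero fun z hz => ?_
      rw [if_neg]; intro h
      exact hjj ((hiff x (mem_range.1 hx) y (mem_range.1 hy) z
        (mem_range.1 hz)).1 h).1
  simp_rw [hcol]
  -- the value of one pair of layers
  have hg : ∀ j1 ≤ W₁, ∀ j2 ≤ W₂, g j1 j2 = ∑ D ∈ (A₁ j1 ×ˢ A₂ j2).filter fun D =>
      G.Compat S₁ J.M1 S₂ J.M2 (J.ofCls .F) D.1 D.2,
      ∏ v ∈ J.MK, loc (ZMod (2 ^ b)) (σ v) (G.pt (S₁ ∪ S₂) (D.1 ∪ D.2) v) := by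
    intro j1 hj1 j2 hj2
    let τ : ℕ → ℕ → Fin 3 := fun x u =>
      if h : ∃ t < k .F, vs .F t = u then digit x h.choose else σ u
    have hτF : ∀ x, ∀ t < k .F, τ x (vs .F t) = digit x t := by
      intro x t ht
      have hex : ∃ t' < k .F, vs .F t' = vs .F t := ⟨t, ht, rfl⟩
      simp only [τ]; rw [dif_pos hex]
      congr 1
      exact H.inj .F (by simpa using hex.choose_spec.1) (by simpa using ht) hex.choose_spec.2
    have hτ : ∀ x u, J.cl u ≠ .F → τ x u = σ u := by
      intro x u hu; refine dif_neg ?_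
      rintro ⟨t, ht, rfl⟩
      exact hu (H.mem ht).2
    have hix : ∀ x c, c ≠ .F → index k vs (τ x) c = X c := fun x c hc =>
      ofDigits3_congr fun t ht => hτ _ _ (by rwa [(H.mem ht).2])
    have hixF : ∀ x < 3 ^ k .F, index k vs (τ x) .F = x := fun x hx =>
      (ofDigits3_congr fun t ht => hτF x t ht).trans (ofDigits3_digit hx)
    rw [← Edges.Join.sum_tab_mul_tab HJ hF (H.inj .F) (hA₁ j1) (hA₂ j2) σ τ
      (fun x _ u hu => hτ x u (mem_filter.1 hu).2) (fun x _ t ht => hτF x t ht)]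
    refine sum_congr rfl fun x hx => ?_
    rw [mem_range] at hx
    have o1 := H.off1 (τ x)
    have o2 := H.off2 (τ x)
    rw [hix x .L (by simp), hix x .I (by simp), hixF x hx] at o1
    rw [hix x .R (by simp), hix x .I (by simp), hixF x hx] at o2
    rw [(H.sg .F).prod_wt _ hx, ← T₁.tab (M := J.M1) rfl J.inj1 hj1 (τ x), ← T₂.tab (M := J.M2) rfl J.inj2 hj2 (τ x), ← o1,
      ← o2, en1, en2, ad1, ad2, hp1, hp2]
    simp only [← add_assoc]
    split_ifs <;> ring
  rw [hσ, ← Edges.tab_eq_cellv hMK HK.inj, HJ.tab_joinFam hS₁ hS₂]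
  -- summation over pairs
  have hz : ∀ j1 j2, ¬ (j1 ≤ W₁ ∧ j2 ≤ W₂) → (∑ D ∈ (A₁ j1 ×ˢ A₂ j2).filter fun D =>
      G.Compat S₁ J.M1 S₂ J.M2 (J.ofCls .F) D.1 D.2,
      ∏ v ∈ J.MK, loc (ZMod (2 ^ b)) (σ v) (G.pt (S₁ ∪ S₂) (D.1 ∪ D.2) v)) = 0 := by
    intro j1 j2 hn
    have : A₁ j1 ×ˢ A₂ j2 = ∅ := by
      rcases not_and_or.1 hn with h | h
      · rw [he₁ j1 (by omega), Finset.empty_product]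
      · rw [he₂ j2 (by omega), Finset.product_empty]
    rw [this]; simp
  set Ψ : ℕ → ℕ → ZMod (2 ^ b) := fun j1 j2 => ∑ D ∈ (A₁ j1 ×ˢ A₂ j2).filter fun D =>
      G.Compat S₁ J.M1 S₂ J.M2 (J.ofCls .F) D.1 D.2,
      ∏ v ∈ J.MK, loc (ZMod (2 ^ b)) (σ v) (G.pt (S₁ ∪ S₂) (D.1 ∪ D.2) v) with hΨ
  have hstep : ∀ j1 ∈ range (W₁ + 1), ∑ j2 ∈ range (W₂ + 1),
      (if j1 + j2 = j then g j1 j2 else 0) = if j1 ≤ j then Ψ j1 (j - j1) else 0 := by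
    intro j1 hj1; rw [mem_range] at hj1
    split_ifs with hle
    · by_cases h2 : j - j1 ≤ W₂
      · rw [sum_eq_single_of_mem (j - j1) (by simp; omega), if_pos (by omega)]
        · exact hg j1 (by omega) _ h2
        · intro j2 _ hne; rw [if_neg (by omega)]
      · rw [show Ψ j1 (j - j1) = 0 from hz _ _ (by omega)]; refine sum_eq_zero fun j2 hj2 => ?_
        rw [mem_range] at hj2; rw [if_neg (by omega)]
    · refine sum_eq_zero fun j2 hj2 => ?_
      rw [if_neg (by omega)]
  rw [sum_congr rfl hstep]
  have e1 : ∑ j1 ∈ range (W₁ + 1), (if j1 ≤ j then Ψ j1 (j - j1) else 0) =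
      ∑ j1 ∈ range (W₁ + j + 1), (if j1 ≤ j then Ψ j1 (j - j1) else 0) := by
    refine sum_subset (range_subset_range.2 (by omega)) fun i _ hi => ?_
    rw [mem_range, not_lt] at hi
    split_ifs
    · exact hz _ _ (by omega)
    · rfl
  have e2 : ∑ j1 ∈ range (j + 1), Ψ j1 (j - j1) =
      ∑ j1 ∈ range (W₁ + j + 1), (if j1 ≤ j then Ψ j1 (j - j1) else 0) := by
    rw [← sum_subset (range_subset_range.2 (by omega : j + 1 ≤ W₁ + j + 1))]
    · refine sum_congr rfl fun i hi => ?_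
      rw [if_pos (by simp at hi; omega)]
    · intro i _ hi; rw [if_neg (by simp at hi; omega)]
  rw [e1, ← e2]

end DS

theorem eq_of_digit_eq_two {q p : ℕ} (h : digit q p = 2) :
    q = q / 3 ^ (p + 1) * 3 ^ (p + 1) + 2 * 3 ^ p + q % 3 ^ p := by
  have h1 : q / 3 ^ p % 3 = 2 := by simpa [digit] using congrArg Fin.val h
  have h2 : q / 3 ^ (p + 1) = q / 3 ^ p / 3 := by rw [pow_succ, Nat.div_div_eq_div_mul]
  have h3 := div_add_mod q (3 ^ p)
  have h4 := div_add_mod (q / 3 ^ p) 3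
  rw [h1] at h4
  rw [h2, pow_succ]
  calc q = 3 ^ p * (q / 3 ^ p) + q % 3 ^ p := h3.symm
    _ = 3 ^ p * (3 * (q / 3 ^ p / 3) + 2) + q % 3 ^ p := by rw [h4]
    _ = _ := by ring

theorem digit_eq_of_lt {i p e : ℕ} (d : Fin 3) (he : e < 3 ^ p) :
    digit (i * 3 ^ (p + 1) + d * 3 ^ p + e) p = d ∧
      (i * 3 ^ (p + 1) + d * 3 ^ p + e) / 3 ^ (p + 1) = i ∧
      (i * 3 ^ (p + 1) + d * 3 ^ p + e) % 3 ^ p = e := by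
  have hlt : (d : ℕ) * 3 ^ p + e < 3 ^ (p + 1) := by
    have : (d : ℕ) * 3 ^ p ≤ 2 * 3 ^ p := Nat.mul_le_mul_right _ (by omega)
    rw [pow_succ]; omega
  refine ⟨?_, ?_, ?_⟩
  · apply Fin.ext
    simp only [digit]
    rw [show i * 3 ^ (p + 1) + d * 3 ^ p + e = e + (i * 3 + d) * 3 ^ p by ring,
      add_mul_div_right _ _ (by positivity), div_eq_of_lt he]
    omega
  · rw [add_assoc, mul_comm, mul_add_div (by positivity), div_eq_of_lt hlt]; rfl
  · rw [show i * 3 ^ (p + 1) + d * 3 ^ p + e = e + 3 ^ p * (i * 3 + d) by ring,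
      Nat.add_mul_mod_self_left, mod_eq_of_lt he]

namespace DS

open Env HProg

variable {E : Env} {h : HState E.b}

/-- The coefficient of an operation. -/
def coef (b : ℕ) : NumOp → ZMod (2 ^ b)
  | .add => 1
  | .sub => -1
  | .mul => 0

theorem wp_pass_one {op : NumOp} (hop : op = .add ∨ op = .sub) {s p w base : ℕ} (hp : p < s)
    (hbase : h.v .base 0 = base) (hpp : h.v .pp 0 = 3 ^ p)
    (hhh : h.v .hh 0 = w * 3 ^ (s - 1 - p)) (hB : base + w * 3 ^ s < E.B) :
    E.wp (.for_ .hi .hh (.for_ .e .pp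
       (asg .y (sc .base + sc .hi * (3 * sc .pp) + sc .pp + sc .e) ;;
        .arith op (sc .y + sc .pp) (sc .y + sc .pp) (sc .y)))) h fun s' =>
      s'.t ≤ h.t + 5 * (w * 3 ^ s) + 1 ∧ (∀ a < base, s'.m a = h.m a) ∧
      ∀ q, s'.m (base + q) = h.m (base + q) + if digit q p = 2 ∧ q < w * 3 ^ s then
        coef E.b op * h.m (base + (q - 3 ^ p)) else 0 := by
  set P := 3 ^ p with hP
  have hPpos : 1 ≤ P := one_le_pow _ _ (by norm_num)
  have hs : w * 3 ^ s = w * 3 ^ (s - 1 - p) * (3 * P) := by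
    rw [hP, ← pow_succ', mul_assoc, ← pow_add]; congr 2; omega
  let rank : ℕ → ℕ := fun q => q / 3 ^ (p + 1) * P + q % P
  let Inv : ℕ → (ℕ → ZMod (2 ^ E.b)) → Prop := fun cur m => (∀ a < base, m a = h.m a) ∧
    ∀ q, m (base + q) = h.m (base + q) + if digit q p = 2 ∧ rank q < cur then
        coef E.b op * h.m (base + (q - P)) else 0
  refine wp_for (w * 3 ^ (s - 1 - p)) (P * 3 + 1) (fun i _ m => Inv (i * P) m) hhh ?_ ?_ ?_
  · exact ⟨fun _ _ => rfl, fun q => by simp⟩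
  · intro i hi s1 f1 i1 inv1
    refine wp_for P 2 (fun e _ m => Inv (i * P + e) m) (by rw [f1 _ (by simp [mods]), hpp]) inv1 ?_ ?_
    · intro e he r f2 i2 ⟨m1, m2⟩
      have g : ∀ a, a ≠ .hi → a ≠ .e → a ≠ .y → r.v a = h.v a := by
        intro a ha hb hc; rw [f2 a (by simp [mods, hb, hc]), f1 a (by simp [mods, ha, hb, hc])]
      have gi : r.v .hi 0 = i := by rw [f2 _ (by simp [mods]), i1]
      obtain ⟨d1, d2, d3⟩ := digit_eq_of_lt (i := i) (1 : Fin 3) he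
      obtain ⟨t1, t2, t3⟩ := digit_eq_of_lt (i := i) (2 : Fin 3) he
      have e3 : 3 ^ (p + 1) = 3 * P := pow_succ' 3 p
      rw [← hP] at d1 d2 d3 t1 t2 t3
      simp only [Fin.val_one, Fin.val_two, one_mul] at d1 d2 d3 t1 t2 t3
      set qq := i * 3 ^ (p + 1) + 2 * P + e with hqq
      have hq1 : qq - P = i * 3 ^ (p + 1) + P + e := by omega
      have hlt : qq < w * 3 ^ s := by
        rw [hs, hqq, e3]
        calc i * (3 * P) + 2 * P + e < i * (3 * P) + 3 * P := by omega
          _ = (i + 1) * (3 * P) := by ring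
          _ ≤ _ := Nat.mul_le_mul_right _ hi
      have ey : HExp.eval r.v (sc .base + sc .hi * (3 * sc .pp) + sc .pp + sc .e) =
          base + (qq - P) := by
        simp [g, gi, i2, hbase, hpp, hq1, e3]; ring
      have eyp : base + (qq - P) + P = base + qq := by omega
      refine wp_set_seq (wp_arith ⟨by simp only; omega, ?_⟩) (fun _ => by rw [ey]; omega)
      simp only [ey, eval_add, eval_arr, eval_lit, upd_same, ne_eq,
        reduceCtorEq, not_false_eq_true, upd_ne, update_self, g, hpp, eyp]
      have hr : rank qq = i * P + e := by simp only [rank, t2, t3]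
      have v1 : r.m (base + qq) = h.m (base + qq) := by
        rw [m2 qq, if_neg (by omega), add_zero]
      have v2 : r.m (base + (qq - P)) = h.m (base + (qq - P)) := by
        rw [m2 (qq - P), if_neg, add_zero]; rw [hq1, d1]; exact fun h => absurd h.1 (by decide)
      rw [v1, v2]
      have v3 : op.apply (h.m (base + qq)) (h.m (base + (qq - P))) =
          h.m (base + qq) + coef E.b op * h.m (base + (qq - P)) := by
        rcases hop with rfl | rfl <;> simp [NumOp.apply, coef, sub_eq_add_neg]
      rw [v3]; refine ⟨fun a ha => by rw [update_of_ne (by omega), m1 a ha], fun q => ?_⟩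
      by_cases hq : q = qq
      · subst hq; rw [update_self, if_pos ⟨t1, by omega⟩]
      · rw [update_of_ne (by omega), m2 q]
        congr 2
        refine propext ⟨fun h => ⟨h.1, by omega⟩, fun h => ⟨h.1, ?_⟩⟩
        rcases Nat.lt_or_ge (rank q) (i * P + e) with hl | hl
        · exact hl
        · obtain ⟨h1, h2⟩ := mul_add_eq (mod_lt q hPpos) he
            (show q / 3 ^ (p + 1) * P + q % P = i * P + e from (by omega : rank q = i * P + e))
          refine absurd ?_ hq
          have := eq_of_digit_eq_two h.1
          rw [h1, ← hP, h2] at this; exact this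
    · intro r _ _ inv ht; refine ⟨by omega, ?_⟩; rw [Nat.add_mul, one_mul]; exact inv
  · intro s1 _ _ ⟨m1, m2⟩ ht; refine ⟨?_, m1, fun q => ?_⟩
    · rw [hs]
      have e1 : w * 3 ^ (s - 1 - p) * (P * 3 + 1 + 1) = w * 3 ^ (s - 1 - p) * (3 * P) +
        2 * (w * 3 ^ (s - 1 - p)) := by ring
      have e2 : w * 3 ^ (s - 1 - p) ≤ w * 3 ^ (s - 1 - p) * (3 * P) :=
        le_mul_of_pos_right _ (by omega)
      omega
    · rw [m2 q]
      congr 2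
      refine propext (and_congr_right fun _ => ?_)
      have hd : q / 3 ^ (p + 1) < w * 3 ^ (s - 1 - p) ↔ q < w * 3 ^ (s - 1 - p) * 3 ^ (p + 1) :=
        Nat.div_lt_iff_lt_mul (by positivity)
      rw [hs, ← show 3 ^ (p + 1) = 3 * P from pow_succ' 3 p, ← hd]; simp only [rank]
      have := mod_lt q hPpos
      constructor
      · intro h
        by_contra hle
        have := Nat.mul_le_mul_right P (not_lt.1 hle)
        omega
      · intro h
        calc _ < q / 3 ^ (p + 1) * P + P := by omega
          _ = (q / 3 ^ (p + 1) + 1) * P := by ring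
          _ ≤ _ := Nat.mul_le_mul_right _ h

theorem wp_pass {op : NumOp} (hop : op = .add ∨ op = .sub) {s w base : ℕ}
    (hs : h.v .s0 0 = s) (hw : h.v .wx 0 = w)
    (hbase : h.v .base 0 = base) (hpow : ∀ i < s, h.v .pow i = 3 ^ i)
    (hB : base + w * 3 ^ s < E.B) {K K' : Fin 3 → Fin 3 → ZMod (2 ^ E.b)}
    (hK : ∀ σ r, K' σ r = K σ r + if σ = 2 then coef E.b op * K 1 r else 0)
    {ι : Type*} (A : ℕ → Finset ι) (g : ι → ℕ → Fin 3)
    (hm : ∀ J < w, ∀ x < 3 ^ s, h.m (base + (J * 3 ^ s + x)) = cellv (fun _ => K) s (A J) g x) :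
    E.wp (pass op) h fun s' => s'.t ≤ h.t + s * (5 * (w * 3 ^ s) + 4) + 1 ∧
      (∀ a < base, s'.m a = h.m a) ∧ (∀ a, base + w * 3 ^ s ≤ a → s'.m a = h.m a) ∧
      ∀ J < w, ∀ x < 3 ^ s, s'.m (base + (J * 3 ^ s + x)) = cellv (fun _ => K') s (A J) g x := by
  have hle : ∀ i, i ≤ s → w * 3 ^ i < E.B := fun i hi =>
    (Nat.mul_le_mul_left w (pow_le_pow_right (by norm_num) hi)).trans_lt (by omega)
  refine wp_for s (5 * (w * 3 ^ s) + 3) (fun p _ m => (∀ a < base, m a = h.m a) ∧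
    (∀ a, base + w * 3 ^ s ≤ a → m a = h.m a) ∧
    ∀ J < w, ∀ x < 3 ^ s, m (base + (J * 3 ^ s + x)) =
      cellv (fun i => if i < p then K' else K) s (A J) g x) hs ?_ ?_ ?_
  · exact ⟨fun _ _ => rfl, fun _ _ => rfl, by simpa using hm⟩
  · intro p hp r f i1 ⟨m1, m2, m3⟩
    have f1 : r.v .pow = h.v .pow := f _ (by simp [mods])
    have f2 : r.v .s0 0 = s := by rw [f _ (by simp [mods]), hs]
    have f3 : r.v .wx 0 = w := by rw [f _ (by simp [mods]), hw]
    have f4 : r.v .base 0 = base := by rw [f _ (by simp [mods]), hbase]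
    refine wp_set_seq (wp_set_seq ?_ ?_) (fun hb => hb _ _)
    · refine (wp_pass_one (s := s) (p := p) (w := w) (base := base) hop hp (by simp [f4])
        (by simp [i1, f1, hpow p hp]) ?_ hB).mono ?_
      · simp [i1, f1, f2, f3, hpow _ (show s - 1 - p < s by omega)]
      · rintro s' - - ⟨ht, n1, n2⟩
        refine ⟨by simp only at ht; omega, fun a ha => by rw [n1 a ha]; exact m1 a ha,
          fun a ha => ?_, fun J hJ x hx => ?_⟩
        · obtain ⟨q, rfl⟩ := exists_eq_add_of_le (show base ≤ a by omega)
          rw [n2 q, if_neg (by omega), add_zero]; exact m2 _ ha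
        · have hlt : J * 3 ^ s + x < w * 3 ^ s := by
            calc _ < J * 3 ^ s + 3 ^ s := by omega
              _ = (J + 1) * 3 ^ s := by ring
              _ ≤ _ := Nat.mul_le_mul_right _ hJ
          rw [n2]; simp only [digit_add_mul_pow hp, hlt, and_true]
          rw [m3 J hJ x hx, cellv_step (K := fun i => if i < p then K' else K)
            (K' := fun i => if i < p + 1 then K' else K) hp (coef E.b op)
            (fun i hi => ?_) (fun σ r => ?_) (A J) g hx]
          · congr 1
            split_ifs with h2
            · obtain ⟨h3, -⟩ := digit_sub_pow hp hx h2
              rw [Nat.add_sub_assoc h3, m3 J hJ _ ((sub_le _ _).trans_lt hx)]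
            · rfl
          · have : i < p + 1 ↔ i < p := by omega
            simp only [this]
          · simpa using hK σ r
    · intro _; simp [i1, f1, f2, f3, hpow _ (show s - 1 - p < s by omega)]
      exact hle _ (by omega)
  · intro r f i1 ⟨m1, m2, m3⟩ ht; refine ⟨ht, m1, m2, fun J hJ x hx => ?_⟩
    rw [m3 J hJ x hx]; refine sum_congr rfl fun D _ => prod_congr rfl fun i hi => ?_
    simp only [if_pos (mem_range.1 hi)]

theorem wp_clip {w base P : ℕ} (hp0 : h.v .p0 0 = P) (hw : h.v .wx 0 = w)
    (hbase : h.v .base 0 = base) (hB : base + w * P < E.B) :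
    E.wp clip h fun s' => s'.t ≤ h.t + 3 * (w * P) + 2 ∧
      (∀ a < base, s'.m a = h.m a) ∧ (∀ a, base + w * P ≤ a → s'.m a = h.m a) ∧
      ∀ q < w * P, s'.m (base + q) = if h.m (base + q) = 0 then 0 else 1 := by
  classical
  have hBpos := E.hB
  refine wp_set_seq ?_ (fun _ => by simp [hp0, hw]; omega)
  refine wp_for (w * P) 2 (fun j _ m => (∀ a < base, m a = h.m a) ∧
    (∀ a, base + j ≤ a → m a = h.m a) ∧
      ∀ q < j, m (base + q) = if h.m (base + q) = 0 then 0 else 1) (by simp [hp0, hw])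
      ⟨fun _ _ => rfl, fun _ _ => rfl, by simp⟩ ?_ ?_
  · intro j hj s f i1 ⟨m1, m2, m3⟩
    have f4 : s.v .base 0 = base := by rw [f _ (by decide)]; simpa using hbase
    refine wp_seq (wp_test (wp_setN ⟨by simp, ?_⟩))
    simp only [eval_add, eval_arr, eval_lit, upd_same, ne_eq,
        reduceCtorEq, not_false_eq_true, upd_ne, update_self, f4, i1,
        m2 (base + j) le_rfl]
    refine ⟨fun a ha => by rw [update_of_ne (by omega), m1 a ha],
      fun a ha => by rw [update_of_ne (by omega), m2 a (by omega)], fun q hq => ?_⟩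
    rcases lt_succ_iff_lt_or_eq.1 hq with h' | rfl
    · rw [update_of_ne (by omega), m3 q h']
    · rw [update_self]; split_ifs <;> simp
  · intro s f i1 ⟨m1, m2, m3⟩ ht; exact ⟨by simp only at ht ⊢; omega, m1, m2, m3⟩

/-- Reduction of the table of the node `x` to the family `A'` with one set for each pattern. -/
theorem wp_flatten {G : Edges} {S : Finset ℕ} {s w x base : ℕ} {f : ℕ → ℕ}
    (hs : h.v .s0 0 = s) (hw : h.v .wx 0 = w) (hx : h.v .x 0 = x) (hbase : h.v .tbl x = base)
    (hp0 : h.v .p0 0 = 3 ^ s) (hpow : ∀ i < s, h.v .pow i = 3 ^ i)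
    (hB : base + w * 3 ^ s < E.B) (A A' : ℕ → Finset (Finset ℕ))
    (hA : ∀ J < w, (A J).card < 2 ^ E.b)
    (hA' : ∀ J < w, ∀ ρ : ℕ → Fin 3, ((A' J).filter fun D => ∀ i < s, G.pt S D (f i) = ρ i).card =
        if ((A J).filter fun D => ∀ i < s, G.pt S D (f i) = ρ i).card = 0 then 0 else 1)
    (hm : ∀ J < w, ∀ y < 3 ^ s, h.m (base + (J * 3 ^ s + y)) =
      cellv (fun _ => loc (ZMod (2 ^ E.b))) s (A J) (fun D i => G.pt S D (f i)) y) :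
    E.wp flatten h fun s' => s'.t ≤ h.t + (10 * s + 3) * (w * 3 ^ s) + 8 * s + 5 ∧
      (∀ a < base, s'.m a = h.m a) ∧ (∀ a, base + w * 3 ^ s ≤ a → s'.m a = h.m a) ∧
      ∀ J < w, ∀ y < 3 ^ s, s'.m (base + (J * 3 ^ s + y)) =
        cellv (fun _ => loc (ZMod (2 ^ E.b))) s (A' J) (fun D i => G.pt S D (f i)) y := by
  refine wp_set_seq ?_ (fun hb => hb _ _)
  refine wp_seq ((wp_pass (s := s) (w := w) (base := base) (.inr rfl) (by simp [hs]) (by simp [hw])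
    (by simp [hx, hbase]) (by simpa using hpow) hB (loc_mobius _) A
    (fun D i => G.pt S D (f i)) (by exact hm)).mono ?_)
  rintro s1 - f1 ⟨ht1, a1, b1, c1⟩
  refine wp_seq ((wp_clip (w := w) (base := base) (P := 3 ^ s) (by rw [f1 _ (by simp [mods, pass])]; simp [hp0])
    (by rw [f1 _ (by simp [mods, pass])]; simp [hw]) (by rw [f1 _ (by simp [mods, pass])]; simp [hx, hbase]) hB).mono ?_)
  rintro s2 - f2 ⟨ht2, a2, b2, c2⟩
  refine (wp_pass (s := s) (w := w) (base := base) (K := eqK _) (K' := loc _) (.inl rfl)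
    (by rw [f2 _ (by decide), f1 _ (by simp [mods, pass])]; simp [hs])
    (by rw [f2 _ (by decide), f1 _ (by simp [mods, pass])]; simp [hw])
    (by rw [f2 _ (by decide), f1 _ (by simp [mods, pass])]; simp [hx, hbase])
    (by rw [f2 _ (by decide), f1 _ (by simp [mods, pass])]; simpa using hpow) hB (eqK_zeta _) A'
    (fun D i => G.pt S D (f i)) ?_).mono ?_
  · intro J hJ y hy
    have hlt : J * 3 ^ s + y < w * 3 ^ s := by
      calc _ < J * 3 ^ s + 3 ^ s := by omega
        _ = (J + 1) * 3 ^ s := by ring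
        _ ≤ _ := Nat.mul_le_mul_right _ hJ
    rw [c2 _ hlt, c1 J hJ y hy, cellv_eqK, cellv_eqK, hA' J hJ]
    have hcard : ((A J).filter fun D => ∀ i < s, G.pt S D (f i) = digit y i).card < 2 ^ E.b :=
      (card_filter_le _ _).trans_lt (hA J hJ)
    have hz : ((((A J).filter fun D => ∀ i < s, G.pt S D (f i) = digit y i).card : ℕ) :
        ZMod (2 ^ E.b)) = 0 ↔
        ((A J).filter fun D => ∀ i < s, G.pt S D (f i) = digit y i).card = 0 := by
      rw [ZMod.natCast_eq_zero_iff]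
      exact ⟨fun h => Nat.eq_zero_of_dvd_of_lt h hcard, fun h => by rw [h]; exact dvd_zero _⟩
    simp only [hz]
    split_ifs <;> simp
  · rintro s3 - - ⟨ht3, a3, b3, c3⟩
    refine ⟨?_, fun a ha => ?_, fun a ha => ?_, c3⟩
    · simp only at ht1
      have e1 : s * (5 * (w * 3 ^ s) + 4) = 5 * (s * (w * 3 ^ s)) + 4 * s := by ring
      have e2 : (10 * s + 3) * (w * 3 ^ s) = 10 * (s * (w * 3 ^ s)) + 3 * (w * 3 ^ s) := by ring
      rw [e1] at ht1 ht3; rw [e2]; omega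
    · rw [a3 a ha, a2 a ha, a1 a ha]
    · rw [b3 a ha, b2 a ha, b1 a ha]

end DS

namespace DS

open Env HProg

variable {E : Env} {h : HState E.b}

theorem wp_sizes {a i f r s0 N : ℕ} (hL : h.v (.nc .L) 0 = a) (hI : h.v (.nc .I) 0 = i)
    (hF : h.v (.nc .F) 0 = f) (hR : h.v (.nc .R) 0 = r) (hs0 : h.v .s0 0 = s0)
    (hpow : ∀ j ≤ N, h.v .pow j = 3 ^ j) (ha : a ≤ N) (hi : i ≤ N) (hf : f ≤ N) (hr : r ≤ N)
    (hs : s0 ≤ N) :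
    E.wp sizes h fun s => s.m = h.m ∧ s.t = h.t + 8 ∧ s.v .d 0 = 3 ^ min (min a f) r ∧
      s.v .qL 0 = 3 ^ (a - min (min a f) r) ∧ s.v .qF 0 = 3 ^ (f - min (min a f) r) ∧
      s.v .qR 0 = 3 ^ (r - min (min a f) r) ∧ s.v .pI 0 = 3 ^ i ∧ s.v .p0 0 = 3 ^ s0 := by
  have e1 : a - (a - f) = min a f := by omega
  have e2 : min a f - (min a f - r) = min (min a f) r := by omega
  have key : (h.v (.nc .L) 0 - (h.v (.nc .L) 0 - h.v (.nc .F) 0)) = min a f := by omega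
  refine wp_set_seq (wp_set_seq (wp_set_seq (wp_set_seq (wp_set_seq (wp_set_seq (wp_set_seq (wp_set
    ?_ ?_) ?_) ?_) ?_) ?_) ?_) ?_) ?_
  · exact fun hb => hb _ _
  · simp [hL, hI, hF, hR, hs0, e1, e2]
    refine ⟨hpow _ (by omega), hpow _ (by omega), hpow _ (by omega), hpow _ (by omega), hpow _ hi,
      hpow _ hs⟩
  all_goals intro hb
  iterate 5 exact hb _ _
  · have := hb .dd 0
    exact (sub_le _ _).trans_lt this
  · have := hb (.nc .L) 0
    exact (sub_le _ _).trans_lt this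

theorem wp_space {A d : ℕ} (hA : h.v .alloc 0 = A) (hd : h.v .d 0 = d)
    (hB : A + d * d + d * d + d * d < E.B) :
    E.wp space h fun s => s.m = h.m ∧ s.t = h.t + 4 ∧ s.v .sA 0 = A ∧ s.v .sB 0 = A + d * d ∧
      s.v .sC 0 = A + d * d + d * d ∧ s.v .out 0 = A + d * d + d * d + d * d := by
  refine wp_set_seq (wp_set_seq (wp_set_seq (wp_set ?_ ?_) ?_) ?_) ?_
  · intro _; simp [hA, hd]; omega
  · simp [hA, hd]
  · intro _; simp [hA, hd]; omega
  · intro _; simp [hA, hd]; omega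
  · exact fun hb => hb _ _

/-- The number of layers of a table, minus one. -/
def layers (full : Bool) (n s : ℕ) : ℕ := if full then n else s

theorem eval_width {full : Bool} {a : Nm} {v : Store} :
    (width full a).eval v = layers full (v .nn 0) (v .sz (v a 0)) := by
  cases full <;> simp [width, layers]

theorem wp_views {full : Bool} {c1 c2 N s1 s2 n : ℕ} (h1 : h.v .c1 0 = c1) (h2 : h.v .c2 0 = c2)
    (hn : h.v .nn 0 = n) (hs1 : h.v .sz c1 = s1) (hs2 : h.v .sz c2 = s2)
    (hpow : ∀ j ≤ N, h.v .pow j = 3 ^ j) (l1 : s1 ≤ N) (l2 : s2 ≤ N)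
    (b1 : layers full n s1 + 1 < E.B) (b2 : layers full n s2 + 1 < E.B) :
    E.wp (views full) h fun s => s.m = h.m ∧ s.t = h.t + 6 ∧
      s.v .w1 0 = layers full n s1 + 1 ∧ s.v .w2 0 = layers full n s2 + 1 ∧
      s.v .t1 0 = h.v .tbl c1 ∧ s.v .t2 0 = h.v .tbl c2 ∧ s.v .p1 0 = 3 ^ s1 ∧ s.v .p2 0 = 3 ^ s2 := by
  refine wp_set_seq (wp_set_seq (wp_set_seq (wp_set_seq (wp_set_seq (wp_set ?_ ?_) ?_) ?_) ?_) ?_) ?_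
  · exact fun hb => hb _ _
  · simp [eval_width, h1, h2, hn, hs1, hs2, hpow _ l1, hpow _ l2]
  iterate 3 exact fun hb => hb _ _
  · intro _; simpa [eval_width, h1, h2, hn, hs1, hs2] using b2
  · intro _; simpa [eval_width, h1, h2, hn, hs1, hs2] using b1

theorem mods_views {full : Bool} : (views full).mods = [.w1, .w2, .t1, .t2, .p1, .p2] := rfl

/-- The first layer with a nonzero cell, or layer `0` if all layers are kept. -/
theorem wp_find {full : Bool} {rr P out : ℕ} (hrr : h.v .rr 0 = rr) (hP : h.v .p0 0 = P)
    (hout : h.v .out 0 = out) (hf : h.v .found 0 = if full then 1 else 0) (hj : h.v .j0 0 = 0)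
    (hne : full = false → ∃ l < rr, ∃ e < P, h.m (out + l * P + e) ≠ 0) (hpos : 1 ≤ rr) :
    E.wp (.for_ .l .rr (.for_ .e .p0
    (.ite (sc .found) .skip
      (.test .tz (sc .out + sc .l * sc .p0 + sc .e) ;;
       .ite (sc .tz) (asg .found 1 ;; asg .j0 (sc .l)) .skip)))) h fun s =>
      s.m = h.m ∧ s.t ≤ h.t + rr * (P * 6 + 2) + 1 ∧ s.v .j0 0 < rr ∧
      (full = true → s.v .j0 0 = 0) ∧ (full = false → (∀ l < s.v .j0 0, ∀ e < P,
        h.m (out + l * P + e) = 0) ∧ ∃ e < P, h.m (out + s.v .j0 0 * P + e) ≠ 0) := by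
  let Inv : ℕ → ℕ → (Store) → (ℕ → ZMod (2 ^ E.b)) → Prop := fun l e v m => m = h.m ∧
    (full = true → v .found 0 = 1 ∧ v .j0 0 = 0) ∧
    (full = false → (v .found 0 = 0 ∧ (∀ l' < l, ∀ e < P, h.m (out + l' * P + e) = 0) ∧
        ∀ e' < e, h.m (out + l * P + e') = 0) ∨
      (v .found 0 ≠ 0 ∧ v .j0 0 < rr ∧ (∀ l < v .j0 0, ∀ e < P,
        h.m (out + l * P + e) = 0) ∧ ∃ e < P, h.m (out + v .j0 0 * P + e) ≠ 0))
  refine wp_for rr (P * 6 + 1) (fun l v m => Inv l 0 v m) hrr ?_ ?_ ?_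
  · refine ⟨rfl, fun hfu => ?_, fun hfu => .inl ?_⟩
    · simp [hf, hj, hfu]
    · simp [hf, hfu]
  · intro l hl s f1 i1 inv
    have fo : s.v .out 0 = out := by rw [f1 _ (by decide), hout]
    have fp : s.v .p0 0 = P := by rw [f1 _ (by decide), hP]
    refine wp_for P 5 (fun e v m => Inv l e v m) fp ?_ ?_ ?_
    · simpa [Inv] using inv
    · intro e he r f2 i2 ⟨m1, m2, m3⟩
      have go : r.v .out 0 = out := by rw [f2 _ (by decide), fo]
      have gp : r.v .p0 0 = P := by rw [f2 _ (by decide), fp]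
      have gl : r.v .l 0 = l := by rw [f2 _ (by decide), i1]
      refine wp_ite (fun h1 => wp_skip ⟨by simp only; omega, m1, ?_, ?_⟩) fun h1 => wp_seq (wp_test (wp_ite
        (fun h2 => wp_set_seq (wp_set ?_ ⟨by simp only; omega, m1, ?_, ?_⟩) ?_)
        fun h2 => wp_skip ⟨by simp only; omega, m1, ?_, ?_⟩))
      · intro hfu; simpa using m2 hfu
      · intro hfu
        rcases m3 hfu with h3 | h3
        · exact absurd h3.1 (by simpa using h1)
        · right; simpa using h3
      · exact fun hb => hb _ _
      · intro hfu; exact absurd (m2 hfu).1 (by simp at h1; omega)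
      · intro hfu
        rcases m3 hfu with ⟨h3, h4, h5⟩ | h3
        · right
          simp [go, gp, gl, i2, m1] at h2 ⊢
          exact ⟨hl, h4, e, he, h2⟩
        · exact absurd (by simpa using h1) h3.1
      · intro _; have := E.hB; simp; omega
      · intro hfu; exact absurd (m2 hfu).1 (by simp at h1; omega)
      · intro hfu
        rcases m3 hfu with ⟨h3, h4, h5⟩ | h3
        · left
          simp [go, gp, gl, i2, m1] at h2 ⊢
          refine ⟨h3, h4, fun e' he' => ?_⟩
          rcases Nat.lt_or_eq_of_le he' with h' | rfl
          · exact h5 e' h'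
          · exact h2
        · exact absurd (by simpa using h1) h3.1
    · intro r f2 i2 ⟨m1, m2, m3⟩ ht; refine ⟨by omega, m1, ?_, ?_⟩
      · intro hfu; simpa using m2 hfu
      · intro hfu; simp only [upd_ne, ne_eq, reduceCtorEq, not_false_eq_true]
        refine (m3 hfu).imp (fun h3 => ⟨h3.1, fun l' hl' e' he' => ?_, by simp⟩) id
        rcases lt_succ_iff_lt_or_eq.1 hl' with h' | rfl
        · exact h3.2.1 l' h' e' he'
        · exact h3.2.2 e' he'
  · intro s f1 i1 ⟨m1, m2, m3⟩ ht; refine ⟨m1, ht, ?_, fun hfu => (m2 hfu).2, fun hfu => ?_⟩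
    · cases full with
      | true => rw [(m2 rfl).2]; omega
      | false =>
        rcases m3 rfl with h3 | h3
        · obtain ⟨l, hl, e, he, hne⟩ := hne rfl; exact absurd (h3.2.1 l hl e he) hne
        · exact h3.2.1
    · rcases m3 hfu with h3 | h3
      · obtain ⟨l, hl, e, he, hne⟩ := hne hfu; exact absurd (h3.2.1 l hl e he) hne
      · exact h3.2.2

theorem wp_settle {full : Bool} {w1 w2 P out x c1 c2 s0 n : ℕ} (hw1 : h.v .w1 0 = w1 + 1)
    (hw2 : h.v .w2 0 = w2 + 1) (hP : h.v .p0 0 = P) (hx : h.v .x 0 = x) (hc1 : h.v .c1 0 = c1)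
    (hc2 : h.v .c2 0 = c2) (hs0 : h.v .s0 0 = s0) (hnn : h.v .nn 0 = n)
    (hout : h.v .out 0 = out) (ne1 : c1 ≠ x) (ne2 : c2 ≠ x) (hPpos : 1 ≤ P)
    (hne : full = false → ∃ l < w1 + w2 + 1, ∃ e < P, h.m (out + l * P + e) ≠ 0)
    (hlo : ∀ j0 < w1 + w2 + 1, (full = true → j0 = 0) →
      (full = false → ∃ e < P, h.m (out + j0 * P + e) ≠ 0) →
      h.v .lo c1 + h.v .lo c2 + j0 < E.B)
    (hB : out + (w1 + w2 + 1 + (layers full n s0 + 1)) * P < E.B) :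
    E.wp (settle full) h fun s =>
      s.m = h.m ∧ s.t ≤ h.t + (w1 + w2 + 1) * (P * 6 + 2) + 9 ∧ ∃ j0 < w1 + w2 + 1,
      (full = true → j0 = 0) ∧ (full = false → (∀ l < j0, ∀ e < P,
        h.m (out + l * P + e) = 0) ∧ ∃ e < P, h.m (out + j0 * P + e) ≠ 0) ∧
      (∀ y, s.v .tbl y = if y = x then out + j0 * P else h.v .tbl y) ∧
      (∀ y, s.v .lo y = if y = x then h.v .lo c1 + h.v .lo c2 + j0 else h.v .lo y) ∧
      (∀ y, s.v .sz y = if y = x then s0 else h.v .sz y) ∧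
      s.v .wx 0 = layers full n s0 + 1 ∧
      s.v .alloc 0 = out + (w1 + w2 + 1 + (layers full n s0 + 1)) * P := by
  have hlin : w1 + w2 + 1 + (layers full n s0 + 1) ≤ (w1 + w2 + 1 + (layers full n s0 + 1)) * P :=
    le_mul_of_pos_right _ hPpos
  have hBpos := E.hB
  refine wp_set_seq (wp_set_seq (wp_set_seq (wp_seq ((wp_find (full := full) (rr := w1 + w2 + 1)
    (P := P) (out := out) ?_ ?_ ?_ ?_ ?_ (by exact hne) (by omega)).mono ?_)) ?_) ?_) ?_
  · simp [hw1, hw2]; omega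
  · simp [hP]
  · simp [hout]
  · cases full <;> simp
  · simp
  · rintro s - f ⟨hm, ht, j1, j2, j3⟩
    have g : ∀ a ∉ [Nm.rr, .found, .j0, .l, .e, .tz], s.v a = h.v a := by
      intro a ha; simp only [List.mem_cons, List.not_mem_nil, or_false, not_or] at ha
      rw [f a (by simp [mods]; tauto)]; simp [upd_ne, ha]
    have grr : s.v .rr 0 = w1 + w2 + 1 := by
      rw [f .rr (by decide)]; simp [hw1, hw2]; omega
    simp only at hm ht j3
    set j0 := s.v .j0 0 with hj0
    have hj0P : j0 * P ≤ (w1 + w2 + 1) * P := Nat.mul_le_mul_right _ (by omega)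
    have hexp : (w1 + w2 + 1 + (layers full n s0 + 1)) * P =
      (w1 + w2 + 1) * P + (layers full n s0 + 1) * P := by ring
    refine wp_set_seq (wp_set_seq (wp_set_seq (wp_set_seq (wp_set ?_
      ⟨hm, ?_, j0, j1, j2, j3, ?_, ?_, ?_, ?_, ?_⟩) ?_) ?_) ?_) ?_
    · intro _
      simp [eval_width, g .out (by decide), hout, g .p0 (by decide), hP, grr, g .x (by decide),
        g .nn (by decide), hnn, g .s0 (by decide), hs0, hx]
      exact hB
    · simp only; omega
    · intro y
      simp [g .out (by decide), hout, g .p0 (by decide), hP, grr, g .x (by decide), hx,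
        g .tbl (by decide), update_apply, ← hj0]
    · intro y
      simp [g .lo (by decide), g .c1 (by decide), g .c2 (by decide), hc1, hc2, g .x (by decide), hx,
        update_apply, ← hj0]
    · intro y
      simp [g .sz (by decide), g .s0 (by decide), hs0, g .x (by decide), hx,
        update_apply, ← hj0]
    · simp [eval_width, g .x (by decide), g .nn (by decide), hnn, g .s0 (by decide), hs0, hx]
    · simp [eval_width, g .out (by decide), hout, g .p0 (by decide), hP, grr, g .x (by decide),
        g .nn (by decide), hnn, g .s0 (by decide), hs0, hx]
    · intro _
      simp [eval_width, g .x (by decide), g .nn (by decide), hnn, g .s0 (by decide), hs0, hx]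
      omega
    · exact fun hb => hb _ _
    · intro _; simp [g .lo (by decide), g .c1 (by decide), g .c2 (by decide), hc1, hc2, ← hj0]
      exact hlo j0 j1 j2 fun hf => (j3 hf).2
    · intro _; simp [g .out (by decide), hout, g .p0 (by decide), hP, ← hj0]; omega
  · intro _; simp; omega
  · intro _; cases full <;> simp <;> omega
  · intro _; simp [hw1, hw2]; omega

end DS

namespace Edges

variable (G : Edges)

/-- The number of edges in `S` that are incident with a vertex. -/
def dS (S : Finset ℕ) (u : ℕ) : ℕ := (S.filter fun l => G.inc l u).card

/-- The endpoints of edges in `S` that are endpoints of other edges. -/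
def mid (S : Finset ℕ) : Finset ℕ := (G.VS S).filter fun u => ∃ l ∈ G.Λ \ S, G.inc l u

variable {G} {S S₁ S₂ M M₁ M₂ : Finset ℕ} {u : ℕ}

theorem dS_union (h : Disjoint S₁ S₂) : G.dS (S₁ ∪ S₂) u = G.dS S₁ u + G.dS S₂ u := by
  rw [dS, filter_union, card_union_of_disjoint (disjoint_filter_filter h)]; rfl

theorem dS_le_card : G.dS S u ≤ S.card := card_filter_le _ _

theorem mem_of_dS_le (h : S ⊆ G.Λ) (hle : G.dS G.Λ u ≤ G.dS S u) {l : ℕ} (hl : l ∈ G.Λ)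
    (hi : G.inc l u) : l ∈ S := by
  have h1 := eq_of_subset_of_card_le
    (filter_subset_filter (fun l => G.inc l u) h) hle
  have : l ∈ S.filter fun l => G.inc l u := by rw [h1]; simp [hl, hi]
  exact (mem_filter.1 this).1

theorem exists_of_dS_lt (hlt : G.dS S u < G.dS G.Λ u) : ∃ l ∈ G.Λ \ S, G.inc l u := by
  by_contra! hne
  refine absurd (card_le_card (s := G.Λ.filter fun l => G.inc l u)
    (t := S.filter fun l => G.inc l u) fun l hl => ?_) (not_le.2 hlt)
  rw [mem_filter] at hl ⊢
  refine ⟨?_, hl.2⟩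
  by_contra h
  exact hne l (mem_sdiff.2 ⟨hl.1, h⟩) hl.2

theorem dS_eq_zero (h : u ∉ G.VS S) : G.dS S u = 0 := by
  rw [dS, card_eq_zero, filter_eq_empty_iff]
  exact fun l hl hi => h (G.mem_VS.2 ⟨l, hl, hi⟩)

end Edges

/-- A pattern on positions is a pattern on vertices. -/
theorem exists_pattern {s : ℕ} {f : ℕ → ℕ} (hf : Set.InjOn f (range s)) (ρ : ℕ → Fin 3) :
    ∃ ρ' : ℕ → Fin 3, ∀ i < s, ρ' (f i) = ρ i := by
  classical
  refine ⟨fun u => if h : ∃ p < s, f p = u then ρ h.choose else 0, fun i hi => ?_⟩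
  have hex : ∃ p < s, f p = f i := ⟨i, hi, rfl⟩
  beta_reduce
  rw [dif_pos hex]
  exact congrArg ρ (hf (by simpa using hex.choose_spec.1) (by simpa using hi) hex.choose_spec.2)

namespace JoinLists

/-- The lists describe the ends of two sets of edges. -/
structure Ends (J : JoinLists) (G : Edges) (S₁ S₂ : Finset ℕ) : Prop where
  c1 : G.Closed S₁ J.M1
  c2 : G.Closed S₂ J.M2
  disj : Disjoint S₁ S₂
  k1 : J.k1 = G.dS S₁
  k2 : J.k2 = G.dS S₂
  dg : J.dg = G.dS G.Λ

variable {J : JoinLists} {G : Edges} {S₁ S₂ : Finset ℕ}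

theorem Ends.tot (H : J.Ends G S₁ S₂) {u : ℕ} (hu : u ∈ J.M1 ∪ J.M2) :
    J.tot u = G.dS (S₁ ∪ S₂) u := by
  rw [Edges.dS_union H.disj, JoinLists.tot, H.k1, H.k2]
  have key : ∀ {S S' M M' : Finset ℕ}, Disjoint S S' → G.Closed S M → G.Closed S' M' → u ∈ M' →
      u ∉ M → G.dS S u = 0 := by
    intro S S' M M' hd hc hc' hu' hn; refine Edges.dS_eq_zero fun hVS => ?_
    obtain ⟨l, hl, hi⟩ := G.mem_VS.1 (hc'.M_sub hu')
    exact disjoint_left.1 hd (hc.mem u hVS hn l (hc'.sub hl) hi) hl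
  rw [mem_union] at hu
  by_cases h1 : u ∈ J.M1 <;> by_cases h2 : u ∈ J.M2
  · simp [h1, h2]
  · simp [h1, h2, key H.disj.symm H.c2 H.c1 h1 h2]
  · simp [h1, h2, key H.disj H.c1 H.c2 h2 h1]
  · simp [h1, h2] at hu

theorem Ends.sub (H : J.Ends G S₁ S₂) : S₁ ∪ S₂ ⊆ G.Λ := union_subset H.c1.sub H.c2.sub

theorem cl_eq_F {u : ℕ} : J.cl u = .F ↔ J.dg u ≤ J.tot u := by
  unfold cl; split_ifs <;> simp_all

theorem Ends.cl_eq_F_iff (H : J.Ends G S₁ S₂) {u : ℕ} (hu : u ∈ J.M1 ∪ J.M2) :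
    J.cl u = .F ↔ G.dS G.Λ u ≤ G.dS (S₁ ∪ S₂) u := by
  rw [cl_eq_F, H.tot hu, H.dg]

theorem Ends.join (H : J.Ends G S₁ S₂) : G.Join S₁ J.M1 S₂ J.M2 J.MK (J.ofCls .F) where
  c₁ := H.c1
  c₂ := H.c2
  disj := H.disj
  c :=
    { sub := H.sub
      M_sub := by
        refine (filter_subset _ _).trans ?_
        rw [G.VS_union]; exact union_subset_union H.c1.M_sub H.c2.M_sub
      mem := by
        intro u hu hn l hl hi
        by_cases hM : u ∈ J.M1 ∪ J.M2
        · have hF : J.cl u = .F := by by_contra hF; exact hn (mem_filter.2 ⟨hM, hF⟩)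
          exact Edges.mem_of_dS_le H.sub ((H.cl_eq_F_iff hM).1 hF) hl hi
        · rw [mem_union, not_or] at hM; rw [G.VS_union, mem_union] at hu; rw [mem_union]
          exact hu.imp (fun h => H.c1.mem u h hM.1 l hl hi) fun h => H.c2.mem u h hM.2 l hl hi }
  union := by
    ext u; simp only [MK, ofCls, mem_union, mem_filter]; tauto
  disjF := disjoint_filter.2 fun u _ h1 h2 => h1 h2

theorem Ends.MK_subset_mid (H : J.Ends G S₁ S₂) : J.MK ⊆ G.mid (S₁ ∪ S₂) := by
  intro u hu
  refine mem_filter.2 ⟨H.join.c.M_sub hu, ?_⟩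
  obtain ⟨h1, h2⟩ := mem_filter.1 hu
  exact Edges.exists_of_dS_lt (not_le.1 fun h => h2 ((H.cl_eq_F_iff h1).2 h))

theorem card_three {a b c : Cls} (hab : a ≠ b) (hac : a ≠ c) (hbc : b ≠ c) {X : Finset ℕ}
    (h : ∀ u ∈ J.M1 ∪ J.M2, J.cl u = a ∨ J.cl u = b ∨ J.cl u = c → u ∈ X) :
    (J.ofCls a).card + (J.ofCls b).card + (J.ofCls c).card ≤ X.card := by
  have hd : ∀ {x y : Cls}, x ≠ y → Disjoint (J.ofCls x) (J.ofCls y) := fun hxy =>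
    disjoint_filter.2 fun u _ h1 h2 => hxy (h1.symm.trans h2)
  rw [← card_union_of_disjoint (hd hab), ← card_union_of_disjoint
    (Finset.disjoint_union_left.2 ⟨hd hac, hd hbc⟩)]
  refine card_le_card fun u hu => ?_
  simp only [mem_union, ofCls, mem_filter] at hu
  refine h u (by simp only [mem_union]; tauto) (by tauto)

theorem Ends.card_LIF (H : J.Ends G S₁ S₂) :
    (J.ofCls .L).card + (J.ofCls .I).card + (J.ofCls .F).card ≤
      J.M1.card + (J.M2.filter fun u => G.dS G.Λ u ≤ G.dS S₂ u).card := by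
  refine (card_three (X := J.M1 ∪ J.M2.filter fun u => G.dS G.Λ u ≤ G.dS S₂ u) (by decide)
    (by decide) (by decide) fun u hu hc => ?_).trans (Finset.card_union_le _ _)
  rw [mem_union, mem_filter]
  by_cases h1 : u ∈ J.M1
  · exact .inl h1
  · have h2 : u ∈ J.M2 := (mem_union.1 hu).resolve_left h1
    have h3 : J.dg u ≤ J.tot u := by
      by_contra h3
      have : J.cl u = .R := by simp [cl, h3, h1]
      simp [this] at hc
    rw [JoinLists.tot, H.k2, H.dg] at h3; exact .inr ⟨h2, by simpa [h1, h2] using h3⟩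

theorem Ends.card_RIF (H : J.Ends G S₁ S₂) :
    (J.ofCls .R).card + (J.ofCls .I).card + (J.ofCls .F).card ≤
      J.M2.card + (J.M1.filter fun u => G.dS G.Λ u ≤ G.dS S₁ u).card := by
  refine (card_three (X := J.M2 ∪ J.M1.filter fun u => G.dS G.Λ u ≤ G.dS S₁ u) (by decide)
    (by decide) (by decide) fun u hu hc => ?_).trans (Finset.card_union_le _ _)
  rw [mem_union, mem_filter]
  by_cases h2 : u ∈ J.M2
  · exact .inl h2
  · have h1 : u ∈ J.M1 := (mem_union.1 hu).resolve_right h2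
    have h3 : J.dg u ≤ J.tot u := by
      by_contra h3
      have : J.cl u = .L := by simp [cl, h3, h1, h2]
      simp [this] at hc
    rw [JoinLists.tot, H.k1, H.dg] at h3; exact .inr ⟨h1, by simpa [h1, h2] using h3⟩

theorem card_LRI : (J.ofCls .L).card + (J.ofCls .R).card + (J.ofCls .I).card ≤ J.MK.card :=
  card_three (by decide) (by decide) (by decide) fun u hu hc =>
    mem_filter.2 ⟨hu, by rintro h; simp [h] at hc⟩

theorem Ends.few (H : J.Ends G S₁ S₂) :
    (J.MK.filter fun u => G.dS G.Λ u ≤ G.dS (S₁ ∪ S₂) u) = ∅ := by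
  refine filter_eq_empty_iff.2 fun u hu hle => ?_
  obtain ⟨h1, h2⟩ := mem_filter.1 hu
  exact h2 ((H.cl_eq_F_iff h1).2 hle)

end JoinLists

namespace DS

open Env HProg

/-- The parameters of a computation are in range, and `TT` bounds the time for the products of a pair
of layers. -/
structure Par (E : Env) (G : Edges) (full flat : Bool) (n K TT : ℕ) : Prop where
  hinc : ∀ v ∈ G.VS G.Λ, G.own v ∈ G.Λ ∧ G.inc (G.own v) v
  VSn : G.VS G.Λ ⊆ range n
  nB : n + 1 < E.B
  cB : 2 * G.Λ.card < E.B
  K2 : 2 ≤ K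
  Kn : K ≤ n
  big : 2 * (2 * K + 1) * 9 ^ K < E.B
  count : full = false → flat = false → n ≤ E.b
  cflat : flat = true → full = false ∧ (2 * K + 1) * 9 ^ K < 2 ^ E.b
  time : ∀ L I F R d, L + I + F ≤ K + 2 → R + I + F ≤ K + 2 → L + R + I ≤ K → d = min (min L F) R →
    3 ^ (I + (L - d) + (F - d) + (R - d)) * (E.tmm (3 ^ d) + 32 * 9 ^ d) ≤ TT

/-- An upper bound for the number of cells needed for a node. -/
def room (full : Bool) (n K : ℕ) : ℕ := 3 * 9 ^ K + (3 * layers full n K + 2) * 3 ^ K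

/-- The vertices in the list of a node. -/
def rowSet (n : ℕ) (v : Store) (x : ℕ) : Finset ℕ :=
  (range (v .sz x)).image fun i => v .lst (x * n + i)

/-- The state of the global data. -/
structure Glob {b : ℕ} (G : Edges) (n : ℕ) (v : Store) (m : ℕ → ZMod (2 ^ b)) : Prop where
  nn : v .nn 0 = n
  deg : ∀ u ∈ G.VS G.Λ, v .deg u = G.dS G.Λ u
  mark : ∀ u, v .mark u = 0
  o : ∀ c, v (.o1 c) 0 = 0 ∧ v (.o2 c) 0 = 0 ∧ v (.o0 c) 0 = 0 ∧ v (.sg c) 0 = 0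
  zero : ∀ a, v .alloc 0 ≤ a → m a = 0
  pos : 1 ≤ v .alloc 0
  m0 : m 0 = 0

/-- The node `x` has been computed: its list and its table describe the edges in `S`. -/
structure NodeOk {b : ℕ} (G : Edges) (full flat : Bool) (n K : ℕ) (v : Store)
    (m : ℕ → ZMod (2 ^ b)) (S : Finset ℕ) (x : ℕ) : Prop where
  inj : Set.InjOn (fun i => v .lst (x * n + i)) (range (v .sz x))
  closed : G.Closed S (rowSet n v x)
  cnt : ∀ i < v .sz x, v .cnt (x * n + i) = G.dS S (v .lst (x * n + i))
  szK : v .sz x ≤ K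
  few : ((rowSet n v x).filter fun u => G.dS G.Λ u ≤ G.dS S u).card ≤ 2
  lo0 : full = true → v .lo x = 0
  le : v .tbl x + (layers full n (v .sz x) + 1) * 3 ^ v .sz x ≤ v .alloc 0
  ex : ∃ A, G.Sem full flat S (rowSet n v x) A (v .lo x) (layers full n (v .sz x)) ∧
    IsTable G m (v .tbl x) (v .sz x) (layers full n (v .sz x)) (fun i => v .lst (x * n + i)) S A ∧
    (flat = true → ∀ j, (A j).card ≤ 3 ^ v .sz x) ∧ (full = false → (A 0).Nonempty)

theorem layers_mono {full : Bool} {n s K : ℕ} (h : s ≤ K) : layers full n s ≤ layers full n K := by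
  cases full <;> simp [layers, h]

section

variable {b : ℕ} {G : Edges} {full flat : Bool} {n K : ℕ} {v v' : Store}
  {m m' : ℕ → ZMod (2 ^ b)} {S S₁ S₂ : Finset ℕ} {x c1 c2 : ℕ}

theorem NodeOk.congr (H : NodeOk G full flat n K v m S x) (hsz : v' .sz x = v .sz x)
    (hlo : v' .lo x = v .lo x) (htbl : v' .tbl x = v .tbl x)
    (hrow : ∀ i < v .sz x, v' .lst (x * n + i) = v .lst (x * n + i) ∧
      v' .cnt (x * n + i) = v .cnt (x * n + i))
    (hal : v .alloc 0 ≤ v' .alloc 0) (hm : ∀ a < v .alloc 0, m' a = m a) :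
    NodeOk G full flat n K v' m' S x := by
  have hset : rowSet n v' x = rowSet n v x := by
    rw [rowSet, rowSet, hsz]; exact Finset.image_congr fun i hi => (hrow i (by simpa using hi)).1
  obtain ⟨A, hA, hT, hc, h0⟩ := H.ex
  refine ⟨?_, by rw [hset]; exact H.closed, ?_, by rw [hsz]; exact H.szK, by rw [hset]; exact H.few,
    by rw [hlo]; exact H.lo0, by rw [hsz, htbl]; exact H.le.trans hal, A, ?_, ?_, by rw [hsz]; exact hc, h0⟩
  · rw [hsz]; refine H.inj.congr fun i hi => ?_
    exact ((hrow i (by simpa using hi)).1).symm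
  · rw [hsz]; intro i hi; rw [(hrow i hi).1, (hrow i hi).2, H.cnt i hi]
  · rw [hset, hlo, hsz]; exact hA
  · rw [hsz, htbl]; intro j hj y hy; rw [hm]
    · rw [hT j hj y hy]; refine sum_congr rfl fun D _ => prod_congr rfl fun i hi => ?_
      simp only
      rw [(hrow i (mem_range.1 hi)).1]
    · refine lt_of_lt_of_le ?_ H.le
      have : (j + 1) * 3 ^ v .sz x ≤ (layers full n (v .sz x) + 1) * 3 ^ v .sz x :=
        Nat.mul_le_mul_right _ (by omega)
      rw [Nat.add_mul, one_mul] at this; omega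

theorem NodeOk.sz_le (H : NodeOk G full flat n K v m S x) (hV : G.VS G.Λ ⊆ range n) :
    v .sz x ≤ n := by
  have h1 : (rowSet n v x).card = v .sz x := by
    rw [rowSet, card_image_of_injOn H.inj, card_range]
  have h2 := card_le_card ((H.closed.M_sub.trans (G.VS_mono H.closed.sub)).trans hV)
  rw [h1, card_range] at h2
  exact h2

/-- The lists of two nodes. -/
def lists (H₁ : NodeOk G full flat n K v m S₁ c1) (H₂ : NodeOk G full flat n K v m S₂ c2) :
    JoinLists where
  s1 := v .sz c1
  s2 := v .sz c2
  f1 i := v .lst (c1 * n + i)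
  f2 i := v .lst (c2 * n + i)
  k1 := G.dS S₁
  k2 := G.dS S₂
  dg := G.dS G.Λ
  inj1 := H₁.inj
  inj2 := H₂.inj

theorem ends_lists (H₁ : NodeOk G full flat n K v m S₁ c1)
    (H₂ : NodeOk G full flat n K v m S₂ c2) (hd : Disjoint S₁ S₂) :
    (lists H₁ H₂).Ends G S₁ S₂ :=
  ⟨H₁.closed, H₂.closed, hd, rfl, rfl, rfl⟩

end

variable {E : Env} {h : HState E.b} {G : Edges} {full flat : Bool} {n K TT : ℕ} {S₁ S₂ : Finset ℕ}
  {x c1 c2 : ℕ}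

theorem nine_pow (d : ℕ) : (3 : ℕ) ^ d * 3 ^ d = 9 ^ d := by
  rw [← mul_pow]; norm_num

/-- The conditions for the combination of two nodes. -/
structure CombineOk (P : Par E G full flat n K TT) (v : Store) (m : ℕ → ZMod (2 ^ E.b))
    (S₁ S₂ : Finset ℕ) (x c1 c2 : ℕ) : Prop where
  gl : Glob G n v m
  n1 : NodeOk G full flat n K v m S₁ c1
  n2 : NodeOk G full flat n K v m S₂ c2
  disj : Disjoint S₁ S₂
  hx : v .x 0 = x
  hc1 : v .c1 0 = c1
  hc2 : v .c2 0 = c2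
  ne1 : c1 ≠ x
  ne2 : c2 ≠ x
  hmid : (G.mid (S₁ ∪ S₂)).card ≤ K
  hroom : v .alloc 0 + room full n K < E.B

theorem CombineOk.classifyOk {P : Par E G full flat n K TT}
    (H : CombineOk P h.v h.m S₁ S₂ x c1 c2) :
    ClassifyOk E.B (lists H.n1 H.n2) n x c1 c2 (K + 2) h.v := by
  have hE := ends_lists H.n1 H.n2 H.disj
  have hs1 : (lists H.n1 H.n2).s1 ≤ K := H.n1.szK
  have hs2 : (lists H.n1 H.n2).s2 ≤ K := H.n2.szK
  have hVS : (lists H.n1 H.n2).M1 ∪ (lists H.n1 H.n2).M2 ⊆ G.VS G.Λ :=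
    union_subset (hE.c1.M_sub.trans (G.VS_mono hE.c1.sub))
      (hE.c2.M_sub.trans (G.VS_mono hE.c2.sub))
  have b1 := hE.card_LIF
  have b2 := hE.card_RIF
  have q1 := H.n1.few
  have q2 := H.n2.few
  rw [JoinLists.card_M1] at b1
  rw [JoinLists.card_M2] at b2
  refine ⟨H.gl.nn, H.hx, H.hc1, H.hc2, H.ne1, H.ne2, fun i hi => ⟨rfl, H.n1.cnt i hi⟩,
    fun i hi => ⟨rfl, H.n2.cnt i hi⟩, fun u hu => H.gl.deg u (hVS hu), hVS.trans P.VSn, ?_, ?_, ?_⟩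
  · refine lt_of_le_of_lt ?_ P.big
    refine Nat.mul_le_mul (Nat.mul_le_mul_left _ (by omega)) ?_
    rw [← nine_pow, ← pow_add]; exact pow_le_pow_right (by norm_num) (by omega)
  · intro u
    have h1 : G.dS S₁ u ≤ G.Λ.card := Edges.dS_le_card.trans (card_le_card hE.c1.sub)
    have h2 : G.dS S₂ u ≤ G.Λ.card := Edges.dS_le_card.trans (card_le_card hE.c2.sub)
    have := P.cB
    exact lt_of_le_of_lt (by show G.dS S₁ u + G.dS S₂ u ≤ _; omega) this
  · have b1' : ((lists H.n1 H.n2).ofCls .L).card + ((lists H.n1 H.n2).ofCls .I).card +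
        ((lists H.n1 H.n2).ofCls .F).card ≤ K + 2 := b1.trans (Nat.add_le_add hs1 q2)
    have b2' : ((lists H.n1 H.n2).ofCls .R).card + ((lists H.n1 H.n2).ofCls .I).card +
        ((lists H.n1 H.n2).ofCls .F).card ≤ K + 2 := b2.trans (Nat.add_le_add hs2 q1)
    intro c; cases c <;> omega

/-- The table of the join before normalization. -/
theorem wp_product {P : Par E G full flat n K TT} (H : CombineOk P h.v h.m S₁ S₂ x c1 c2) :
    E.wp (classify ;; prepare full ;; contract) h fun s => ∃ s0 out,
      s.t ≤ h.t + (2 * K + 1) * (60 * 3 ^ (K + 2)) + 18 +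
        (layers full n K + 1) * ((layers full n K + 1) * TT) ∧
      (lists H.n1 H.n2).Placed n x h.v ((lists H.n1 H.n2).M1 ∪ (lists H.n1 H.n2).M2) s.v ∧
      s.v .s0 0 = s0 ∧ s0 ≤ K ∧ s.v .p0 0 = 3 ^ s0 ∧ s.v .out 0 = out ∧ h.v .alloc 0 ≤ out ∧
      out ≤ h.v .alloc 0 + 3 * 9 ^ K ∧ s.v .w1 0 = layers full n (h.v .sz c1) + 1 ∧
      s.v .w2 0 = layers full n (h.v .sz c2) + 1 ∧ (∀ u, s.v .mark u = 0) ∧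
      (∀ i ≤ s0, s.v .pow i = 3 ^ i) ∧
      (∀ a < h.v .alloc 0, s.m a = h.m a) ∧
      (∀ a, out + (layers full n (h.v .sz c1) + layers full n (h.v .sz c2) + 1) * 3 ^ s0 ≤ a →
        s.m a = 0) ∧
      ∀ A₁ A₂, G.Sem full flat S₁ (rowSet n h.v c1) A₁ (h.v .lo c1) (layers full n (h.v .sz c1)) →
        G.Sem full flat S₂ (rowSet n h.v c2) A₂ (h.v .lo c2) (layers full n (h.v .sz c2)) →
        IsTable G h.m (h.v .tbl c1) (h.v .sz c1) (layers full n (h.v .sz c1))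
          (fun i => h.v .lst (c1 * n + i)) S₁ A₁ →
        IsTable G h.m (h.v .tbl c2) (h.v .sz c2) (layers full n (h.v .sz c2))
          (fun i => h.v .lst (c2 * n + i)) S₂ A₂ →
        IsTable G s.m out s0 (layers full n (h.v .sz c1) + layers full n (h.v .sz c2))
          (fun i => s.v .lst (x * n + i)) (S₁ ∪ S₂) (G.joinFam S₁ (rowSet n h.v c1) S₂
            (rowSet n h.v c2) ((lists H.n1 H.n2).ofCls .F) A₁ A₂) := by
  have hE := ends_lists H.n1 H.n2 H.disj
  have hC := H.classifyOk
  have hs1 : (lists H.n1 H.n2).s1 ≤ K := H.n1.szK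
  have hs2 : (lists H.n1 H.n2).s2 ≤ K := H.n2.szK
  have b1 := hE.card_LIF
  have b2 := hE.card_RIF
  have q1 : ((lists H.n1 H.n2).M1.filter fun u => G.dS G.Λ u ≤ G.dS S₁ u).card ≤ 2 := H.n1.few
  have q2 : ((lists H.n1 H.n2).M2.filter fun u => G.dS G.Λ u ≤ G.dS S₂ u).card ≤ 2 := H.n2.few
  have b3 := JoinLists.card_LRI (J := lists H.n1 H.n2)
  have b4 : (lists H.n1 H.n2).MK.card ≤ K := (card_le_card hE.MK_subset_mid).trans H.hmid
  rw [JoinLists.card_M1] at b1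
  rw [JoinLists.card_M2] at b2
  set J := lists H.n1 H.n2 with hJ
  have e1 : h.v .sz c1 = J.s1 := rfl
  have e2 : h.v .sz c2 = J.s2 := rfl
  set W₁ := layers full n (h.v .sz c1) with hW₁
  set W₂ := layers full n (h.v .sz c2) with hW₂
  set W := layers full n K with hW
  have hWW₁ : W₁ ≤ W := layers_mono H.n1.szK
  have hWW₂ : W₂ ≤ W := layers_mono H.n2.szK
  have hWB : W + 1 < E.B := by
    have := P.nB; have := P.Kn
    rw [hW, layers]; split_ifs <;> omega
  refine wp_seq ((wp_classify hC e1 e2 H.gl.mark H.gl.o).mono ?_)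
  rintro s1 hb1 f1 ⟨hm1, ht1, hPl, hmk, hpw⟩
  obtain ⟨k, vs, e0, HC, HK⟩ := hPl.ex
  set s0 := s1.v .s0 0 with hs0
  have hkc : ∀ c, k c = (J.ofCls c).card := HC.card
  rw [← hkc, ← hkc, ← hkc] at b1 b2 b3
  have hMK : J.MK = (range s0).image fun p => s1.v .lst (x * n + p) := HK.image.symm
  have hs0K : s0 ≤ K := by
    rw [hMK, card_image_of_injOn HK.inj, card_range] at b4; exact b4
  set d := min (min (k .L) (k .F)) (k .R) with hd
  have hdK : d ≤ K := by omega
  have hs0N : s0 ≤ J.s1 + J.s2 := HK.le.trans J.card_union_le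
  have hkN : ∀ c, k c ≤ J.s1 + J.s2 := fun c => by rw [hkc]; exact J.card_ofCls_le c
  have h9 : (3 : ℕ) ^ d * 3 ^ d ≤ 9 ^ K := by
    rw [nine_pow]; exact pow_le_pow_right (by norm_num) hdK
  have h3s0 : (3 : ℕ) ^ s0 ≤ 3 ^ K := pow_le_pow_right (by norm_num) hs0K
  have hroom := H.hroom
  rw [room, ← hW] at hroom
  have hWs : (W₁ + W₂ + 1) * 3 ^ s0 ≤ (3 * W + 2) * 3 ^ K := Nat.mul_le_mul (by omega) h3s0
  refine wp_seq (wp_seq ((wp_sizes (HC.nc _) (HC.nc _) (HC.nc _) (HC.nc _) hs0.symm hpw (hkN _) (hkN _)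
    (hkN _) (hkN _) hs0N).mono ?_))
  rw [← hd]
  rintro s2 - f2 ⟨hm2, ht2, v1, v2, v3, v4, v5, v6⟩
  refine wp_seq ((wp_space (A := h.v .alloc 0) (d := 3 ^ d) ?_ v1 (by omega)).mono ?_)
  · rw [f2 _ (by decide), f1 _ (by decide)]
  rintro s3 - f3 ⟨hm3, ht3, v7, v8, v9, v10⟩
  have hp3 : s3.v .pow = s1.v .pow := by rw [f3 _ (by decide), f2 _ (by decide)]
  refine (wp_views (full := full) (c1 := c1) (c2 := c2) (N := J.s1 + J.s2) (s1 := J.s1) (s2 := J.s2) (n := n)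
    ?_ ?_ ?_ ?_ ?_ (by rw [hp3]; exact hpw) (by omega) (by omega) ?_ ?_).mono ?_
  · rw [f3 _ (by decide), f2 _ (by decide), f1 _ (by decide), H.hc1]
  · rw [f3 _ (by decide), f2 _ (by decide), f1 _ (by decide), H.hc2]
  · rw [f3 _ (by decide), f2 _ (by decide), f1 _ (by decide), H.gl.nn]
  · rw [f3 _ (by decide), f2 _ (by decide), f1 _ (by decide)]; exact e1
  · rw [f3 _ (by decide), f2 _ (by decide), f1 _ (by decide)]; exact e2
  · rw [← e1]; exact lt_of_le_of_lt (by omega) hWB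
  · rw [← e2]; exact lt_of_le_of_lt (by omega) hWB
  rintro s4 - f4 ⟨hm4, ht4, v11, v12, v13, v14, v15, v16⟩
  rw [← e1] at v11 v15
  rw [← e2] at v12 v16
  rw [← hW₁] at v11
  rw [← hW₂] at v12
  rw [e1] at v15
  rw [e2] at v16
  have htb : s3.v .tbl = h.v .tbl := by rw [f3 _ (by decide), f2 _ (by decide), f1 _ (by decide)]
  rw [htb] at v13 v14
  have g4 : ∀ a ∉ (prepare true).mods, s4.v a = s1.v a := by
    intro a ha; simp only [prepare, mods, List.mem_append, not_or] at ha
    rw [f4 a (by rw [mods_views, ← mods_views (full := true)]; exact ha.2.2), f3 a ha.2.1, f2 a ha.1]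
  have g4' : ∀ a ∉ (views true).mods, s4.v a = s3.v a := by
    intro a ha; exact f4 a (by rw [mods_views, ← mods_views (full := true)]; exact ha)
  have hc4 : ∀ c, s4.v (.nc c) = s1.v (.nc c) ∧ s4.v (.o1 c) = s1.v (.o1 c) ∧
      s4.v (.o2 c) = s1.v (.o2 c) ∧ s4.v (.o0 c) = s1.v (.o0 c) ∧ s4.v (.sg c) = s1.v (.sg c) := by
    intro c; refine ⟨g4 _ ?_, g4 _ ?_, g4 _ ?_, g4 _ ?_, g4 _ ?_⟩ <;> cases c <;> decide
  have HC4 := HC.congr (v' := s4.v) (e0' := e0) hc4 fun _ _ => rfl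
  have hm : s4.m = h.m := by rw [hm4, hm3, hm2, hm1]
  have w1 : s4.v .d 0 = 3 ^ d := by rw [g4' _ (by decide), f3 _ (by decide), v1]
  have w2 : s4.v .qL 0 = 3 ^ (k .L - d) := by rw [g4' _ (by decide), f3 _ (by decide), v2]
  have w3 : s4.v .qF 0 = 3 ^ (k .F - d) := by rw [g4' _ (by decide), f3 _ (by decide), v3]
  have w4 : s4.v .qR 0 = 3 ^ (k .R - d) := by rw [g4' _ (by decide), f3 _ (by decide), v4]
  have w5 : s4.v .pI 0 = 3 ^ k .I := by rw [g4' _ (by decide), f3 _ (by decide), v5]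
  have w6 : s4.v .p0 0 = 3 ^ s0 := by rw [g4' _ (by decide), f3 _ (by decide), v6]
  have w7 : s4.v .sA 0 = h.v .alloc 0 := by rw [g4' _ (by decide), v7]
  have w8 : s4.v .sB 0 = h.v .alloc 0 + 3 ^ d * 3 ^ d := by rw [g4' _ (by decide), v8]
  have w9 : s4.v .sC 0 = h.v .alloc 0 + 3 ^ d * 3 ^ d + 3 ^ d * 3 ^ d := by
    rw [g4' _ (by decide), v9]
  have w10 : s4.v .out 0 = h.v .alloc 0 + 3 ^ d * 3 ^ d + 3 ^ d * 3 ^ d + 3 ^ d * 3 ^ d := by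
    rw [g4' _ (by decide), v10]
  have hq : ∀ {c}, d ≤ k c → 3 ^ (k c - d) * 3 ^ d = 3 ^ k c := fun hc => by
    rw [← pow_add, Nat.sub_add_cancel hc]
  have qL : 3 ^ (k .L - d) * 3 ^ d = 3 ^ k .L := hq (by omega)
  have qF : 3 ^ (k .F - d) * 3 ^ d = 3 ^ k .F := hq (by omega)
  have qR : 3 ^ (k .R - d) * 3 ^ d = 3 ^ k .R := hq (by omega)
  have hcell : ∀ {t j s o W A : ℕ}, t + (W + 1) * 3 ^ s ≤ A → j < W + 1 → o < 3 ^ s →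
      t + j * 3 ^ s + o < A := by
    intro t j s o W A h1 h2 h3
    have : (j + 1) * 3 ^ s ≤ (W + 1) * 3 ^ s := Nat.mul_le_mul_right _ h2
    rw [Nat.add_mul, one_mul] at this; omega
  have hout : ∀ {j xI xL xR : ℕ}, xI < 3 ^ k .I → xL < 3 ^ k .L → xR < 3 ^ k .R → j < W₁ + W₂ + 1 →
      ad0 s4.v j xI xL xR < s4.v .out 0 + (W₁ + W₂ + 1) * 3 ^ s0 := by
    intro j xI xL xR hI hL hR hj
    have := hcell (t := s4.v .out 0) le_rfl hj (HC4.off0_iff HK hI hL hR).1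
    rw [ad0, w6]; omega
  refine (wp_contract (A := h.v .alloc 0) (d := 3 ^ d) (w1 := W₁ + 1) (w2 := W₂ + 1)
    (pI := 3 ^ k .I) (qL := 3 ^ (k .L - d)) (qF := 3 ^ (k .F - d)) (qR := 3 ^ (k .R - d))
    ⟨⟨w1, one_le_pow _ _ (by norm_num), w7, w8, w9, w10.ge, H.gl.pos, by rw [hm]; exact H.gl.m0⟩,
      v11, v12, w5, w2, w3, w4, by omega, one_le_pow _ _ (by norm_num),
      one_le_pow _ _ (by norm_num), one_le_pow _ _ (by norm_num),
      one_le_pow _ _ (by norm_num), by omega, ?_, ?_, ?_⟩).mono ?_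
  · intro j hj xI hI xL hL xF hF; rw [qL] at hL; rw [qF] at hF
    have := hcell H.n1.le hj (HC4.off1_lt hI hL hF)
    rw [e1] at this; rw [ad1, v13, v15]; omega
  · intro j hj xI hI xF hF xR hR; rw [qR] at hR; rw [qF] at hF
    have := hcell H.n2.le hj (HC4.off2_lt hI hR hF)
    rw [e2] at this; rw [ad2, v14, v16]; omega
  · intro j1 hj1 j2 hj2 xI hI xL hL xR hR; rw [qL] at hL; rw [qR] at hR
    have := hout hI hL hR (j := j1 + j2) (by omega)
    omega
  rintro s5 - f5 ⟨ht5, hlow, hhigh⟩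
  rw [qL, qR, qF] at hhigh
  have g5 : ∀ a ∉ contract.mods, s5.v a = s4.v a := f5
  refine ⟨s0, s4.v .out 0, ?_, ?_, ?_, hs0K, ?_, ?_, by omega, by omega, ?_, ?_, ?_, ?_, ?_, ?_, ?_⟩
  · have hT := P.time (k .L) (k .I) (k .F) (k .R) d (by omega) (by omega) (by omega) hd
    have hs12 : (J.s1 + J.s2 + 1) * (60 * 3 ^ (K + 2)) ≤ (2 * K + 1) * (60 * 3 ^ (K + 2)) :=
      Nat.mul_le_mul_right _ (by omega)
    have hpp : 3 ^ k .I * (3 ^ (k .L - d) * (3 ^ (k .F - d) * 3 ^ (k .R - d))) =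
        3 ^ (k .I + (k .L - d) + (k .F - d) + (k .R - d)) := by
      simp only [pow_add, mul_assoc]
    rw [hpp, nine_pow] at ht5
    have hmul : (W₁ + 1) * ((W₂ + 1) * 3 ^ (k .I + (k .L - d) + (k .F - d) + (k .R - d))) *
        (E.tmm (3 ^ d) + 32 * 9 ^ d) ≤ (W + 1) * ((W + 1) * TT) := by
      rw [mul_assoc, mul_assoc]; exact Nat.mul_le_mul (by omega) (Nat.mul_le_mul (by omega) hT)
    omega
  · refine (hPl.congr hc4 (g4 _ (by decide)) (g4 _ (by decide)) (g4 _ (by decide))).congr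
      (fun c => ?_) (g5 _ (by decide)) (g5 _ (by decide)) (g5 _ (by decide))
    refine ⟨g5 _ ?_, g5 _ ?_, g5 _ ?_, g5 _ ?_, g5 _ ?_⟩ <;> cases c <;> decide
  · rw [g5 _ (by decide), g4 _ (by decide)]
  · rw [g5 _ (by decide), w6]
  · rw [g5 _ (by decide)]
  · rw [g5 _ (by decide), v11]
  · rw [g5 _ (by decide), v12]
  · intro u; rw [g5 _ (by decide), g4 _ (by decide), hmk]
  · intro i hi; rw [g5 _ (by decide), g4 _ (by decide), hpw i (by omega)]
  · intro a ha; rw [hlow a ha, hm]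
  · intro a ha; rw [hhigh a (by omega), hm, H.gl.zero a (by omega), zero_add]
    refine sum_eq_zero fun j1 hj1 => sum_eq_zero fun j2 hj2 =>
      sum_eq_zero fun xI hI => sum_eq_zero fun xL hL => sum_eq_zero fun xR hR =>
      if_neg ?_
    rw [mem_range] at hj1 hj2 hI hL hR
    have := hout hI hL hR (j := j1 + j2) (by omega)
    omega
  · intro A₁ A₂ hA₁ hA₂ hT₁ hT₂ j hj y hy
    have hlst : s5.v .lst = s1.v .lst := by rw [g5 _ (by decide), g4 _ (by decide)]
    rw [hlst, hhigh _ (by omega), hm, H.gl.zero _ (by omega), zero_add]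
    have := contract_eq_cellv (v := s4.v) (m := h.m) (full := full) (flat := flat) (W₁ := W₁)
      (W₂ := W₂) HC4 HK hE.join hA₁ hA₂ v15 v16 w6
      (by rw [v13]; exact hT₁) (by rw [v14]; exact hT₂) hj hy
    exact this

end DS

namespace DS

open Env HProg

variable {E : Env} {h : HState E.b} {G : Edges} {full flat : Bool} {n K TT : ℕ} {S₁ S₂ : Finset ℕ}
  {x c1 c2 : ℕ}

/-- A layer with a partial solution has a nonzero cell. -/
theorem exists_cell_ne_zero {P : Par E G full flat n K TT} (H : CombineOk P h.v h.m S₁ S₂ x c1 c2)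
    (hfull : full = false) {A₁ A₂ : ℕ → Finset (Finset ℕ)}
    (hA₁ : G.Sem full flat S₁ (rowSet n h.v c1) A₁ (h.v .lo c1) (layers full n (h.v .sz c1)))
    (hA₂ : G.Sem full flat S₂ (rowSet n h.v c2) A₂ (h.v .lo c2) (layers full n (h.v .sz c2)))
    (hc₁ : flat = true → ∀ j, (A₁ j).card ≤ 3 ^ h.v .sz c1)
    (hc₂ : flat = true → ∀ j, (A₂ j).card ≤ 3 ^ h.v .sz c2) {l : ℕ}
    (hl : l ≤ layers full n (h.v .sz c1) + layers full n (h.v .sz c2)) :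
    (flat = true → (G.joinFam S₁ (rowSet n h.v c1) S₂ (rowSet n h.v c2)
      ((lists H.n1 H.n2).ofCls .F) A₁ A₂ l).card < 2 ^ E.b) ∧
    ∀ {s0 : ℕ} {f : ℕ → ℕ}, (lists H.n1 H.n2).MK = (range s0).image f →
      Set.InjOn f (range s0) →
      (G.joinFam S₁ (rowSet n h.v c1) S₂ (rowSet n h.v c2) ((lists H.n1 H.n2).ofCls .F) A₁ A₂ l).Nonempty →
      ∃ e < 3 ^ s0, cellv (fun _ => loc (ZMod (2 ^ E.b))) s0 (G.joinFam S₁ (rowSet n h.v c1) S₂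
        (rowSet n h.v c2) ((lists H.n1 H.n2).ofCls .F) A₁ A₂ l)
        (fun D i => G.pt (S₁ ∪ S₂) D (f i)) e ≠ 0 := by
  have hE := ends_lists H.n1 H.n2 H.disj
  have hsem := hE.join.sem hA₁ hA₂ P.hinc
  have hflat : flat = true → (G.joinFam S₁ (rowSet n h.v c1) S₂ (rowSet n h.v c2)
      ((lists H.n1 H.n2).ofCls .F) A₁ A₂ l).card < 2 ^ E.b := by
    intro hfl; refine lt_of_le_of_lt ?_ (P.cflat hfl).2
    refine (Edges.Join.card_joinFam_le (hc₁ hfl) (hc₂ hfl) l).trans ?_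
    subst hfull; simp only [layers, Bool.false_eq_true, if_false] at hl
    have h1 := H.n1.szK
    have h2 := H.n2.szK
    refine Nat.mul_le_mul (by omega) ?_
    rw [← nine_pow]
    exact Nat.mul_le_mul (pow_le_pow_right (by norm_num) h1)
      (pow_le_pow_right (by norm_num) h2)
  refine ⟨hflat, fun hM hf ⟨D₀, hD₀⟩ => Edges.exists_cellv_ne_zero hM hf hD₀ ?_⟩
  rcases Bool.eq_false_or_eq_true flat with hfl | hfl
  · exact (card_filter_le _ _).trans_lt (hflat hfl)
  · have hn := P.count hfull hfl
    refine lt_of_lt_of_le (Edges.card_filter_lt_two_pow (n := n) hE.join.c P.hinc ?_ P.VSn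
      (c := h.v .lo c1 + h.v .lo c2 + l) (fun D hD => ?_) D₀) (pow_le_pow_right (by norm_num) hn)
    · have := P.K2; have := P.Kn; omega
    · exact ⟨(hsem.sound l D hD).1.1, (hsem.sound l D hD).2⟩

theorem wp_combine {P : Par E G full flat n K TT} (H : CombineOk P h.v h.m S₁ S₂ x c1 c2) :
    E.wp (combine full flat) h fun s =>
      s.t ≤ h.t + 1200 * ((layers full n K + 1) * ((layers full n K + 1) * TT)) ∧
      Glob G n s.v s.m ∧ NodeOk G full flat n K s.v s.m (S₁ ∪ S₂) x ∧
      (h.v .alloc 0 ≤ s.v .tbl x ∧ rowSet n s.v x ⊆ G.mid (S₁ ∪ S₂)) ∧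
      h.v .alloc 0 ≤ s.v .alloc 0 ∧ s.v .alloc 0 ≤ h.v .alloc 0 + room full n K ∧
      ∀ y S, y ≠ x → NodeOk G full flat n K h.v h.m S y → NodeOk G full flat n K s.v s.m S y := by
  have hE := ends_lists H.n1 H.n2 H.disj
  obtain ⟨A₁, hA₁, hT₁, hc₁, hn₁⟩ := H.n1.ex
  obtain ⟨A₂, hA₂, hT₂, hc₂, hn₂⟩ := H.n2.ex
  have hsem := hE.join.sem hA₁ hA₂ P.hinc
  have hcells := fun (hf : full = false) {l : ℕ} => exists_cell_ne_zero H hf hA₁ hA₂ hc₁ hc₂ (l := l)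
  refine wp_seq ((wp_product H).mono ?_)
  rintro s1 - f1 ⟨s0, out, ht1, hPl, e1, hs0K, e2, e3, hout1, hout2, e4, e5, hmk, hpw, hlow, hhigh, hfam⟩
  replace hfam := hfam A₁ A₂ hA₁ hA₂ hT₁ hT₂
  replace f1 : ∀ a ∉ (classify ;; prepare true ;; contract).mods, s1.v a = h.v a := f1
  obtain ⟨k, vs, e0, HC, HK⟩ := hPl.ex
  rw [e1] at HK
  set J := lists H.n1 H.n2 with hJ
  set W₁ := layers full n (h.v .sz c1) with hW₁
  set W₂ := layers full n (h.v .sz c2) with hW₂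
  set W := layers full n K with hW
  set F := G.joinFam S₁ (rowSet n h.v c1) S₂ (rowSet n h.v c2) (J.ofCls .F) A₁ A₂ with hF
  set f0 : ℕ → ℕ := fun p => s1.v .lst (x * n + p) with hf0
  have hMK : J.MK = (range s0).image f0 := HK.image.symm
  have hMKc : J.MK.card = s0 := by rw [hMK, card_image_of_injOn HK.inj, card_range]
  have hPos : 1 ≤ 3 ^ s0 := one_le_pow _ _ (by norm_num)
  have h3s0 : (3 : ℕ) ^ s0 ≤ 3 ^ K := pow_le_pow_right (by norm_num) hs0K
  have hWW₁ : W₁ ≤ W := layers_mono H.n1.szK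
  have hWW₂ : W₂ ≤ W := layers_mono H.n2.szK
  have hWW₀ : layers full n s0 ≤ W := layers_mono hs0K
  have hroom := H.hroom
  have hspace : out + (W₁ + W₂ + 1 + (layers full n s0 + 1)) * 3 ^ s0 ≤ h.v .alloc 0 + room full n K := by
    have : (W₁ + W₂ + 1 + (layers full n s0 + 1)) * 3 ^ s0 ≤ (3 * W + 2) * 3 ^ K :=
      Nat.mul_le_mul (by omega) h3s0
    rw [room, ← hW]; omega
  have hcell1 : ∀ l ≤ W₁ + W₂, ∀ e < 3 ^ s0, s1.m (out + l * 3 ^ s0 + e) =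
      cellv (fun _ => loc (ZMod (2 ^ E.b))) s0 (F l) (fun D i => G.pt (S₁ ∪ S₂) D (f0 i)) e :=
    fun l hl e he => hfam l hl e he
  have hne_of : ∀ l ≤ W₁ + W₂, ∀ e < 3 ^ s0, s1.m (out + l * 3 ^ s0 + e) ≠ 0 → (F l).Nonempty := by
    intro l hl e he hne; rw [hcell1 l hl e he] at hne
    by_contra hemp
    rw [Finset.not_nonempty_iff_eq_empty.1 hemp] at hne; exact hne (by simp [cellv])
  have hlo' : ∀ l ≤ W₁ + W₂, (F l).Nonempty → h.v .lo c1 + h.v .lo c2 + l ≤ n := by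
    rintro l hl ⟨D, hD⟩
    rw [← (hsem.sound l D hD).2]
    have := card_le_card ((inter_subset_left.trans (hsem.sound l D hD).1.1).trans
      ((G.VS_mono hE.sub).trans P.VSn) : D ∩ G.Own (S₁ ∪ S₂) ⊆ range n)
    rwa [card_range] at this
  have hFemp : ∀ l, W₁ + W₂ < l → F l = ∅ := hsem.empty
  have hnB := P.nB
  refine wp_seq ((wp_settle (full := full) (w1 := W₁) (w2 := W₂) (P := 3 ^ s0) (out := out) (x := x) (c1 := c1)
    (c2 := c2) (s0 := s0) (n := n) e4 e5 e2 ?_ ?_ ?_ e1 ?_ e3 H.ne1 H.ne2 hPos ?_ ?_ (by omega)).mono ?_)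
  · rw [f1 _ (by decide), H.hx]
  · rw [f1 _ (by decide), H.hc1]
  · rw [f1 _ (by decide), H.hc2]
  · rw [f1 _ (by decide), H.gl.nn]
  · intro hfu; obtain ⟨j, hj, hne⟩ := hsem.exists_nonempty (Edges.exists_target full)
    obtain ⟨e, he, hce⟩ := (hcells hfu hj).2 hMK HK.inj hne
    exact ⟨j, by omega, e, he, by rw [hcell1 j hj e he]; exact hce⟩
  · intro j hj h1 h2; rw [f1 _ (by decide)]
    cases hfu : full with
    | true => rw [H.n1.lo0 hfu, H.n2.lo0 hfu, h1 hfu]; omega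
    | false =>
      obtain ⟨e, he, hne⟩ := h2 hfu
      have := hlo' j (by omega) (hne_of j (by omega) e he hne)
      omega
  rintro s2 - f2 ⟨hm2, ht2, j0, hj0, hj1, hj2, htbl, hlo, hsz, hwx, hal⟩
  replace f2 : ∀ a ∉ (settle true).mods, s2.v a = s1.v a := f2
  rw [f1 .tbl (by decide)] at htbl
  rw [f1 .lo (by decide)] at hlo
  rw [f1 .sz (by decide)] at hsz
  set W₀ := layers full n s0 with hW₀
  -- the window
  have hwin : G.Sem full flat (S₁ ∪ S₂) J.MK (fun j => if j ≤ W₀ then F (j0 + j) else ∅)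
      (h.v .lo c1 + h.v .lo c2 + j0) W₀ := by
    refine hsem.window hE.join.c P.hinc (fun hfu => ?_) fun hfu => ⟨?_, ?_, ?_⟩
    · refine ⟨by rw [H.n1.lo0 hfu, H.n2.lo0 hfu], hj1 hfu, ?_⟩
      have := card_le_card P.VSn
      rw [card_range] at this; simpa [hW₀, layers, hfu] using this
    · obtain ⟨e, he, hne⟩ := (hj2 hfu).2; exact hne_of j0 (by omega) e he hne
    · intro l hl
      by_contra hne
      obtain ⟨e, he, hce⟩ := (hcells hfu (l := l) (by omega)).2 hMK HK.inj
        (nonempty_iff_ne_empty.2 hne)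
      exact hce (by rw [← hcell1 l (by omega) e he]; exact (hj2 hfu).1 l hl e he)
    · rw [hMKc]; simp [hW₀, layers, hfu]
  have hwt : ∀ j < W₀ + 1, ∀ y < 3 ^ s0, s2.m (out + j0 * 3 ^ s0 + (j * 3 ^ s0 + y)) =
      cellv (fun _ => loc (ZMod (2 ^ E.b))) s0 (if j ≤ W₀ then F (j0 + j) else ∅)
        (fun D i => G.pt (S₁ ∪ S₂) D (f0 i)) y := by
    intro j hj y hy
    have e : out + j0 * 3 ^ s0 + (j * 3 ^ s0 + y) = out + (j0 + j) * 3 ^ s0 + y := by ring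
    rw [if_pos (by omega), hm2, e]
    rcases Nat.lt_or_ge (W₁ + W₂) (j0 + j) with hlt | hle
    · rw [hFemp _ hlt, hhigh]
      · simp [cellv]
      · have : (W₁ + W₂ + 1) * 3 ^ s0 ≤ (j0 + j) * 3 ^ s0 := Nat.mul_le_mul_right _ hlt
        omega
    · exact hcell1 _ hle y hy
  have hwne : full = false → (if 0 ≤ W₀ then F (j0 + 0) else ∅).Nonempty := by
    intro hfu; obtain ⟨e, he, hne⟩ := (hj2 hfu).2; simpa using hne_of j0 (by omega) e he hne
  have hend : out + j0 * 3 ^ s0 + (W₀ + 1) * 3 ^ s0 ≤ s2.v .alloc 0 := by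
    rw [hal]
    have : (j0 + (W₀ + 1)) * 3 ^ s0 ≤ (W₁ + W₂ + 1 + (W₀ + 1)) * 3 ^ s0 :=
      Nat.mul_le_mul_right _ (by omega)
    rw [Nat.add_mul j0] at this; omega
  have hstart : h.v .alloc 0 ≤ out + j0 * 3 ^ s0 := by omega
  have fin : ∀ (v3 : Store) (m3 : ℕ → ZMod (2 ^ E.b)), (∀ a ∉ flatten.mods, v3 a = s2.v a) →
      (∃ A, G.Sem full flat (S₁ ∪ S₂) J.MK A (h.v .lo c1 + h.v .lo c2 + j0) W₀ ∧
        IsTable G m3 (out + j0 * 3 ^ s0) s0 W₀ f0 (S₁ ∪ S₂) A ∧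
        (flat = true → ∀ j, (A j).card ≤ 3 ^ s0) ∧ (full = false → (A 0).Nonempty)) →
      (∀ a < out + j0 * 3 ^ s0, m3 a = s2.m a) →
      (∀ a, out + j0 * 3 ^ s0 + (W₀ + 1) * 3 ^ s0 ≤ a → m3 a = s2.m a) →
      Glob G n v3 m3 ∧ NodeOk G full flat n K v3 m3 (S₁ ∪ S₂) x ∧
      (h.v .alloc 0 ≤ v3 .tbl x ∧ rowSet n v3 x ⊆ G.mid (S₁ ∪ S₂)) ∧
      h.v .alloc 0 ≤ v3 .alloc 0 ∧ v3 .alloc 0 ≤ h.v .alloc 0 + room full n K ∧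
      ∀ y S, y ≠ x → NodeOk G full flat n K h.v h.m S y → NodeOk G full flat n K v3 m3 S y := by
    intro v3 m3 f3 hex hb ha
    have g3 : ∀ a ∉ flatten.mods, a ∉ (settle true).mods → v3 a = s1.v a := fun a h1 h2 => by
      rw [f3 a h1, f2 a h2]
    have a3 : v3 .alloc 0 = out + (W₁ + W₂ + 1 + (W₀ + 1)) * 3 ^ s0 := by rw [f3 _ (by decide), hal]
    have ltb : v3 .tbl = s2.v .tbl := f3 _ (by decide)
    have llo : v3 .lo = s2.v .lo := f3 _ (by decide)
    have lsz : v3 .sz = s2.v .sz := f3 _ (by decide)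
    have lls : v3 .lst = s1.v .lst := g3 _ (by decide) (by decide)
    have lcn : v3 .cnt = s1.v .cnt := g3 _ (by decide) (by decide)
    have szx : v3 .sz x = s0 := by rw [lsz, hsz, if_pos rfl]
    have lox : v3 .lo x = h.v .lo c1 + h.v .lo c2 + j0 := by rw [llo, hlo, if_pos rfl]
    have tbx : v3 .tbl x = out + j0 * 3 ^ s0 := by rw [ltb, htbl, if_pos rfl]
    have rowx : rowSet n v3 x = J.MK := by rw [rowSet, szx, lls, hMK]
    have mlow : ∀ a < h.v .alloc 0, m3 a = h.m a := fun a ha' => by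
      rw [hb a (by omega), hm2, hlow a ha']
    refine ⟨⟨?_, ?_, ?_, ?_, ?_, ?_, ?_⟩, ⟨?_, ?_, ?_, ?_, ?_, ?_, ?_, ?_⟩,
      ⟨by omega, by rw [rowx]; exact hE.MK_subset_mid⟩, by omega, by omega, ?_⟩
    · rw [g3 _ (by decide) (by decide), f1 _ (by decide), H.gl.nn]
    · intro u hu; rw [g3 _ (by decide) (by decide), f1 _ (by decide), H.gl.deg u hu]
    · intro u; rw [g3 _ (by decide) (by decide), hmk]
    · intro c
      have h3 : ∀ c, v3 (.o1 c) = s1.v (.o1 c) ∧ v3 (.o2 c) = s1.v (.o2 c) ∧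
          v3 (.o0 c) = s1.v (.o0 c) ∧ v3 (.sg c) = s1.v (.sg c) := by
        intro c; refine ⟨g3 _ ?_ ?_, g3 _ ?_ ?_, g3 _ ?_ ?_, g3 _ ?_ ?_⟩ <;> cases c <;> decide
      have hd : ∀ i, digit 0 i = 0 := fun i => by simp [digit]
      have hp : 0 < 3 ^ k c := by positivity
      rw [(h3 c).1, (h3 c).2.1, (h3 c).2.2.1, (h3 c).2.2.2, HC.o1 c 0 hp, HC.o2 c 0 hp, HC.o0 c 0 hp,
        HC.sg c 0 hp]
      simp [hd]
    · intro a ha'; rw [a3] at ha'; rw [ha a (by omega), hm2]; refine hhigh a ?_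
      have : (W₁ + W₂ + 1) * 3 ^ s0 ≤ (W₁ + W₂ + 1 + (W₀ + 1)) * 3 ^ s0 :=
        Nat.mul_le_mul_right _ (by omega)
      omega
    · have := H.gl.pos; omega
    · rw [mlow 0 H.gl.pos, H.gl.m0]
    · rw [szx, lls]; exact HK.inj
    · rw [rowx]; exact hE.join.c
    · rw [szx, lls, lcn]; intro i hi; rw [hPl.cnt i (by omega), hE.tot]
      have : f0 i ∈ J.MK := by rw [hMK]; exact mem_image_of_mem _ (by simpa using hi)
      exact (mem_filter.1 this).1
    · omega
    · rw [rowx, hE.few]; simp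
    · intro hfu; rw [lox, H.n1.lo0 hfu, H.n2.lo0 hfu, hj1 hfu]
    · rw [szx, tbx, a3, ← hal]; exact hend
    · rw [rowx, lox, szx, tbx, lls]; exact hex
    · intro y S hy hN; refine hN.congr ?_ ?_ ?_ ?_ (by omega) mlow
      · rw [lsz, hsz, if_neg hy]
      · rw [llo, hlo, if_neg hy]
      · rw [ltb, htbl, if_neg hy]
      · intro i hi; rw [lls, lcn]; exact hPl.frame y i hy (lt_of_lt_of_le hi (hN.sz_le P.VSn))
  -- the time
  have hTT : 3 ^ K ≤ TT := by
    have := P.time K 0 0 0 0 (by omega) (by omega) (by omega) (by simp)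
    simp only [Nat.sub_zero, zero_add, add_zero, pow_zero, mul_one] at this
    exact (le_mul_of_pos_right _ (by omega)).trans this
  have hKW : K ≤ W := by
    have := P.Kn
    rw [hW, layers]; split_ifs <;> omega
  set X := (W + 1) * ((W + 1) * TT) with hX
  have hX1 : (W + 1) * ((W + 1) * 3 ^ K) ≤ X := Nat.mul_le_mul_left _ (Nat.mul_le_mul_left _ hTT)
  have hX2 : (W + 1) * 3 ^ K ≤ X := (le_mul_of_pos_left _ (by omega)).trans hX1
  have hX3 : W + 1 ≤ (W + 1) * 3 ^ K := le_mul_of_pos_right _ (by positivity)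
  have hXa : (2 * K + 1) * (60 * 3 ^ (K + 2)) ≤ 1080 * X := by
    calc (2 * K + 1) * (60 * 3 ^ (K + 2)) = 540 * ((2 * K + 1) * 3 ^ K) := by ring
      _ ≤ 540 * (2 * (W + 1) * 3 ^ K) :=
        Nat.mul_le_mul_left _ (Nat.mul_le_mul_right _ (by omega))
      _ = 1080 * ((W + 1) * 3 ^ K) := by ring
      _ ≤ _ := Nat.mul_le_mul_left _ hX2
  have hXb : (W₁ + W₂ + 1) * (3 ^ s0 * 6 + 2) ≤ 16 * X := by
    calc (W₁ + W₂ + 1) * (3 ^ s0 * 6 + 2) ≤ (2 * (W + 1)) * (8 * 3 ^ K) :=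
        Nat.mul_le_mul (by omega) (by omega)
      _ = 16 * ((W + 1) * 3 ^ K) := by ring
      _ ≤ _ := Nat.mul_le_mul_left _ hX2
  have hXc : (10 * s0 + 3) * ((W₀ + 1) * 3 ^ s0) ≤ 10 * X := by
    calc (10 * s0 + 3) * ((W₀ + 1) * 3 ^ s0) ≤ (10 * (W + 1)) * ((W + 1) * 3 ^ K) :=
        Nat.mul_le_mul (by omega) (Nat.mul_le_mul (by omega) h3s0)
      _ = 10 * ((W + 1) * ((W + 1) * 3 ^ K)) := by ring
      _ ≤ _ := Nat.mul_le_mul_left _ hX1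
  obtain rfl | rfl : flat = false ∨ flat = true := by cases flat <;> simp
  · refine wp_skip ⟨by simp only; omega, fin s2.v s2.m (fun _ _ => rfl) ⟨_, hwin, ?_, by simp, hwne⟩
      (fun _ _ => rfl) fun _ _ => rfl⟩
    intro j hj y hy; rw [add_assoc]; exact hwt j (by omega) y hy
  · have hfu := (P.cflat rfl).1
    obtain ⟨A', hA', hcard, hemp, hpat⟩ := hwin.exists_flat
    refine (wp_flatten (G := G) (S := S₁ ∪ S₂) (s := s0) (w := W₀ + 1) (x := x) (base := out + j0 * 3 ^ s0)
      (f := f0) ?_ hwx ?_ ?_ ?_ ?_ ?_ (fun j => if j ≤ W₀ then F (j0 + j) else ∅) A' ?_ ?_ hwt).mono ?_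
    · rw [f2 _ (by decide), e1]
    · rw [f2 _ (by decide), f1 _ (by decide), H.hx]
    · rw [htbl, if_pos rfl]
    · rw [f2 _ (by decide), e2]
    · intro i hi; rw [f2 _ (by decide), hpw i hi.le]
    · omega
    · intro j hj
      split_ifs
      · rcases Nat.lt_or_ge (W₁ + W₂) (j0 + j) with hlt | hle
        · rw [hFemp _ hlt]; simp
        · exact (hcells hfu hle).1 rfl
      · simp
    · intro j hj ρ; obtain ⟨ρ', hρ'⟩ := exists_pattern HK.inj ρ
      have key : ∀ D, (∀ i < s0, G.pt (S₁ ∪ S₂) D (f0 i) = ρ i) ↔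
          ∀ v ∈ J.MK, G.pt (S₁ ∪ S₂) D v = ρ' v := by
        intro D; rw [hMK]
        simp only [mem_image, mem_range, forall_exists_index, and_imp,
          forall_apply_eq_imp_iff₂]
        exact forall₂_congr fun i hi => by rw [hρ' i hi]
      simp only [key]; exact hpat j ρ'
    · rintro s3 - f3 ⟨ht3, b3, c3, d3⟩
      refine ⟨by omega, fin s3.v s3.m f3 ⟨A', hA', ?_, fun _ j => ?_, fun hfu' => ?_⟩ b3 c3⟩
      · intro j hj y hy; rw [add_assoc]; exact d3 j (by omega) y hy
      · rw [← hMKc]; exact hcard j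
      · rw [nonempty_iff_ne_empty, ne_eq, hemp, ← ne_eq, ← nonempty_iff_ne_empty]; exact hwne hfu'

end DS

/-! ## Leaves -/

namespace Edges

variable (G : Edges)

/-- The partial solutions at an edge, by size. -/
def leafFam (x j : ℕ) : Finset (Finset ℕ) :=
  ({G.eu x, G.ev x} : Finset ℕ).powerset.filter fun D => (D.filter fun v => G.own v = x).card = j

variable {G} {x : ℕ}

theorem VS_singleton : G.VS {x} = {G.eu x, G.ev x} := by simp [VS]

theorem closed_singleton (hx : x ∈ G.Λ) : G.Closed {x} {G.eu x, G.ev x} where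
  sub := by simpa using hx
  M_sub := by rw [VS_singleton]
  mem v hv hn := absurd (VS_singleton (G := G) ▸ hv) hn

theorem dS_singleton {u : ℕ} (hu : u ∈ ({G.eu x, G.ev x} : Finset ℕ)) : G.dS {x} u = 1 := by
  rw [dS, filter_true_of_mem, Finset.card_singleton]
  intro l hl
  rw [mem_singleton] at hl
  subst hl
  simp only [mem_insert, mem_singleton] at hu
  exact hu.imp Eq.symm Eq.symm

theorem sem_leaf {full flat : Bool} {W : ℕ} (hW : 2 ≤ W) :
    G.Sem full flat {x} {G.eu x, G.ev x} (G.leafFam x) 0 W := by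
  have hown : ∀ D ⊆ ({G.eu x, G.ev x} : Finset ℕ), D ∩ G.Own {x} = D.filter fun v => G.own v = x := by
    intro D hD
    ext v
    simp only [Own, mem_inter, mem_filter, mem_singleton, VS_singleton]
    exact ⟨fun h => ⟨h.1, h.2.2⟩, fun h => ⟨h.1, hD h.1, h.2⟩⟩
  refine ⟨fun j hj => ?_, fun j D hD => ?_, fun D hD => ?_⟩
  · refine filter_eq_empty_iff.2 fun D hD => ?_
    have h1 := card_le_card (mem_powerset.1 hD)
    have h2 := card_le_two (a := G.eu x) (b := G.ev x)
    have h3 := card_filter_le D fun v => G.own v = x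
    omega
  · obtain ⟨h1, h2⟩ := mem_filter.1 hD; rw [mem_powerset] at h1
    refine ⟨⟨by rwa [VS_singleton], fun v hv hn => absurd (VS_singleton (G := G) ▸ hv) hn⟩, ?_⟩
    rw [hown D h1, h2, zero_add]
  · have hsub : D ∩ G.VS {x} ⊆ {G.eu x, G.ev x} := by
      rw [VS_singleton]; exact inter_subset_right
    refine ⟨(D ∩ G.Own {x}).card, by simp, D ∩ G.VS {x}, ?_, fun v hv => ?_, fun _ => rfl⟩
    · refine mem_filter.2 ⟨mem_powerset.2 hsub, ?_⟩
      rw [← hown _ hsub, inter_VS_inter_Own]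
    · exact pt_inter _ _ (by rwa [VS_singleton])

theorem cellv_leaf {R : Type*} [CommRing R] (hne : G.eu x ≠ G.ev x) {f : ℕ → ℕ} (h0 : f 0 = G.eu x)
    (h1 : f 1 = G.ev x) (a c : ℕ) (ha : a = if G.own (G.eu x) = x then 1 else 0)
    (hc : c = if G.own (G.ev x) = x then 1 else 0) (j y : ℕ) :
    cellv (fun _ => loc R) 2 (G.leafFam x j) (fun D i => G.pt {x} D (f i)) y =
      (if 0 = j then loc R (digit y 0) 1 * loc R (digit y 1) 1 else 0) +
      (if a = j then loc R (digit y 0) 0 * loc R (digit y 1) 2 else 0) +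
      (if c = j then loc R (digit y 0) 2 * loc R (digit y 1) 0 else 0) +
      (if a + c = j then loc R (digit y 0) 0 * loc R (digit y 1) 0 else 0) := by
  have hp : ({G.eu x, G.ev x} : Finset ℕ).powerset =
      {∅, {G.eu x}, {G.ev x}, {G.eu x, G.ev x}} := by
    ext D
    simp only [mem_powerset, mem_insert, mem_singleton,
      Finset.subset_insert_iff]
    constructor
    · intro h
      by_cases hu : G.eu x ∈ D <;> by_cases hw : G.ev x ∈ D
      · right; right; right
        refine Finset.Subset.antisymm (fun v hv => ?_) (by simp [Finset.insert_subset_iff, hu, hw])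
        by_cases hvu : v = G.eu x
        · simp [hvu]
        · have := h (mem_erase.2 ⟨hvu, hv⟩)
          simp at this; simp [this]
      · right; left
        refine Finset.Subset.antisymm (fun v hv => ?_) (by simp [hu])
        by_cases hvu : v = G.eu x
        · simp [hvu]
        · have := h (mem_erase.2 ⟨hvu, hv⟩)
          simp at this; subst this; exact absurd hv hw
      · right; right; left
        rw [erase_eq_of_notMem hu] at h; exact Finset.Subset.antisymm h (by simp [hw])
      · left
        rw [erase_eq_of_notMem hu] at h; refine Finset.eq_empty_of_forall_notMem fun v hv => ?_
        have := h hv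
        simp at this; subst this; exact hw hv
    · rintro (rfl | rfl | rfl | rfl) v hv <;> simp at hv ⊢ <;> tauto
  have hd : ∀ D v, G.dom {x} D v ↔ (G.eu x = v ∧ G.ev x ∈ D) ∨ (G.ev x = v ∧ G.eu x ∈ D) := by
    intro D v; simp [dom]
  rw [cellv, leafFam, sum_filter, hp]
  have hne' := hne.symm
  rw [sum_insert, sum_insert, sum_insert, Finset.sum_singleton]
  · simp only [prod_range_succ, Finset.prod_range_zero, one_mul, h0, h1, pt, hd]
    have e0 : ((∅ : Finset ℕ).filter fun v => G.own v = x).card = 0 := by simp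
    have e1 : (({G.eu x} : Finset ℕ).filter fun v => G.own v = x).card = a := by
      rw [ha, filter_singleton]; split_ifs <;> simp
    have e2 : (({G.ev x} : Finset ℕ).filter fun v => G.own v = x).card = c := by
      rw [hc, filter_singleton]; split_ifs <;> simp
    have e3 : (({G.eu x, G.ev x} : Finset ℕ).filter fun v => G.own v = x).card = a + c := by
      rw [← e1, ← e2, ← card_union_of_disjoint, ← filter_union]
      · rfl
      · exact disjoint_filter_filter (by simpa using hne)
    rw [e0, e1, e2, e3]; simp [hne, hne', add_assoc]
  · simp only [mem_singleton]; intro h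
    have : G.eu x ∈ ({G.eu x, G.ev x} : Finset ℕ) := by simp
    rw [← h] at this; simp [hne] at this
  · simp only [mem_insert, mem_singleton, not_or, Finset.singleton_inj]; refine ⟨hne, fun h => ?_⟩
    have : G.ev x ∈ ({G.eu x, G.ev x} : Finset ℕ) := by simp
    rw [← h] at this; simp [hne'] at this
  · simp only [mem_insert, mem_singleton, not_or]
    refine ⟨(singleton_ne_empty _).symm, (singleton_ne_empty _).symm, fun h => ?_⟩
    have : G.ev x ∈ ({G.eu x, G.ev x} : Finset ℕ) := by simp
    rw [← h] at this; simp at this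

end Edges

namespace DS

open Env HProg

variable {E : Env} {h : HState E.b} {G : Edges} {full flat : Bool} {n K TT x : ℕ}

theorem wp_leafList {U W : ℕ} (hx : h.v .x 0 = x) (hn : h.v .nn 0 = n) (hxN : x < E.inp 1)
    (hU : E.inp (4 * x + 4) = U) (hW : E.inp (4 * x + 5) = W) :
    E.wp leafList h fun s => s.m = h.m ∧ s.t = h.t + 11 ∧
      (∀ y, s.v .tbl y = if y = x then h.v .alloc 0 else h.v .tbl y) ∧
      (∀ y, s.v .lo y = if y = x then 0 else h.v .lo y) ∧
      (∀ y, s.v .sz y = if y = x then 2 else h.v .sz y) ∧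
      (∀ i, s.v .lst i = if i = x * n + 1 then W else if i = x * n then U else h.v .lst i) ∧
      (∀ i, s.v .cnt i = if i = x * n + 1 then 1 else if i = x * n then 1 else h.v .cnt i) ∧
      s.v .lu 0 = 9 * (if h.v .own U = x then 1 else 0) ∧
      s.v .lw 0 = 9 * (if h.v .own W = x then 1 else 0) := by
  have hB := E.hB
  have h9 : ∀ o, 9 - 9 * ((o - x) + (x - o)) = 9 * (if o = x then 1 else 0) := by
    intro o; split_ifs <;> omega
  refine wp_read_seq (wp_read_seq (wp_set_seq (wp_set_seq (wp_set_seq (wp_set_seq (wp_set_seq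
    (wp_set_seq (wp_set_seq (wp_set_seq (wp_set ?_ ?_) ?_) ?_) ?_) ?_) ?_) ?_) ?_) ?_) ?_) ?_
  · intro _; exact lt_of_le_of_lt (sub_le _ _) (by simp; omega)
  · simp [hx, hn, hU, hW, h9, update_apply]
  · intro _; exact lt_of_le_of_lt (sub_le _ _) (by simp; omega)
  · intro _; simp; omega
  · intro _; simp; omega
  · exact fun hb => hb _ _
  · exact fun hb => hb _ _
  · intro _; simp; omega
  · intro _; simp; omega
  · exact fun hb => hb _ _
  · simp [hx]; omega
  · simp [hx]; omega

theorem wp_leafCells {A a c : ℕ} (hA : h.v .alloc 0 = A) (hu : h.v .lu 0 = 9 * a)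
    (hw : h.v .lw 0 = 9 * c) (h0 : ∀ i, A ≤ i → h.m i = 0) :
    E.wp leafCells h fun s => s.t = h.t + 7 ∧ (∀ i < A, s.m i = h.m i) ∧
      ∀ j, ∀ y < 9, s.m (A + j * 9 + y) =
        (if 0 = j then loc (ZMod (2 ^ E.b)) (digit y 0) 1 * loc _ (digit y 1) 1 else 0) +
        (if a = j then loc (ZMod (2 ^ E.b)) (digit y 0) 0 * loc _ (digit y 1) 2 else 0) +
        (if c = j then loc (ZMod (2 ^ E.b)) (digit y 0) 2 * loc _ (digit y 1) 0 else 0) +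
        (if a + c = j then loc (ZMod (2 ^ E.b)) (digit y 0) 0 * loc _ (digit y 1) 0 else 0) := by
  refine wp_setN_seq (wp_setN_seq (wp_setN_seq (wp_setN_seq (wp_setN_seq (wp_setN_seq (wp_setN
    ⟨rfl, fun i hi => ?_, fun j y hy => ?_⟩))))))
  · simp only [eval_add, eval_arr, eval_lit, eval_ofNat, hA]
    iterate 7 rw [update_of_ne (by omega)]
  · have key : ∀ l y0, y0 < 9 → (A + j * 9 + y = A + 9 * l + y0 ↔ l = j ∧ y = y0) := by
      intro l y0 h0; omega
    have k0 : ∀ y0, y0 < 9 → (A + j * 9 + y = A + y0 ↔ 0 = j ∧ y = y0) := by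
      intro y0 h0; omega
    have k1 : A + j * 9 + y = A + 9 * a + 9 * c ↔ a + c = j ∧ y = 0 := by omega
    have hz : h.m (A + j * 9 + y) = 0 := h0 _ (by omega)
    simp only [eval_add, eval_arr, eval_lit, eval_ofNat, hA, hu, hw,
      update_apply, key _ 6 (by norm_num), key _ 2 (by norm_num), k0 4 (by norm_num),
      k0 5 (by norm_num), k0 7 (by norm_num), k0 8 (by norm_num), k1, hz, Nat.cast_one]
    have hd : ∀ y i, digit y i = ⟨y / 3 ^ i % 3, mod_lt _ (by norm_num)⟩ := fun _ _ => rfl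
    clear hz key k0 k1
    interval_cases y <;> simp [hd, loc]

theorem wp_leaf {P : Par E G full flat n K TT} (gl : Glob G n h.v h.m) (hx : h.v .x 0 = x)
    (hxΛ : x ∈ G.Λ) (hxN : x < E.inp 1) (hU : E.inp (4 * x + 4) = G.eu x)
    (hW : E.inp (4 * x + 5) = G.ev x) (hne : G.eu x ≠ G.ev x)
    (hown : ∀ u ∈ ({G.eu x, G.ev x} : Finset ℕ), h.v .own u = G.own u)
    (hroom : h.v .alloc 0 + room full n K < E.B) :
    E.wp (leaf full) h fun s =>
      s.t ≤ h.t + 1200 * ((layers full n K + 1) * ((layers full n K + 1) * TT)) ∧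
      Glob G n s.v s.m ∧ NodeOk G full flat n K s.v s.m {x} x ∧
      h.v .alloc 0 ≤ s.v .alloc 0 ∧ s.v .alloc 0 ≤ h.v .alloc 0 + room full n K ∧
      ∀ y S, y ≠ x → NodeOk G full flat n K h.v h.m S y → NodeOk G full flat n K s.v s.m S y := by
  have hK2 := P.K2
  have hKn := P.Kn
  set W := layers full n 2 with hWdef
  have hW2 : 2 ≤ W := by rw [hWdef, layers]; split_ifs <;> omega
  have hr : 9 * (W + 1) ≤ room full n K := by
    have h1 : W ≤ layers full n K := layers_mono hK2
    have h2 : 3 ^ 2 ≤ 3 ^ K := pow_le_pow_right (by norm_num) hK2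
    have h3 : (W + 1) * 3 ^ 2 ≤ (3 * layers full n K + 2) * 3 ^ K := Nat.mul_le_mul (by omega) h2
    rw [room]; omega
  refine wp_seq ((wp_leafList hx gl.nn hxN hU hW).mono ?_)
  rintro s1 - f1 ⟨hm1, ht1, a1, a2, a3, a4, a5, a6, a7⟩
  rw [hown _ (by simp)] at a6 a7
  refine wp_seq ((wp_leafCells (A := h.v .alloc 0) (by rw [f1 _ (by decide)]) a6 a7
    (by rw [hm1]; exact gl.zero)).mono ?_)
  rintro s2 - f2 ⟨ht2, b1, b2⟩
  have g : ∀ y ∉ leafList.mods, s2.v y = h.v y := fun y hy => by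
    rw [f2 y (by simp [leafCells, mods]), f1 y hy]
  have hv2 : s2.v = s1.v := funext fun y => f2 y (by simp [leafCells, mods])
  have e1 : HExp.eval s2.v (sc .alloc + 9 * (width full .x + 1)) = h.v .alloc 0 + 9 * (W + 1) := by
    simp [eval_width, hv2, f1 .alloc (by decide), f1 .x (by decide), f1 .nn (by decide), hx, gl.nn, a3,
      hWdef]
  refine wp_set (fun _ => by rw [e1]; omega) ?_
  rw [e1]
  simp only [eval_lit]
  set v3 := upd s2.v .alloc 0 (h.v .alloc 0 + 9 * (W + 1)) with hv3
  have g3 : ∀ y ∉ leafList.mods, y ≠ .alloc → v3 y = h.v y := fun y hy hy' => by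
    rw [hv3, upd_ne _ hy', g y hy]
  have al : v3 .alloc 0 = h.v .alloc 0 + 9 * (W + 1) := by simp [hv3]
  have q1 : v3 .tbl = s1.v .tbl := by rw [hv3, upd_ne _ (by simp), hv2]
  have q2 : v3 .lo = s1.v .lo := by rw [hv3, upd_ne _ (by simp), hv2]
  have q3 : v3 .sz = s1.v .sz := by rw [hv3, upd_ne _ (by simp), hv2]
  have q4 : v3 .lst = s1.v .lst := by rw [hv3, upd_ne _ (by simp), hv2]
  have q5 : v3 .cnt = s1.v .cnt := by rw [hv3, upd_ne _ (by simp), hv2]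
  have szx : v3 .sz x = 2 := by rw [q3, a3, if_pos rfl]
  have l0 : v3 .lst (x * n + 0) = G.eu x := by rw [q4, a4]; simp
  have l1 : v3 .lst (x * n + 1) = G.ev x := by rw [q4, a4]; simp
  have hrow : rowSet n v3 x = {G.eu x, G.ev x} := by
    rw [rowSet, szx, ← l0, ← l1]; simp [range_add_one, Finset.pair_comm]
  have tbx : v3 .tbl x = h.v .alloc 0 := by rw [q1, a1, if_pos rfl]
  have lox : v3 .lo x = 0 := by rw [q2, a2, if_pos rfl]
  have mlow : ∀ i < h.v .alloc 0, s2.m i = h.m i := fun i hi => by rw [b1 i hi, hm1]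
  have hcell : ∀ j, ∀ y < 9, s2.m (h.v .alloc 0 + j * 9 + y) =
      cellv (fun _ => loc (ZMod (2 ^ E.b))) 2 (G.leafFam x j)
        (fun D i => G.pt {x} D (v3 .lst (x * n + i))) y := fun j y hy => by
    rw [b2 j y hy, Edges.cellv_leaf hne l0 l1 _ _ rfl rfl]
  have hTT : 1 ≤ TT := by
    have := P.time 0 0 0 0 0 (by omega) (by omega) (by omega) (by simp)
    simp only [Nat.sub_zero, add_zero, pow_zero, one_mul] at this; omega
  have hX : 1 ≤ (layers full n K + 1) * ((layers full n K + 1) * TT) :=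
    Nat.mul_pos (by omega) (Nat.mul_pos (by omega) hTT)
  have hrowne : ∀ y i, y ≠ x → i < n → v3 .lst (y * n + i) = h.v .lst (y * n + i) ∧
      v3 .cnt (y * n + i) = h.v .cnt (y * n + i) := by
    intro y i hy hi
    have n1 := row_ne (p := 1) hy hi (by omega)
    have n2 := row_ne (p := 0) hy hi (by omega)
    rw [add_zero] at n2; rw [q4, q5, a4, a5, if_neg n1, if_neg n2, if_neg n1, if_neg n2]
    exact ⟨rfl, rfl⟩
  refine ⟨by omega, ⟨?_, ?_, ?_, ?_, ?_, ?_, ?_⟩, ⟨?_, ?_, ?_, by omega, ?_, fun _ => lox, ?_,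
    G.leafFam x, ?_, ?_, ?_, ?_⟩, by rw [al]; omega, by rw [al]; omega, ?_⟩
  · rw [g3 _ (by decide) (by decide), gl.nn]
  · intro u hu; rw [g3 _ (by decide) (by decide), gl.deg u hu]
  · intro u; rw [g3 _ (by decide) (by decide), gl.mark]
  · intro c
    have : ∀ c, v3 (.o1 c) = h.v (.o1 c) ∧ v3 (.o2 c) = h.v (.o2 c) ∧ v3 (.o0 c) = h.v (.o0 c) ∧
        v3 (.sg c) = h.v (.sg c) := by
      intro c; refine ⟨g3 _ ?_ ?_, g3 _ ?_ ?_, g3 _ ?_ ?_, g3 _ ?_ ?_⟩ <;> cases c <;> decide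
    rw [(this c).1, (this c).2.1, (this c).2.2.1, (this c).2.2.2]; exact gl.o c
  · intro i hi; rw [al] at hi
    have e : i = h.v .alloc 0 + (i - h.v .alloc 0) / 9 * 9 + (i - h.v .alloc 0) % 9 := by omega
    rw [e, hcell _ _ (mod_lt _ (by norm_num)),
      (Edges.sem_leaf (full := full) (flat := flat) (G := G) (x := x) hW2).empty _ (by omega)]
    simp [cellv]
  · rw [al]; have := gl.pos; omega
  · rw [mlow 0 gl.pos, gl.m0]
  · rw [szx]; intro i hi j hj hij; simp only [coe_range, Set.mem_Iio] at hi hj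
    interval_cases i <;> interval_cases j <;> simp_all
  · rw [hrow]; exact Edges.closed_singleton hxΛ
  · rw [szx]; intro i hi
    have : v3 .lst (x * n + i) ∈ ({G.eu x, G.ev x} : Finset ℕ) := by
      rw [← hrow, rowSet, szx]; exact mem_image_of_mem _ (by simpa using hi)
    rw [Edges.dS_singleton this, q5, a5]
    interval_cases i <;> simp
  · exact (card_filter_le _ _).trans (by rw [hrow]; exact card_le_two)
  · rw [szx, tbx, al, ← hWdef]; omega
  · rw [hrow, lox, szx]; exact Edges.sem_leaf hW2
  · rw [szx, tbx]; intro j _ y hy; exact hcell j y (by simpa using hy)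
  · intro _ j; rw [szx]; refine (card_filter_le _ _).trans ?_; rw [card_powerset]
    exact (pow_le_pow_right (by norm_num) card_le_two).trans (by norm_num)
  · exact fun _ => ⟨∅, by simp [Edges.leafFam]⟩
  · intro y S hy hN
    refine hN.congr ?_ ?_ ?_ (fun i hi => hrowne y i hy (lt_of_lt_of_le hi (hN.sz_le P.VSn))) (by rw [al]; omega) mlow
    · rw [q3, a3, if_neg hy]
    · rw [q2, a2, if_neg hy]
    · rw [q1, a1, if_neg hy]

end DS

/-! ## Reading the edges -/

namespace DS

open Env HProg

variable {E : Env} {h : HState E.b}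

theorem wp_touch {a : Nm} (ha : a = .u ∨ a = .w) {u x : ℕ} (hu : h.v a 0 = u) (hx : h.v .x 0 = x)
    (h1 : h.v .noniso 0 + 1 < E.B) (h2 : h.v .deg u + 1 < E.B) :
    E.wp (touch a) h fun s => s.m = h.m ∧ s.t ≤ h.t + 4 ∧
      s.v .deg = update (h.v .deg) u (h.v .deg u + 1) ∧
      s.v .own = update (h.v .own) u x ∧
      s.v .noniso 0 = h.v .noniso 0 + if h.v .deg u = 0 then 1 else 0 := by
  refine wp_seq (wp_ite (fun h0 => wp_skip (wp_set_seq (wp_set ?_ ?_) ?_)) fun h0 =>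
    wp_set (fun _ => by simpa using h1) (wp_set_seq (wp_set ?_ ?_) ?_))
  all_goals rcases ha with rfl | rfl
  all_goals simp [hu] at h0
  all_goals simp [hu, hx, h0, h2]
  all_goals first | (intro hb; have := hb .x 0; simpa [hx] using this) | omega

theorem wp_scan {G : Edges} {N : ℕ} (hN : h.v .nN 0 = N) (hNi : E.inp 1 = N)
    (hΛ : ∀ x, x ∈ G.Λ ↔ x < N ∧ E.inp (4 * x + 2) = 1) (hty : ∀ x < N, 1 ≤ E.inp (4 * x + 2))
    (hU : ∀ x ∈ G.Λ, E.inp (4 * x + 4) = G.eu x ∧ E.inp (4 * x + 5) = G.ev x ∧ G.eu x ≠ G.ev x)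
    (hc : 2 * N + 2 < E.B) (h0 : ∀ u, h.v .deg u = 0) (h1 : h.v .noniso 0 = 0) :
    E.wp scan h fun s => s.m = h.m ∧ s.t ≤ h.t + 20 * N + 1 ∧ (∀ u, s.v .deg u = G.dS G.Λ u) ∧
      (∀ u ∈ G.VS G.Λ, s.v .own u ∈ G.Λ ∧ G.inc (s.v .own u) u) ∧
      s.v .noniso 0 = (G.VS G.Λ).card ∧ (G.Λ.Nonempty → s.v .root 0 ∈ G.Λ) := by
  let L : ℕ → Finset ℕ := fun j => G.Λ.filter (· < j)
  have hLN : L N = G.Λ := filter_true_of_mem fun x hx => ((hΛ x).1 hx).1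
  have hLc : ∀ j, j ≤ N → (L j).card ≤ N := fun j hj => by
    refine (card_le_card (t := range N) fun x hx => ?_).trans (by simp)
    have := (mem_filter.1 hx).2
    simp; omega
  have hVc : ∀ j, j ≤ N → (G.VS (L j)).card ≤ 2 * N := fun j hj => by
    refine (card_biUnion_le_card_mul _ _ 2 fun _ _ => card_le_two).trans ?_
    have := hLc j hj; omega
  refine wp_for N 19 (fun j v m => m = h.m ∧ (∀ u, v .deg u = G.dS (L j) u) ∧
    (∀ u ∈ G.VS (L j), v .own u ∈ G.Λ ∧ G.inc (v .own u) u) ∧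
    v .noniso 0 = (G.VS (L j)).card ∧ ((L j).Nonempty → v .root 0 ∈ G.Λ)) hN ?_ ?_ ?_
  · have : L 0 = ∅ := by simp [L]
    refine ⟨rfl, ?_⟩
    simp [this, h0, h1, Edges.dS, Edges.VS]
  · intro j hj s f hi ⟨hm, hd, ho, hn, hr⟩
    refine wp_read_seq (wp_ite (fun hne => wp_skip ?_) fun heq => ?_) (by simp [hi]; omega)
    · have hL : L (j + 1) = L j := by
        ext x
        simp only [L, mem_filter, lt_succ_iff_lt_or_eq]
        refine ⟨fun hx => ⟨hx.1, hx.2.resolve_right ?_⟩, fun hx => ⟨hx.1, .inl hx.2⟩⟩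
        rintro rfl
        have := ((hΛ x).1 hx.1).2
        simp [hi, this] at hne
      refine ⟨by simp only; omega, hm, ?_⟩
      rw [hL]; simpa using ⟨hd, ho, hn, hr⟩
    · have hjΛ : j ∈ G.Λ := (hΛ j).2 ⟨hj, by have := hty j hj; simp [hi] at heq; omega⟩
      obtain ⟨e1, e2, hne⟩ := hU j hjΛ
      refine wp_read_seq (wp_read_seq
        (wp_seq ((wp_touch (u := G.eu j) (x := j) (.inl rfl) ?_ ?_ ?_ ?_).mono ?_)) ?_) ?_
      · simp [hi, e1]
      · simp [hi]
      · have := hVc j hj.le; simp [hn]; omega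
      · have := (Edges.dS_le_card (G := G) (S := L j) (u := G.eu j)).trans (hLc j hj.le)
        simp [hd]; omega
      · rintro s1 - f1 ⟨m1, t1, d1, o1, n1⟩
        simp only [upd_ne, ne_eq, reduceCtorEq, not_false_eq_true] at d1 o1 n1
        have hjL : j ∉ L j := by simp [L]
        have hL : L (j + 1) = {j} ∪ L j := by
          ext x
          simp only [L, mem_filter, lt_succ_iff_lt_or_eq, mem_union, mem_singleton]
          constructor
          · rintro ⟨hx, hlt | rfl⟩ <;> simp_all
          · rintro (rfl | hx)
            · exact ⟨hjΛ, .inr rfl⟩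
            · exact ⟨hx.1, .inl hx.2⟩
        have hz : ∀ u, G.dS (L j) u = 0 ↔ u ∉ G.VS (L j) := by
          refine fun u => ⟨fun h hu => ?_, Edges.dS_eq_zero⟩
          obtain ⟨l, hl, hi⟩ := G.mem_VS.1 hu; rw [Edges.dS, card_eq_zero, filter_eq_empty_iff] at h
          exact h hl hi
        have hdj : ∀ u, G.dS (L (j + 1)) u = (if u = G.eu j ∨ u = G.ev j then 1 else 0) + G.dS (L j) u := by
          intro u; rw [hL, Edges.dS_union (by simpa using hjL)]
          congr 1
          rw [Edges.dS, filter_singleton]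
          have : G.inc j u ↔ u = G.eu j ∨ u = G.ev j := or_congr eq_comm eq_comm
          simp only [this]
          split_ifs <;> simp
        have hnc : (G.VS (L (j + 1))).card = (G.VS (L j)).card + (if G.dS (L j) (G.eu j) = 0 then 1 else 0) +
            if G.dS (L j) (G.ev j) = 0 then 1 else 0 := by
          rw [hL, G.VS_union, Edges.VS_singleton, Finset.insert_union, card_insert_eq_ite,
            Finset.singleton_union, card_insert_eq_ite]
          simp only [mem_insert, hne, false_or, hz]
          split_ifs <;> omega
        have hV2 := hVc (j + 1) hj
        have gw : s1.v .w 0 = G.ev j := by rw [f1 _ (by decide)]; simp [hi, e2]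
        have gx : s1.v .x 0 = j := by rw [f1 _ (by decide)]; simp [hi]
        have gd : s1.v .deg (G.ev j) = G.dS (L j) (G.ev j) := by
          rw [d1, update_of_ne hne.symm, hd]
        refine wp_seq ((wp_touch (u := G.ev j) (x := j) (.inr rfl) gw gx ?_ ?_).mono ?_)
        · rw [n1, hn, hd]
          have := hVc j hj.le
          split_ifs <;> omega
        · have := (Edges.dS_le_card (G := G) (S := L j) (u := G.ev j)).trans (hLc j hj.le)
          rw [gd]; omega
        · rintro s2 - f2 ⟨m2, t2, d2, o2, n2⟩
          refine wp_set (fun hb => hb _ _) ⟨?_, ?_, ?_, ?_, ?_, ?_⟩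
          · simp only at t1 ⊢; omega
          · simp only at m1 ⊢; rw [m2, m1, hm]
          · intro u
            simp only [upd_ne, ne_eq, reduceCtorEq, not_false_eq_true, eval_lit, d2, d1, hd, hdj,
              update_apply]
            by_cases ha : u = G.eu j <;> by_cases hb : u = G.ev j <;> simp_all [add_comm]
          · intro u hu
            simp only [upd_ne, ne_eq, reduceCtorEq, not_false_eq_true, eval_lit, o2, o1,
              update_apply]
            split_ifs with ha hb
            · exact ⟨hjΛ, .inr ha.symm⟩
            · exact ⟨hjΛ, .inl hb.symm⟩
            · refine ho u ?_
              rw [hL, G.VS_union, Edges.VS_singleton] at hu; simpa [ha, hb] using hu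
          · simp only [upd_ne, ne_eq, reduceCtorEq, not_false_eq_true, eval_lit, n2, n1, hn, hnc, gd, hd]
          · intro _
            have : s2.v .x 0 = j := by rw [f2 _ (by decide), gx]
            simpa [this] using hjΛ
      · simp [hi]; omega
      · simp [hi]; omega
  · intro s f hi ⟨hm, hd, ho, hn, hr⟩ ht; rw [hLN] at hd ho hn hr
    exact ⟨hm, by omega, hd, ho, hn, hr⟩

end DS

/-! ## Breadth first search -/

/-- The list of neighbours of a node. -/
def slots (inp : ℕ → ℕ) (x : ℕ) : List ℕ :=
  if inp (4 * x + 2) = 1 then [inp (4 * x + 3)]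
  else [inp (4 * x + 3), inp (4 * x + 4), inp (4 * x + 5)]

/-- The input describes a tree with root `r`, parents `p`, and heights `rank`. -/
structure RTree (inp : ℕ → ℕ) (N r : ℕ) (p rank : ℕ → ℕ) : Prop where
  rN : r < N
  pr : p r = N
  out : ∀ x, N ≤ x → p x = N
  par : ∀ x < N, x ≠ r → p x < N ∧ rank (p x) < rank x
  ty : ∀ x < N, inp (4 * x + 2) = 1 ∨ inp (4 * x + 2) = 3
  tyr : inp (4 * r + 2) = 1
  nodup : ∀ x < N, (slots inp x).Nodup
  nb : ∀ x < N, ∀ y, y ∈ slots inp x ↔ y < N ∧ ((y ≠ r ∧ p y = x) ∨ (x ≠ r ∧ y = p x))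

/-- The children of a node. -/
def children (inp p : ℕ → ℕ) (x : ℕ) : List ℕ := (slots inp x).filter (· ≠ p x)

/-- The leaves below a node. -/
noncomputable def below (Λ : Finset ℕ) (p : ℕ → ℕ) (r x : ℕ) : Finset ℕ :=
  open Classical in if x = r then {r} else Λ.filter fun l => ∃ k, p^[k] l = x

namespace RTree

variable {inp : ℕ → ℕ} {N r : ℕ} {p rank : ℕ → ℕ} (H : RTree inp N r p rank)
include H

theorem mem_children {x y : ℕ} (hx : x < N) :
    y ∈ children inp p x ↔ y < N ∧ y ≠ r ∧ p y = x := by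
  simp only [children, List.mem_filter, H.nb x hx, ne_eq, decide_not, Bool.not_eq_eq_eq_not,
    Bool.not_true, decide_eq_false_iff_not]
  constructor
  · rintro ⟨⟨hy, h | h⟩, hne⟩
    · exact ⟨hy, h⟩
    · exact absurd h.2 hne
  · rintro ⟨hy, hr, rfl⟩
    refine ⟨⟨hy, .inl ⟨hr, rfl⟩⟩, fun h => ?_⟩
    have h1 := H.par y hy hr
    by_cases hx : p y = r
    · rw [hx, H.pr] at h; omega
    · have h2 := H.par _ h1.1 hx
      rw [← h] at h2; omega

theorem children_nodup {x : ℕ} (hx : x < N) : (children inp p x).Nodup := (H.nodup x hx).filter _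

theorem children_inner {x : ℕ} (hx : x < N) (hty : inp (4 * x + 2) = 3) :
    ∃ a b, a ≠ b ∧ children inp p x = [a, b] := by
  have hr : x ≠ r := by rintro rfl; have := H.tyr; omega
  have hp : p x ∈ slots inp x := (H.nb x hx _).2 ⟨(H.par x hx hr).1, .inr ⟨hr, rfl⟩⟩
  have h2 : (children inp p x).length = 2 := by
    have : children inp p x = (slots inp x).erase (p x) := by
      rw [(H.nodup x hx).erase_eq_filter]; exact List.filter_congr fun y _ => by simp [bne, BEq.beq]
    rw [this, List.length_erase_of_mem hp, slots, if_neg (by omega)]; rfl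
  obtain ⟨a, b, hab⟩ := List.length_eq_two.1 h2
  have := H.children_nodup hx
  rw [hab] at this
  exact ⟨a, b, by simpa using this, hab⟩

theorem children_leaf {x : ℕ} (hx : x < N) (hr : x ≠ r) (hty : inp (4 * x + 2) = 1) :
    children inp p x = [] := by
  have hp : p x ∈ slots inp x := (H.nb x hx _).2 ⟨(H.par x hx hr).1, .inr ⟨hr, rfl⟩⟩
  rw [slots, if_pos hty, List.mem_singleton] at hp
  rw [children, slots, if_pos hty, ← hp]; simp

theorem children_root : ∃ c, children inp p r = [c] := by
  have hs : slots inp r = [inp (4 * r + 3)] := by rw [slots, if_pos H.tyr]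
  have h1 := ((H.nb r H.rN (inp (4 * r + 3))).1 (by rw [hs]; simp)).1
  refine ⟨_, by rw [children, hs, List.filter_cons_of_pos (by simp [H.pr]; omega)]; rfl⟩

theorem of_parent {y x : ℕ} (h : p y = x) (hx : x < N) : y < N ∧ y ≠ r :=
  ⟨by by_contra hy; have := H.out y (by omega); omega, by rintro rfl; have := H.pr; omega⟩

theorem of_iterate {k y : ℕ} (h : p^[k] y < N) : y < N ∧ rank (p^[k] y) + k ≤ rank y := by
  induction k generalizing y with
  | zero => exact ⟨h, by simp⟩
  | succ k ih =>
    rw [iterate_succ_apply] at h ⊢; obtain ⟨h1, h2⟩ := ih h; obtain ⟨h3, h4⟩ := H.of_parent rfl h1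
    have := (H.par y h3 h4).2
    exact ⟨h3, by omega⟩

theorem iterate_inj {i j y a b : ℕ} (hij : i ≤ j) (ha : p^[i] y = a) (hb : p^[j] y = b)
    (hab : p a = p b) (hA : a < N) (hr : a ≠ r) : a = b := by
  obtain ⟨d, rfl⟩ := exists_eq_add_of_le hij
  rw [Nat.add_comm, Function.iterate_add_apply, ha] at hb
  cases d with
  | zero => exact hb
  | succ d =>
    exfalso
    rw [iterate_succ_apply, hab] at hb; obtain ⟨h1, h2⟩ := H.par a hA hr; rw [hab] at h1
    by_cases hbN : b < N
    · have h3 := H.of_iterate (y := p b) (k := d) (by omega)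
      have hbr : b ≠ r := by rintro rfl; have := H.pr; omega
      have := (H.par b hbN hbr).2
      rw [hb] at h3; omega
    · have := H.out b (by omega); omega

variable {Λ : Finset ℕ} (hΛ : ∀ x, x ∈ Λ ↔ x < N ∧ inp (4 * x + 2) = 1)
include hΛ

omit H hΛ in
theorem mem_below {x l : ℕ} (hx : x ≠ r) : l ∈ below Λ p r x ↔ l ∈ Λ ∧ ∃ k, p^[k] l = x := by
  classical
  rw [below, if_neg hx, mem_filter]

theorem below_inner {x a b : ℕ} (hx : x < N) (hty : inp (4 * x + 2) = 3)
    (hab : children inp p x = [a, b]) : below Λ p r x = below Λ p r a ∪ below Λ p r b ∧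
      Disjoint (below Λ p r a) (below Λ p r b) := by
  have hr : x ≠ r := by rintro rfl; have := H.tyr; omega
  have hch := fun y => H.mem_children (y := y) hx
  have hnd := H.children_nodup hx
  rw [hab] at hch hnd
  obtain ⟨a1, a2, a3⟩ := (hch a).1 (by simp)
  obtain ⟨b1, b2, b3⟩ := (hch b).1 (by simp)
  constructor
  · ext l
    rw [mem_union, mem_below hr, mem_below a2, mem_below b2, ← and_or_left]
    refine and_congr_right fun hl => ⟨?_, ?_⟩
    · rintro ⟨k, hk⟩
      cases k with
      | zero => have := ((hΛ l).1 hl).2; simp at hk; rw [hk] at this; omega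
      | succ k =>
        rw [iterate_succ_apply'] at hk
        have h1 := H.of_parent hk hx
        have := (hch _).2 ⟨h1.1, h1.2, hk⟩
        simp only [List.mem_cons, List.not_mem_nil, or_false] at this
        exact this.imp (fun h => ⟨k, h⟩) fun h => ⟨k, h⟩
    · rintro (⟨k, hk⟩ | ⟨k, hk⟩) <;> exact ⟨k + 1, by rw [iterate_succ_apply', hk]; assumption⟩
  · rw [disjoint_left]; intro l hla hlb; obtain ⟨-, i, hi⟩ := (mem_below a2).1 hla
    obtain ⟨-, j, hj⟩ := (mem_below b2).1 hlb
    have : a = b := by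
      rcases le_total i j with hij | hij
      · exact H.iterate_inj hij hi hj (a3.trans b3.symm) a1 a2
      · exact (H.iterate_inj hij hj hi (b3.trans a3.symm) b1 b2).symm
    simp [this] at hnd

theorem below_leaf {x : ℕ} (hx : x ∈ Λ) : below Λ p r x = {x} := by
  classical
  by_cases hr : x = r
  · rw [below, if_pos hr, hr]
  obtain ⟨h1, h2⟩ := (hΛ x).1 hx
  ext l
  rw [mem_below hr, mem_singleton]
  refine ⟨?_, by rintro rfl; exact ⟨hx, 0, rfl⟩⟩
  rintro ⟨hl, k, hk⟩
  cases k with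
  | zero => exact hk
  | succ k =>
    rw [iterate_succ_apply'] at hk
    have h3 := H.of_parent hk h1
    have := (H.mem_children h1).2 ⟨h3.1, h3.2, hk⟩
    rw [H.children_leaf h1 hr h2] at this; simp at this

theorem below_root {c : ℕ} (hc : children inp p r = [c]) :
    below Λ p r r ∪ below Λ p r c = Λ ∧ Disjoint (below Λ p r r) (below Λ p r c) := by
  classical
  have hrΛ : r ∈ Λ := (hΛ r).2 ⟨H.rN, H.tyr⟩
  have hch := fun y => H.mem_children (y := y) H.rN
  rw [hc] at hch
  obtain ⟨c1, c2, c3⟩ := (hch c).1 (by simp)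
  have hreach : ∀ m y, rank y ≤ m → y < N → y ≠ r → ∃ k, p^[k] y = c := by
    intro m
    induction m with
    | zero => intro y h1 h2 h3; have := (H.par y h2 h3).2; omega
    | succ m ih =>
      intro y h1 h2 h3; obtain ⟨h4, h5⟩ := H.par y h2 h3
      by_cases hp : p y = r
      · exact ⟨0, by simpa using (hch y).2 ⟨h2, h3, hp⟩⟩
      · obtain ⟨k, hk⟩ := ih (p y) (by omega) h4 hp; exact ⟨k + 1, hk⟩
  rw [H.below_leaf hΛ hrΛ]
  constructor
  · ext l
    rw [mem_union, mem_singleton, mem_below c2]; refine ⟨?_, fun hl => ?_⟩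
    · rintro (rfl | h); exacts [hrΛ, h.1]
    · by_cases hlr : l = r
      · exact .inl hlr
      · exact .inr ⟨hl, hreach _ l le_rfl ((hΛ l).1 hl).1 hlr⟩
  · rw [Finset.disjoint_singleton_left, mem_below c2]
    rintro ⟨-, k, hk⟩
    cases k with
    | zero => exact c2 hk.symm
    | succ k =>
      rw [iterate_succ_apply, H.pr] at hk
      have := (H.of_iterate (y := N) (k := k) (by omega)).1
      omega

end RTree

namespace DS

open Env HProg

variable {E : Env} {h : HState E.b} {N r : ℕ} {p rank : ℕ → ℕ}

/-- The queue. -/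
structure Queue (p : ℕ → ℕ) (Q : List ℕ) (v : Store) : Prop where
  tail : v .tail 0 = Q.length
  ord : ∀ i x, Q[i]? = some x → v .ord i = x
  par : ∀ y ∈ Q, v .par y = p y

theorem wp_slot {Q : List ℕ} {e : HExp} {k x : ℕ} (he : ∀ v, e.eval v = k) (hk : k ≤ 5)
    (hQ : Queue p Q h.v) (hx : h.v .x 0 = x) (hxQ : x ∈ Q) (hxN : x < E.inp 1)
    (hy : E.inp (4 * x + k) ≠ p x → p (E.inp (4 * x + k)) = x) (hB : Q.length + 1 < E.B) :
    E.wp (slot e) h fun s => s.m = h.m ∧ s.t ≤ h.t + 5 ∧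
      Queue p (Q ++ [E.inp (4 * x + k)].filter (· ≠ p x)) s.v := by
  set y := E.inp (4 * x + k) with hyd
  have e1 : (4 * sc .x + e).eval h.v = 4 * x + k := by simp [he, hx]
  refine wp_read_seq ?_ (by rw [e1]; omega)
  rw [e1, ← hyd]
  refine wp_ite (fun h1 => wp_set_seq (wp_set_seq (wp_set ?_ ⟨rfl, le_rfl, ?_⟩) ?_) ?_) fun h1 =>
    wp_skip ⟨rfl, by simp only; omega, ?_⟩
  · intro _; simp [hQ.tail]; omega
  · have hne : y ≠ p x := by
      simp [hx, hQ.par x hxQ] at h1; omega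
    rw [List.filter_cons_of_pos (by simpa using hne), List.filter_nil]
    refine ⟨?_, fun i z hz => ?_, fun z hz => ?_⟩
    · simp [hQ.tail]
    · simp only [upd_ne, upd_same, ne_eq, reduceCtorEq, not_false_eq_true, eval_arr, eval_lit,
        update_self, hQ.tail, update_apply]
      rcases Nat.lt_trichotomy i Q.length with hi | rfl | hi
      · rw [if_neg (by omega)]; rw [List.getElem?_append_left hi] at hz; exact hQ.ord i z hz
      · rw [if_pos rfl]; simpa using hz
      · rw [List.getElem?_eq_none (by simp; omega)] at hz; simp at hz
    · simp only [upd_ne, upd_same, ne_eq, reduceCtorEq, not_false_eq_true, eval_arr, eval_lit,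
        update_self, update_apply, hx]
      split_ifs with hzy
      · rw [hzy, hy hne]
      · rw [List.mem_append, List.mem_singleton] at hz; exact hQ.par z (hz.resolve_right hzy)
  · exact fun hb => hb _ _
  · exact fun hb => hb _ _
  · have heq : y = p x := by simp [hx, hQ.par x hxQ] at h1; omega
    rw [List.filter_cons_of_neg (by simpa using heq), List.filter_nil, List.append_nil]
    exact ⟨by simpa using hQ.tail, by simpa using hQ.ord, by simpa using hQ.par⟩

/-- The result of the search. -/
structure Order (inp : ℕ → ℕ) (N r : ℕ) (p : ℕ → ℕ) (Q : List ℕ) (v : Store) : Prop where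
  nodup : Q.Nodup
  mem : ∀ y, y ∈ Q ↔ y < N
  ord : ∀ i x, Q[i]? = some x → v .ord i = x
  zero : Q[0]? = some r
  fcr : v .fc r = 1
  fc : ∀ i x, Q[i]? = some x → i < v .fc x ∧
    ∀ t y, (children inp p x)[t]? = some y → Q[v .fc x + t]? = some y

theorem wp_bfs (H : RTree E.inp N r p rank) (hNi : E.inp 1 = N) (hN : h.v .nN 0 = N)
    (hr : h.v .root 0 = r) (hB : N + 4 < E.B) :
    E.wp bfs h fun s => s.m = h.m ∧ s.t ≤ h.t + 30 * N + 4 ∧ ∃ Q, Order E.inp N r p Q s.v := by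
  have hBpos := E.hB
  let Inv : ℕ → (Store) → List ℕ → Prop := fun j v Q => Queue p Q v ∧ Q.Nodup ∧
    (∀ y, y ∈ Q ↔ y = r ∨ (y < N ∧ y ≠ r ∧ ∃ i < j, Q[i]? = some (p y))) ∧ Q[0]? = some r ∧
    (0 < j → v .fc r = 1) ∧ ∀ i < j, ∀ x, Q[i]? = some x → i < v .fc x ∧
      ∀ t y, (children E.inp p x)[t]? = some y → Q[v .fc x + t]? = some y
  have hall : ∀ {j v Q}, Inv j v Q → (Q.length ≤ j → ∀ y < N, y ∈ Q) ∧ (∀ y ∈ Q, y < N) ∧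
      Q.length ≤ N := by
    rintro j v Q ⟨q1, q2, q3, q4, -⟩
    have hlt : ∀ y ∈ Q, y < N := fun y hy => by
      rcases (q3 y).1 hy with rfl | h; exacts [H.rN, h.1]
    refine ⟨fun hle => ?_, hlt, ?_⟩
    · have : ∀ m y, rank y ≤ m → y < N → y ∈ Q := by
        intro m
        induction m with
        | zero =>
          intro y h1 h2
          by_cases h3 : y = r
          · exact (q3 y).2 (.inl h3)
          · have := (H.par y h2 h3).2; omega
        | succ m ih =>
          intro y h1 h2
          by_cases h3 : y = r
          · exact (q3 y).2 (.inl h3)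
          · obtain ⟨h4, h5⟩ := H.par y h2 h3
            obtain ⟨i, hi, he⟩ := List.mem_iff_getElem.1 (ih (p y) (by omega) h4)
            exact (q3 y).2 (.inr ⟨h2, h3, i, by omega, by rw [List.getElem?_eq_getElem hi, he]⟩)
      exact fun y hy => this _ y le_rfl hy
    · have := (q2.subperm (l₂ := List.range N) fun y hy => by simpa using hlt y hy).length_le
      simpa using this
  refine wp_set_seq (wp_set_seq (wp_set_seq (wp_for N 28 (fun j v m => m = h.m ∧ ∃ Q, Inv j v Q)
    (by simp [hN]) ?_ ?_ ?_) (fun _ => by simp; omega)) (fun hb => hb _ _)) (fun hb => hb _ _)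
  · refine ⟨rfl, [r], ⟨by simp, ?_, ?_⟩, by simp, by simp, by simp, by simp, by simp⟩
    · intro i x hx
      cases i with
      | zero => simpa [hr] using hx
      | succ i => simp at hx
    · simp [hr, hN, H.pr]
  · intro j hj s f hi ⟨hm, Q, hInv⟩; obtain ⟨a1, a2, a3⟩ := hall hInv
    have hjQ : j < Q.length := by
      by_contra hle
      have := (List.nodup_range.subperm (l₁ := List.range N) (l₂ := Q) fun y hy =>
        a1 (by omega) y (by simpa using hy)).length_le
      simp at this; omega
    obtain ⟨q1, q2, q3, q4, q5, q6⟩ := hInv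
    set x := Q[j] with hxd
    have hQj : Q[j]? = some x := List.getElem?_eq_getElem hjQ
    have hxQ : x ∈ Q := List.getElem_mem hjQ
    have hxN : x < N := a2 x hxQ
    have hch : ∀ y ∈ slots E.inp x, y ≠ p x → p y = x := fun y hy hne =>
      (((H.nb x hxN y).1 hy).2.resolve_right fun h => hne h.2).2
    -- the new invariant
    have key : ∀ (v' : Store), Queue p (Q ++ children E.inp p x) v' →
        v' .fc = update (s.v .fc) x Q.length → Inv (j + 1) (upd v' .hd 0 (j + 1))
          (Q ++ children E.inp p x) := by
      intro v' hQ' hfc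
      have hpos : ∀ i, Q[i]? = some x → i = j := fun i hix =>
        (List.getElem?_inj (by by_contra hn; rw [List.getElem?_eq_none (by omega)] at hix; simp at hix)
          q2).1 (hix.trans hQj.symm)
      have hmemQ : ∀ i z, i ≤ j → ((Q ++ children E.inp p x)[i]? = some z ↔ Q[i]? = some z) :=
        fun i z hij => by rw [List.getElem?_append_left (by omega)]
      refine ⟨⟨by simpa using hQ'.tail, by simpa using hQ'.ord, by simpa using hQ'.par⟩,
        q2.append (H.children_nodup hxN) ?_, fun y => ?_, ?_, fun _ => ?_, fun i hij z hz => ?_⟩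
      · intro y hy hyc; obtain ⟨h1, h2, h3⟩ := (H.mem_children hxN).1 hyc
        obtain ⟨-, -, i, hi, hi'⟩ := ((q3 y).1 hy).resolve_left h2; rw [h3] at hi'
        exact absurd (hpos i hi') (by omega)
      · rw [List.mem_append, q3, H.mem_children hxN]
        constructor
        · rintro ((h | ⟨h1, h2, i, hi, h3⟩) | ⟨h1, h2, h3⟩)
          · exact .inl h
          · exact .inr ⟨h1, h2, i, by omega, (hmemQ i _ hi.le).2 h3⟩
          · exact .inr ⟨h1, h2, j, by omega, by rw [hmemQ j _ le_rfl, h3, hQj]⟩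
        · rintro (h | ⟨h1, h2, i, hi, h3⟩)
          · exact .inl (.inl h)
          · rw [hmemQ i _ (by omega)] at h3
            rcases lt_succ_iff_lt_or_eq.1 hi with hi | rfl
            · exact .inl (.inr ⟨h1, h2, i, hi, h3⟩)
            · rw [hQj] at h3; exact .inr ⟨h1, h2, (Option.some.inj h3).symm⟩
      · rw [hmemQ 0 _ (Nat.zero_le _)]; exact q4
      · simp only [upd_ne, ne_eq, reduceCtorEq, not_false_eq_true, hfc, update_apply]
        split_ifs with hxr
        · have h0 := hpos 0 (by rw [q4, hxr])
          subst h0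
          by_contra hne
          have h1 : 1 < Q.length := by omega
          rcases (q3 Q[1]).1 (List.getElem_mem h1) with h2 | ⟨-, -, i, hi, -⟩
          · have h3 := q2.getElem_inj_iff (hi := h1) (hj := hjQ) |>.1 (by
              rw [h2]; rw [List.getElem?_eq_getElem hjQ] at q4; exact (Option.some.inj q4).symm)
            omega
          · omega
        · refine q5 (Nat.pos_of_ne_zero ?_)
          rintro rfl
          rw [q4] at hQj; exact hxr (Option.some.inj hQj)
      · simp only [upd_ne, ne_eq, reduceCtorEq, not_false_eq_true, hfc, update_apply]
        rw [hmemQ i _ (by omega)] at hz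
        split_ifs with hzx
        · rw [hzx] at hz ⊢
          have := hpos i hz
          exact ⟨by omega, fun t y hy => by rw [List.getElem?_append_right (by omega)]; simpa using hy⟩
        · have hij' : i < j := by
            rcases lt_succ_iff_lt_or_eq.1 hij with h | rfl
            · exact h
            · exact absurd (Option.some.inj (hz.symm.trans hQj)) hzx
          obtain ⟨h1, h2⟩ := q6 i hij' z hz; refine ⟨h1, fun t y hy => ?_⟩
          have := h2 t y hy
          rw [List.getElem?_append_left]
          · exact this
          · by_contra hn; rw [List.getElem?_eq_none (by omega)] at this; simp at this
    have hord : s.v .ord j = x := q1.ord j x hQj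
    refine wp_set_seq (wp_set_seq (wp_read_seq (wp_seq ((wp_slot (p := p) (Q := Q) (x := x) (e := (3 : HExp)) (k := 3)
      (fun _ => rfl) (by norm_num) ⟨?_, ?_, ?_⟩ ?_ hxQ (by omega) ?_ (by omega)).mono ?_)) ?_) ?_) ?_
    · simpa using q1.tail
    · simpa using q1.ord
    · simpa using q1.par
    · simp [hi, hord]
    · exact hch _ (by rw [slots]; split_ifs <;> simp)
    · rintro s1 - f1 ⟨m1, t1, Q1⟩
      have g1 : s1.v .x 0 = x := by rw [f1 _ (by decide)]; simp [hi, hord]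
      have g2 : s1.v .ty 0 = E.inp (4 * x + 2) := by rw [f1 _ (by decide)]; simp [hi, hord]
      have g3 : s1.v .fc = update (s.v .fc) x Q.length := by
        rw [f1 _ (by decide)]; simp [hi, hord, q1.tail]
      simp only at t1 m1
      have hl1 : ∀ a : ℕ, ([a].filter (· ≠ p x)).length ≤ 1 := fun a => List.length_filter_le _ _
      refine wp_ite (fun hne => ?_) fun heq => wp_skip ⟨by simp only; omega, by rw [m1]; exact hm, _, key _ ?_ g3⟩
      · have h3 : E.inp (4 * x + 2) ≠ 1 := by simp [g2] at hne; omega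
        have hsl : slots E.inp x = [E.inp (4 * x + 3), E.inp (4 * x + 4), E.inp (4 * x + 5)] := if_neg h3
        refine wp_seq ((wp_slot (h := ⟨s1.v, s1.m, s1.t + 1⟩) (p := p) (x := x) (e := (4 : HExp)) (k := 4) (fun _ => rfl) (by norm_num) Q1 g1
          (by simp [hxQ]) (by omega) ?_ ?_).mono ?_)
        · exact hch _ (by rw [hsl]; simp)
        · have := hl1 (E.inp (4 * x + 3)); rw [List.length_append]; omega
        rintro s2 - f2 ⟨m2, t2, Q2⟩
        have g1' : s2.v .x 0 = x := by rw [f2 _ (by decide), g1]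
        refine (wp_slot (p := p) (x := x) (e := (5 : HExp)) (k := 5) (fun _ => rfl) (by norm_num) Q2 g1'
          (by simp [hxQ]) (by omega) ?_ ?_).mono ?_
        · exact hch _ (by rw [hsl]; simp)
        · have := hl1 (E.inp (4 * x + 3)); have := hl1 (E.inp (4 * x + 4))
          rw [List.length_append, List.length_append]; omega
        rintro s3 - f3 ⟨m3, t3, Q3⟩
        simp only at t2
        refine ⟨by omega, by rw [m3, m2, m1]; exact hm, _, key _ ?_ ?_⟩
        · rw [children, hsl]
          have : [E.inp (4 * x + 3), E.inp (4 * x + 4), E.inp (4 * x + 5)] =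
            [E.inp (4 * x + 3)] ++ [E.inp (4 * x + 4)] ++ [E.inp (4 * x + 5)] := rfl
          rw [this, List.filter_append, List.filter_append, ← List.append_assoc, ← List.append_assoc]
          exact Q3
        · rw [f3 _ (by decide), f2 _ (by decide), g3]
      · have h1 : E.inp (4 * x + 2) = 1 := by
          have := H.ty x hxN; simp [g2] at heq; omega
        rw [children, slots, if_pos h1]; exact Q1
    · simp [hi, hord]; omega
    · exact fun hb => hb _ _
    · exact fun hb => hb _ _
  · intro s f hi ⟨hm, Q, hInv⟩ ht; obtain ⟨a1, a2, a3⟩ := hall hInv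
    obtain ⟨q1, q2, q3, q4, q5, q6⟩ := hInv
    have hlen : ∀ i x, Q[i]? = some x → i < N := fun i x hx => by
      by_contra hn; rw [List.getElem?_eq_none (by omega)] at hx; simp at hx
    exact ⟨hm, by simp only at ht ⊢; omega, Q, q2, fun y => ⟨a2 y, a1 a3 y⟩, q1.ord, q4,
      q5 (by have := H.rN; omega), fun i x hx => q6 i (hlen i x hx) x hx⟩

end DS

namespace DS

open Env HProg

/-- The names on which the description of the state depends. -/
def persistent : List Nm :=
  [.nn, .deg, .mark, .o1 .L, .o1 .I, .o1 .F, .o1 .R, .o2 .L, .o2 .I, .o2 .F, .o2 .R, .o0 .L, .o0 .I,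
   .o0 .F, .o0 .R, .sg .L, .sg .I, .sg .F, .sg .R, .alloc, .sz, .lo, .tbl, .lst, .cnt]

section

variable {b : ℕ} {G : Edges} {full flat : Bool} {n K : ℕ} {v v' : Store}
  {m : ℕ → ZMod (2 ^ b)} {S : Finset ℕ} {x : ℕ}

theorem Glob.of_eq (H : Glob G n v m) (he : ∀ a ∈ persistent, v' a = v a) : Glob G n v' m := by
  refine ⟨?_, ?_, ?_, fun c => ?_, ?_, ?_, H.m0⟩
  · rw [he _ (by decide)]; exact H.nn
  · rw [he _ (by decide)]; exact H.deg
  · rw [he _ (by decide)]; exact H.mark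
  · have : v' (.o1 c) = v (.o1 c) ∧ v' (.o2 c) = v (.o2 c) ∧ v' (.o0 c) = v (.o0 c) ∧
        v' (.sg c) = v (.sg c) := by
      refine ⟨he _ ?_, he _ ?_, he _ ?_, he _ ?_⟩ <;> cases c <;> decide
    rw [this.1, this.2.1, this.2.2.1, this.2.2.2]; exact H.o c
  · rw [he _ (by decide)]; exact H.zero
  · rw [he _ (by decide)]; exact H.pos

theorem NodeOk.of_eq (H : NodeOk G full flat n K v m S x) (he : ∀ a ∈ persistent, v' a = v a) :
    NodeOk G full flat n K v' m S x :=
  H.congr (by rw [he _ (by decide)]) (by rw [he _ (by decide)]) (by rw [he _ (by decide)])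
    (fun i _ => by rw [he .lst (by decide), he .cnt (by decide)]; exact ⟨rfl, rfl⟩)
    (by rw [he .alloc (by decide)]) fun _ _ => rfl

theorem Order.length {inp : ℕ → ℕ} {N r : ℕ} {p : ℕ → ℕ} {Q : List ℕ} (O : Order inp N r p Q v) :
    Q.length = N := by
  rw [← List.toFinset_card_of_nodup O.nodup]
  have : Q.toFinset = range N := by ext y; simp [O.mem]
  rw [this, card_range]

end

variable {E : Env} {h : HState E.b} {G : Edges} {full flat : Bool} {n K TT N r : ℕ} {p rank : ℕ → ℕ}
  {Q : List ℕ}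

theorem wp_tables (P : Par E G full flat n K TT) (H : RTree E.inp N r p rank)
    (O : Order E.inp N r p Q h.v) (hNi : E.inp 1 = N)
    (hΛ : ∀ x, x ∈ G.Λ ↔ x < N ∧ E.inp (4 * x + 2) = 1)
    (hU : ∀ x ∈ G.Λ, E.inp (4 * x + 4) = G.eu x ∧ E.inp (4 * x + 5) = G.ev x ∧ G.eu x ≠ G.ev x)
    (hmid : ∀ x < N, x ≠ r → (G.mid (below G.Λ p r x)).card ≤ K)
    (hN : h.v .nN 0 = N) (hown : h.v .own = G.own) (gl : Glob G n h.v h.m)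
    (hroom : h.v .alloc 0 + (N + 1) * room full n K < E.B) :
    E.wp (tables full flat) h fun s =>
      s.t ≤ h.t + (N + 1) * (1200 * ((layers full n K + 1) * ((layers full n K + 1) * TT)) + 9) ∧
      Glob G n s.v s.m ∧ NodeOk G full flat n K s.v s.m G.Λ N ∧ h.v .alloc 0 ≤ s.v .tbl N ∧
      rowSet n s.v N = ∅ := by
  have hB := E.hB
  have hlen := O.length
  set X := 1200 * ((layers full n K + 1) * ((layers full n K + 1) * TT)) with hX
  have hget : ∀ i < N, ∃ x, Q[i]? = some x ∧ x < N := fun i hi =>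
    ⟨Q[i], List.getElem?_eq_getElem (by omega), (O.mem _).1 (List.getElem_mem _)⟩
  have hltQ : ∀ i x, Q[i]? = some x → x < N := fun i x hx => (O.mem x).1 (List.mem_of_getElem? hx)
  refine wp_seq (wp_for N (X + 8) (fun j v m => Glob G n v m ∧ h.v .alloc 0 ≤ v .alloc 0 ∧
    v .alloc 0 ≤ h.v .alloc 0 + j * room full n K ∧ ∀ i x, N - j ≤ i → Q[i]? = some x →
      NodeOk G full flat n K v m (below G.Λ p r x) x) hN ?_ ?_ ?_)
  · refine ⟨gl.of_eq fun a ha => upd_ne _ (by rintro rfl; revert ha; decide) _ _, le_rfl, by simp,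
      fun i x hi hx => ?_⟩
    rw [List.getElem?_eq_none (by omega)] at hx; simp at hx
  · intro j hj s f hi ⟨g1, g2, g3, g4⟩
    have fr : ∀ a, a ∈ [Nm.ord, .fc, .nN, .own] → s.v a = h.v a := by
      intro a ha; refine f a ?_
      revert a; cases full <;> cases flat <;> decide
    have hroom' : s.v .alloc 0 + room full n K < E.B := by
      have : (j + 1) * room full n K ≤ (N + 1) * room full n K := Nat.mul_le_mul_right _ (by omega)
      rw [Nat.add_mul, one_mul] at this; omega
    obtain ⟨x, hx, hxN⟩ := hget (N - 1 - j) (by omega)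
    have hord : s.v .ord (s.v .nN 0 - 1 - j) = x := by
      rw [fr .ord (by decide), fr .nN (by decide), hN]; exact O.ord _ _ hx
    -- what remains after the node has been processed
    have key : ∀ (s0 s1 : HState E.b), (∀ a ∈ persistent, s0.v a = s.v a) → s0.m = s.m →
        s0.t ≤ s.t + 6 → (s1.t ≤ s0.t + X ∧ Glob G n s1.v s1.m ∧
        NodeOk G full flat n K s1.v s1.m (below G.Λ p r x) x ∧
        s0.v .alloc 0 ≤ s1.v .alloc 0 ∧ s1.v .alloc 0 ≤ s0.v .alloc 0 + room full n K ∧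
        ∀ y S, y ≠ x → NodeOk G full flat n K s0.v s0.m S y → NodeOk G full flat n K s1.v s1.m S y) →
        s1.t ≤ s.t + (X + 8) ∧ Glob G n (upd s1.v .step 0 (j + 1)) s1.m ∧
        h.v .alloc 0 ≤ upd s1.v .step 0 (j + 1) .alloc 0 ∧
        upd s1.v .step 0 (j + 1) .alloc 0 ≤ h.v .alloc 0 + (j + 1) * room full n K ∧
        ∀ i y, N - (j + 1) ≤ i → Q[i]? = some y →
          NodeOk G full flat n K (upd s1.v .step 0 (j + 1)) s1.m (below G.Λ p r y) y := by
      intro s0 s1 he em et ⟨k1, k2, k3, k4, k5, k6⟩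
      have hp : ∀ a ∈ persistent, upd s1.v .step 0 (j + 1) a = s1.v a := fun a ha =>
        upd_ne _ (by rintro rfl; revert ha; decide) _ _
      rw [he .alloc (by decide)] at k4 k5
      refine ⟨by omega, k2.of_eq hp, ?_, ?_, fun i y hi hy => NodeOk.of_eq ?_ hp⟩
      · rw [hp .alloc (by decide)]; omega
      · rw [hp .alloc (by decide), Nat.add_mul, one_mul]; omega
      · by_cases hyx : y = x
        · rw [hyx]; exact k3
        · refine k6 y _ hyx ?_
          rw [em]; refine (g4 i y ?_ hy).of_eq he
          by_contra hlt
          obtain rfl : i = N - 1 - j := by omega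
          exact hyx (Option.some.inj (hy.symm.trans hx))
    refine wp_set_seq (wp_read_seq (wp_ite (fun hne => ?_) fun heq => ?_) ?_) (fun hb => hb _ _)
    · have hty : E.inp (4 * x + 2) = 3 := by
        have h1 := H.ty x hxN
        simp only [eval_arr, eval_sub, eval_one, eval_lit, hi, hord] at hne; simp at hne
        omega
      have hxr : x ≠ r := by rintro rfl; have := H.tyr; omega
      obtain ⟨a, b, hab, hch⟩ := H.children_inner hxN hty; obtain ⟨o1, o2⟩ := O.fc _ x hx
      have qa := o2 0 a (by rw [hch]; rfl)
      have qb := o2 1 b (by rw [hch]; rfl)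
      obtain ⟨e1, e2⟩ := H.below_inner hΛ hxN hty hch
      have hmem := fun y => H.mem_children (y := y) hxN
      rw [hch] at hmem
      have hself : ∀ y, p y = x → y ≠ x := by
        rintro y hy rfl
        have := (H.par _ hxN hxr).2; rw [hy] at this; omega
      refine wp_set_seq (wp_set_seq ?_ (fun hb => hb _ _)) (fun hb => hb _ _)
      have he : ∀ c ∈ persistent, ∀ (k1 k2 k3 k4 : ℕ), upd (upd (upd (upd s.v .x 0 k1) .ty 0 k2) .c1 0 k3)
          .c2 0 k4 c = s.v c := by
        intro c hc _ _ _ _; rw [upd_ne, upd_ne, upd_ne, upd_ne] <;> (rintro rfl; revert hc; decide)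
      refine (wp_combine (P := P) (x := x) (c1 := a) (c2 := b) (S₁ := below G.Λ p r a)
        (S₂ := below G.Λ p r b) ⟨?_, ?_, ?_, e2, ?_, ?_, ?_, ?_, ?_,
          ?_, ?_⟩).mono ?_
      · exact g1.of_eq fun c hc => he c hc _ _ _ _
      · exact (g4 _ a (by rw [Nat.add_zero] at *; omega) qa).of_eq fun c hc => he c hc _ _ _ _
      · exact (g4 _ b (by omega) qb).of_eq fun c hc => he c hc _ _ _ _
      · simp [hi, hord]
      · have := O.ord _ _ qa
        simp [hi, hord, fr .ord (by decide), fr .fc (by decide)]; simpa using this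
      · have := O.ord _ _ qb
        simp [hi, hord, fr .ord (by decide), fr .fc (by decide)]; simpa using this
      · exact hself a ((hmem a).1 (by simp)).2.2
      · exact hself b ((hmem b).1 (by simp)).2.2
      · rw [← e1]; exact hmid x hxN hxr
      · simpa using hroom'
      · rintro s1 - - ⟨k1, k2, k3, -, k4, k5, k6⟩
        rw [← e1] at k3
        exact key ⟨_, _, _⟩ s1 (fun c hc => he c hc _ _ _ _) rfl (by simp only; omega) ⟨k1, k2, k3, k4, k5, k6⟩
    · have hty : E.inp (4 * x + 2) = 1 := by
        have h1 := H.ty x hxN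
        simp [hi, hord] at heq
        omega
      have hxΛ : x ∈ G.Λ := (hΛ x).2 ⟨hxN, hty⟩
      obtain ⟨u1, u2, u3⟩ := hU x hxΛ
      have he : ∀ c ∈ persistent, ∀ (k1 k2 : ℕ), upd (upd s.v .x 0 k1) .ty 0 k2 c = s.v c := by
        intro c hc _ _; rw [upd_ne, upd_ne] <;> (rintro rfl; revert hc; decide)
      refine (wp_leaf (P := P) (x := x) ?_ ?_ hxΛ (by omega) u1 u2 u3
        ?_ ?_).mono ?_
      · exact g1.of_eq fun c hc => he c hc _ _
      · simp [hi, hord]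
      · intro u _; simp [fr .own (by decide), hown]
      · simpa using hroom'
      · rintro s1 - - ⟨k1, k2, k3, k4, k5, k6⟩
        rw [← H.below_leaf hΛ hxΛ] at k3
        exact key ⟨_, _, _⟩ s1 (fun c hc => he c hc _ _) rfl (by simp only; omega) ⟨k1, k2, k3, k4, k5, k6⟩
    · simp [hi, hord]; omega
  · intro s f hi ⟨g1, g2, g3, g4⟩ ht
    have fr : ∀ a, a ∈ [Nm.ord, .fc, .nN, .own] → s.v a = h.v a := by
      intro a ha; refine f a ?_
      revert a; cases full <;> cases flat <;> decide
    obtain ⟨c, hch⟩ := H.children_root; obtain ⟨e1, e2⟩ := H.below_root hΛ hch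
    have qc := (O.fc 0 r O.zero).2 0 c (by rw [hch]; rfl)
    rw [O.fcr] at qc
    have he : ∀ a ∈ persistent, ∀ (k1 k2 k3 : ℕ), upd (upd (upd s.v .x 0 k1) .c1 0 k2)
        .c2 0 k3 a = s.v a := by
      intro a ha _ _ _; rw [upd_ne, upd_ne, upd_ne] <;> (rintro rfl; revert ha; decide)
    have hmid0 : G.mid G.Λ = ∅ := by simp [Edges.mid]
    refine wp_set_seq (wp_set_seq (wp_set_seq ?_ (fun hb => hb _ _)) (fun hb => hb _ _)) (fun hb => hb _ _)
    refine (wp_combine (P := P) (x := N) (c1 := r) (c2 := c) (S₁ := below G.Λ p r r)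
      (S₂ := below G.Λ p r c) ⟨?_, ?_, ?_, e2, ?_, ?_, ?_, ?_, ?_,
        ?_, ?_⟩).mono ?_
    · exact g1.of_eq fun c hc => he c hc _ _ _
    · exact (g4 _ r (by omega) O.zero).of_eq fun c hc => he c hc _ _ _
    · exact (g4 _ c (by omega) qc).of_eq fun c hc => he c hc _ _ _
    · simp [fr .nN (by decide), hN]
    · have := O.ord _ _ O.zero
      simp [fr .ord (by decide)]; exact this
    · have := O.ord _ _ qc
      simp [fr .ord (by decide)]; exact this
    · have := H.rN; omega
    · have := hltQ _ _ qc; omega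
    · rw [e1, hmid0]; simp
    · have : N * room full n K + room full n K = (N + 1) * room full n K := by ring
      simp; omega
    · rintro s1 - - ⟨k1, k2, k3, k4, -⟩
      rw [e1] at k3 k4; rw [hmid0] at k4; refine ⟨?_, k2, k3, ?_, subset_empty.1 k4.2⟩
      · rw [← hX] at k1
        have : (N + 1) * (X + 9) = N * (X + 8 + 1) + X + 9 := by ring
        simp only at k1; omega
      · have := k4.1
        simp at this; omega

theorem wp_main (hP : ∀ o : ℕ → ℕ, (∀ v ∈ G.VS G.Λ, o v ∈ G.Λ ∧ G.inc (o v) v) →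
      Par E { G with own := o } full flat n K TT)
    (hT : ∀ r ∈ G.Λ, ∃ p rank, RTree E.inp N r p rank ∧
      ∀ x < N, x ≠ r → (G.mid (below G.Λ p r x)).card ≤ K)
    (hni : E.inp 0 = n) (hNi : E.inp 1 = N) (hne : G.Λ.Nonempty)
    (hΛ : ∀ x, x ∈ G.Λ ↔ x < N ∧ E.inp (4 * x + 2) = 1)
    (hU : ∀ x ∈ G.Λ, E.inp (4 * x + 4) = G.eu x ∧ E.inp (4 * x + 5) = G.ev x ∧ G.eu x ≠ G.ev x)
    (hv : ∀ a i, h.v a i = 0) (hm : ∀ i, h.m i = 0) (hBN : 2 * N + 4 < E.B)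
    (hroom : n + 1 + (N + 1) * room full n K < E.B) :
    E.wp (main full flat) h fun s =>
      s.t ≤ h.t + (N + 1) * (1200 * ((layers full n K + 1) * ((layers full n K + 1) * TT)) + 59) ∧
      s.v .nn 0 = n ∧ s.v .nN 0 = N ∧ s.v .noniso 0 = (G.VS G.Λ).card ∧ s.m 0 = 0 ∧
      n + 1 ≤ s.v .tbl N ∧ ∃ o : ℕ → ℕ, (∀ v ∈ G.VS G.Λ, o v ∈ G.Λ ∧ G.inc (o v) v) ∧
        NodeOk { G with own := o } full flat n K s.v s.m G.Λ N ∧ rowSet n s.v N = ∅ := by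
  have hB := E.hB
  have hty : ∀ x < N, 1 ≤ E.inp (4 * x + 2) := fun x hx => by
    obtain ⟨r, hr⟩ := hne; obtain ⟨p, rank, H, -⟩ := hT r hr
    rcases H.ty x hx with h | h <;> omega
  refine wp_seq (wp_read_seq (wp_read_seq (wp_set_seq (wp_seq ((wp_scan (G := G) (N := N) ?_ hNi hΛ hty hU
    (by omega) (by simp [hv]) (by simp [hv])).mono ?_)) ?_) ?_) ?_)
  · simp [hNi]
  · rintro s1 - f1 ⟨m1, t1, d1, o1, n1, r1⟩
    obtain ⟨p, rank, H, hmid⟩ := hT _ (r1 hne)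
    have P := hP _ o1
    refine (wp_bfs H hNi (by rw [f1 _ (by decide)]; simp [hNi]) rfl (by omega)).mono ?_
    rintro s2 - f2 ⟨m2, t2, Q, O⟩
    simp only at m1
    have hz : ∀ a, a ∉ scan.mods → a ∉ bfs.mods → a ≠ .nn → a ≠ .nN → a ≠ .alloc → ∀ i, s2.v a i = 0 := by
      intro a h1 h2 h3 h4 h5 i; rw [f2 a h2, f1 a h1]; simp [h3, h4, h5, hv]
    have al : s2.v .alloc 0 = n + 1 := by rw [f2 _ (by decide), f1 _ (by decide)]; simp [hni]
    refine (wp_tables (G := { G with own := s1.v .own }) P H O hNi hΛ hU hmid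
      (by rw [f2 _ (by decide), f1 _ (by decide)]; simp [hNi]) (f2 _ (by decide)) ⟨?_, ?_, ?_, ?_, ?_, ?_, ?_⟩
      (by rw [al]; exact hroom)).mono ?_
    · rw [f2 _ (by decide), f1 _ (by decide)]; simp [hni]
    · intro u _; rw [f2 _ (by decide)]; exact d1 u
    · exact fun u => hz .mark (by decide) (by decide) (by decide) (by decide) (by decide) u
    · intro c
      refine ⟨hz _ ?_ ?_ ?_ ?_ ?_ _, hz _ ?_ ?_ ?_ ?_ ?_ _, hz _ ?_ ?_ ?_ ?_ ?_ _, hz _ ?_ ?_ ?_ ?_ ?_ _⟩ <;>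
        cases c <;> decide
    · intro a _; rw [m2, m1]; exact hm a
    · omega
    · rw [m2, m1]; exact hm 0
    · rintro s3 - f3 ⟨k1, k2, k3, k4, k5⟩
      have fr : ∀ a, a ∈ [Nm.nn, .nN, .noniso] → s3.v a = s1.v a := by
        intro a ha; rw [f3 a, f2 a]
        · revert a; decide
        · revert a; cases full <;> cases flat <;> decide
      refine ⟨?_, ?_, ?_, ?_, k2.m0, by omega, _, o1, k3, k5⟩
      · simp only at t1
        have : ∀ X, (N + 1) * (X + 59) = (N + 1) * (X + 9) + 50 * N + 50 := fun X => by ring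
        rw [this]; omega
      · exact k2.nn
      · rw [fr _ (by decide), f1 _ (by decide)]; simp [hNi]
      · rw [fr _ (by decide), n1]
  · intro _; simp [hni]; omega
  · show 1 < _; omega
  · simp

end DS

/-! ## Dominating sets of graphs with isolated vertices -/

namespace Edges

/-- `G` lists the edges of the graph `H`. -/
structure Lists (G : Edges) {n : ℕ} (H : SimpleGraph (Fin n)) : Prop where
  sub : G.VS G.Λ ⊆ range n
  adj : ∀ u v : Fin n, H.Adj u v ↔
    ∃ l ∈ G.Λ, (G.eu l = u ∧ G.ev l = v) ∨ (G.ev l = u ∧ G.eu l = v)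

/-- The set of vertices of the graph that consists of `D` and the isolated vertices. -/
def back (G : Edges) (n : ℕ) (D : Finset ℕ) : Finset (Fin n) :=
  univ.filter fun v => (v : ℕ) ∈ D ∨ (v : ℕ) ∉ G.VS G.Λ

namespace Lists

variable {G : Edges} {n : ℕ} {H : SimpleGraph (Fin n)} (L : G.Lists H) {D : Finset ℕ}
include L

theorem back_iff (hD : D ⊆ G.VS G.Λ) : IsDominatingSet H (G.back n D) ↔ G.Dominating D := by
  simp only [IsDominatingSet, Dominating, hD, true_and, back, mem_filter, mem_univ,
    true_and, not_or, not_not, and_imp, L.adj]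
  constructor
  · intro h v hv
    by_cases hvD : v ∈ D
    · exact .inl hvD
    obtain ⟨d, hd, l, hl, hld⟩ := h ⟨v, mem_range.1 (L.sub hv)⟩ hvD hv
    have hdV : (d : ℕ) ∈ G.VS G.Λ := G.mem_VS.2 ⟨l, hl, hld.elim (fun h => .inr h.2) fun h => .inl h.2⟩
    have hdD : (d : ℕ) ∈ D := hd.resolve_right fun h => h hdV
    rcases hld with ⟨h1, h2⟩ | ⟨h1, h2⟩
    · exact .inr ⟨l, hl, .inl ⟨h1, h2 ▸ hdD⟩⟩
    · exact .inr ⟨l, hl, .inr ⟨h1, h2 ▸ hdD⟩⟩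
  · intro h v hvD hv; obtain ⟨l, hl, hld⟩ := (h v hv).resolve_left hvD
    have hex : ∃ d ∈ D, (G.eu l = v ∧ G.ev l = d) ∨ (G.ev l = v ∧ G.eu l = d) :=
      hld.elim (fun h => ⟨_, h.2, .inl ⟨h.1, rfl⟩⟩) fun h => ⟨_, h.2, .inr ⟨h.1, rfl⟩⟩
    obtain ⟨d, hd, hld⟩ := hex; exact ⟨⟨d, mem_range.1 (L.sub (hD hd))⟩, .inl hd, l, hl, hld⟩

theorem card_back (hD : D ⊆ G.VS G.Λ) : (G.back n D).card = D.card + (n - (G.VS G.Λ).card) := by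
  have h1 : ((G.back n D).map Fin.valEmbedding) = D ∪ (range n \ G.VS G.Λ) := by
    ext v
    simp only [back, mem_map, mem_filter, mem_univ, true_and, Fin.valEmbedding_apply,
      mem_union, mem_sdiff, mem_range]
    constructor
    · rintro ⟨a, h, rfl⟩; exact h.imp id fun h => ⟨a.2, h⟩
    · rintro (h | h)
      · exact ⟨⟨v, mem_range.1 (L.sub (hD h))⟩, .inl h, rfl⟩
      · exact ⟨⟨v, h.1⟩, .inr h.2, rfl⟩
  rw [← card_map Fin.valEmbedding, h1, card_union_of_disjoint, Finset.card_sdiff_of_subset L.sub,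
    card_range]
  exact disjoint_left.2 fun v h h' => (mem_sdiff.1 h').2 (hD h)

theorem back_inj {D' : Finset ℕ} (hD : D ⊆ G.VS G.Λ) (hD' : D' ⊆ G.VS G.Λ)
    (h : G.back n D = G.back n D') : D = D' := by
  have key : ∀ {A B : Finset ℕ}, A ⊆ G.VS G.Λ → G.back n A = G.back n B → A ⊆ B := by
    intro A B hA he v hv
    have : (⟨v, mem_range.1 (L.sub (hA hv))⟩ : Fin n) ∈ G.back n A := by simp [back, hv]
    rw [he] at this; simpa [back, hA hv] using this
  exact (key hD h).antisymm (key hD' h.symm)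

theorem isDominatingSet_iff {D : Finset (Fin n)} :
    IsDominatingSet H D ↔ ∃ D', G.Dominating D' ∧ G.back n D' = D := by
  refine ⟨fun hD => ?_, ?_⟩
  · have he : G.back n (D.map Fin.valEmbedding ∩ G.VS G.Λ) = D := by
      ext v
      simp only [back, mem_filter, mem_univ, true_and, mem_inter, mem_map,
        Fin.valEmbedding_apply, Fin.val_inj, exists_eq_right]
      refine ⟨fun h => h.elim And.left fun hv => ?_, fun h => ?_⟩
      · by_contra hvD
        obtain ⟨d, -, had⟩ := hD v hvD; obtain ⟨l, hl, hld⟩ := (L.adj v d).1 had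
        exact hv (G.mem_VS.2 ⟨l, hl, hld.imp And.left And.left⟩)
      · by_cases hv : (v : ℕ) ∈ G.VS G.Λ
        · exact .inl ⟨h, hv⟩
        · exact .inr hv
    exact ⟨_, (L.back_iff inter_subset_right).1 (by rwa [he]), he⟩
  · rintro ⟨D', h, rfl⟩
    exact (L.back_iff h.1).2 h

theorem isMinimumDominatingSet_iff {D : Finset (Fin n)} :
    IsMinimumDominatingSet H D ↔ ∃ D', G.Target false D' ∧ G.back n D' = D := by
  constructor
  · rintro ⟨h, hmin⟩
    obtain ⟨D', hD', rfl⟩ := L.isDominatingSet_iff.1 h; refine ⟨D', ⟨hD', fun _ D'' h'' => ?_⟩, rfl⟩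
    have := hmin _ ((L.back_iff h''.1).2 h'')
    rw [L.card_back hD'.1, L.card_back h''.1] at this; omega
  · rintro ⟨D', h, rfl⟩
    refine ⟨(L.back_iff h.1.1).2 h.1, fun D hD => ?_⟩
    obtain ⟨D'', h'', rfl⟩ := L.isDominatingSet_iff.1 hD
    have := h.2 rfl D'' h''
    rw [L.card_back h.1.1, L.card_back h''.1]; omega

theorem ncard_image {A : Finset (Finset ℕ)} {X : Set (Finset (Fin n))} (hA : ∀ D ∈ A, D ⊆ G.VS G.Λ)
    (hX : ∀ D, D ∈ X ↔ ∃ D' ∈ A, G.back n D' = D) : X.ncard = A.card := by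
  have : X = G.back n '' (A : Set (Finset ℕ)) := by ext D; simp [hX]
  rw [this, Set.InjOn.ncard_image fun D hD D' hD' h => L.back_inj (hA D hD) (hA D' hD') h,
    Set.ncard_coe_finset]

end Lists

end Edges

/-! ## The output -/

namespace DS

open Env HProg

theorem NodeOk.root {b : ℕ} {G : Edges} {full flat : Bool} {n K N : ℕ} {v : Store}
    {m : ℕ → ZMod (2 ^ b)} {S : Finset ℕ} (H : NodeOk G full flat n K v m S N) (h0 : rowSet n v N = ∅) :
    ∃ A, G.Sem full flat S ∅ A (v .lo N) (layers full n 0) ∧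
      (∀ j ≤ layers full n 0, m (v .tbl N + j) = (A j).card) ∧ (full = false → (A 0).Nonempty) := by
  have hsz : v .sz N = 0 := by
    have := card_image_of_injOn H.inj
    rw [card_range] at this; rw [← this]; exact card_eq_zero.2 h0
  obtain ⟨A, h1, h2, -, h3⟩ := H.ex
  rw [hsz, h0] at h1
  rw [hsz] at h2
  refine ⟨A, h1, fun j hj => ?_, h3⟩
  have := h2 j hj 0 (by simp)
  simpa [cellv] using this

variable {E : Env} {h : HState E.b} {n N c : ℕ}

theorem wp_outputAll {f : ℕ → ℕ} (hn : h.v .nn 0 = n) (hN : h.v .nN 0 = N) (hc : h.v .noniso 0 = c)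
    (ht : n + 1 ≤ h.v .tbl N) (hf : ∀ j ≤ n, h.m (h.v .tbl N + j) = f j) (hB : n + 1 < E.B) :
    E.wp outputAll h fun s => s.t ≤ h.t + 4 * (n + 1) + 3 ∧ ∀ i ≤ n,
      s.m i = if n - c ≤ i then (f (i - (n - c)) : ZMod (2 ^ E.b)) else 0 := by
  refine wp_set_seq (wp_set_seq (wp_for (n + 1) 3 (fun j _ m => (∀ a, n + 1 ≤ a → m a = h.m a) ∧
    ∀ i < j, m i = if n - c ≤ i then (f (i - (n - c)) : ZMod (2 ^ E.b)) else 0) ?_ ?_ ?_ ?_) ?_) ?_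
  · simp [hn]
  · simp
  · intro j hj s fr hi ⟨g1, g2⟩
    have e1 : s.v .y 0 = n - c := by rw [fr _ (by decide)]; simp [hn, hc]
    have e2 : s.v .nN 0 = N := by rw [fr _ (by decide)]; simp [hN]
    have e3 : s.v .tbl = h.v .tbl := by rw [fr _ (by decide)]; simp
    have hold : ∀ (x : ZMod (2 ^ E.b)), (∀ a, n + 1 ≤ a → update s.m j x a = h.m a) ∧
        ∀ i < j, update s.m j x i =
          if n - c ≤ i then (f (i - (n - c)) : ZMod (2 ^ E.b)) else 0 := fun x =>
      ⟨fun a ha => by rw [update_of_ne (by omega), g1 a ha],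
        fun i hij => by rw [update_of_ne (by omega), g2 i hij]⟩
    have hlast : ∀ (x : ZMod (2 ^ E.b)), x = (if n - c ≤ j then (f (j - (n - c)) : ZMod (2 ^ E.b)) else 0) →
        (∀ a, n + 1 ≤ a → update s.m j x a = h.m a) ∧
        ∀ i < j + 1, update s.m j x i =
          if n - c ≤ i then (f (i - (n - c)) : ZMod (2 ^ E.b)) else 0 := fun x hx =>
      ⟨(hold x).1, fun i hij => by
        rcases lt_succ_iff_lt_or_eq.1 hij with h' | rfl
        · exact (hold x).2 i h'
        · rw [update_self, hx]⟩
    refine wp_setN_seq (wp_ite (fun hne => wp_skip ⟨by simp only; omega, ?_⟩) fun heq =>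
      wp_arith ⟨by simp only; omega, ?_⟩)
    · have : ¬ n - c ≤ j := by simp [e1, hi] at hne; omega
      simpa [hi] using hlast 0 (by rw [if_neg this])
    · have hle : n - c ≤ j := by simp [e1, hi] at heq; omega
      have hm' := g1 (h.v .tbl N + (j - (n - c))) (by omega)
      rw [hf _ (by omega)] at hm'
      have := hlast (f (j - (n - c))) (by rw [if_pos hle])
      simp only [eval_arr, eval_lit, hi, e1, e2, e3, eval_add, eval_sub, eval_zero,
        NumOp.apply, update_self, Nat.cast_zero, Function.update_idem, zero_add]
      rw [update_of_ne (by omega), hm']; exact this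
  · intro s fr hi ⟨g1, g2⟩ ht; refine ⟨?_, fun i hi => g2 i (by omega)⟩
    simp only at ht; omega
  · exact fun _ => lt_of_le_of_lt (sub_le _ _) (by simp [hn]; omega)
  · intro _; simp [hn]; omega

end DS

/-! ## Branch decompositions as rooted trees -/

theorem SimpleGraph.IsTree.exists_parent {V : Type*} {G : SimpleGraph V} (hG : G.IsTree) (r : V) :
    ∃ P : V → V, (∀ x, x ≠ r → G.Adj x (P x) ∧ G.dist r (P x) < G.dist r x) ∧
      ∀ x y, G.Adj x y → (y ≠ r ∧ P y = x) ∨ (x ≠ r ∧ y = P x) := by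
  have hex : ∀ x, ∃ q : G.Walk r x, q.length = G.dist r x := fun x =>
    hG.connected.exists_walk_length_eq_dist r x
  choose q hq using hex
  have hun : ∀ x y, G.Adj x y → G.dist r y < G.dist r x → y = (q x).penultimate := by
    intro x y hxy hlt
    have h1 : ((q y).concat hxy.symm).IsPath := by
      refine SimpleGraph.Walk.isPath_of_length_eq_dist _ (le_antisymm ?_ (SimpleGraph.dist_le _))
      rw [SimpleGraph.Walk.length_concat, hq]; omega
    have h2 := (q x).isPath_of_length_eq_dist (hq x)
    have h3 := (hG.existsUnique_path r x).unique h1 h2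
    rw [← h3]; simp
  refine ⟨fun x => (q x).penultimate, fun x hx => ?_, fun x y hxy => ?_⟩
  · have hnil : ¬ (q x).Nil := fun h => hx h.eq.symm
    have hadj := (q x).adj_penultimate hnil
    refine ⟨hadj.symm, ?_⟩
    change G.dist r (q x).penultimate < _
    have h1 := SimpleGraph.dist_le (q x).dropLast
    rcases hG.dist_eq_dist_add_one_of_adj r hadj with h | h
    · have h2 : (q x).dropLast.length + 1 = (q x).length := by
        have := congrArg SimpleGraph.Walk.length ((q x).concat_dropLast hadj)
        rwa [SimpleGraph.Walk.length_concat] at this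
      rw [hq] at h2; omega
    · omega
  · rcases hG.dist_eq_dist_add_one_of_adj r hxy with h | h
    · refine .inr ⟨?_, hun x y hxy (by omega)⟩
      rintro rfl; simp at h
    · refine .inl ⟨?_, (hun y x hxy.symm (by omega)).symm⟩
      rintro rfl; simp at h

/-- The edges listed in the input. -/
def edgesOf (μ : ℕ → ℕ) (N : ℕ) : Edges where
  eu x := μ (4 * x + 4)
  ev x := μ (4 * x + 5)
  own _ := 0
  Λ := (range N).filter fun x => μ (4 * x + 2) = 1

namespace BranchDecomposition

variable {n N : ℕ} {G : SimpleGraph (Fin n)} {T : BranchDecomposition G N} {μ : ℕ → ℕ}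
  (hT : T.IsEncodedBy μ)
include hT

theorem IsEncodedBy.ty (x : Fin N) :
    (μ (4 * x + 2) = 1 ↔ (T.tree.neighborSet x).ncard = 1) ∧ (μ (4 * x + 2) = 1 ∨ μ (4 * x + 2) = 3) := by
  obtain ⟨-, -, h1, h3, -⟩ := hT
  rcases T.degree x with h | h
  · have := (h1 ⟨x, h⟩).1
    simp only at this
    simp [h, this]
  · have := (h3 x h).1
    simp [h, this]

omit hT in
theorem mem_edgesOf {x : ℕ} : x ∈ (edgesOf μ N).Λ ↔ x < N ∧ μ (4 * x + 2) = 1 := by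
  simp [edgesOf]

theorem IsEncodedBy.leaf {l : ℕ} (hl : l ∈ (edgesOf μ N).Λ) :
    ∃ (x : {x : Fin N // (T.tree.neighborSet x).ncard = 1}) (u v : Fin n), (x : ℕ) = l ∧
      (T.leafEdge x : Sym2 (Fin n)) = s(u, v) ∧ (edgesOf μ N).eu l = u ∧ (edgesOf μ N).ev l = v := by
  obtain ⟨h1, h2⟩ := mem_edgesOf.1 hl
  have h3 := (hT.ty ⟨l, h1⟩).1.1 h2
  obtain ⟨-, -, u, v, huv, hu, hv⟩ := hT.2.2.1 ⟨⟨l, h1⟩, h3⟩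
  exact ⟨⟨⟨l, h1⟩, h3⟩, u, v, rfl, huv, hu, hv⟩

theorem IsEncodedBy.leaf_mem (x : {x : Fin N // (T.tree.neighborSet x).ncard = 1}) :
    (x : ℕ) ∈ (edgesOf μ N).Λ := mem_edgesOf.2 ⟨x.1.2, (hT.ty x.1).1.2 x.2⟩

theorem IsEncodedBy.inc_iff {x : {x : Fin N // (T.tree.neighborSet x).ncard = 1}} {v : ℕ} :
    (edgesOf μ N).inc x v ↔ ∃ h : v < n, (⟨v, h⟩ : Fin n) ∈ (T.leafEdge x : Sym2 (Fin n)) := by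
  obtain ⟨y, u, w, hy, he, hu, hw⟩ := hT.leaf (hT.leaf_mem x)
  obtain rfl : y = x := Subtype.ext (Fin.ext hy)
  rw [Edges.inc, hu, hw, he]
  simp only [Sym2.mem_iff, Fin.ext_iff]
  constructor
  · rintro (rfl | rfl); exacts [⟨u.2, .inl rfl⟩, ⟨w.2, .inr rfl⟩]
  · rintro ⟨-, h⟩; exact h.imp Eq.symm Eq.symm

theorem IsEncodedBy.eu_ne_ev {l : ℕ} (hl : l ∈ (edgesOf μ N).Λ) :
    (edgesOf μ N).eu l ≠ (edgesOf μ N).ev l := by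
  obtain ⟨x, u, v, rfl, he, hu, hv⟩ := hT.leaf hl
  have h := (T.leafEdge x).2
  rw [he, SimpleGraph.mem_edgeSet] at h
  rw [hu, hv]
  exact fun h' => h.ne (Fin.ext h')

theorem IsEncodedBy.lists : (edgesOf μ N).Lists G := by
  refine ⟨fun v hv => ?_, fun u v => ⟨fun h => ?_, ?_⟩⟩
  · obtain ⟨l, hl, hi⟩ := Edges.mem_VS _ |>.1 hv
    obtain ⟨x, -, -, rfl, -⟩ := hT.leaf hl; exact mem_range.2 (hT.inc_iff.1 hi).1
  · obtain ⟨x, hx⟩ := T.leafEdge.surjective ⟨s(u, v), h⟩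
    obtain ⟨y, a, b, hy, he, ha, hb⟩ := hT.leaf (hT.leaf_mem x)
    obtain rfl : y = x := Subtype.ext (Fin.ext hy); rw [hx] at he; refine ⟨_, hT.leaf_mem y, ?_⟩
    rw [ha, hb]
    rcases Sym2.eq_iff.1 he with ⟨rfl, rfl⟩ | ⟨rfl, rfl⟩
    · exact .inl ⟨rfl, rfl⟩
    · exact .inr ⟨rfl, rfl⟩
  · rintro ⟨l, hl, h⟩
    obtain ⟨x, a, b, rfl, he, ha, hb⟩ := hT.leaf hl
    rw [ha, hb, Fin.val_inj, Fin.val_inj, Fin.val_inj, Fin.val_inj] at h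
    have := (T.leafEdge x).2
    rw [he, SimpleGraph.mem_edgeSet] at this
    rcases h with ⟨rfl, rfl⟩ | ⟨rfl, rfl⟩
    exacts [this, this.symm]

theorem IsEncodedBy.slots (x : Fin N) : (slots μ x).Nodup ∧
    ∀ y, y ∈ slots μ x ↔ ∃ h : y < N, T.tree.Adj x ⟨y, h⟩ := by
  classical
  rcases T.degree x with h | h
  · have h2 := (hT.ty x).1.2 h
    obtain ⟨-, ⟨z, hz, hμ⟩, -⟩ := hT.2.2.1 ⟨x, h⟩; simp only at hμ hz
    rw [_root_.slots, if_pos h2, hμ]; refine ⟨by simp, fun y => ?_⟩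
    rw [List.mem_singleton]
    constructor
    · rintro rfl; exact ⟨z.2, hz⟩
    · rintro ⟨hy, ha⟩
      obtain ⟨w, hw⟩ := Set.ncard_eq_one.1 h
      have e1 : z ∈ T.tree.neighborSet x := hz
      have e2 : (⟨y, hy⟩ : Fin N) ∈ T.tree.neighborSet x := ha
      rw [hw, Set.mem_singleton_iff] at e1 e2; rw [e1, ← e2]
  · obtain ⟨h2, h3⟩ := hT.2.2.2.1 x h; rw [_root_.slots, if_neg (by omega)]
    set a := μ (4 * x + 3)
    set b := μ (4 * x + 4)
    set c := μ (4 * x + 5)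
    have hmem : ∀ y, y ∈ (T.tree.neighborSet x).toFinset.map Fin.valEmbedding ↔
        ∃ h : y < N, T.tree.Adj x ⟨y, h⟩ := by
      intro y
      simp only [mem_map, Set.mem_toFinset, SimpleGraph.mem_neighborSet, Fin.valEmbedding_apply]
      constructor
      · rintro ⟨z, hz, rfl⟩; exact ⟨z.2, hz⟩
      · rintro ⟨hy, hz⟩; exact ⟨_, hz, rfl⟩
    have hc : ((T.tree.neighborSet x).toFinset.map Fin.valEmbedding).card = 3 := by
      rw [card_map, ← Set.ncard_eq_toFinset_card', h]
    have hs : (T.tree.neighborSet x).toFinset.map Fin.valEmbedding ⊆ [a, b, c].toFinset := by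
      intro y hy; obtain ⟨hy, hz⟩ := (hmem y).1 hy
      rcases (h3 _).1 hz with h | h | h <;> simp only at h <;> simp [h]
    have hle := [a, b, c].toFinset_card_le
    have heq := eq_of_subset_of_card_le hs (by rw [hc]; exact hle)
    refine ⟨?_, fun y => ?_⟩
    · rw [← Multiset.coe_nodup, ← Multiset.toFinset_card_eq_card_iff_nodup]
      show [a, b, c].toFinset.card = 3
      rw [← heq, hc]
    · rw [← hmem, heq, List.mem_toFinset]

omit hT in
theorem ncard_middleSet_le_width {x y : Fin N} (h : T.tree.Adj x y) :
    (T.middleSet x y).ncard ≤ T.width := by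
  classical
  have := Finset.le_sup (f := fun e : Fin N × Fin N =>
    if T.tree.Adj e.1 e.2 then (T.middleSet e.1 e.2).ncard else 0) (mem_univ (x, y))
  exact (if_pos h).symm.le.trans this

omit hT in
theorem width_le : T.width ≤ n := by
  classical
  refine Finset.sup_le fun e _ => ?_
  split_ifs
  · have := Set.ncard_le_card (T.middleSet e.1 e.2)
    simpa using this
  · exact Nat.zero_le _

theorem IsEncodedBy.card : (edgesOf μ N).Λ.card = G.edgeSet.ncard ∧ N + 2 = 2 * G.edgeSet.ncard := by
  classical
  have hmap : (edgesOf μ N).Λ =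
      (univ.filter fun x : Fin N => (T.tree.neighborSet x).ncard = 1).map Fin.valEmbedding := by
    ext l
    simp only [mem_edgesOf, mem_map, mem_filter, mem_univ, true_and,
      Fin.valEmbedding_apply]
    constructor
    · rintro ⟨h1, h2⟩; exact ⟨⟨l, h1⟩, (hT.ty _).1.1 h2, rfl⟩
    · rintro ⟨x, h, rfl⟩; exact ⟨x.2, (hT.ty x).1.2 h⟩
  have h1 : (univ.filter fun x : Fin N => (T.tree.neighborSet x).ncard = 1).card =
      G.edgeSet.ncard := by
    rw [← Fintype.card_subtype, ← Nat.card_eq_fintype_card, Nat.card_congr T.leafEdge]; rfl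
  refine ⟨by rw [hmap, card_map, h1], ?_⟩
  have h2 := T.tree.sum_degrees_eq_twice_card_edges
  have h3 := T.isTree.card_edgeFinset
  rw [Fintype.card_fin] at h3
  have h4 : ∑ x : Fin N, (T.tree.degree x + if (T.tree.neighborSet x).ncard = 1 then 2 else 0) = 3 * N := by
    rw [sum_congr rfl (g := fun _ => 3), sum_const, Finset.card_univ, Fintype.card_fin,
      smul_eq_mul, mul_comm]
    intro x _
    have : T.tree.degree x = (T.tree.neighborSet x).ncard := by
      rw [Set.ncard_eq_toFinset_card']; rfl
    rcases T.degree x with h | h <;> simp [this, h]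
  rw [sum_add_distrib, h2, ← sum_filter, sum_const, h1, smul_eq_mul] at h4
  omega

theorem IsEncodedBy.rtree {r : ℕ} (hr : r ∈ (edgesOf μ N).Λ) :
    ∃ p rank, RTree μ N r p rank ∧
      ∀ x < N, x ≠ r → ((edgesOf μ N).mid (below (edgesOf μ N).Λ p r x)).card ≤ T.width := by
  classical
  obtain ⟨hrN, hrt⟩ := mem_edgesOf.1 hr
  obtain ⟨P, hP1, hP2⟩ := T.isTree.exists_parent ⟨r, hrN⟩
  set p : ℕ → ℕ := fun x => if h : x < N ∧ x ≠ r then (P ⟨x, h.1⟩ : ℕ) else N with hp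
  set rank : ℕ → ℕ := fun x => if h : x < N then T.tree.dist ⟨r, hrN⟩ ⟨x, h⟩ else 0 with hrank
  have hpx : ∀ x (h : x < N), x ≠ r → p x = P ⟨x, h⟩ := fun x h hx => by rw [hp]; simp [h, hx]
  have hne : ∀ {x : ℕ} (h : x < N), x ≠ r → (⟨x, h⟩ : Fin N) ≠ ⟨r, hrN⟩ := fun h hx h' =>
    hx (congrArg Fin.val h')
  have H : RTree μ N r p rank := by
    refine ⟨hrN, by simp [hp], fun x hx => ?_, fun x hx hxr => ?_, fun x hx => (hT.ty ⟨x, hx⟩).2, hrt,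
      fun x hx => (hT.slots ⟨x, hx⟩).1, fun x hx y => ?_⟩
    · rw [hp]; simp only; rw [dif_neg]; omega
    · rw [hpx x hx hxr]; refine ⟨Fin.is_lt _, ?_⟩; simpa [hrank, hx] using (hP1 _ (hne hx hxr)).2
    · rw [(hT.slots ⟨x, hx⟩).2 y]
      constructor
      · rintro ⟨hy, ha⟩
        refine ⟨hy, (hP2 _ _ ha).imp ?_ ?_⟩
        · rintro ⟨h1, h2⟩
          have hyr : y ≠ r := fun h => h1 (Fin.ext h)
          exact ⟨hyr, by rw [hpx y hy hyr, h2]⟩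
        · rintro ⟨h1, h2⟩
          have hxr : x ≠ r := fun h => h1 (Fin.ext h)
          exact ⟨hxr, by rw [hpx x hx hxr, ← h2]⟩
      · rintro ⟨hy, ⟨h1, h2⟩ | ⟨h1, h2⟩⟩
        · refine ⟨hy, ?_⟩
          have := (hP1 _ (hne hy h1)).1.symm
          rw [hpx y hy h1] at h2
          rwa [show P ⟨y, hy⟩ = ⟨x, hx⟩ from Fin.ext h2] at this
        · refine ⟨hy, ?_⟩
          have := (hP1 _ (hne hx h1)).1
          rw [hpx x hx h1] at h2
          rwa [show P ⟨x, hx⟩ = ⟨y, hy⟩ from Fin.ext h2.symm] at this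
  refine ⟨p, rank, H, fun x hx hxr => ?_⟩
  obtain ⟨hpN, hprank⟩ := H.par x hx hxr
  set X : Fin N := ⟨x, hx⟩ with hX
  set Y : Fin N := ⟨p x, hpN⟩ with hY
  have hadj : ∀ y (hy : y < N) (hyr : y ≠ r), T.tree.Adj ⟨y, hy⟩ ⟨p y, (H.par y hy hyr).1⟩ := by
    intro y hy hyr
    have := (hP1 _ (hne hy hyr)).1
    convert this using 1
    exact Fin.ext (hpx y hy hyr)
  -- edges to parents of other nodes remain
  have hedge : ∀ y (hy : y < N) (hyr : y ≠ r), y ≠ x →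
      (T.tree.deleteEdges {s(X, Y)}).Adj ⟨y, hy⟩ ⟨p y, (H.par y hy hyr).1⟩ := by
    intro y hy hyr hyx; rw [SimpleGraph.deleteEdges_adj]; refine ⟨hadj y hy hyr, fun h => ?_⟩
    rcases Sym2.eq_iff.1 (Set.mem_singleton_iff.1 h) with ⟨h1, -⟩ | ⟨h1, h2⟩
    · exact hyx (congrArg Fin.val h1)
    · have e1 : y = p x := congrArg Fin.val h1
      have e2 : p y = x := congrArg Fin.val h2
      have := (H.par y hy hyr).2
      rw [e2, e1] at this; omega
  have hdown : ∀ k y (hy : y < N), p^[k] y = x → (T.tree.deleteEdges {s(X, Y)}).Reachable X ⟨y, hy⟩ := by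
    intro k
    induction k with
    | zero => intro y hy h; obtain rfl : y = x := h; exact SimpleGraph.Reachable.refl _
    | succ k ih =>
      intro y hy h
      have h1 := (H.of_iterate (y := y) (k := k + 1) (by omega)).2
      rw [iterate_succ_apply] at h
      obtain ⟨-, hyr⟩ := H.of_parent (y := y) rfl (H.of_iterate (y := p y) (k := k) (by omega)).1
      have hyx : y ≠ x := by rintro rfl; rw [iterate_succ_apply, h] at h1; omega
      exact (ih _ (H.par y hy hyr).1 h).trans (hedge y hy hyr hyx).symm.reachable
  have hup : ∀ m y (hy : y < N), rank y ≤ m → (∀ k, p^[k] y ≠ x) →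
      (T.tree.deleteEdges {s(X, Y)}).Reachable ⟨y, hy⟩ ⟨r, hrN⟩ := by
    intro m
    induction m with
    | zero =>
      intro y hy hm _
      by_cases hyr : y = r
      · subst hyr; exact SimpleGraph.Reachable.refl _
      · have := (H.par y hy hyr).2; omega
    | succ m ih =>
      intro y hy hm hk
      by_cases hyr : y = r
      · subst hyr; exact SimpleGraph.Reachable.refl _
      · have := (H.par y hy hyr).2
        exact (hedge y hy hyr (hk 0)).reachable.trans (ih _ _ (by omega) fun k => hk (k + 1))
  have hYr := hup _ (p x) hpN le_rfl fun k h => by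
    have := (H.of_iterate (y := p x) (k := k) (by omega)).2
    rw [h] at this; omega
  have hsub : (edgesOf μ N).mid (below (edgesOf μ N).Λ p r x) ⊆
      (T.middleSet X Y).toFinset.map Fin.valEmbedding := by
    intro v hv; obtain ⟨hv1, l', hl', hi'⟩ := mem_filter.1 hv
    obtain ⟨l, hl, hi⟩ := (Edges.mem_VS _).1 hv1; obtain ⟨hlΛ, k, hk⟩ := (RTree.mem_below hxr).1 hl
    obtain ⟨hlΛ', hnb⟩ := mem_sdiff.1 hl'; rw [RTree.mem_below hxr, not_and, not_exists] at hnb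
    obtain ⟨z, -, -, rfl, -⟩ := hT.leaf hlΛ; obtain ⟨z', -, -, rfl, -⟩ := hT.leaf hlΛ'
    obtain ⟨hvn, hm⟩ := hT.inc_iff.1 hi; obtain ⟨hvn', hm2⟩ := hT.inc_iff.1 hi'; rw [mem_map]
    refine ⟨⟨v, hvn⟩, ?_, rfl⟩
    rw [Set.mem_toFinset]; refine ⟨⟨z, hdown k _ _ hk, hm⟩, ⟨z', ?_, hm2⟩⟩; rw [Sym2.eq_swap]
    exact hYr.trans (hup _ _ z'.1.2 le_rfl (hnb hlΛ')).symm
  refine (card_le_card hsub).trans ?_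
  rw [card_map, ← Set.ncard_eq_toFinset_card']
  exact ncard_middleSet_le_width (hadj x hx hxr)

end BranchDecomposition

/-! ## Matrix multiplication programs -/

theorem WordExp.Fits.mono {w w' : ℕ} (h : w ≤ w') {μ : ℕ → ℕ} {e : WordExp} (he : e.Fits w μ) :
    e.Fits w' μ := by
  have hp : 2 ^ w ≤ 2 ^ w' := pow_le_pow_right two_pos h
  induction e with
  | lit a => exact lt_of_lt_of_le he hp
  | get e ih => exact ⟨ih he.1, he.2.trans_le hp⟩
  | add e f ih ih' => exact ⟨ih he.1, ih' he.2.1, he.2.2.trans_le hp⟩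
  | sub e f ih ih' => exact ⟨ih he.1, ih' he.2⟩
  | mul e f ih ih' => exact ⟨ih he.1, ih' he.2.1, he.2.2.trans_le hp⟩

theorem Run.rescale {w w' b q t : ℕ} {p : Program} {s s' : Memory b} (h : Run w b 1 p s s' t)
    (hw : w ≤ w') (hq : 1 ≤ q) : ∃ t' ≤ q * t, Run w' b q p s s' t' := by
  have hp : 2 ^ w ≤ 2 ^ w' := pow_le_pow_right two_pos hw
  have hle : ∀ a, a ≤ q * a := fun a => le_mul_of_pos_left _ hq
  induction h with
  | setWord a e s ha he => exact ⟨_, hle _, .setWord a e s (ha.mono hw) (he.mono hw)⟩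
  | setNum a e s ha he =>
    refine ⟨_, ?_, .setNum a e s (ha.mono hw) (he.mono hw)⟩
    rw [Nat.mul_add, mul_one]; exact Nat.add_le_add_right (hle _) _
  | arith op a x y s ha hx hy =>
    refine ⟨_, ?_, .arith op a x y s (ha.mono hw) (hx.mono hw) (hy.mono hw)⟩
    rw [Nat.mul_add, mul_one]; exact Nat.add_le_add_right (hle _) _
  | testNum_zero a x s ha hx h =>
    refine ⟨_, ?_, .testNum_zero a x s (ha.mono hw) (hx.mono hw) h⟩
    rw [Nat.mul_add, mul_one]; exact Nat.add_le_add_right (hle _) _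
  | testNum_ne a x s ha hx h =>
    refine ⟨_, ?_, .testNum_ne a x s (ha.mono hw) (hx.mono hw) h⟩
    rw [Nat.mul_add, mul_one]; exact Nat.add_le_add_right (hle _) _
  | seq p r s s' s'' t t' _ _ ih ih' =>
    obtain ⟨u, hu, h⟩ := ih; obtain ⟨u', hu', h'⟩ := ih'
    exact ⟨_, by rw [Nat.mul_add]; exact Nat.add_le_add hu hu', .seq _ _ _ _ _ _ _ h h'⟩
  | ite_true e p r s s' t he h _ ih =>
    obtain ⟨u, hu, h'⟩ := ih
    exact ⟨_, by rw [Nat.mul_add]; exact Nat.add_le_add (hle _) hu, .ite_true _ _ _ _ _ _ (he.mono hw) h h'⟩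
  | ite_false e p r s s' t he h _ ih =>
    obtain ⟨u, hu, h'⟩ := ih
    exact ⟨_, by rw [Nat.mul_add]; exact Nat.add_le_add (hle _) hu, .ite_false _ _ _ _ _ _ (he.mono hw) h h'⟩
  | loop_stop e p s he h => exact ⟨_, hle _, Run.loop_stop _ _ _ (he.mono hw) h⟩
  | loop_step e p s s' s'' t t' he h _ _ ih ih' =>
    obtain ⟨u, hu, h1⟩ := ih; obtain ⟨u', hu', h2⟩ := ih'
    exact ⟨_, by rw [Nat.mul_add, Nat.mul_add]; exact Nat.add_le_add (Nat.add_le_add (hle _) hu) hu',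
      .loop_step _ _ _ _ _ _ _ (he.mono hw) h h1 h2⟩
  | call p ws wl ns nl wd wr nd nr s u t hfit h1 h2 h3 h4 _ ih =>
    obtain ⟨u', hu', h'⟩ := ih
    refine ⟨_, ?_, .call _ _ _ _ _ _ _ _ _ _ _ _ (fun e he => (hfit e he).mono hw) (h1.trans hp)
      (h2.trans hp) (h3.trans hp) (h4.trans hp) h'⟩
    rw [Nat.mul_add q _ t, Nat.mul_add q _ (1 * _), one_mul]
    exact Nat.add_le_add (Nat.add_le_add_right (hle _) _) hu'

open Classical in
theorem Run.card_changed {w b t : ℕ} {p : Program} {s s' : Memory b} (h : Run w b 1 p s s' t)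
    (X : Finset ℕ) : (X.filter fun i => s'.num i ≠ s.num i).card ≤ t := by
  have hupd : ∀ (f : ℕ → ZMod (2 ^ b)) (a : ℕ) (x : ZMod (2 ^ b)),
      (X.filter fun i => update f a x i ≠ f i).card ≤ 1 := by
    intro f a x; refine (card_le_card (t := {a}) fun i hi => ?_).trans (by simp)
    by_contra hne
    exact (mem_filter.1 hi).2 (update_of_ne (by simpa using hne) _ _)
  have htr : ∀ f g k : ℕ → ZMod (2 ^ b), (X.filter fun i => k i ≠ f i).card ≤
      (X.filter fun i => g i ≠ f i).card + (X.filter fun i => k i ≠ g i).card := by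
    intro f g k; refine (card_le_card fun i hi => ?_).trans (Finset.card_union_le _ _)
    simp only [mem_union, mem_filter] at hi ⊢
    by_cases h : g i = f i
    · exact .inr ⟨hi.1, h ▸ hi.2⟩
    · exact .inl ⟨hi.1, h⟩
  induction h with
  | setWord a e s ha he => simp
  | setNum a e s ha he => exact (hupd _ _ _).trans (by omega)
  | arith op a x y s ha hx hy => exact (hupd _ _ _).trans (by omega)
  | testNum_zero a x s ha hx h => simp
  | testNum_ne a x s ha hx h => simp
  | seq p r s s' s'' t t' _ _ ih ih' => exact (htr _ s'.num _).trans (Nat.add_le_add ih ih')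
  | ite_true e p r s s' t he h _ ih => exact ih.trans (by omega)
  | ite_false e p r s s' t he h _ ih => exact ih.trans (by omega)
  | loop_stop e p s he h => simp
  | loop_step e p s s' s'' t t' he h _ _ ih ih' =>
    exact (htr _ s'.num _).trans ((Nat.add_le_add ih ih').trans (by omega))
  | call p ws wl ns nl wd wr nd nr s u t hfit h1 h2 h3 h4 _ ih =>
    refine (card_le_card (t := Finset.Ico (nd.eval s.word) (nd.eval s.word + nr.eval s.word))
      fun i hi => ?_).trans (by rw [Nat.card_Ico]; omega)
    by_contra hne
    rw [Finset.mem_Ico] at hne; exact (mem_filter.1 hi).2 (if_neg hne)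

theorem two_le_of_mem {ω : ℝ} (hω : ω ∈ matrixMultiplicationExponents) : 2 ≤ ω := by
  classical
  obtain ⟨p, c, C, h⟩ := hω
  have key : ∀ N : ℕ, 1 ≤ N → (N : ℝ) ^ (2 : ℝ) ≤ C * (N : ℝ) ^ ω := by
    intro N hN; obtain ⟨s, t, hr, ht, hs⟩ := h 1 N hN 1 (1 + Matrix.of fun _ _ => 1)
    refine le_trans ?_ ht
    have h1 := hr.card_changed (range (N * N))
    rw [filter_true_of_mem, card_range] at h1
    · rw [Real.rpow_two, pow_two]; exact_mod_cast h1
    · intro i hi; rw [mem_range] at hi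
      have h2 := hs (Fin.divNat ⟨i, hi⟩) (Fin.modNat ⟨i, hi⟩)
      have h3 : N * (i / N) + i % N = i := div_add_mod i N
      simp only [Fin.coe_divNat, Fin.coe_modNat, h3, one_mul] at h2; rw [h2]
      simp only [matrixInput, hi, dif_pos, Matrix.add_apply, Matrix.of_apply]; simp
  by_contra! hlt
  obtain ⟨N, h1, h2⟩ := (((tendsto_rpow_atTop (sub_pos.2 hlt)).comp
    tendsto_natCast_atTop_atTop).eventually_gt_atTop (C : ℝ)).and (Filter.eventually_ge_atTop 1) |>.exists
  have hN : (0 : ℝ) < N := by exact_mod_cast h2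
  have h3 := key N h2
  simp only [Function.comp] at h1
  rw [Real.rpow_sub hN, lt_div_iff₀ (Real.rpow_pos_of_pos hN _)] at h1
  linarith

/-- The environment of a computation. -/
noncomputable def Env.ofMatrix {ω : ℝ} {p : Program} {c C : ℕ}
    (H : ∀ (b N : ℕ), 1 ≤ N →
      ∀ A B : Matrix (Fin N) (Fin N) (ZMod (2 ^ b)), ∃ (s : Memory b) (t : ℕ),
        Run (c * (log 2 N + 1)) b 1 p (matrixInput A B) s t ∧ (t : ℝ) ≤ C * (N : ℝ) ^ ω ∧
        ∀ i j : Fin N, s.num (N * i + j) = (A * B) i j)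
    (b q l : ℕ) (μ : ℕ → ℕ) (hq : 1 ≤ q) (hB : 1024 ≤ 2 ^ (12 * l)) (hinp : ∀ i, μ i < 2 ^ (12 * l))
    (hN : 4 * μ 1 + 2 < 2 ^ (12 * l)) : Env where
  w := (c + 70) * 12 * l
  b := b
  q := q
  B := 2 ^ (12 * l)
  inp := μ
  M := p
  tmm D := ⌊C * (D : ℝ) ^ ω⌋₊
  hq := hq
  hB := hB
  hinp := hinp
  hN := hN
  hw := by rw [← pow_mul]; exact pow_le_pow_right two_pos (by nlinarith)
  hM := by
    intro D hD hDB f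
    obtain ⟨s, t, hr, ht, hs⟩ := H b D hD (.of fun i j => f (i * D + j))
      (.of fun i j => f (D * D + i * D + j))
    have hlog : log 2 D < 12 * l := Nat.log_lt_of_lt_pow (by omega) hDB
    obtain ⟨t', ht', hr'⟩ := hr.rescale (w' := (c + 70) * 12 * l) (q := q) (by nlinarith) hq
    refine ⟨s, t', ?_, ht'.trans (Nat.mul_le_mul_left _ (le_floor ht)), fun i hi j hj => ?_⟩
    · rw [matrixInput] at hr'
      convert hr' using 3 with i
      have hdm : ∀ i, i / D * D + i % D = i := fun i => by rw [mul_comm]; exact div_add_mod i D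
      simp only [cellsFrom, Matrix.of_apply, Fin.coe_divNat, Fin.coe_modNat, zero_add]
      by_cases h1 : i < D * D
      · rw [if_pos (by omega), dif_pos h1, hdm]
      · rw [dif_neg h1]
        by_cases h2 : i - D * D < D * D
        · rw [if_pos (by omega), dif_pos h2, add_assoc, hdm]; congr 1; omega
        · rw [if_neg (by omega), dif_neg h2]
    · have := hs ⟨i, hi⟩ ⟨j, hj⟩
      rw [Matrix.mul_apply] at this; rw [this, Finset.sum_range]; rfl

/-- The products of blocks take `O(3 ^ (ω K / 2))` time. -/
theorem floor_time {ω : ℝ} (hω : 2 ≤ ω) {C K L I F R d : ℕ} (h1 : L + I + F ≤ K + 2)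
    (h2 : R + I + F ≤ K + 2) (h3 : L + R + I ≤ K) (hd : d = min (min L F) R) :
    3 ^ (I + (L - d) + (F - d) + (R - d)) * (⌊C * ((3 ^ d : ℕ) : ℝ) ^ ω⌋₊ + 32 * 9 ^ d) ≤
      ⌊((C : ℝ) + 32) * 3 ^ ω * 3 ^ (ω / 2 * K)⌋₊ := by
  have hexp : I + (L - d) + (F - d) + (R - d) + 2 * d ≤ K + 2 ∧ 2 * d ≤ K + 2 := by omega
  set a := I + (L - d) + (F - d) + (R - d) with ha
  have h3d : ((3 ^ d : ℕ) : ℝ) ^ ω = 3 ^ (ω * d) := by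
    push_cast
    rw [← Real.rpow_natCast, ← Real.rpow_mul (by norm_num), mul_comm]
  have h9 : (9 : ℝ) ^ d ≤ 3 ^ (ω * d) := by
    have : (9 : ℝ) ^ d = 3 ^ ((2 : ℝ) * d) := by
      rw [Real.rpow_mul (by norm_num), Real.rpow_natCast]; norm_num
    rw [this]
    exact Real.rpow_le_rpow_of_exponent_le (by norm_num) (mul_le_mul_of_nonneg_right hω (by positivity))
  refine le_floor ?_
  push_cast
  have hfl : (⌊C * ((3 : ℝ) ^ d) ^ ω⌋₊ : ℝ) ≤ C * 3 ^ (ω * d) := by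
    rw [← h3d]; push_cast; exact floor_le (by positivity)
  calc (3 : ℝ) ^ a * (⌊C * ((3 : ℝ) ^ d) ^ ω⌋₊ + 32 * 9 ^ d)
      ≤ 3 ^ a * (C * 3 ^ (ω * d) + 32 * 3 ^ (ω * d)) := by gcongr
    _ = (C + 32) * 3 ^ (a + ω * d) := by
      rw [Real.rpow_add (by norm_num), Real.rpow_natCast]; ring
    _ ≤ (C + 32) * 3 ^ (ω + ω / 2 * K) := by
      refine mul_le_mul_of_nonneg_left (Real.rpow_le_rpow_of_exponent_le (by norm_num) ?_) (by positivity)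
      have e1 : (a : ℝ) + 2 * d ≤ K + 2 := by exact_mod_cast hexp.1
      have e2 : 2 * (d : ℝ) ≤ K + 2 := by exact_mod_cast hexp.2
      nlinarith
    _ = (C + 32) * 3 ^ ω * 3 ^ (ω / 2 * K) := by rw [Real.rpow_add (by norm_num)]; ring

/-- All words are polynomial in `n` and `2 ^ k`. -/
theorem word_bounds {n k m N : ℕ} (hk : 2 ≤ k) (hkn : k ≤ n) (hm : m ≤ n * n) (hN : N + 2 = 2 * m) :
    1024 ≤ 2 ^ (12 * (k + log 2 n)) ∧ 4 * N + 4 < 2 ^ (12 * (k + log 2 n)) ∧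
      n + 1 < 2 ^ (12 * (k + log 2 n)) ∧ 2 * m < 2 ^ (12 * (k + log 2 n)) ∧
      2 * (2 * k + 1) * 9 ^ k < 2 ^ (12 * (k + log 2 n)) ∧
      n + 1 + (N + 1) * (3 * 9 ^ k + (3 * n + 2) * 3 ^ k) < 2 ^ (12 * (k + log 2 n)) := by
  set Z := 2 ^ (k + log 2 n) with hZ
  have e : 2 ^ (12 * (k + log 2 n)) = Z ^ 12 := by rw [hZ, ← pow_mul, mul_comm]
  have hn : 2 * n ≤ Z := by
    have h1 : n < 2 ^ (log 2 n + 1) := Nat.lt_pow_succ_log_self (by norm_num) n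
    have h2 : 2 ^ (log 2 n + 1 + 1) ≤ Z := pow_le_pow_right two_pos (by omega)
    rw [pow_succ] at h2; omega
  have hkZ : 2 ^ k ≤ Z := pow_le_pow_right two_pos (by omega)
  have h8 : 4 ≤ Z := by omega
  have h9 : 9 ^ k ≤ Z ^ 4 := by
    calc 9 ^ k ≤ 16 ^ k := pow_le_pow_left (by norm_num) _
      _ = (2 ^ k) ^ 4 := by rw [← pow_mul, mul_comm, pow_mul]; norm_num
      _ ≤ _ := pow_le_pow_left hkZ _
  have h3 : 3 ^ k ≤ Z ^ 2 := by
    calc 3 ^ k ≤ 4 ^ k := pow_le_pow_left (by norm_num) _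
      _ = (2 ^ k) ^ 2 := by rw [← pow_mul, mul_comm, pow_mul]; norm_num
      _ ≤ _ := pow_le_pow_left hkZ _
  have hmZ : 4 * m ≤ Z ^ 2 := by
    have := Nat.mul_le_mul hn hn
    rw [pow_two]; nlinarith
  have hp : ∀ i j, i ≤ j → Z ^ i ≤ Z ^ j := fun i j h => pow_le_pow_right (by omega) h
  have h1 := hp 1 2 (by norm_num)
  have h24 := hp 2 4 (by norm_num)
  have h28 := hp 2 8 (by norm_num)
  have h48 := hp 4 8 (by norm_num)
  have hbig : 256 * Z ^ 8 ≤ Z ^ 12 := by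
    have := Nat.mul_le_mul_right (Z ^ 8) (pow_le_pow_left h8 4)
    calc _ = 4 ^ 4 * Z ^ 8 := by norm_num
      _ ≤ Z ^ 4 * Z ^ 8 := this
      _ = Z ^ 12 := by ring
  have h16 : 4 ^ 8 ≤ Z ^ 8 := pow_le_pow_left h8 8
  have ha : 2 * (2 * k + 1) * 9 ^ k ≤ 4 * Z * Z ^ 4 := Nat.mul_le_mul (by omega) h9
  have hZ5 : 4 * Z * Z ^ 4 ≤ 4 * Z ^ 8 := by
    calc 4 * Z * Z ^ 4 = 4 * Z ^ 5 := by ring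
      _ ≤ _ := Nat.mul_le_mul_left _ (hp 5 8 (by norm_num))
  have hb : (N + 1) * (3 * 9 ^ k + (3 * n + 2) * 3 ^ k) ≤ Z ^ 2 * (3 * Z ^ 4 + 3 * Z * Z ^ 2) :=
    Nat.mul_le_mul (by omega) (Nat.add_le_add (Nat.mul_le_mul_left _ h9) (Nat.mul_le_mul (by omega) h3))
  have hb' : Z ^ 2 * (3 * Z ^ 4 + 3 * Z * Z ^ 2) ≤ 6 * Z ^ 8 := by
    have e1 : Z ^ 2 * (3 * Z ^ 4 + 3 * Z * Z ^ 2) = 3 * Z ^ 6 + 3 * Z ^ 5 := by ring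
    have := hp 5 8 (by norm_num)
    have := hp 6 8 (by norm_num)
    omega
  rw [e]
  rw [pow_one] at h1
  refine ⟨?_, ?_, ?_, ?_, ?_, ?_⟩ <;> omega

/-! ## The algorithms -/

theorem BranchDecomposition.IsEncodedBy.small {n N : ℕ} {G : SimpleGraph (Fin n)}
    {T : BranchDecomposition G N} {μ : ℕ → ℕ} (hT : T.IsEncodedBy μ) (i : ℕ) :
    μ i ≤ n ∨ μ i ≤ N ∨ μ i ≤ 3 := by
  rcases Nat.lt_or_ge i (4 * N + 2) with hi | hi
  swap
  · rw [hT.2.2.2.2 i hi]; omega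
  match i, hi with
  | 0, _ => exact .inl hT.1.le
  | 1, _ => exact .inr (.inl hT.2.1.le)
  | j + 2, hi =>
    obtain ⟨x, r, hr, rfl⟩ : ∃ x r, r < 4 ∧ j = 4 * x + r := ⟨j / 4, j % 4, mod_lt _ (by norm_num), by omega⟩
    have hx : x < N := by omega
    have hty := (hT.ty ⟨x, hx⟩).2
    have hsl : ∀ y ∈ _root_.slots μ x, y ≤ N := fun y hy => (((hT.slots ⟨x, hx⟩).2 y).1 hy).1.le
    simp only at hty
    rcases hty with h | h
    · obtain ⟨-, u, v, -, -, hu, hv⟩ := hT.leaf (BranchDecomposition.mem_edgesOf.2 ⟨hx, h⟩)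
      simp only [edgesOf] at hu hv; rw [_root_.slots, if_pos h] at hsl
      have := hsl _ (List.mem_singleton_self _)
      interval_cases r <;> simp only [add_assoc, reduceAdd] <;> omega
    · rw [_root_.slots, if_neg (by omega)] at hsl; simp only [List.forall_mem_cons] at hsl
      interval_cases r <;> simp only [add_assoc, reduceAdd] <;> omega

namespace DS

open Env HProg

/-- The main part of the algorithms. -/
def program (full flat : Bool) : HProg := main full flat ;; if full then outputAll else outputMin

/-- The size of a minimum dominating set. -/
def minSize : HExp := rd .lo (sc .nN) + (sc .nn - sc .noniso)

variable {E : Env} {h : HState E.b} {G : Edges} {full flat : Bool} {n K TT N : ℕ}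

theorem wp_program {H : SimpleGraph (Fin n)} (L : G.Lists H)
    (hP : ∀ o : ℕ → ℕ, (∀ v ∈ G.VS G.Λ, o v ∈ G.Λ ∧ G.inc (o v) v) →
      Par E { G with own := o } full flat n K TT)
    (hmain : E.wp (main full flat) h fun s =>
      s.t ≤ h.t + (N + 1) * (1200 * ((layers full n K + 1) * ((layers full n K + 1) * TT)) + 59) ∧
      s.v .nn 0 = n ∧ s.v .nN 0 = N ∧ s.v .noniso 0 = (G.VS G.Λ).card ∧ s.m 0 = 0 ∧
      n + 1 ≤ s.v .tbl N ∧ ∃ o : ℕ → ℕ, (∀ v ∈ G.VS G.Λ, o v ∈ G.Λ ∧ G.inc (o v) v) ∧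
        NodeOk { G with own := o } full flat n K s.v s.m G.Λ N ∧ rowSet n s.v N = ∅) :
    E.wp (program full flat) h fun s =>
      s.t ≤ h.t + (N + 1) * (1200 * ((layers full n K + 1) * ((layers full n K + 1) * TT)) + 59) +
        (if full then 4 * (n + 1) + 3 else 1) ∧
      (full = true → ∀ κ ≤ n, s.m κ = ({D | IsDominatingSet H D ∧ D.card = κ}.ncard : ℕ)) ∧
      (full = false → flat = false → s.m 0 = ({D | IsMinimumDominatingSet H D}.ncard : ℕ)) ∧
      (full = false → ∀ D, IsMinimumDominatingSet H D → minSize.eval s.v = D.card) := by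
  refine wp_seq (hmain.mono ?_)
  rintro s - - ⟨ht, e1, e2, e3, e4, e5, o, ho, hN, h0⟩
  have P := hP o ho
  obtain ⟨A, hA, hm, hne⟩ := hN.root h0
  have L' : ({ G with own := o } : Edges).Lists H := ⟨L.sub, L.adj⟩
  set G' : Edges := { G with own := o } with hG'
  cases full with
  | true =>
    obtain rfl : flat = false := by
      cases flat; exacts [rfl, absurd (P.cflat rfl).1 (by simp)]
    rw [hN.lo0 rfl] at hA
    refine (wp_outputAll (f := fun j => (A j).card) e1 e2 e3 e5 hm P.nB).mono ?_
    rintro s' - - ⟨ht', hm'⟩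
    refine ⟨by simp only [if_true]; omega, fun _ κ hκ => ?_, by simp, by simp⟩
    rw [hm' κ hκ]
    have hmem : ∀ j D, D ∈ A j ↔ G'.Dominating D ∧ D.card = j := hA.eq_of_full ho
    split_ifs with hle
    · rw [L'.ncard_image (A := A (κ - (n - (G.VS G.Λ).card))) (fun D hD => ((hmem _ D).1 hD).1.1)]
      intro D; simp only [Set.mem_ofPred_eq, L'.isDominatingSet_iff, hmem]
      constructor
      · rintro ⟨⟨D', h1, rfl⟩, h2⟩
        rw [L'.card_back h1.1] at h2
        exact ⟨D', ⟨h1, by change _ + (n - (G.VS G.Λ).card) = _ at h2; omega⟩, rfl⟩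
      · rintro ⟨D', ⟨h1, h2⟩, rfl⟩
        refine ⟨⟨D', h1, rfl⟩, ?_⟩
        rw [L'.card_back h1.1, h2]; exact Nat.sub_add_cancel hle
    · rw [L'.ncard_image (A := ∅) (by simp)]
      · simp
      · intro D
        simp only [Set.mem_ofPred_eq, L'.isDominatingSet_iff, notMem_empty, false_and, exists_false,
          iff_false]
        rintro ⟨⟨D', h1, rfl⟩, h2⟩
        rw [L'.card_back h1.1] at h2
        exact hle (by change _ + (n - (G.VS G.Λ).card) = _ at h2; omega)
  | false =>
    have hlo : ∀ D', G'.Target false D' → D'.card = s.v .lo N := fun D' => hA.card_of_target (hne rfl) ho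
    refine wp_arith ⟨by simp; omega, by simp, fun _ hflat => ?_, fun _ D hD => ?_⟩
    · subst hflat
      have := hm 0 (Nat.zero_le _)
      simp only [eval_arr, eval_lit, eval_zero, e2, NumOp.apply, update_self, e4, zero_add]
      rw [add_zero] at this
      rw [this, L'.ncard_image (A := A 0) fun D hD => ((hA.eq_of_min (hne rfl) ho D).1 hD).1.1]
      intro D
      simp only [Set.mem_ofPred_eq, L'.isMinimumDominatingSet_iff, hA.eq_of_min (hne rfl) ho]
    · obtain ⟨D', h1, rfl⟩ := L'.isMinimumDominatingSet_iff.1 hD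
      rw [L'.card_back h1.1.1, hlo D' h1]
      simp only [minSize, eval_add, eval_sub, eval_arr, eval_lit, e1, e2, e3]
      rfl

/-- The algorithms, with a program for matrix multiplication. -/
def algorithm (full flat : Bool) (p : Program) : Program :=
  .seq ((program full flat).comp p) (.setWord (.lit 0) minSize.comp)

theorem val_ncard {n b : ℕ} {X : Set (Finset (Fin n))} (h0 : ∅ ∉ X) (hb : n ≤ b) :
    ((X.ncard : ℕ) : ZMod (2 ^ b)).val = X.ncard := by
  refine ZMod.val_natCast_of_lt (lt_of_lt_of_le ?_ (pow_le_pow_right two_pos hb))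
  have := Set.ncard_lt_card (s := X) fun h => h0 (h ▸ Set.mem_univ _)
  simpa using this

theorem exists_run {ω : ℝ} (hω : 2 ≤ ω) {p : Program} {c C : ℕ}
    (HM : ∀ (b N : ℕ), 1 ≤ N →
      ∀ A B : Matrix (Fin N) (Fin N) (ZMod (2 ^ b)), ∃ (s : Memory b) (t : ℕ),
        Run (c * (log 2 N + 1)) b 1 p (matrixInput A B) s t ∧ (t : ℝ) ≤ C * (N : ℝ) ^ ω ∧
        ∀ i j : Fin N, s.num (N * i + j) = (A * B) i j)
    {n N m k : ℕ} {H : SimpleGraph (Fin n)} {T : BranchDecomposition H N} (hm : m = H.edgeSet.ncard)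
    (hk : k = max 2 T.width) {μ : ℕ → ℕ} (hT : T.IsEncodedBy μ) (full flat : Bool) (b q : ℕ) (hq : 1 ≤ q)
    (hb : flat = false → n ≤ b) (hf : flat = true → full = false ∧ (2 * k + 1) * 9 ^ k < 2 ^ b) :
    ∃ (s : Memory b) (t : ℕ), Run ((c + 70) * 12 * (k + log 2 n)) b q
        (algorithm full flat p) ⟨μ, fun _ => 0⟩ s t ∧
      (t : ℝ) ≤ ⌈8000 * 9727 * (((C : ℝ) + 32) * 3 ^ ω)⌉₊ *
        (m * (layers full n k : ℝ) ^ 2 * 3 ^ (ω / 2 * k) * q) ∧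
      (full = true → flat = false → ∀ κ ≤ n, (s.num κ).val =
        {D : Finset (Fin n) | IsDominatingSet H D ∧ D.card = κ}.ncard) ∧
      (full = false → flat = false → (s.num 0).val =
        {D : Finset (Fin n) | IsMinimumDominatingSet H D}.ncard) ∧
      (full = false → ∀ D, IsMinimumDominatingSet H D → s.word 0 = D.card) := by
  classical
  obtain ⟨hc1, hc2⟩ := hT.card
  rw [← hm] at hc1 hc2
  have hΛ : (edgesOf μ N).Λ.Nonempty := card_pos.1 (by omega)
  have hn2 : 2 ≤ n := by
    obtain ⟨l, hl⟩ := hΛ; obtain ⟨-, u, v, -, -, hu, hv⟩ := hT.leaf hl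
    have := hT.eu_ne_ev hl
    omega
  have hk2 : 2 ≤ k := by omega
  have hkn : k ≤ n := by have := T.width_le; omega
  have hmn : m ≤ n * n := by
    have h1 := H.card_edgeFinset_le_card_choose_two
    rw [Fintype.card_fin, Nat.choose_two_right] at h1; rw [hm, Set.ncard_eq_toFinset_card']
    exact h1.trans ((Nat.div_le_self _ _).trans (Nat.mul_le_mul_left _ (sub_le _ _)))
  obtain ⟨w1, w2, w3, w4, w5, w6⟩ := word_bounds hk2 hkn hmn hc2
  have hinp : ∀ i, μ i < 2 ^ (12 * (k + log 2 n)) := fun i => by have := hT.small i; omega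
  have hWn : layers full n k ≤ n := by rw [layers]; split_ifs <;> omega
  have hW2 : 2 ≤ layers full n k := by rw [layers]; split_ifs <;> omega
  set W := layers full n k with hW
  set Y : ℝ := ((C : ℝ) + 32) * 3 ^ ω * 3 ^ (ω / 2 * k) with hY
  have hroom : n + 1 + (N + 1) * room full n k < 2 ^ (12 * (k + log 2 n)) := by
    refine lt_of_le_of_lt (Nat.add_le_add_left (Nat.mul_le_mul_left _ ?_) _) w6
    exact Nat.add_le_add_left (Nat.mul_le_mul_right _ (by omega)) _
  let E : Env := Env.ofMatrix HM b q (k + log 2 n) μ hq w1 hinp (by rw [hT.2.1]; omega)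
  have hP : ∀ o : ℕ → ℕ, (∀ v ∈ (edgesOf μ N).VS (edgesOf μ N).Λ,
      o v ∈ (edgesOf μ N).Λ ∧ (edgesOf μ N).inc (o v) v) →
      Par E { edgesOf μ N with own := o } full flat n k ⌊Y⌋₊ := fun o ho =>
    ⟨ho, hT.lists.sub, w3, by change 2 * (edgesOf μ N).Λ.card < _; rw [hc1]; exact w4, hk2, hkn, w5,
      fun _ => hb, hf, fun L I F R d h1 h2 h3 hd => floor_time hω h1 h2 h3 hd⟩
  have hmain := wp_main (E := E) (h := ⟨fun _ _ => 0, fun _ => 0, 0⟩) hP (fun r hr => by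
      obtain ⟨p, rank, h1, h2⟩ := hT.rtree hr
      exact ⟨p, rank, h1, fun x hx hxr => (h2 x hx hxr).trans (by omega)⟩) hT.1 hT.2.1 hΛ
    (fun x => BranchDecomposition.mem_edgesOf) (fun x hx => ⟨rfl, rfl, hT.eu_ne_ev hx⟩) (fun _ _ => rfl)
    (fun _ => rfl) (lt_of_le_of_lt (by omega) w2) hroom
  obtain ⟨h', ⟨t, hr, ht⟩, hbd, -, ht', q1, q2, q3⟩ := wp_program hT.lists hP hmain
    (by cases full <;> cases flat <;> decide) fun _ _ => lt_of_lt_of_le (by norm_num) w1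
  have h0 : E.conc ⟨fun _ _ => 0, fun _ => 0, 0⟩ = (⟨μ, fun _ => 0⟩ : Memory b) := by
    refine congrArg (fun f => (⟨f, fun _ => 0⟩ : Memory b)) (funext fun i => ?_)
    rw [Env.words]
    split_ifs with hi
    · rfl
    · have : μ i = 0 := hT.2.2.2.2 i (by
        have e : E.len = 4 * N + 2 := by rw [← hT.2.1]; rfl
        omega)
      rw [this]; split <;> rfl
  rw [h0] at hr
  have hwf : minSize.wf = true := by decide
  have hz : ∅ ∉ {D : Finset (Fin n) | IsDominatingSet H D} := fun h => by
    obtain ⟨d, hd, -⟩ := h ⟨0, by omega⟩ (by simp)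
    simp at hd
  refine ⟨_, _, .seq _ _ _ _ _ _ _ hr (.setWord (.lit 0) minSize.comp (E.conc h') (by simp [WordExp.Fits])
    (E.fits_wf hbd hwf)), ?_, fun hfu hfl κ hκ => ?_, fun hfu hfl => ?_, fun hfu D hD => ?_⟩
  · have hcost := cost_comp_le_of_wf hwf
    have hY1 : 1 ≤ Y := by
      have h1 : (1 : ℝ) ≤ 3 ^ ω := Real.one_le_rpow (by norm_num) (by linarith)
      have h2 : (1 : ℝ) ≤ 3 ^ (ω / 2 * k) := Real.one_le_rpow (by norm_num) (by positivity)
      have h3 : (1 : ℝ) ≤ C + 32 := by have : (0 : ℝ) ≤ C := by positivity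
                                       linarith
      exact one_le_mul_of_one_le_of_one_le (one_le_mul_of_one_le_of_one_le h3 h1) h2
    have hfl : (⌊Y⌋₊ : ℝ) ≤ Y := floor_le (by linarith)
    have hWR : (2 : ℝ) ≤ W := by exact_mod_cast hW2
    have hmR : (1 : ℝ) ≤ m := by exact_mod_cast (by omega : 1 ≤ m)
    have hNm : (N : ℝ) + 1 ≤ 2 * m := by exact_mod_cast (by omega : N + 1 ≤ 2 * m)
    have hext : ((if full then 4 * (n + 1) + 3 else 1 : ℕ) : ℝ) + 1 ≤ 8 * W ^ 2 := by
      have : (if full then 4 * (n + 1) + 3 else 1) + 1 ≤ 8 * W ^ 2 := by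
        cases full
        · simp only [Bool.false_eq_true, if_false]; nlinarith
        · have : W = n := by simp [hW, layers]
          simp only [if_true, this]; nlinarith
      exact_mod_cast this
    have htR : (h'.t : ℝ) ≤ (N + 1) * (1200 * ((W + 1) * ((W + 1) * ⌊Y⌋₊)) + 59) +
        (if full then 4 * (n + 1) + 3 else 1 : ℕ) := by
      have : h'.t ≤ 0 + (N + 1) * (1200 * ((W + 1) * ((W + 1) * ⌊Y⌋₊)) + 59) +
        (if full then 4 * (n + 1) + 3 else 1) := ht'
      rw [zero_add] at this
      exact_mod_cast this
    have hWY : 1 ≤ (W : ℝ) ^ 2 * Y := one_le_mul_of_one_le_of_one_le (by nlinarith) hY1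
    have hsum : (h'.t : ℝ) + 1 ≤ 9727 * (m * W ^ 2 * Y) := by
      have hb1 : ((N : ℝ) + 1) * (1200 * ((W + 1) * ((W + 1) * ⌊Y⌋₊)) + 59) ≤
          2 * m * (1200 * (2 * W * (2 * W * Y)) + 59 * (W ^ 2 * Y)) := by
        have : (W : ℝ) + 1 ≤ 2 * W := by linarith
        gcongr
        linarith
      have hb2 : 8 * (W : ℝ) ^ 2 ≤ 8 * (m * W ^ 2 * Y) := by
        have : (W : ℝ) ^ 2 ≤ m * W ^ 2 * Y := by
          have h1 : (W : ℝ) ^ 2 * 1 ≤ W ^ 2 * (m * Y) := mul_le_mul_of_nonneg_left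
            (one_le_mul_of_one_le_of_one_le hmR hY1) (by positivity)
          linarith
        linarith
      have hpos : 0 ≤ (m : ℝ) * W ^ 2 * Y := by positivity
      linarith
    have htot : ((t + ((WordExp.lit 0).cost + minSize.comp.cost + 1) : ℕ) : ℝ) ≤ 8000 * q * (h'.t + 1) := by
      have h1 : t + 8000 * q * 0 ≤ 8000 * q * h'.t := ht
      have : t + ((WordExp.lit 0).cost + minSize.comp.cost + 1) ≤ 8000 * q * (h'.t + 1) := by
        simp only [WordExp.cost]; rw [Nat.mul_add]; omega
      exact_mod_cast this
    calc _ ≤ (8000 : ℝ) * q * (h'.t + 1) := htot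
      _ ≤ 8000 * q * (9727 * (m * W ^ 2 * Y)) := by gcongr
      _ = 8000 * 9727 * (((C : ℝ) + 32) * 3 ^ ω) * (m * W ^ 2 * 3 ^ (ω / 2 * k) * q) := by rw [hY]; ring
      _ ≤ _ := by gcongr; exact Nat.le_ceil _
  · change (h'.m κ).val = _
    rw [q1 hfu κ hκ]; exact val_ncard (fun h => hz h.1) (hb hfl)
  · change (h'.m 0).val = _
    rw [q2 hfu hfl]; exact val_ncard (fun h => hz h.1) (hb hfl)
  · change update (E.words h'.v) 0 (minSize.comp.eval (E.words h'.v)) 0 = _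
    rw [update_self, E.eval_comp, q3 hfu D hD]

end DS

theorem mainTheorem7 (ω : ℝ) (hω : ω ∈ matrixMultiplicationExponents) :
    -- counting the dominating sets of each size
    (∃ (p : Program) (c C : ℕ), ∀ (n N : ℕ) (G : SimpleGraph (Fin n))
      (T : BranchDecomposition G N) (m k : ℕ), m = G.edgeSet.ncard → k = max 2 T.width →
      ∀ μ : ℕ → ℕ, T.IsEncodedBy μ →
      ∀ iMul : ℕ → ℕ, (∀ a, 1 ≤ iMul a) →
      ∃ (s : Memory n) (t : ℕ),
        Run (c * (k + log 2 n)) n (iMul n) p ⟨μ, fun _ => 0⟩ s t ∧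
        (t : ℝ) ≤ C * (m * (n : ℝ) ^ 2 * (3 : ℝ) ^ (ω / 2 * k) * iMul n) ∧
        ∀ κ ≤ n, (s.num κ).val =
          {D : Finset (Fin n) | IsDominatingSet G D ∧ D.card = κ}.ncard) ∧
    -- counting the minimum dominating sets
    (∃ (p : Program) (c C : ℕ), ∀ (n N : ℕ) (G : SimpleGraph (Fin n))
      (T : BranchDecomposition G N) (m k : ℕ), m = G.edgeSet.ncard → k = max 2 T.width →
      ∀ μ : ℕ → ℕ, T.IsEncodedBy μ →
      ∀ iMul : ℕ → ℕ, (∀ a, 1 ≤ iMul a) →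
      ∃ (s : Memory n) (t : ℕ),
        Run (c * (k + log 2 n)) n (iMul n) p ⟨μ, fun _ => 0⟩ s t ∧
        (t : ℝ) ≤ C * (m * (k : ℝ) ^ 2 * (3 : ℝ) ^ (ω / 2 * k) * iMul n) ∧
        (s.num 0).val = {D : Finset (Fin n) | IsMinimumDominatingSet G D}.ncard) ∧
    -- computing the size of a minimum dominating set
    (∃ (p : Program) (c C : ℕ), ∀ (n N : ℕ) (G : SimpleGraph (Fin n))
      (T : BranchDecomposition G N) (m k : ℕ), m = G.edgeSet.ncard → k = max 2 T.width →
      ∀ μ : ℕ → ℕ, T.IsEncodedBy μ →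
      ∀ iMul : ℕ → ℕ, (∀ a, 1 ≤ iMul a) →
      ∃ (s : Memory (c * k)) (t : ℕ),
        Run (c * (k + log 2 n)) (c * k) (iMul k) p ⟨μ, fun _ => 0⟩ s t ∧
        (t : ℝ) ≤ C * (m * (k : ℝ) ^ 2 * (3 : ℝ) ^ (ω / 2 * k) * iMul k) ∧
        ∀ D : Finset (Fin n), IsMinimumDominatingSet G D → s.word 0 = D.card) := by
  have h2 := two_le_of_mem hω
  obtain ⟨p, c, C, HM⟩ := hω
  set X := ⌈8000 * 9727 * (((C : ℝ) + 32) * 3 ^ ω)⌉₊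
  refine ⟨⟨DS.algorithm true false p, (c + 70) * 12, X, fun n N G T m k hm hk μ hT iMul hi => ?_⟩,
    ⟨DS.algorithm false false p, (c + 70) * 12, X, fun n N G T m k hm hk μ hT iMul hi => ?_⟩,
    ⟨DS.algorithm false true p, (c + 70) * 12, X, fun n N G T m k hm hk μ hT iMul hi => ?_⟩⟩
  · obtain ⟨s, t, hr, ht, h, -⟩ := DS.exists_run h2 HM hm hk hT true false n (iMul n) (hi n) (fun _ => le_rfl)
      (by simp)
    exact ⟨s, t, hr, ht, h rfl rfl⟩
  · obtain ⟨s, t, hr, ht, -, h, -⟩ := DS.exists_run h2 HM hm hk hT false false n (iMul n) (hi n)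
      (fun _ => le_rfl) (by simp)
    exact ⟨s, t, hr, ht, h rfl rfl⟩
  · have hpow : (2 * k + 1) * 9 ^ k < 2 ^ ((c + 70) * 12 * k) := by
      have h1 : ∀ k : ℕ, 2 * k + 1 ≤ 4 ^ k := fun k => by
        induction k with
        | zero => simp
        | succ k ih => rw [pow_succ]; omega
      calc (2 * k + 1) * 9 ^ k ≤ 4 ^ k * 9 ^ k := Nat.mul_le_mul_right _ (h1 k)
        _ = 36 ^ k := by rw [← mul_pow]; norm_num
        _ < 64 ^ k := Nat.pow_lt_pow_left (by norm_num) (by omega)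
        _ = 2 ^ (6 * k) := by rw [pow_mul]; norm_num
        _ ≤ _ := pow_le_pow_right two_pos (Nat.mul_le_mul_right _ (by omega))
    obtain ⟨s, t, hr, ht, -, -, h⟩ := DS.exists_run h2 HM hm hk hT false true ((c + 70) * 12 * k) (iMul k)
      (hi k) (by simp) fun _ => ⟨rfl, hpow⟩
    exact ⟨s, t, hr, ht, h rfl⟩
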